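/- Let $a<b$, $\Omega=(a,b)$, $T>0$, and let $m_0\ge 5$ be an integer. Let $\psi_0:[a,b]\to\mathbb C$ and $\phi_0,\phi_1:[a,b]\to\mathbb R$ be independent of $\varepsilon$. For each $\varepsilon\in(0,1]$ let $\psi=\psi^\varepsilon$ (complex-valued) and $\phi=\phi^\varepsilon$ (real-valued) solve on $\overline\Omega\times[0,T]$ the periodic Klein–Gordon–Schrödinger system $$ i\partial_t\psi+\partial_{xx}\psi+\phi\psi=0,\qquad \varepsilon^2\partial_{tt}\phi-\partial_{xx}\phi+\tfrac1{\varepsilon^2}\phi-|\psi|^2=0, $$ with $\psi,\partial_x\psi,\phi,\partial_x\phi$ taking equal values at $a$ and $b$, and $\psi(\cdot,0)=\psi_0$, $\phi(\cdot,0)=\phi_0$, $\partial_t\phi(\cdot,0)=\varepsilon^{-2}\phi_1$. Let $H^m_{\rm per}(\Omega)=\{u\in H^m(\Omega): u^{(k)}(a)=u^{(k)}(b),\ 0\le k\le m-1\}$. Assume (A) for every $\varepsilon\in(0,1]$, $\psi\in C([0,T];H^{m_0}_{\rm per}(\Omega))$ and $\phi\in C^1([0,T];H^{m_0}_{\rm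 per}(\Omega))$, and $\|\psi\|_{L^\infty([0,T];H^{m_0})}$ and $\|\phi\|_{L^\infty([0,T];H^{m_0})}+\varepsilon^2\|\partial_t\phi\|_{L^\infty([0,T];H^{m_0})}$ are bounded uniformly in $\varepsilon\in(0,1]$. Put $C_\psi=\sup_{0<\varepsilon\le1}\|\psi\|_{L^\infty([0,T];H^{m_0})}$ and $C_\phi=\sup_{0<\varepsilon\le1}\max\{\|\phi\|_{L^\infty([0,T];H^{m_0})},\ \varepsilon^2\|\partial_t\phi\|_{L^\infty([0,T];H^{m_0})}\}$. **The MTI-FP method.** Let $N$ be a positive even integer, $h=(b-a)/N$, $x_j=a+jh$ ($0\le j\le N$), $\tau>0$, $t_n=n\tau$, $\mu_l=2\pi l/(b-a)$ ($-N/2\le l\le N/2-1$). For a grid vector $\mathbf w=(w_0,\dots,w_N)$ with $w_0=w_N$ let $\widetilde{\mathbf w}_l=\frac1N\sum_{j=0}^{N-1}w_je^{-i\mu_l(x_j-a)}$ and $(I_N\mathbf w)(x)=\sum_{l=-N/2}^{N/2-1}\widetilde{\mathbf w}_le^{i\mu_l(x-a)}$. A grid vector described below by its coefficients $\widetilde{(\cdot)}_l$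 has the grid values of the corresponding trigonometric polynomial; products of grid vectors are taken pointwise. Set $$\omega_l=\tfrac1{\varepsilon^2}\sqrt{1+\varepsilon^2\mu_l^2},\quad \lambda_l^\pm=-\tfrac1{\varepsilon^2}\bigl[1\pm\sqrt{1+\varepsilon^2\mu_l^2}\bigr],\quad a_l(s)=\frac{\lambda_l^+e^{is\lambda_l^-}-\lambda_l^-e^{is\lambda_l^+}}{\lambda_l^+-\lambda_l^-},$$ $$p_l(\tau)=\int_0^\tau\frac{\sin(\omega_l(\tau-\theta))}{\varepsilon^2\omega_l}d\theta,\quad q_l(\tau)=\int_0^\tau\theta\,\frac{\sin(\omega_l(\tau-\theta))}{\varepsilon^2\omega_l}d\theta,$$ $$c_l^\pm=ie^{-i\mu_l^2\tau}\int_0^\tau e^{i(\mu_l^2\pm\varepsilon^{-2})\theta}d\theta,\quad d_l^\pm=ie^{-i\mu_l^2\tau}\int_0^\tau\theta e^{i(\mu_l^2\pm\varepsilon^{-2})\theta}d\theta,$$ and let $a_l',p_l',q_l'$ be the derivatives of $a_l,p_l,q_l$. Start from $\Psi^0_j=\psi_0(x_j)$, $\Phi^0_j=\phi_0(x_j)$,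 $\dot\Phi^0_j=\varepsilon^{-2}\phi_1(x_j)$. Given $(\Psi^n,\Phi^n,\dot\Phi^n)$, let $\mathbf v^0=\frac12(\Phi^n-i\varepsilon^2\dot\Phi^n)$, $\widetilde{(\dot\Psi^n)}_l=-i\frac{\sin(\mu_l^2\tau)}{\tau}\widetilde{(\Psi^n)}_l+i\widetilde{(\Phi^n\Psi^n)}_l$, $$\widetilde{(\mathbf v^1)}_l=a_l(\tau)\widetilde{(\mathbf v^0)}_l,\qquad \widetilde{(\dot{\mathbf v}^1)}_l=a_l'(\tau)\widetilde{(\mathbf v^0)}_l,$$ $$\widetilde{(\mathbf r^1)}_l=p_l\widetilde{(|\Psi^n|^2)}_l+2q_l\widetilde{({\rm Re}(\overline{\Psi^n}\dot\Psi^n))}_l,\qquad \widetilde{(\dot{\mathbf r}^1)}_l=p_l'\widetilde{(|\Psi^n|^2)}_l+2q_l'\widetilde{({\rm Re}(\overline{\Psi^n}\dot\Psi^n))}_l,$$ and define $$\widetilde{(\Psi^{n+1})}_l=e^{-i\mu_l^2\tau}\widetilde{(\Psi^n)}_l+c_l^+\widetilde{(\mathbf v^0\Psi^n)}_l+d_l^+\widetilde{(\mathbf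 v^0\dot\Psi^n)}_l+c_l^-\widetilde{(\overline{\mathbf v^0}\Psi^n)}_l+d_l^-\widetilde{(\overline{\mathbf v^0}\dot\Psi^n)}_l,$$ $$\Phi^{n+1}=e^{i\tau/\varepsilon^2}\mathbf v^1+e^{-i\tau/\varepsilon^2}\overline{\mathbf v^1}+\mathbf r^1,$$ $$\dot\Phi^{n+1}=e^{i\tau/\varepsilon^2}\bigl(\dot{\mathbf v}^1+\tfrac i{\varepsilon^2}\mathbf v^1\bigr)+e^{-i\tau/\varepsilon^2}\bigl(\overline{\dot{\mathbf v}^1}-\tfrac i{\varepsilon^2}\overline{\mathbf v^1}\bigr)+\dot{\mathbf r}^1 .$$ Let $e^n_\psi=\psi(\cdot,t_n)-I_N\Psi^n$, $e^n_\phi=\phi(\cdot,t_n)-I_N\Phi^n$, $\dot e^n_\phi=\partial_t\phi(\cdot,t_n)-I_N\dot\Phi^n$ and $\mathcal N^n=\|e^n_\psi\|_{H^1}+\|e^n_\phi\|_{H^1}+\varepsilon^2\|\dot e^n_\phi\|_{H^1}$. **Theorem.** There are constants $0<h_0<1$, $0<\tau_0<1$ and $C>0$, independent of $\varepsilon$,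 $h$, $\tau$ and $n$, such that for all $\varepsilon\in(0,1]$, all $N$ with $0<h\le h_0$, all $0<\tau\le\tau_0$ and all integers $0\le n\le T/\tau$: $$\mathcal N^n\le C\Bigl(h^{m_0-1}+\frac{\tau^2}{\varepsilon^2}\Bigr),\qquad \mathcal N^n\le C\bigl(h^{m_0-1}+\varepsilon^2\bigr),$$ $$\|I_N\Psi^n\|_{H^1}\le C_\psi+1,\qquad \|I_N\Phi^n\|_{H^1}\le C_\phi+1,\qquad \|I_N\dot\Phi^n\|_{H^1}\le\frac1{\varepsilon^2}(C_\phi+1),$$ and, uniformly in $\varepsilon$, with $M_\tau=\max_{0<\delta\le1}\min\{\tau^2/\delta^2,\delta^2\}$ (the maximum being attained), $$\mathcal N^n\le C\bigl(h^{m_0-1}+M_\tau\bigr),\qquad \mathcal N^n\le C\bigl(h^{m_0-1}+\tau\bigr),\qquad h^{m_0-1}+M_\tau\le C\bigl(h^{m_0-1}+\tau\bigr).$$ -/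

import Mathlib

open MeasureTheory Set Filter Topology
open scoped ContDiff

noncomputable section

namespace KGS

/-! ### Sobolev spaces on the interval `(a, b)` -/

/-- Test functions on `(a, b)`: smooth, with compact support inside `(a, b)`. -/
def IsTestFunction (a b : ℝ) (η : ℝ → ℂ) : Prop :=
  ContDiff ℝ ∞ η ∧ HasCompactSupport η ∧ tsupport η ⊆ Ioo a b

/-- `u` and `g` are in `L²(a, b)` and `g` is the weak derivative of order `k` of `u` on `(a, b)`. -/
structure HasWeakDeriv (a b : ℝ) (k : ℕ) (u g : ℝ → ℂ) : Prop where
  memLp : MemLp u 2 (volume.restrict (Ioo a b))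
  memLp_deriv : MemLp g 2 (volume.restrict (Ioo a b))
  integral_eq : ∀ η : ℝ → ℂ, IsTestFunction a b η →
    ∫ x in a..b, u x * iteratedDeriv k η x = (-1) ^ k * ∫ x in a..b, g x * η x

/-- `u ∈ H^m(a, b)`. -/
def MemH (a b : ℝ) (m : ℕ) (u : ℝ → ℂ) : Prop :=
  ∀ k ≤ m, ∃ g : ℝ → ℂ, HasWeakDeriv a b k u g

open Classical in
/-- The weak derivative of order `k` of `u` on `(a, b)` (unique almost everywhere; `0` if there is
none in `L²`). -/
def weakDeriv (a b : ℝ) (k : ℕ) (u : ℝ → ℂ) : ℝ → ℂ :=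
  if h : ∃ g : ℝ → ℂ, HasWeakDeriv a b k u g then h.choose else 0

/-- The norm of `H^m(a, b)`, the square root of `∑_{k ≤ m} ‖u^{(k)}‖²_{L²}`. -/
def sobolevNorm (a b : ℝ) (m : ℕ) (u : ℝ → ℂ) : ℝ :=
  Real.sqrt (∑ k ∈ Finset.range (m + 1), ∫ x in a..b, ‖weakDeriv a b k u x‖ ^ 2)

/-- `u ∈ H^m_per(a, b)`: `u ∈ H^m(a, b)` and `u^{(k)}(a) = u^{(k)}(b)` for `k = 0, …, m - 1`,
where `u^{(k)}` is read through its continuous representative on `[a, b]`; for `m ≥ 1` the function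
`u` itself has to be the continuous representative on `[a, b]`. -/
structure MemHper (a b : ℝ) (m : ℕ) (u : ℝ → ℂ) : Prop where
  memH : MemH a b m u
  continuousOn : 0 < m → ContinuousOn u (Icc a b)
  periodic : ∀ k < m, ∃ g : ℝ → ℂ,
    HasWeakDeriv a b k u g ∧ ContinuousOn g (Icc a b) ∧ g a = g b

/-- `u ∈ C([0, T]; H^m_per(a, b))`, with `u t x` the value at time `t` and position `x`. -/
structure MemCHper (a b T : ℝ) (m : ℕ) (u : ℝ → ℝ → ℂ) : Prop where
  mem : ∀ t ∈ Icc 0 T, MemHper a b m (u t)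
  tendsto : ∀ t ∈ Icc 0 T,
    Tendsto (fun s => sobolevNorm a b m (fun x => u s x - u t x)) (𝓝[Icc 0 T] t) (𝓝 0)

/-- `u ∈ C¹([0, T]; H^m_per(a, b))` with time derivative `du`. -/
structure MemC1Hper (a b T : ℝ) (m : ℕ) (u du : ℝ → ℝ → ℂ) : Prop where
  mem : MemCHper a b T m u
  mem_deriv : MemCHper a b T m du
  tendsto : ∀ t ∈ Icc 0 T,
    Tendsto (fun s => sobolevNorm a b m (fun x => (u s x - u t x) / ((s - t : ℝ) : ℂ) - du t x))
      (𝓝[Icc 0 T \ {t}] t) (𝓝 0)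

/-! ### The periodic Klein-Gordon-Schrödinger system -/

/-- The time derivative `∂ₜφ(x, t)` on `[0, T]` (one-sided at the end points). -/
def timeDeriv (T : ℝ) (φ : ℝ → ℝ → ℝ) (t x : ℝ) : ℝ :=
  derivWithin (fun s => φ s x) (Icc 0 T) t

/-- `(ψ, φ)` is a (classical) solution on `[a, b] × [0, T]` of the Klein-Gordon-Schrödinger system
with periodic boundary conditions and initial data `ψ(0) = ψ₀`, `φ(0) = φ₀`, `∂ₜφ(0) = φ₁ / ε²`. -/
structure IsSolution (a b T ε : ℝ) (ψ₀ : ℝ → ℂ) (φ₀ φ₁ : ℝ → ℝ)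
    (ψ : ℝ → ℝ → ℂ) (φ : ℝ → ℝ → ℝ) : Prop where
  smooth_x_ψ : ∀ t ∈ Icc 0 T, ContDiffOn ℝ 2 (ψ t) (Ioo a b)
  smooth_x_φ : ∀ t ∈ Icc 0 T, ContDiffOn ℝ 2 (φ t) (Ioo a b)
  diff_t_ψ : ∀ t ∈ Ioo 0 T, ∀ x ∈ Ioo a b, DifferentiableAt ℝ (fun s => ψ s x) t
  diff_t_φ : ∀ t ∈ Icc 0 T, ∀ x ∈ Icc a b,
    DifferentiableWithinAt ℝ (fun s => φ s x) (Icc 0 T) t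
  diff_tt_φ : ∀ t ∈ Ioo 0 T, ∀ x ∈ Ioo a b,
    DifferentiableAt ℝ (fun s => timeDeriv T φ s x) t
  schrodinger : ∀ t ∈ Ioo 0 T, ∀ x ∈ Ioo a b,
    Complex.I * deriv (fun s => ψ s x) t + iteratedDeriv 2 (ψ t) x + (φ t x : ℂ) * ψ t x = 0
  klein_gordon : ∀ t ∈ Ioo 0 T, ∀ x ∈ Ioo a b,
    ε ^ 2 * deriv (fun s => timeDeriv T φ s x) t - iteratedDeriv 2 (φ t) x
      + 1 / ε ^ 2 * φ t x - ‖ψ t x‖ ^ 2 = 0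
  periodic_ψ : ∀ t ∈ Icc 0 T, ψ t a = ψ t b
  periodic_dx_ψ : ∀ t ∈ Icc 0 T,
    derivWithin (ψ t) (Icc a b) a = derivWithin (ψ t) (Icc a b) b
  periodic_φ : ∀ t ∈ Icc 0 T, φ t a = φ t b
  periodic_dx_φ : ∀ t ∈ Icc 0 T,
    derivWithin (φ t) (Icc a b) a = derivWithin (φ t) (Icc a b) b
  init_ψ : ∀ x ∈ Icc a b, ψ 0 x = ψ₀ x
  init_φ : ∀ x ∈ Icc a b, φ 0 x = φ₀ x
  init_dt_φ : ∀ x ∈ Icc a b, timeDeriv T φ 0 x = 1 / ε ^ 2 * φ₁ x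

/-- The regularity assumption on a family `(ψ ε, φ ε)`, `0 < ε ≤ 1`: `ψ ∈ C([0,T]; H^m_per)` and
`φ ∈ C¹([0,T]; H^m_per)`, with `‖ψ‖_{L^∞(H^m)}` and
`‖φ‖_{L^∞(H^m)} + ε² ‖∂ₜφ‖_{L^∞(H^m)}` bounded uniformly in `ε`. -/
structure Regular (a b T : ℝ) (m : ℕ) (ψ : ℝ → ℝ → ℝ → ℂ) (φ : ℝ → ℝ → ℝ → ℝ) : Prop where
  mem_ψ : ∀ ε ∈ Ioc (0 : ℝ) 1, MemCHper a b T m (ψ ε)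
  mem_φ : ∀ ε ∈ Ioc (0 : ℝ) 1, MemC1Hper a b T m
    (fun t x => (φ ε t x : ℂ)) (fun t x => (timeDeriv T (φ ε) t x : ℂ))
  bound_ψ : ∃ K : ℝ, ∀ ε ∈ Ioc (0 : ℝ) 1, ∀ t ∈ Icc 0 T, sobolevNorm a b m (ψ ε t) ≤ K
  bound_φ : ∃ K : ℝ, ∀ ε ∈ Ioc (0 : ℝ) 1, ∀ t ∈ Icc 0 T,
    sobolevNorm a b m (fun x => (φ ε t x : ℂ))
      + ε ^ 2 * sobolevNorm a b m (fun x => (timeDeriv T (φ ε) t x : ℂ)) ≤ K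

/-- The supremum over `0 < ε ≤ 1` of `‖ψ‖_{L^∞([0,T]; H^m)}`. -/
def boundψ (a b T : ℝ) (m : ℕ) (ψ : ℝ → ℝ → ℝ → ℂ) : ℝ :=
  sSup {r : ℝ | ∃ ε ∈ Ioc (0 : ℝ) 1, ∃ t ∈ Icc 0 T, r = sobolevNorm a b m (ψ ε t)}

/-- The supremum over `0 < ε ≤ 1` of `‖φ‖_{L^∞([0,T]; H^m)}` and
`ε² ‖∂ₜφ‖_{L^∞([0,T]; H^m)}`. -/
def boundφ (a b T : ℝ) (m : ℕ) (φ : ℝ → ℝ → ℝ → ℝ) : ℝ :=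
  sSup {r : ℝ | ∃ ε ∈ Ioc (0 : ℝ) 1, ∃ t ∈ Icc 0 T,
    r = max (sobolevNorm a b m (fun x => (φ ε t x : ℂ)))
      (ε ^ 2 * sobolevNorm a b m (fun x => (timeDeriv T (φ ε) t x : ℂ)))}

/-! ### Grid functions and trigonometric interpolation -/

/-- Mesh size `h = (b - a) / N`. -/
def meshSize (a b : ℝ) (N : ℕ) : ℝ := (b - a) / N

/-- Grid points `x_j = a + j h`. -/
def gridPoint (a b : ℝ) (N j : ℕ) : ℝ := a + j * meshSize a b N

/-- `μ_l = 2 π l / (b - a)`. -/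
def freq (a b : ℝ) (l : ℤ) : ℝ := 2 * Real.pi * l / (b - a)

/-- The frequencies `l = -N/2, …, N/2 - 1` (`N` even). -/
def modes (N : ℕ) : Finset ℤ := Finset.Ico (-((N : ℤ) / 2)) ((N : ℤ) / 2)

/-- The value at `x` of the trigonometric polynomial with coefficients `c`. -/
def trigPoly (a b : ℝ) (N : ℕ) (c : ℤ → ℂ) (x : ℝ) : ℂ :=
  ∑ l ∈ modes N, c l * Complex.exp (Complex.I * freq a b l * (x - a))

/-- Discrete Fourier coefficients of a grid function `(v_0, …, v_N)` (with `v_N = v_0`). -/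
def dft (a b : ℝ) (N : ℕ) (v : Fin (N + 1) → ℂ) (l : ℤ) : ℂ :=
  1 / N * ∑ j : Fin N,
    v j.castSucc * Complex.exp (-(Complex.I * freq a b l * (gridPoint a b N j - a)))

/-- Grid values of the trigonometric polynomial with coefficients `c`. -/
def gridValues (a b : ℝ) (N : ℕ) (c : ℤ → ℂ) : Fin (N + 1) → ℂ :=
  fun j => trigPoly a b N c (gridPoint a b N j)

/-- The trigonometric interpolant `I_N v` of a grid function. -/
def interp (a b : ℝ) (N : ℕ) (v : Fin (N + 1) → ℂ) : ℝ → ℂ :=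
  trigPoly a b N (dft a b N v)

/-! ### Coefficients of the multiscale time integrator; the argument `μ` is a frequency `μ_l` -/

/-- `ω_l = √(1 + ε² μ_l²) / ε²`. -/
def omega (ε μ : ℝ) : ℝ := 1 / ε ^ 2 * Real.sqrt (1 + ε ^ 2 * μ ^ 2)

/-- `λ_l⁺`. -/
def lamPlus (ε μ : ℝ) : ℝ := -(1 / ε ^ 2) * (1 + Real.sqrt (1 + ε ^ 2 * μ ^ 2))

/-- `λ_l⁻`. -/
def lamMinus (ε μ : ℝ) : ℝ := -(1 / ε ^ 2) * (1 - Real.sqrt (1 + ε ^ 2 * μ ^ 2))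

/-- `a_l(s)`. -/
def coefA (ε μ s : ℝ) : ℂ :=
  (lamPlus ε μ * Complex.exp (Complex.I * s * lamMinus ε μ)
    - lamMinus ε μ * Complex.exp (Complex.I * s * lamPlus ε μ)) / (lamPlus ε μ - lamMinus ε μ)

/-- `a_l'(s)`. -/
def coefA' (ε μ s : ℝ) : ℂ :=
  Complex.I * lamPlus ε μ * lamMinus ε μ *
    (Complex.exp (Complex.I * s * lamMinus ε μ) - Complex.exp (Complex.I * s * lamPlus ε μ))
      / (lamPlus ε μ - lamMinus ε μ)

/-- `p_l(τ)`. -/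
def coefP (ε μ τ : ℝ) : ℝ :=
  ∫ θ in (0 : ℝ)..τ, Real.sin (omega ε μ * (τ - θ)) / (ε ^ 2 * omega ε μ)

/-- `q_l(τ)`. -/
def coefQ (ε μ τ : ℝ) : ℝ :=
  ∫ θ in (0 : ℝ)..τ, θ * (Real.sin (omega ε μ * (τ - θ)) / (ε ^ 2 * omega ε μ))

/-- `p_l'(τ)`. -/
def coefP' (ε μ τ : ℝ) : ℝ :=
  ∫ θ in (0 : ℝ)..τ, Real.cos (omega ε μ * (τ - θ)) / ε ^ 2

/-- `q_l'(τ)`. -/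
def coefQ' (ε μ τ : ℝ) : ℝ :=
  ∫ θ in (0 : ℝ)..τ, θ * (Real.cos (omega ε μ * (τ - θ)) / ε ^ 2)

/-- `c_l^±(τ)`, the sign being `σ = 1` or `σ = -1`. -/
def coefC (σ ε μ τ : ℝ) : ℂ :=
  Complex.I * Complex.exp (-(Complex.I * μ ^ 2 * τ)) *
    ∫ θ in (0 : ℝ)..τ, Complex.exp (Complex.I * (μ ^ 2 + σ / ε ^ 2) * θ)

/-- `d_l^±(τ)`, the sign being `σ = 1` or `σ = -1`. -/
def coefD (σ ε μ τ : ℝ) : ℂ :=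
  Complex.I * Complex.exp (-(Complex.I * μ ^ 2 * τ)) *
    ∫ θ in (0 : ℝ)..τ, θ * Complex.exp (Complex.I * (μ ^ 2 + σ / ε ^ 2) * θ)

/-! ### The MTI-FP method -/

/-- The numerical solution at one time level: approximations of `ψ`, `φ`, `∂ₜφ` at the grid
points. -/
structure State (N : ℕ) where
  Ψ : Fin (N + 1) → ℂ
  Φ : Fin (N + 1) → ℂ
  dΦ : Fin (N + 1) → ℂ

/-- The grid function `v^{n,0}`. -/
def vZero {N : ℕ} (ε : ℝ) (S : State N) : Fin (N + 1) → ℂ :=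
  fun j => 1 / 2 * (S.Φ j - Complex.I * ε ^ 2 * S.dΦ j)

/-- The grid function approximating `∂ₜψ` at the time level `t_n`. -/
def dΨ {N : ℕ} (a b τ : ℝ) (S : State N) : Fin (N + 1) → ℂ :=
  gridValues a b N fun l =>
    -Complex.I * (Real.sin (freq a b l ^ 2 * τ) / τ) * dft a b N S.Ψ l
      + Complex.I * dft a b N (fun j => S.Φ j * S.Ψ j) l

/-- `v^{n,1}`. -/
def vOne {N : ℕ} (a b ε τ : ℝ) (S : State N) : Fin (N + 1) → ℂ :=
  gridValues a b N fun l => coefA ε (freq a b l) τ * dft a b N (vZero ε S) l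

/-- The approximation of `∂ₛvⁿ` at `s = τ`. -/
def dvOne {N : ℕ} (a b ε τ : ℝ) (S : State N) : Fin (N + 1) → ℂ :=
  gridValues a b N fun l => coefA' ε (freq a b l) τ * dft a b N (vZero ε S) l

/-- The grid function `|Ψⁿ|²`. -/
def density {N : ℕ} (S : State N) : Fin (N + 1) → ℂ :=
  fun j => ((‖S.Ψ j‖ ^ 2 : ℝ) : ℂ)

/-- The grid function `Re (conj Ψⁿ · ∂ₜΨⁿ)`. -/
def densityRate {N : ℕ} (a b τ : ℝ) (S : State N) : Fin (N + 1) → ℂ :=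
  fun j => (((starRingEnd ℂ (S.Ψ j) * dΨ a b τ S j).re : ℝ) : ℂ)

/-- `r^{n,1}`. -/
def rOne {N : ℕ} (a b ε τ : ℝ) (S : State N) : Fin (N + 1) → ℂ :=
  gridValues a b N fun l =>
    coefP ε (freq a b l) τ * dft a b N (density S) l
      + 2 * coefQ ε (freq a b l) τ * dft a b N (densityRate a b τ S) l

/-- The approximation of `∂ₛrⁿ` at `s = τ`. -/
def drOne {N : ℕ} (a b ε τ : ℝ) (S : State N) : Fin (N + 1) → ℂ :=
  gridValues a b N fun l =>
    coefP' ε (freq a b l) τ * dft a b N (density S) l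
      + 2 * coefQ' ε (freq a b l) τ * dft a b N (densityRate a b τ S) l

/-- One time step of size `τ` of the MTI-FP method. -/
def step {N : ℕ} (a b ε τ : ℝ) (S : State N) : State N where
  Ψ := gridValues a b N fun l =>
    Complex.exp (-(Complex.I * freq a b l ^ 2 * τ)) * dft a b N S.Ψ l
      + coefC 1 ε (freq a b l) τ * dft a b N (fun j => vZero ε S j * S.Ψ j) l
      + coefD 1 ε (freq a b l) τ * dft a b N (fun j => vZero ε S j * dΨ a b τ S j) l
      + coefC (-1) ε (freq a b l) τ
          * dft a b N (fun j => starRingEnd ℂ (vZero ε S j) * S.Ψ j) l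
      + coefD (-1) ε (freq a b l) τ
          * dft a b N (fun j => starRingEnd ℂ (vZero ε S j) * dΨ a b τ S j) l
  Φ := fun j =>
    Complex.exp (Complex.I * τ / ε ^ 2) * vOne a b ε τ S j
      + Complex.exp (-(Complex.I * τ / ε ^ 2)) * starRingEnd ℂ (vOne a b ε τ S j)
      + rOne a b ε τ S j
  dΦ := fun j =>
    Complex.exp (Complex.I * τ / ε ^ 2)
        * (dvOne a b ε τ S j + Complex.I / ε ^ 2 * vOne a b ε τ S j)
      + Complex.exp (-(Complex.I * τ / ε ^ 2))
        * (starRingEnd ℂ (dvOne a b ε τ S j)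
            - Complex.I / ε ^ 2 * starRingEnd ℂ (vOne a b ε τ S j))
      + drOne a b ε τ S j

/-- The initial grid values. -/
def initState (a b ε : ℝ) (ψ₀ : ℝ → ℂ) (φ₀ φ₁ : ℝ → ℝ) (N : ℕ) : State N where
  Ψ := fun j => ψ₀ (gridPoint a b N j)
  Φ := fun j => (φ₀ (gridPoint a b N j) : ℂ)
  dΦ := fun j => ((1 / ε ^ 2 * φ₁ (gridPoint a b N j) : ℝ) : ℂ)

/-- The numerical solution of the MTI-FP method at the time level `t_n = n τ`. -/
def mtifp (a b ε : ℝ) (ψ₀ : ℝ → ℂ) (φ₀ φ₁ : ℝ → ℝ) (N : ℕ) (τ : ℝ) (n : ℕ) : State N :=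
  (step a b ε τ)^[n] (initState a b ε ψ₀ φ₀ φ₁ N)

/-- The error `‖e_ψ‖_{H¹} + ‖e_φ‖_{H¹} + ε² ‖ė_φ‖_{H¹}` of a numerical solution `S` against the
values at time `t` of the exact solution `(ψ, φ)`. -/
def errorH1 {N : ℕ} (a b T ε : ℝ) (ψ : ℝ → ℝ → ℂ) (φ : ℝ → ℝ → ℝ) (t : ℝ) (S : State N) : ℝ :=
  sobolevNorm a b 1 (fun x => ψ t x - interp a b N S.Ψ x)
    + sobolevNorm a b 1 (fun x => (φ t x : ℂ) - interp a b N S.Φ x)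
    + ε ^ 2 * sobolevNorm a b 1 (fun x => (timeDeriv T φ t x : ℂ) - interp a b N S.dΦ x)

end KGS

end

/-! Everything is carried over to Fourier coefficients on the modes -N/2 ≤ l < N/2. The discrete
Fourier transform turns one step of the scheme into an explicit map of coefficient sequences in
which pointwise products become the cyclic convolution `dprod`, bounded in H¹ and H³ uniformly in N
(`exists_nrm_dprod_le`). By the aliasing estimate `exists_nrm_alias_le`, the Fourier coefficients of
the exact solution solve the same semi-discrete system up to defects of size h^(m₀-1) in H¹
(`exists_approxSol`). After that the only question is the error of the time integrator for this
system.

The error is measured by `energy`: the H¹ norm of ψ plus the H¹ norms of the characteristic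
variables ε²∂ₜφ ± iε²ωφ of the Klein-Gordon equation. In these unknowns both linear flows multiply
each mode by a number of modulus one, so they cause no growth, and one step is Lipschitz with
constant 1 + Cτ, uniformly in ε and N, as long as the error is at most 1 (`energy_step_sub_le`). No
relation between τ and h is needed: the filter sin(μ²τ)/τ replaces the loss of two derivatives by a
factor 1/τ, and the coefficients multiplying the filtered rate are O(τ²) in the norms that matter.

For the local error, the numerical step is read as the exact solution of a simplified system: in the
Schrödinger equation φ is replaced by its leading oscillation `oscil` and ψ by a linear polynomial
in time, and in the Klein-Gordon equation |ψ|² is replaced by a linear polynomial. The difference to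
the exact solution obeys a linear equation with a small source, and Duhamel's principle applies mode
by mode (`nrm_le_of_hasDerivAt_phase`). The source is O(τ²/ε²) plus the defect, which gives the
first bound. Uniformly in ε it is only O(s) at time s, but it oscillates with frequency of order
1/ε², so one integration by parts gains ε². For ψ this uses ε⁴∂ₜₜφ = -φ + O(ε²), for φ the
inequality 1/ω ≤ ε². Hence the local error is O(τ(min(τ²/ε², ε²) + h^(m₀-1))), see
`ApproxSol.localError`.

A discrete Gronwall induction (`ApproxSol.energy_le`) sums the local errors. The smallness of the
error required by the stability estimate is reproduced at every step, because min(τ²/ε², ε²) ≤ τ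
makes the final bound small for small h and τ, uniformly in ε. The three error bounds and the bounds
on the numerical solution all follow from this one estimate.

One point is delicate. The characteristic variables contain ε²ω = √(1 + ε²μ²), so the initial
interpolation error of φ has to be O(h^(m₀-1)) in H² instead of H¹, which asks for φ₀ in H^(m₀+1),
one derivative more than is assumed. This regularity comes for free: φ₀ does not depend on ε, and
for ε = 1 the boundedness of φ and ∂ₜφ in H^(m₀) over a time interval of positive length forces it
by an observability argument (`CoefSystem.hsBound_succ`). -/

namespace KGS

/-! ### Fourier coefficients on `(a, b)` -/

/-- The `l`-th Fourier coefficient of `u` on `(a, b)`. -/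
noncomputable def fcoef (a b : ℝ) (u : ℝ → ℂ) (l : ℤ) : ℂ :=
  1 / (b - a) * ∫ x in a..b, u x * Complex.exp (-(Complex.I * freq a b l * (x - a)))

/-- The basis function `e^{i μ_l (x - a)}`. -/
noncomputable def basisFun (a b : ℝ) (l : ℤ) (x : ℝ) : ℂ :=
  Complex.exp (Complex.I * freq a b l * (x - a))

lemma norm_basisFun (a b : ℝ) (l : ℤ) (x : ℝ) : ‖basisFun a b l x‖ = 1 := by
  unfold basisFun
  have : Complex.I * freq a b l * (x - a) = ((freq a b l * (x - a) : ℝ) : ℂ) * Complex.I := by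
    push_cast; ring
  rw [this, Complex.norm_exp_ofReal_mul_I]

lemma exp_neg_eq_basisFun (a b : ℝ) (l : ℤ) (x : ℝ) :
    Complex.exp (-(Complex.I * freq a b l * (x - a))) = basisFun a b (-l) x := by
  unfold basisFun freq
  congr 1; push_cast; ring

lemma continuous_basisFun (a b : ℝ) (l : ℤ) : Continuous (basisFun a b l) := by
  unfold basisFun; fun_prop

lemma contDiff_basisFun (a b : ℝ) (l : ℤ) : ContDiff ℝ ∞ (basisFun a b l) := by
  unfold basisFun
  have : ContDiff ℝ ∞ (fun x : ℝ => (x : ℂ)) := Complex.ofRealCLM.contDiff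
  exact ((contDiff_const.mul (this.sub contDiff_const))).cexp

lemma hasDerivAt_basisFun (a b : ℝ) (l : ℤ) (x : ℝ) :
    HasDerivAt (basisFun a b l) (Complex.I * freq a b l * basisFun a b l x) x := by
  unfold basisFun
  have h : HasDerivAt (fun y : ℝ => Complex.I * freq a b l * ((y : ℂ) - a))
      (Complex.I * freq a b l) x := by
    simpa using ((Complex.ofRealCLM.hasDerivAt (x := x)).sub_const (a : ℂ)).const_mul
      (Complex.I * freq a b l)
  simpa [mul_comm] using h.cexp

lemma basisFun_left (a b : ℝ) (l : ℤ) : basisFun a b l a = 1 := by simp [basisFun]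

lemma basisFun_right {a b : ℝ} (hab : a < b) (l : ℤ) : basisFun a b l b = 1 := by
  unfold basisFun freq
  have h : (b : ℂ) - a ≠ 0 := by
    rw [← Complex.ofReal_sub, Complex.ofReal_ne_zero]; linarith
  rw [Complex.exp_eq_one_iff]
  exact ⟨l, by push_cast; field_simp⟩

lemma basisFun_add (a b : ℝ) (k l : ℤ) (x : ℝ) :
    basisFun a b (k + l) x = basisFun a b k x * basisFun a b l x := by
  unfold basisFun freq
  rw [← Complex.exp_add]; congr 1; push_cast; ring

lemma conj_basisFun (a b : ℝ) (l : ℤ) (x : ℝ) :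
    starRingEnd ℂ (basisFun a b l x) = basisFun a b (-l) x := by
  unfold basisFun freq
  rw [← Complex.exp_conj]; congr 1; simp [map_ofNat]; ring

lemma freq_neg (a b : ℝ) (l : ℤ) : freq a b (-l) = -freq a b l := by
  unfold freq; push_cast; ring

/-- The exponentials of the scheme are based at the left end point, Mathlib's at the origin. The two
differ by a constant of modulus one, so Parseval and inversion transfer. -/
lemma fourier_eq_basisFun (a b : ℝ) (l : ℤ) (x : ℝ) :
    fourier l (x : AddCircle (b - a)) =
      Complex.exp (Complex.I * freq a b l * a) * basisFun a b l x := by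
  rw [fourier_coe_apply]
  unfold basisFun freq
  rw [← Complex.exp_add]; congr 1; push_cast; ring

lemma fcoef_def' (a b : ℝ) (u : ℝ → ℂ) (l : ℤ) :
    fcoef a b u l = 1 / (b - a) * ∫ x in a..b, u x * basisFun a b (-l) x := by
  simp only [fcoef, exp_neg_eq_basisFun]

lemma fcoef_eq_fourierCoeffOn {a b : ℝ} (hab : a < b) (u : ℝ → ℂ) (l : ℤ) :
    fcoef a b u l = Complex.exp (Complex.I * freq a b l * a) * fourierCoeffOn hab u l := by
  rw [fourierCoeffOn_eq_integral, fcoef_def']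
  simp only [fourier_eq_basisFun, smul_eq_mul, Complex.real_smul]
  have : ∀ x : ℝ, Complex.exp (Complex.I * freq a b (-l) * a) * basisFun a b (-l) x * u x
      = Complex.exp (Complex.I * freq a b (-l) * a) * (u x * basisFun a b (-l) x) := by
    intro x; ring
  simp only [this, intervalIntegral.integral_const_mul]
  have h2 : Complex.exp (Complex.I * freq a b l * a) * Complex.exp (Complex.I * freq a b (-l) * a)
      = 1 := by
    rw [← Complex.exp_add, freq_neg]; simp
  push_cast
  linear_combination (-(1 / ((b : ℂ) - a) * ∫ x in a..b, u x * basisFun a b (-l) x)) * h2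

lemma norm_fcoef_eq {a b : ℝ} (hab : a < b) (u : ℝ → ℂ) (l : ℤ) :
    ‖fcoef a b u l‖ = ‖fourierCoeffOn hab u l‖ := by
  rw [fcoef_eq_fourierCoeffOn hab, norm_mul]
  have : Complex.I * freq a b l * a = ((freq a b l * a : ℝ) : ℂ) * Complex.I := by
    push_cast; ring
  rw [this, Complex.norm_exp_ofReal_mul_I, one_mul]

lemma memLp_Ioc {a b : ℝ} {u : ℝ → ℂ} (hu : MemLp u 2 (volume.restrict (Ioo a b))) :
    MemLp u 2 (volume.restrict (Ioc a b)) := by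
  rwa [Measure.restrict_congr_set Ioo_ae_eq_Ioc] at hu

/-- Parseval's identity. -/
lemma hasSum_sq_fcoef {a b : ℝ} (hab : a < b) {u : ℝ → ℂ}
    (hu : MemLp u 2 (volume.restrict (Ioo a b))) :
    HasSum (fun l => ‖fcoef a b u l‖ ^ 2) ((b - a)⁻¹ * ∫ x in a..b, ‖u x‖ ^ 2) := by
  simp only [norm_fcoef_eq hab]
  exact hasSum_sq_fourierCoeffOn hab (memLp_Ioc hu)

lemma fcoef_congr_ae {a b : ℝ} (hab : a < b) {u v : ℝ → ℂ}
    (h : u =ᵐ[volume.restrict (Ioo a b)] v) (l : ℤ) : fcoef a b u l = fcoef a b v l := by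
  rw [Measure.restrict_congr_set Ioo_ae_eq_Ioc] at h
  rw [fcoef_eq_fourierCoeffOn hab, fcoef_eq_fourierCoeffOn hab, fourierCoeffOn_congr_ae hab h]

lemma fcoef_congr {a b : ℝ} (hab : a < b) {u v : ℝ → ℂ}
    (h : ∀ x ∈ Ioo a b, u x = v x) (l : ℤ) : fcoef a b u l = fcoef a b v l :=
  fcoef_congr_ae hab (by
    filter_upwards [ae_restrict_mem measurableSet_Ioo] with x hx using h x hx) l

lemma intervalIntegrable_mul_basisFun {a b : ℝ} {u : ℝ → ℂ}
    (hu : IntervalIntegrable u volume a b) (l : ℤ) :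
    IntervalIntegrable (fun x => u x * basisFun a b l x) volume a b :=
  hu.mul_continuousOn (continuous_basisFun a b l).continuousOn

lemma fcoef_add {a b : ℝ} {u v : ℝ → ℂ} (hu : IntervalIntegrable u volume a b)
    (hv : IntervalIntegrable v volume a b) (l : ℤ) :
    fcoef a b (fun x => u x + v x) l = fcoef a b u l + fcoef a b v l := by
  simp only [fcoef_def', add_mul]
  rw [intervalIntegral.integral_add (intervalIntegrable_mul_basisFun hu _)
    (intervalIntegrable_mul_basisFun hv _)]
  ring

lemma fcoef_sub {a b : ℝ} {u v : ℝ → ℂ} (hu : IntervalIntegrable u volume a b)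
    (hv : IntervalIntegrable v volume a b) (l : ℤ) :
    fcoef a b (fun x => u x - v x) l = fcoef a b u l - fcoef a b v l := by
  simp only [fcoef_def', sub_mul]
  rw [intervalIntegral.integral_sub (intervalIntegrable_mul_basisFun hu _)
    (intervalIntegrable_mul_basisFun hv _)]
  ring

lemma fcoef_const_mul (a b : ℝ) (c : ℂ) (u : ℝ → ℂ) (l : ℤ) :
    fcoef a b (fun x => c * u x) l = c * fcoef a b u l := by
  simp only [fcoef_def', mul_assoc c, intervalIntegral.integral_const_mul]
  ring

lemma fcoef_conj (a b : ℝ) (u : ℝ → ℂ) (l : ℤ) :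
    fcoef a b (fun x => starRingEnd ℂ (u x)) l = starRingEnd ℂ (fcoef a b u (-l)) := by
  simp only [fcoef_def', map_mul, map_div₀, map_one, map_sub, Complex.conj_ofReal, neg_neg]
  congr 1
  rw [intervalIntegral.intervalIntegral_eq_integral_uIoc,
    intervalIntegral.intervalIntegral_eq_integral_uIoc]
  simp only [Complex.real_smul, map_mul, Complex.conj_ofReal]
  rw [← integral_conj]
  simp only [map_mul, conj_basisFun]

/-- Fourier inversion. -/
lemma hasSum_fourier_series {a b : ℝ} (hab : a < b) {u : ℝ → ℂ} (hc : ContinuousOn u (Icc a b))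
    (hper : u a = u b) (hs : Summable (fun l => ‖fcoef a b u l‖)) {x : ℝ} (hx : x ∈ Icc a b) :
    HasSum (fun l => fcoef a b u l * basisFun a b l x) (u x) := by
  have hp := Fact.mk (by linarith : 0 < b - a)
  have hper' : u a = u (a + (b - a)) := by rw [hper]; congr 1; ring
  let f : C(AddCircle (b - a), ℂ) :=
    ⟨AddCircle.liftIco (b - a) a u, AddCircle.liftIco_continuous hper' (by
      rwa [add_sub_cancel])⟩
  have hcoef : ∀ l, fourierCoeff f l = fourierCoeffOn hab u l := by
    intro l
    have := fourierCoeff_liftIco_eq (T := b - a) (a := a) u l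
    simp only [add_sub_cancel] at this
    exact this
  have hsum : Summable (fourierCoeff f) := by
    refine Summable.of_norm ?_
    simp only [hcoef, ← norm_fcoef_eq hab]
    exact hs
  have key : ∀ y ∈ Ico a b, HasSum (fun l => fcoef a b u l * basisFun a b l y) (u y) := by
    intro y hy
    have h := has_pointwise_sum_fourier_series_of_summable hsum (y : AddCircle (b - a))
    have h2 : f (y : AddCircle (b - a)) = u y :=
      AddCircle.liftIco_coe_apply (by rwa [add_sub_cancel])
    rw [h2] at h
    convert h using 2 with l
    rw [hcoef, fourier_eq_basisFun, fcoef_eq_fourierCoeffOn hab, smul_eq_mul]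
    ring
  -- The circle is cut open at `a`, so the argument above sees only `[a, b)`; the point `b` is
  -- reached through periodicity.
  rcases eq_or_lt_of_le hx.2 with h | h
  · rw [h, ← hper]
    simpa [basisFun_left, basisFun_right hab] using key a ⟨le_rfl, hab⟩
  · exact key x ⟨hx.1, h⟩

end KGS

namespace KGS

/-! ### Weak derivatives and Fourier coefficients -/

lemma exists_bound_deriv_smoothTransition : ∃ M : ℝ, 0 < M ∧
    ∀ x, |deriv Real.smoothTransition x| ≤ M := by
  have hc : Continuous (deriv Real.smoothTransition) :=
    (Real.smoothTransition.contDiff (n := 1)).continuous_deriv le_rfl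
  obtain ⟨M, hM⟩ := (isCompact_Icc (a := (0 : ℝ)) (b := 1)).exists_bound_of_continuousOn
    hc.continuousOn
  refine ⟨max M 1, by positivity, fun x => ?_⟩
  by_cases hx : x ∈ Icc (0 : ℝ) 1
  · exact (hM x hx).trans (le_max_left _ _)
  · have : deriv Real.smoothTransition x = 0 := by
      rw [mem_Icc, not_and_or, not_le, not_le] at hx
      rcases hx with hx | hx
      · have : Real.smoothTransition =ᶠ[𝓝 x] fun _ => 0 := by
          filter_upwards [Iio_mem_nhds hx] with y hy
          exact Real.smoothTransition.zero_of_nonpos (le_of_lt hy)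
        rw [this.deriv_eq]; simp
      · have : Real.smoothTransition =ᶠ[𝓝 x] fun _ => 1 := by
          filter_upwards [Ioi_mem_nhds hx] with y hy
          exact Real.smoothTransition.one_of_one_le (le_of_lt hy)
        rw [this.deriv_eq]; simp
    rw [this]; simp

/-- A smooth cutoff of the interval `(a, b)` with transition layers of width `δ`. -/
lemma exists_cutoff : ∃ M : ℝ, 0 < M ∧ ∀ {a b δ : ℝ}, 0 < δ → 4 * δ < b - a →
    ∃ χ : ℝ → ℝ, ContDiff ℝ ∞ χ ∧ tsupport χ ⊆ Icc (a + δ) (b - δ) ∧ (∀ x, |χ x| ≤ 1) ∧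
      (∀ x ∈ Icc (a + 2 * δ) (b - 2 * δ), χ x = 1) ∧ ∀ x, |deriv χ x| ≤ M / δ := by
  obtain ⟨M, hM0, hM⟩ := exists_bound_deriv_smoothTransition
  refine ⟨2 * M, by positivity, fun {a b δ} hδ hδb => ?_⟩
  set S := Real.smoothTransition
  -- Two rescaled transitions, one per end point; the shift by -1 keeps the support at distance δ
  -- from the end. Each has derivative at most M/δ, whence the factor 2 in the constant.
  set f : ℝ → ℝ := fun x => S ((x - a) / δ - 1)
  set g : ℝ → ℝ := fun x => S ((b - x) / δ - 1)
  have hf : ContDiff ℝ ∞ f := Real.smoothTransition.contDiff.comp (by fun_prop)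
  have hg : ContDiff ℝ ∞ g := Real.smoothTransition.contDiff.comp (by fun_prop)
  have hS : ∀ y, |S y| ≤ 1 := fun y => by
    rw [abs_of_nonneg (Real.smoothTransition.nonneg y)]; exact Real.smoothTransition.le_one y
  have hdS : ∀ y, HasDerivAt S (deriv S y) y := fun y =>
    ((Real.smoothTransition.contDiff (n := 1)).differentiable (by norm_num) y).hasDerivAt
  have hdf : ∀ x, HasDerivAt f (deriv S ((x - a) / δ - 1) * (1 / δ)) x := fun x =>
    (hdS _).comp x ((((hasDerivAt_id x).sub_const a).div_const δ).sub_const 1)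
  have hdg : ∀ x, HasDerivAt g (deriv S ((b - x) / δ - 1) * (-1 / δ)) x := fun x =>
    (hdS _).comp x ((((hasDerivAt_id x).const_sub b).div_const δ).sub_const 1)
  refine ⟨fun x => f x * g x, hf.mul hg, ?_, ?_, ?_, ?_⟩
  · refine closure_minimal (fun x hx => ?_) isClosed_Icc
    rw [Function.mem_support] at hx
    by_contra hcon
    rw [mem_Icc, not_and_or, not_le, not_le] at hcon
    apply hx
    rcases hcon with h | h
    · have : f x = 0 := Real.smoothTransition.zero_of_nonpos (by
        rw [sub_nonpos, div_le_one hδ]; linarith)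
      simp [this]
    · have : g x = 0 := Real.smoothTransition.zero_of_nonpos (by
        rw [sub_nonpos, div_le_one hδ]; linarith)
      simp [this]
  · intro x
    rw [abs_mul]
    exact mul_le_one₀ (hS _) (abs_nonneg _) (hS _)
  · intro x hx
    have h1 : f x = 1 := Real.smoothTransition.one_of_one_le (by
      rw [le_sub_iff_add_le, le_div_iff₀ hδ]; linarith [hx.1])
    have h2 : g x = 1 := Real.smoothTransition.one_of_one_le (by
      rw [le_sub_iff_add_le, le_div_iff₀ hδ]; linarith [hx.2])
    simp [h1, h2]
  · intro x
    have := ((hdf x).mul (hdg x)).deriv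
    change |deriv (f * g) x| ≤ _
    rw [this]
    refine (abs_add_le _ _).trans ?_
    rw [abs_mul, abs_mul, abs_mul, abs_mul]
    have e1 : |1 / δ| = 1 / δ := abs_of_pos (by positivity)
    have e2 : |-1 / δ| = 1 / δ := by rw [neg_div, abs_neg, e1]
    rw [e1, e2]
    have h1 : |deriv S ((x - a) / δ - 1)| * (1 / δ) * |g x| ≤ M * (1 / δ) * 1 := by
      gcongr
      · exact hM _
      · exact hS _
    have h2 : |f x| * (|deriv S ((b - x) / δ - 1)| * (1 / δ)) ≤ 1 * (M * (1 / δ)) := by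
      gcongr
      · exact hS _
      · exact hM _
    calc _ ≤ M * (1 / δ) * 1 + 1 * (M * (1 / δ)) := add_le_add h1 h2
      _ = 2 * M / δ := by ring

lemma IsTestFunction.deriv {a b : ℝ} {η : ℝ → ℂ} (h : IsTestFunction a b η) :
    IsTestFunction a b (deriv η) :=
  ⟨((contDiff_infty_iff_deriv (𝕜 := ℝ)).1 h.1).2, h.2.1.deriv, (tsupport_deriv_subset (𝕜 := ℝ)).trans h.2.2⟩

/-- Integration by parts against a smooth function `η` with `η a = η b` which need not vanish
near the end points. -/
lemma integral_mul_deriv_of_forall_test {a b : ℝ} (hab : a < b) {G g η : ℝ → ℂ}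
    (hG : ContinuousOn G (Icc a b)) (hper : G a = G b)
    (hg : IntervalIntegrable g volume a b)
    (h : ∀ η, IsTestFunction a b η → ∫ x in a..b, G x * deriv η x = -∫ x in a..b, g x * η x)
    (hη : ContDiff ℝ ∞ η) (hηper : η a = η b) :
    ∫ x in a..b, G x * deriv η x = -∫ x in a..b, g x * η x := by
  obtain ⟨M, hM0, hM⟩ := exists_cutoff
  have hba : 0 < b - a := sub_pos.2 hab
  set H : ℝ → ℂ := fun x => G x * η x
  have hH : ContinuousOn H (Icc a b) := hG.mul hη.continuous.continuousOn
  set w : ℝ → ℂ := fun x => G x * deriv η x + g x * η x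
  have hdη : Continuous (deriv η) := hη.continuous_deriv (by norm_num)
  have hGi : IntervalIntegrable G volume a b :=
    ContinuousOn.intervalIntegrable (by rwa [uIcc_of_le hab.le])
  have hGdη : IntervalIntegrable (fun x => G x * deriv η x) volume a b :=
    hGi.mul_continuousOn hdη.continuousOn
  have hgη : IntervalIntegrable (fun x => g x * η x) volume a b :=
    hg.mul_continuousOn hη.continuous.continuousOn
  have hw : IntervalIntegrable w volume a b := hGdη.add hgη
  suffices hz : ∫ x in a..b, w x = 0 by
    rw [intervalIntegral.integral_add hGdη hgη] at hz
    exact eq_neg_of_add_eq_zero_left hz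
  set δ : ℕ → ℝ := fun n => (b - a) / (5 * (n + 1))
  have hδ : ∀ n, 0 < δ n := fun n => by positivity
  have hδb : ∀ n, 4 * δ n < b - a := fun n => by
    have : δ n ≤ (b - a) / 5 := by
      apply div_le_div_of_nonneg_left hba.le (by norm_num)
      have : (0 : ℝ) ≤ n := n.cast_nonneg
      linarith
    linarith
  have hδt : Tendsto δ atTop (𝓝 0) := by
    have := (tendsto_one_div_add_atTop_nhds_zero_nat (𝕜 := ℝ)).const_mul ((b - a) / 5)
    rw [mul_zero] at this
    refine this.congr fun n => ?_
    simp only [δ]; field_simp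
  choose χ hχ1 hχ2 hχ3 hχ4 hχ5 using fun n => hM (hδ n) (hδb n)
  have hχsupp : ∀ n, tsupport (χ n) ⊆ Ioo a b := fun n => (hχ2 n).trans
    (Icc_subset_Ioo (by linarith [hδ n]) (by linarith [hδ n]))
  have hχout : ∀ n x, x ∉ Ioo a b → χ n x = 0 := fun n x hx =>
    image_eq_zero_of_notMem_tsupport fun h' => hx (hχsupp n h')
  have hχd : ∀ n x, HasDerivAt (χ n) (deriv (χ n) x) x := fun n x =>
    ((hχ1 n).differentiable (by norm_num) x).hasDerivAt
  have hχdc : ∀ n, Continuous (deriv (χ n)) := fun n => (hχ1 n).continuous_deriv (by norm_num)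
  -- the identity obtained from the test function `χ η`
  have hid : ∀ n, ∫ x in a..b, (χ n x : ℂ) * w x
      = -∫ x in a..b, ((deriv (χ n) x : ℝ) : ℂ) * (H x - H a) := by
    intro n
    have hχC : ContDiff ℝ ∞ (fun x => (χ n x : ℂ)) := Complex.ofRealCLM.contDiff.comp (hχ1 n)
    have htest : IsTestFunction a b (fun x => (χ n x : ℂ) * η x) := by
      have hs : tsupport (fun x => (χ n x : ℂ) * η x) ⊆ tsupport (χ n) := by
        apply closure_mono
        intro x hx
        rw [Function.mem_support] at hx ⊢
        intro h0; apply hx; simp [h0]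
      refine ⟨hχC.mul hη, ?_, hs.trans (hχsupp n)⟩
      exact isCompact_Icc.of_isClosed_subset (isClosed_tsupport _) (hs.trans (hχ2 n))
    have h1 := h _ htest
    have hd : ∀ x, deriv (fun x => (χ n x : ℂ) * η x) x
        = ((deriv (χ n) x : ℝ) : ℂ) * η x + χ n x * deriv η x := fun x =>
      ((hχd n x).ofReal_comp.mul (hη.differentiable (by norm_num) x).hasDerivAt).deriv
    simp only [hd] at h1
    have i1 : IntervalIntegrable (fun x => ((deriv (χ n) x : ℝ) : ℂ) * H x) volume a b := by
      apply ContinuousOn.intervalIntegrable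
      rw [uIcc_of_le hab.le]
      exact (Complex.continuous_ofReal.comp (hχdc n)).continuousOn.mul hH
    have i1' : IntervalIntegrable (fun x => ((deriv (χ n) x : ℝ) : ℂ) * H a) volume a b :=
      ((Complex.continuous_ofReal.comp (hχdc n)).mul continuous_const).intervalIntegrable _ _
    have i2 : IntervalIntegrable (fun x => (χ n x : ℂ) * (G x * deriv η x)) volume a b :=
      hGdη.continuousOn_mul hχC.continuous.continuousOn
    have i3 : IntervalIntegrable (fun x => (χ n x : ℂ) * (g x * η x)) volume a b :=
      hgη.continuousOn_mul hχC.continuous.continuousOn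
    -- The cutoff vanishes at both ends, so a constant may be subtracted from `H` under the integral
    -- against its derivative. The constant `H a = H b` makes both boundary layers small at once;
    -- this is where periodicity enters.
    have h0 : ∫ x in a..b, ((deriv (χ n) x : ℝ) : ℂ) * H a = 0 := by
      rw [intervalIntegral.integral_mul_const, intervalIntegral.integral_eq_sub_of_hasDerivAt
        (f := fun x => (χ n x : ℂ)) (fun x _ => (hχd n x).ofReal_comp)
        ((Complex.continuous_ofReal.comp (hχdc n)).intervalIntegrable _ _),
        hχout n a (by simp), hχout n b (by simp)]
      simp
    have e1 : ∫ x in a..b, G x * (((deriv (χ n) x : ℝ) : ℂ) * η x + χ n x * deriv η x)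
        = (∫ x in a..b, ((deriv (χ n) x : ℝ) : ℂ) * H x)
          + ∫ x in a..b, (χ n x : ℂ) * (G x * deriv η x) := by
      rw [← intervalIntegral.integral_add i1 i2]
      congr 1; ext x; simp only [H]; ring
    have e2 : ∫ x in a..b, g x * ((χ n x : ℂ) * η x) = ∫ x in a..b, (χ n x : ℂ) * (g x * η x) := by
      congr 1; ext x; ring
    have e3 : ∫ x in a..b, (χ n x : ℂ) * w x = (∫ x in a..b, (χ n x : ℂ) * (G x * deriv η x))
        + ∫ x in a..b, (χ n x : ℂ) * (g x * η x) := by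
      rw [← intervalIntegral.integral_add i2 i3]
      congr 1; ext x; simp only [w]; ring
    have e4 : ∫ x in a..b, ((deriv (χ n) x : ℝ) : ℂ) * (H x - H a)
        = ∫ x in a..b, ((deriv (χ n) x : ℝ) : ℂ) * H x := by
      simp only [mul_sub]
      rw [intervalIntegral.integral_sub i1 i1', h0, sub_zero]
    rw [e1, e2] at h1
    rw [e3, e4]
    linear_combination h1
  -- the left side converges to `∫ w`
  have hl : Tendsto (fun n => ∫ x in a..b, (χ n x : ℂ) * w x) atTop (𝓝 (∫ x in a..b, w x)) := by
    apply intervalIntegral.tendsto_integral_filter_of_dominated_convergence (fun x => ‖w x‖)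
    · refine Eventually.of_forall fun n => ?_
      have := (hw.continuousOn_mul (g := fun x => (χ n x : ℂ))
        (Complex.continuous_ofReal.comp (hχ1 n).continuous).continuousOn)
      exact (intervalIntegrable_iff.1 this).aestronglyMeasurable
    · refine Eventually.of_forall fun n => ae_of_all _ fun x _ => ?_
      rw [norm_mul, Complex.norm_real]
      exact mul_le_of_le_one_left (norm_nonneg _) (hχ3 n x)
    · exact hw.norm
    · have hb : ∀ᵐ x ∂(volume : Measure ℝ), x ≠ b := by simp [ae_iff, measure_singleton]
      filter_upwards [hb] with x hxb hx
      rw [uIoc_of_le hab.le] at hx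
      have hx1 : 0 < min (x - a) (b - x) :=
        lt_min (by linarith [hx.1]) (by have := lt_of_le_of_ne hx.2 hxb; linarith)
      have : ∀ᶠ n in atTop, 2 * δ n < min (x - a) (b - x) := by
        have h2 := hδt.const_mul 2
        rw [mul_zero] at h2
        exact h2.eventually_lt_const hx1
      refine tendsto_const_nhds.congr' ?_
      filter_upwards [this] with n hn
      rw [lt_min_iff] at hn
      rw [hχ4 n x ⟨by linarith, by linarith⟩]; simp
  -- the right side converges to `0`
  have hr : Tendsto (fun n => ∫ x in a..b, ((deriv (χ n) x : ℝ) : ℂ) * (H x - H a)) atTop (𝓝 0) := by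
    rw [Metric.tendsto_atTop]
    intro κ hκ
    -- A layer has length 2δ and carries a derivative of size M/δ, so it contributes at most 2Mκ' =
    -- κ/4; two layers stay below κ.
    set κ' := κ / (8 * M)
    have hκ' : 0 < κ' := by positivity
    have hHab : H a = H b := by simp only [H, hper, hηper]
    have ha := Metric.continuousWithinAt_iff.1 (hH a (left_mem_Icc.2 hab.le)) κ' hκ'
    have hb := Metric.continuousWithinAt_iff.1 (hH b (right_mem_Icc.2 hab.le)) κ' hκ'
    obtain ⟨r1, hr1, h1⟩ := ha
    obtain ⟨r2, hr2, h2⟩ := hb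
    have h3 := hδt.const_mul 2
    rw [mul_zero] at h3
    obtain ⟨n0, hn0⟩ := eventually_atTop.1 (h3.eventually_lt_const (lt_min hr1 hr2))
    refine ⟨n0, fun n hn => ?_⟩
    have hδn := lt_min_iff.1 (hn0 n hn)
    have hci : ∀ c d, c ∈ Icc a b → d ∈ Icc a b → IntervalIntegrable
        (fun x => ((deriv (χ n) x : ℝ) : ℂ) * (H x - H a)) volume c d := by
      intro c d hc hd
      apply ContinuousOn.intervalIntegrable
      refine ContinuousOn.mono ?_ (uIcc_subset_Icc hc hd)
      exact (Complex.continuous_ofReal.comp (hχdc n)).continuousOn.mul (hH.sub continuousOn_const)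
    have m1 : a + 2 * δ n ∈ Icc a b := ⟨by linarith [hδ n], by linarith [hδ n, hδb n]⟩
    have m2 : b - 2 * δ n ∈ Icc a b := ⟨by linarith [hδ n, hδb n], by linarith [hδ n]⟩
    have ma := left_mem_Icc.2 hab.le
    have mb := right_mem_Icc.2 hab.le
    rw [dist_zero_right, ← intervalIntegral.integral_add_adjacent_intervals (hci _ _ ma m1)
      (hci _ _ m1 mb), ← intervalIntegral.integral_add_adjacent_intervals (hci _ _ m1 m2)
      (hci _ _ m2 mb)]
    have z2 : ∫ x in (a + 2 * δ n)..(b - 2 * δ n), ((deriv (χ n) x : ℝ) : ℂ) * (H x - H a) = 0 := by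
      rw [intervalIntegral.integral_congr_Ioo_of_le (g := fun _ => 0) (by linarith [hδb n])]
      · simp
      · intro x hx
        have : χ n =ᶠ[𝓝 x] fun _ => 1 := by
          filter_upwards [Ioo_mem_nhds hx.1 hx.2] with y hy
          exact hχ4 n y (Ioo_subset_Icc_self hy)
        simp [this.deriv_eq]
    have z1 : ‖∫ x in a..(a + 2 * δ n), ((deriv (χ n) x : ℝ) : ℂ) * (H x - H a)‖
        ≤ M / δ n * κ' * |a + 2 * δ n - a| := by
      apply intervalIntegral.norm_integral_le_of_norm_le_const
      intro x hx
      rw [uIoc_of_le m1.1] at hx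
      rw [norm_mul, Complex.norm_real]
      refine mul_le_mul (hχ5 n x) ?_ (norm_nonneg _) (by have := hδ n; positivity)
      rw [← dist_eq_norm]
      refine (h1 ⟨hx.1.le, hx.2.trans m1.2⟩ ?_).le
      rw [Real.dist_eq, abs_of_pos (by linarith [hx.1])]
      linarith [hx.2]
    have z3 : ‖∫ x in (b - 2 * δ n)..b, ((deriv (χ n) x : ℝ) : ℂ) * (H x - H a)‖
        ≤ M / δ n * κ' * |b - (b - 2 * δ n)| := by
      apply intervalIntegral.norm_integral_le_of_norm_le_const
      intro x hx
      rw [uIoc_of_le m2.2] at hx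
      rw [norm_mul, Complex.norm_real]
      refine mul_le_mul (hχ5 n x) ?_ (norm_nonneg _) (by have := hδ n; positivity)
      rw [← dist_eq_norm, hHab]
      refine (h2 ⟨m2.1.trans hx.1.le, hx.2⟩ ?_).le
      rw [Real.dist_eq, abs_of_nonpos (by linarith [hx.2])]
      linarith [hx.1]
    have hδn0 := hδ n
    rw [z2, zero_add]
    refine (norm_add_le _ _).trans_lt ?_
    rw [show a + 2 * δ n - a = 2 * δ n by ring, abs_of_pos (by positivity)] at z1
    rw [show b - (b - 2 * δ n) = 2 * δ n by ring, abs_of_pos (by positivity)] at z3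
    have e : M / δ n * κ' * (2 * δ n) = κ / 4 := by
      simp only [κ']; field_simp; norm_num
    rw [e] at z1 z3
    linarith
  have := tendsto_nhds_unique (hl.congr hid) hr.neg
  simpa using this

/-- The exponentials are periodic but not compactly supported in `(a, b)`, so they are admissible
only through the extended integration by parts. -/
lemma fcoef_weakDeriv {a b : ℝ} (hab : a < b) {G g : ℝ → ℂ}
    (hG : ContinuousOn G (Icc a b)) (hper : G a = G b) (hg : IntervalIntegrable g volume a b)
    (h : ∀ η, IsTestFunction a b η → ∫ x in a..b, G x * deriv η x = -∫ x in a..b, g x * η x)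
    (l : ℤ) : fcoef a b g l = Complex.I * freq a b l * fcoef a b G l := by
  have h1 := integral_mul_deriv_of_forall_test hab hG hper hg h (contDiff_basisFun a b (-l))
    (by rw [basisFun_left, basisFun_right hab])
  have hd : ∀ x, deriv (basisFun a b (-l)) x = -(Complex.I * freq a b l) * basisFun a b (-l) x :=
    fun x => by rw [(hasDerivAt_basisFun a b (-l) x).deriv, freq_neg]; push_cast; ring
  simp only [hd, mul_left_comm (G _), intervalIntegral.integral_const_mul] at h1
  rw [fcoef_def', fcoef_def']
  linear_combination (1 / ((b : ℂ) - a)) * h1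

/-! ### Uniqueness and linearity of weak derivatives; the periodic Sobolev spaces. -/

lemma intervalIntegrable_of_memLp {a b : ℝ} (hab : a < b) {u : ℝ → ℂ}
    (hu : MemLp u 2 (volume.restrict (Ioo a b))) : IntervalIntegrable u volume a b := by
  rw [intervalIntegrable_iff_integrableOn_Ioo_of_le hab.le]
  exact hu.integrable (by norm_num)

/-- Fundamental lemma of the calculus of variations. Since `weakDeriv` is obtained by choice, this
uniqueness is what allows any other weak derivative to be used for computing norms. -/
lemma HasWeakDeriv.ae_eq {a b : ℝ} (hab : a < b) {k : ℕ} {u g g' : ℝ → ℂ}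
    (h : HasWeakDeriv a b k u g) (h' : HasWeakDeriv a b k u g') :
    g =ᵐ[volume.restrict (Ioo a b)] g' := by
  have hi := intervalIntegrable_of_memLp hab h.memLp_deriv
  have hi' := intervalIntegrable_of_memLp hab h'.memLp_deriv
  have hint : IntegrableOn (fun x => g x - g' x) (Ioo a b) := by
    rw [← intervalIntegrable_iff_integrableOn_Ioo_of_le hab.le]
    exact hi.sub hi'
  have := isOpen_Ioo.ae_eq_zero_of_integral_contDiff_smul_eq_zero (U := Ioo a b) (μ := volume)
    (f := fun x => g x - g' x) hint.locallyIntegrableOn ?_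
  · rw [Filter.EventuallyEq, ae_restrict_iff' measurableSet_Ioo]
    filter_upwards [this] with x hx hxm
    exact sub_eq_zero.1 (hx hxm)
  · intro θ hθ1 hθ2 hθ3
    have hsupp : tsupport (fun x => (θ x : ℂ)) ⊆ tsupport θ := by
      apply closure_mono
      intro x hx
      rw [Function.mem_support] at hx ⊢
      intro h0; apply hx; simp [h0]
    have ht : IsTestFunction a b (fun x => (θ x : ℂ)) :=
      ⟨Complex.ofRealCLM.contDiff.comp hθ1,
        hθ2.of_isClosed_subset (isClosed_tsupport _) hsupp, hsupp.trans hθ3⟩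
    have e : ∫ x in a..b, g x * (θ x : ℂ) = ∫ x in a..b, g' x * (θ x : ℂ) := by
      have := (h.integral_eq _ ht).symm.trans (h'.integral_eq _ ht)
      exact mul_left_cancel₀ (pow_ne_zero _ (by norm_num)) this
    have hz : ∀ x, x ∉ Ioc a b → θ x • (g x - g' x) = 0 := fun x hx => by
      rw [image_eq_zero_of_notMem_tsupport (f := θ) fun h' => hx (Ioo_subset_Ioc_self (hθ3 h')),
        zero_smul]
    rw [← setIntegral_eq_integral_of_forall_compl_eq_zero hz,
      ← intervalIntegral.integral_of_le hab.le]
    have hθC : Continuous (fun x => (θ x : ℂ)) := Complex.continuous_ofReal.comp hθ1.continuous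
    have : ∀ x, θ x • (g x - g' x) = g x * (θ x : ℂ) - g' x * (θ x : ℂ) := fun x => by
      rw [Complex.real_smul]; ring
    simp only [this]
    rw [intervalIntegral.integral_sub (hi.mul_continuousOn hθC.continuousOn)
      (hi'.mul_continuousOn hθC.continuousOn), e, sub_self]

lemma hasWeakDeriv_zero {a b : ℝ} {u : ℝ → ℂ} (h : MemLp u 2 (volume.restrict (Ioo a b))) :
    HasWeakDeriv a b 0 u u := ⟨h, h, fun η _ => by simp⟩

lemma HasWeakDeriv.add {a b : ℝ} (hab : a < b) {k : ℕ} {u g u' g' : ℝ → ℂ}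
    (h : HasWeakDeriv a b k u g) (h' : HasWeakDeriv a b k u' g') :
    HasWeakDeriv a b k (fun x => u x + u' x) (fun x => g x + g' x) := by
  refine ⟨h.memLp.add h'.memLp, h.memLp_deriv.add h'.memLp_deriv, fun η hη => ?_⟩
  have c1 : Continuous (iteratedDeriv k η) := hη.1.continuous_iteratedDeriv k (by exact_mod_cast le_top)
  have c2 : Continuous η := hη.1.continuous
  simp only [add_mul]
  rw [intervalIntegral.integral_add, intervalIntegral.integral_add, h.integral_eq η hη,
    h'.integral_eq η hη, mul_add]
  · exact (intervalIntegrable_of_memLp hab h.memLp_deriv).mul_continuousOn c2.continuousOn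
  · exact (intervalIntegrable_of_memLp hab h'.memLp_deriv).mul_continuousOn c2.continuousOn
  · exact (intervalIntegrable_of_memLp hab h.memLp).mul_continuousOn c1.continuousOn
  · exact (intervalIntegrable_of_memLp hab h'.memLp).mul_continuousOn c1.continuousOn

lemma HasWeakDeriv.const_mul {a b : ℝ} {k : ℕ} {u g : ℝ → ℂ} (c : ℂ)
    (h : HasWeakDeriv a b k u g) :
    HasWeakDeriv a b k (fun x => c * u x) (fun x => c * g x) := by
  refine ⟨h.memLp.const_mul c, h.memLp_deriv.const_mul c, fun η hη => ?_⟩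
  simp only [mul_assoc, intervalIntegral.integral_const_mul]
  rw [h.integral_eq η hη]; ring

lemma MemHper.const_mul {a b : ℝ} {m : ℕ} {u : ℝ → ℂ} (c : ℂ) (h : MemHper a b m u) :
    MemHper a b m (fun x => c * u x) where
  memH k hk := by
    obtain ⟨g, hg⟩ := h.memH k hk
    exact ⟨_, hg.const_mul c⟩
  continuousOn hm := continuousOn_const.mul (h.continuousOn hm)
  periodic k hk := by
    obtain ⟨g, hg, hc, hp⟩ := h.periodic k hk
    exact ⟨_, hg.const_mul c, continuousOn_const.mul hc, by rw [hp]⟩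

lemma MemHper.add {a b : ℝ} (hab : a < b) {m : ℕ} {u v : ℝ → ℂ} (h : MemHper a b m u)
    (h' : MemHper a b m v) : MemHper a b m (fun x => u x + v x) where
  memH k hk := by
    obtain ⟨g, hg⟩ := h.memH k hk
    obtain ⟨g', hg'⟩ := h'.memH k hk
    exact ⟨_, hg.add hab hg'⟩
  continuousOn hm := (h.continuousOn hm).add (h'.continuousOn hm)
  periodic k hk := by
    obtain ⟨g, hg, hc, hp⟩ := h.periodic k hk
    obtain ⟨g', hg', hc', hp'⟩ := h'.periodic k hk
    exact ⟨_, hg.add hab hg', hc.add hc', by rw [hp, hp']⟩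

lemma MemHper.sub {a b : ℝ} (hab : a < b) {m : ℕ} {u v : ℝ → ℂ} (h : MemHper a b m u)
    (h' : MemHper a b m v) : MemHper a b m (fun x => u x - v x) := by
  have := h.add hab (h'.const_mul (-1))
  simpa [sub_eq_add_neg] using this

lemma MemHper.of_le {a b : ℝ} {m m' : ℕ} {u : ℝ → ℂ} (h : MemHper a b m u) (hm : m' ≤ m) :
    MemHper a b m' u :=
  ⟨fun k hk => h.memH k (hk.trans hm), fun h0 => h.continuousOn (h0.trans_le hm),
    fun k hk => h.periodic k (hk.trans_le hm)⟩

lemma MemHper.memLp {a b : ℝ} {m : ℕ} {u : ℝ → ℂ} (h : MemHper a b m u) :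
    MemLp u 2 (volume.restrict (Ioo a b)) := (h.memH 0 (Nat.zero_le _)).choose_spec.memLp

/-- Periodicity is given for some continuous representative of the zeroth derivative. Two continuous
functions that agree almost everywhere agree up to the end points, so it passes to `u` itself. -/
lemma MemHper.apply_eq {a b : ℝ} (hab : a < b) {m : ℕ} (hm : 0 < m) {u : ℝ → ℂ}
    (h : MemHper a b m u) : u a = u b := by
  obtain ⟨g, hg, hc, hp⟩ := h.periodic 0 hm
  have h1 := (hasWeakDeriv_zero h.memLp).ae_eq hab hg
  have h2 : EqOn u g (Icc a b) := by
    have := Measure.eqOn_Icc_of_ae_eq volume hab.ne (f := u) (g := g) ?_ (h.continuousOn hm) hc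
    · exact this
    · rwa [Measure.restrict_congr_set Ioo_ae_eq_Icc] at h1
  rw [h2 (left_mem_Icc.2 hab.le), h2 (right_mem_Icc.2 hab.le), hp]

/-- Induction on the order. Passing from k to k + 1 uses the continuous periodic representative of
order k < m; the derivative of top order only has to be square integrable. -/
lemma MemHper.fcoef_eq {a b : ℝ} (hab : a < b) {m : ℕ} {u : ℝ → ℂ} (h : MemHper a b m u) :
    ∀ k ≤ m, ∀ g, HasWeakDeriv a b k u g → ∀ l,
      fcoef a b g l = (Complex.I * freq a b l) ^ k * fcoef a b u l := by
  intro k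
  induction k with
  | zero =>
    intro _ g hg l
    rw [pow_zero, one_mul]
    exact fcoef_congr_ae hab (hg.ae_eq hab (hasWeakDeriv_zero h.memLp)) l
  | succ k ih =>
    intro hk g hg l
    obtain ⟨G, hG, hc, hp⟩ := h.periodic k hk
    rw [fcoef_weakDeriv hab hc hp (intervalIntegrable_of_memLp hab hg.memLp_deriv) ?_ l,
      ih (by omega) G hG l]
    · ring
    · intro η hη
      have h1 := hG.integral_eq _ hη.deriv
      have h2 := hg.integral_eq _ hη
      rw [iteratedDeriv_succ'] at h2
      rw [h1] at h2
      have : ((-1 : ℂ)) ^ k ≠ 0 := pow_ne_zero _ (by norm_num)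
      apply mul_left_cancel₀ this
      rw [h2]; ring

/-! ### Sobolev norms read off from Fourier coefficients. -/

lemma weakDeriv_spec {a b : ℝ} {k : ℕ} {u : ℝ → ℂ} (h : ∃ g, HasWeakDeriv a b k u g) :
    HasWeakDeriv a b k u (weakDeriv a b k u) := by
  unfold weakDeriv
  rw [dif_pos h]
  exact h.choose_spec

lemma sobolevNorm_sq {a b : ℝ} (hab : a < b) (m : ℕ) (u : ℝ → ℂ) : sobolevNorm a b m u ^ 2 =
    ∑ k ∈ Finset.range (m + 1), ∫ x in a..b, ‖weakDeriv a b k u x‖ ^ 2 := by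
  unfold sobolevNorm
  rw [Real.sq_sqrt]
  exact Finset.sum_nonneg fun k _ => intervalIntegral.integral_nonneg hab.le fun x _ => by positivity

lemma sobolevNorm_nonneg (a b : ℝ) (m : ℕ) (u : ℝ → ℂ) : 0 ≤ sobolevNorm a b m u :=
  Real.sqrt_nonneg _

lemma sobolevNorm_mono {a b : ℝ} (hab : a < b) {m n : ℕ} (hmn : m ≤ n) (u : ℝ → ℂ) :
    sobolevNorm a b m u ≤ sobolevNorm a b n u := by
  unfold sobolevNorm
  apply Real.sqrt_le_sqrt
  apply Finset.sum_le_sum_of_subset_of_nonneg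
  · exact Finset.range_mono (by omega)
  · exact fun k _ _ => intervalIntegral.integral_nonneg hab.le fun x _ => by positivity

/-- The Sobolev norm in terms of Fourier coefficients. -/
lemma MemHper.hasSum_sobolevNorm {a b : ℝ} (hab : a < b) {m : ℕ} {u : ℝ → ℂ}
    (h : MemHper a b m u) : HasSum
      (fun l => ∑ k ∈ Finset.range (m + 1), (|freq a b l| ^ k * ‖fcoef a b u l‖) ^ 2)
      ((b - a)⁻¹ * sobolevNorm a b m u ^ 2) := by
  rw [sobolevNorm_sq hab, Finset.mul_sum]
  apply hasSum_sum
  intro k hk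
  have hk' : k ≤ m := by simpa [Nat.lt_succ_iff] using hk
  have hw := weakDeriv_spec (h.memH k hk')
  convert hasSum_sq_fcoef hab hw.memLp_deriv using 3 with l
  rw [h.fcoef_eq hab k hk' _ hw l]
  simp

end KGS

namespace KGS

/-! ### Convolution of weighted square summable sequences -/

/-- Cauchy-Schwarz with values in `ENNReal`, where the convolution estimates need no summability
side conditions. -/
lemma tsum_mul_sq_le {ι : Type*} (f g : ι → ENNReal) :
    (∑' i, f i * g i) ^ 2 ≤ (∑' i, f i ^ 2) * ∑' i, g i ^ 2 := by
  have key : ∑' i, f i * g i ≤ ((∑' i, f i ^ 2) * ∑' i, g i ^ 2) ^ (1 / 2 : ℝ) := by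
    rw [ENNReal.tsum_eq_iSup_sum]
    refine iSup_le fun S => ?_
    have := ENNReal.inner_le_Lp_mul_Lq S f g (p := 2) (q := 2) (by
      rw [Real.holderConjugate_iff]; norm_num)
    refine this.trans ?_
    rw [← ENNReal.mul_rpow_of_nonneg _ _ (by norm_num)]
    refine ENNReal.rpow_le_rpow ?_ (by norm_num)
    simp only [ENNReal.rpow_ofNat]
    gcongr
    · exact ENNReal.sum_le_tsum S
    · exact ENNReal.sum_le_tsum S
  calc (∑' i, f i * g i) ^ 2 ≤ (((∑' i, f i ^ 2) * ∑' i, g i ^ 2) ^ (1 / 2 : ℝ)) ^ 2 := by gcongr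
    _ = _ := by
      rw [← ENNReal.rpow_ofNat, ← ENNReal.rpow_mul]; norm_num

lemma tsum_mul_sq_le_weighted {ι : Type*} (f g : ι → ENNReal) :
    (∑' i, f i * g i) ^ 2 ≤ (∑' i, f i ^ 2 * g i) * ∑' i, g i := by
  have hh : ∀ x : ENNReal, x ^ (1 / 2 : ℝ) * x ^ (1 / 2 : ℝ) = x := fun x => by
    rw [← ENNReal.rpow_add_of_nonneg _ _ (by norm_num) (by norm_num)]; norm_num
  have := tsum_mul_sq_le (fun i => f i * g i ^ (1 / 2 : ℝ)) (fun i => g i ^ (1 / 2 : ℝ))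
  simp only [mul_assoc, mul_pow, hh] at this
  simp only [pow_two (_ ^ (1 / 2 : ℝ)), hh] at this
  exact this

/-- Young's inequality ℓ² * ℓ¹ ⊂ ℓ²: Cauchy-Schwarz with `g` as the weight, then exchange of the
sums and translation invariance. -/
lemma tsum_conv_sq_le {G : Type*} [AddCommGroup G] (f g : G → ENNReal) :
    ∑' l, (∑' k, f k * g (l - k)) ^ 2 ≤ (∑' k, f k ^ 2) * (∑' k, g k) ^ 2 := by
  have h1 : ∀ l, ∑' k, g (l - k) = ∑' k, g k := fun l => (Equiv.subLeft l).tsum_eq g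
  have h2 : ∀ k, ∑' l, g (l - k) = ∑' k, g k := fun k => (Equiv.subRight k).tsum_eq g
  calc ∑' l, (∑' k, f k * g (l - k)) ^ 2
      ≤ ∑' l, (∑' k, f k ^ 2 * g (l - k)) * ∑' k, g (l - k) :=
        ENNReal.tsum_le_tsum fun l => tsum_mul_sq_le_weighted _ _
    _ = (∑' l, ∑' k, f k ^ 2 * g (l - k)) * ∑' k, g k := by
        simp only [h1]; rw [ENNReal.tsum_mul_right]
    _ = (∑' k, f k ^ 2) * (∑' k, g k) ^ 2 := by
        rw [ENNReal.tsum_comm]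
        simp only [ENNReal.tsum_mul_left, h2]
        rw [ENNReal.tsum_mul_right]; ring

lemma ennreal_add_sq_le (x y : ENNReal) : (x + y) ^ 2 ≤ 4 * (x ^ 2 + y ^ 2) := by
  wlog h : x ≤ y generalizing x y
  · rw [add_comm x, add_comm (x ^ 2)]; exact this y x (le_of_not_ge h)
  calc (x + y) ^ 2 ≤ (y + y) ^ 2 := by gcongr
    _ = 4 * y ^ 2 := by ring
    _ ≤ _ := by gcongr; exact le_add_self

/-- Weighted ℓ² embeds into ℓ¹ when the squared inverse weight is summable: the sequence form of the
Sobolev embedding. -/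
lemma tsum_sq_le_of_weight {ι : Type*} (W f : ι → ENNReal) (h0 : ∀ i, W i ≠ 0)
    (ht : ∀ i, W i ≠ ⊤) : (∑' i, f i) ^ 2 ≤ (∑' i, (W i)⁻¹ ^ 2) * ∑' i, (W i * f i) ^ 2 := by
  have := tsum_mul_sq_le (fun i => (W i)⁻¹) (fun i => W i * f i)
  simpa only [← mul_assoc, ENNReal.inv_mul_cancel (h0 _) (ht _), one_mul] using this

/-- The convolution algebra property of weighted `ℓ²`. -/
lemma tsum_weighted_conv_sq_le {G : Type*} [AddCommGroup G] (W : G → ENNReal) (A : ENNReal)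
    (h0 : ∀ i, W i ≠ 0) (ht : ∀ i, W i ≠ ⊤) (hW : ∀ k l, W l ≤ A * (W k + W (l - k)))
    (f g : G → ENNReal) :
    ∑' l, (W l * ∑' k, f k * g (l - k)) ^ 2 ≤
      8 * A ^ 2 * (∑' i, (W i)⁻¹ ^ 2) * (∑' i, (W i * f i) ^ 2) * ∑' i, (W i * g i) ^ 2 := by
  -- Quasi-subadditivity puts the weight on one of the two factors; the other one is then measured
  -- in ℓ¹ and Young's inequality applies.
  have hl : ∀ l, (W l * ∑' k, f k * g (l - k)) ^ 2 ≤ 4 * A ^ 2 *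
      ((∑' k, (W k * f k) * g (l - k)) ^ 2 + (∑' k, (W k * g k) * f (l - k)) ^ 2) := by
    intro l
    have e : ∑' k, f k * (W (l - k) * g (l - k)) = ∑' k, (W k * g k) * f (l - k) := by
      rw [← (Equiv.subLeft l).tsum_eq (fun k => f k * (W (l - k) * g (l - k)))]
      simp [mul_comm]
    have h1 : W l * ∑' k, f k * g (l - k)
        ≤ A * ((∑' k, (W k * f k) * g (l - k)) + ∑' k, (W k * g k) * f (l - k)) := by
      rw [← e, ← ENNReal.tsum_add, ← ENNReal.tsum_mul_left, ← ENNReal.tsum_mul_left]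
      refine ENNReal.tsum_le_tsum fun k => ?_
      calc W l * (f k * g (l - k)) ≤ (A * (W k + W (l - k))) * (f k * g (l - k)) := by
            gcongr; exact hW k l
        _ = _ := by ring
    calc _ ≤ (A * ((∑' k, (W k * f k) * g (l - k)) + ∑' k, (W k * g k) * f (l - k))) ^ 2 := by
          gcongr
      _ = A ^ 2 * ((∑' k, (W k * f k) * g (l - k)) + ∑' k, (W k * g k) * f (l - k)) ^ 2 := by
          rw [mul_pow]
      _ ≤ A ^ 2 * (4 * ((∑' k, (W k * f k) * g (l - k)) ^ 2
            + (∑' k, (W k * g k) * f (l - k)) ^ 2)) := by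
          gcongr; exact ennreal_add_sq_le _ _
      _ = _ := by ring
  calc _ ≤ ∑' l, 4 * A ^ 2 * ((∑' k, (W k * f k) * g (l - k)) ^ 2
        + (∑' k, (W k * g k) * f (l - k)) ^ 2) := ENNReal.tsum_le_tsum hl
    _ = 4 * A ^ 2 * ((∑' l, (∑' k, (W k * f k) * g (l - k)) ^ 2)
        + ∑' l, (∑' k, (W k * g k) * f (l - k)) ^ 2) := by
        rw [ENNReal.tsum_mul_left, ENNReal.tsum_add]
    _ ≤ 4 * A ^ 2 * ((∑' k, (W k * f k) ^ 2) * ((∑' i, (W i)⁻¹ ^ 2) * ∑' i, (W i * g i) ^ 2)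
        + (∑' k, (W k * g k) ^ 2) * ((∑' i, (W i)⁻¹ ^ 2) * ∑' i, (W i * f i) ^ 2)) := by
        gcongr
        · exact (tsum_conv_sq_le _ _).trans (by gcongr; exact tsum_sq_le_of_weight W g h0 ht)
        · exact (tsum_conv_sq_le _ _).trans (by gcongr; exact tsum_sq_le_of_weight W f h0 ht)
    _ = _ := by ring

/-! ### Weighted norms of Fourier coefficients -/

/-- The weight `√(1 + μ_l²)`. -/
noncomputable def wt (a b : ℝ) (l : ℤ) : ℝ := Real.sqrt (1 + freq a b l ^ 2)

lemma wt_sq (a b : ℝ) (l : ℤ) : wt a b l ^ 2 = 1 + freq a b l ^ 2 := Real.sq_sqrt (by positivity)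

lemma one_le_wt (a b : ℝ) (l : ℤ) : 1 ≤ wt a b l := by
  unfold wt; rw [Real.one_le_sqrt]; nlinarith [sq_nonneg (freq a b l)]

lemma wt_pos (a b : ℝ) (l : ℤ) : 0 < wt a b l := one_pos.trans_le (one_le_wt a b l)

lemma abs_freq_le_wt (a b : ℝ) (l : ℤ) : |freq a b l| ≤ wt a b l := by
  unfold wt; apply Real.abs_le_sqrt; linarith

lemma freq_sq_le_wt_sq (a b : ℝ) (l : ℤ) : freq a b l ^ 2 ≤ wt a b l ^ 2 := by
  rw [wt_sq]; linarith

lemma wt_neg (a b : ℝ) (l : ℤ) : wt a b (-l) = wt a b l := by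
  unfold wt; rw [freq_neg]; simp

lemma freq_add (a b : ℝ) (k l : ℤ) : freq a b (k + l) = freq a b k + freq a b l := by
  unfold freq; push_cast; ring

lemma abs_freq {a b : ℝ} (hab : a < b) (l : ℤ) : |freq a b l| = 2 * Real.pi / (b - a) * |(l : ℝ)| := by
  unfold freq
  have : 0 < b - a := sub_pos.2 hab
  rw [abs_div, abs_mul, abs_of_pos this, abs_of_pos (by positivity : 0 < 2 * Real.pi)]
  ring

lemma wt_le_wt_of_abs_le {a b : ℝ} (hab : a < b) {k l : ℤ} (h : |k| ≤ |l|) : wt a b k ≤ wt a b l := by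
  unfold wt
  apply Real.sqrt_le_sqrt
  have : |freq a b k| ≤ |freq a b l| := by
    rw [abs_freq hab, abs_freq hab]
    have h1 : |(k : ℝ)| ≤ |(l : ℝ)| := by exact_mod_cast h
    have : 0 < b - a := sub_pos.2 hab
    gcongr
  have := sq_le_sq.2 this
  linarith

lemma wt_add_le (a b : ℝ) (k l : ℤ) : wt a b (k + l) ≤ wt a b k + wt a b l := by
  have h1 := wt_sq a b k
  have h2 := wt_sq a b l
  have h3 := abs_freq_le_wt a b k
  have h4 := abs_freq_le_wt a b l
  have h5 : |freq a b k| * |freq a b l| ≤ wt a b k * wt a b l :=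
    mul_le_mul h3 h4 (abs_nonneg _) (wt_pos a b k).le
  rw [← abs_mul] at h5
  have h6 := le_abs_self (freq a b k * freq a b l)
  have h7 := wt_pos a b k
  have h8 := wt_pos a b l
  apply le_of_sq_le_sq _ (by positivity)
  rw [wt_sq, freq_add]
  nlinarith
where le_of_sq_le_sq {x y : ℝ} (h : x ^ 2 ≤ y ^ 2) (hy : 0 ≤ y) : x ≤ y :=
  abs_le_of_sq_le_sq' h hy |>.2

lemma wt_pow_le (a b : ℝ) (s : ℕ) (k l : ℤ) :
    wt a b l ^ s ≤ 2 ^ s * (wt a b k ^ s + wt a b (l - k) ^ s) := by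
  have h := wt_add_le a b k (l - k)
  rw [add_sub_cancel] at h
  have h7 := wt_pos a b k
  have h8 := wt_pos a b (l - k)
  have h9 := wt_pos a b l
  calc wt a b l ^ s ≤ (wt a b k + wt a b (l - k)) ^ s := by gcongr
    _ ≤ 2 ^ (s - 1) * (wt a b k ^ s + wt a b (l - k) ^ s) := add_pow_le h7.le h8.le s
    _ ≤ _ := by gcongr <;> norm_num

lemma summable_wt_inv_sq {a b : ℝ} (hab : a < b) : Summable fun l => (wt a b l)⁻¹ ^ 2 := by
  have h1 : Summable fun l : ℤ => ((b - a) / (2 * Real.pi)) ^ 2 * (1 / (l : ℝ) ^ 2) :=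
    (Real.summable_one_div_int_pow.2 (by norm_num)).mul_left _
  -- The mode 0 is not covered by the majorant C/l² and gets a term of its own.
  have h2 : Summable fun l : ℤ => if l = 0 then (1 : ℝ) else 0 :=
    (hasSum_ite_eq 0 1).summable
  refine Summable.of_nonneg_of_le (fun l => by positivity) (fun l => ?_) (h1.add h2)
  have hb : 0 < b - a := sub_pos.2 hab
  by_cases hl : l = 0
  · subst hl; simp [wt, freq]
  · simp only [hl, if_false, add_zero]
    rw [inv_pow, wt_sq]
    have hl' : (0 : ℝ) < (l : ℝ) ^ 2 := by positivity
    have : freq a b l ^ 2 = ((2 * Real.pi) / (b - a)) ^ 2 * (l : ℝ) ^ 2 := by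
      unfold freq; ring
    have h3 : 0 < ((2 * Real.pi) / (b - a)) ^ 2 * (l : ℝ) ^ 2 := by
      have := Real.pi_pos; positivity
    calc (1 + freq a b l ^ 2)⁻¹ ≤ (((2 * Real.pi) / (b - a)) ^ 2 * (l : ℝ) ^ 2)⁻¹ := by
          rw [this]; gcongr; linarith
      _ = _ := by have := Real.pi_pos; field_simp

/-- `∑ (1 + μ_l²)⁻¹`. -/
noncomputable def wtSum (a b : ℝ) : ℝ := ∑' l, (wt a b l)⁻¹ ^ 2

lemma wtSum_nonneg (a b : ℝ) : 0 ≤ wtSum a b := tsum_nonneg fun l => by positivity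

/-- All partial sums of `∑ (1 + μ_l²)^s |c_l|²` are at most `K²`. -/
def HsBound (a b : ℝ) (s : ℕ) (c : ℤ → ℂ) (K : ℝ) : Prop :=
  ∀ S : Finset ℤ, ∑ l ∈ S, (wt a b l ^ s * ‖c l‖) ^ 2 ≤ K ^ 2

/-- Bridge between the real partial sums, which suit finite sets of modes, and the `ENNReal` sums of
the convolution estimates. -/
lemma hsBound_iff {a b : ℝ} {s : ℕ} {c : ℤ → ℂ} {K : ℝ} (hK : 0 ≤ K) : HsBound a b s c K ↔
    ∑' l, (ENNReal.ofReal (wt a b l ^ s) * ‖c l‖ₑ) ^ 2 ≤ ENNReal.ofReal K ^ 2 := by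
  have e : ∀ l, (ENNReal.ofReal (wt a b l ^ s) * ‖c l‖ₑ) ^ 2
      = ENNReal.ofReal ((wt a b l ^ s * ‖c l‖) ^ 2) := fun l => by
    have := wt_pos a b l
    rw [ENNReal.ofReal_pow (p := wt a b l ^ s * ‖c l‖) (by positivity),
      ENNReal.ofReal_mul (by positivity), ofReal_norm]
  have e2 : ∀ S : Finset ℤ, ∑ l ∈ S, (ENNReal.ofReal (wt a b l ^ s) * ‖c l‖ₑ) ^ 2
      = ENNReal.ofReal (∑ l ∈ S, (wt a b l ^ s * ‖c l‖) ^ 2) := fun S => by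
    rw [ENNReal.ofReal_sum_of_nonneg fun l _ => by positivity]
    simp only [e]
  rw [ENNReal.tsum_eq_iSup_sum, iSup_le_iff]
  refine forall_congr' fun S => ?_
  rw [e2, ← ENNReal.ofReal_pow hK, ENNReal.ofReal_le_ofReal_iff (by positivity)]

lemma HsBound.mono {a b : ℝ} {s : ℕ} {c : ℤ → ℂ} {K K' : ℝ} (h : HsBound a b s c K) (hK : 0 ≤ K)
    (hKK : K ≤ K') : HsBound a b s c K' := fun S => (h S).trans (by gcongr)

lemma HsBound.of_le {a b : ℝ} {s s' : ℕ} {c : ℤ → ℂ} {K : ℝ} (h : HsBound a b s c K) (hs : s' ≤ s) :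
    HsBound a b s' c K := fun S => by
  refine (Finset.sum_le_sum fun l _ => ?_).trans (h S)
  have := one_le_wt a b l
  have := wt_pos a b l
  gcongr

lemma HsBound.conj_neg {a b : ℝ} {s : ℕ} {c : ℤ → ℂ} {K : ℝ} (h : HsBound a b s c K) :
    HsBound a b s (fun l => starRingEnd ℂ (c (-l))) K := fun S => by
  have := h (S.map (Equiv.neg ℤ).toEmbedding)
  simpa [wt_neg] using this

/-- The convolution of two sequences. -/
noncomputable def conv (c d : ℤ → ℂ) (l : ℤ) : ℂ := ∑' k, c k * d (l - k)

lemma tsum_wt_inv_sq {a b : ℝ} (hab : a < b) {s : ℕ} (hs : 1 ≤ s) :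
    ∑' l, (ENNReal.ofReal (wt a b l ^ s))⁻¹ ^ 2 ≤ ENNReal.ofReal (wtSum a b) := by
  unfold wtSum
  rw [ENNReal.ofReal_tsum_of_nonneg (fun l => by positivity) (summable_wt_inv_sq hab)]
  refine ENNReal.tsum_le_tsum fun l => ?_
  have h0 := wt_pos a b l
  rw [← ENNReal.ofReal_inv_of_pos (by positivity), ← ENNReal.ofReal_pow (by positivity)]
  apply ENNReal.ofReal_le_ofReal
  have : wt a b l ≤ wt a b l ^ s := le_self_pow₀ (one_le_wt a b l) (by omega)
  gcongr

/-- In one dimension H^s is an algebra for s ≥ 1: the weights are subadditive up to the factor 2^s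
and their inverse squares are summable. -/
lemma exists_hsBound_conv {a b : ℝ} (hab : a < b) {s : ℕ} (hs : 1 ≤ s) : ∃ C : ℝ, 0 < C ∧
    ∀ (c d : ℤ → ℂ) (K L : ℝ), 0 ≤ K → 0 ≤ L → HsBound a b s c K → HsBound a b s d L →
      HsBound a b s (conv c d) (C * K * L) := by
  refine ⟨Real.sqrt (8 * (2 ^ s) ^ 2 * wtSum a b) + 1, by positivity, fun c d K L hK hL hc hd => ?_⟩
  set C0 := Real.sqrt (8 * (2 ^ s) ^ 2 * wtSum a b)
  have hC0 : C0 ^ 2 = 8 * (2 ^ s) ^ 2 * wtSum a b :=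
    Real.sq_sqrt (mul_nonneg (by positivity) (wtSum_nonneg a b))
  suffices h : HsBound a b s (conv c d) (C0 * K * L) by
    refine h.mono (by positivity) ?_
    gcongr; linarith
  rw [hsBound_iff (by positivity)]
  rw [hsBound_iff hK] at hc
  rw [hsBound_iff hL] at hd
  have hW := tsum_weighted_conv_sq_le (fun l => ENNReal.ofReal (wt a b l ^ s))
    (ENNReal.ofReal (2 ^ s)) (fun l => by have := wt_pos a b l; simp; positivity)
    (fun l => ENNReal.ofReal_ne_top) (fun k l => by
      have := wt_pos a b l
      have := wt_pos a b k
      have := wt_pos a b (l - k)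
      rw [← ENNReal.ofReal_add (by positivity) (by positivity), ← ENNReal.ofReal_mul (by positivity)]
      exact ENNReal.ofReal_le_ofReal (wt_pow_le a b s k l)) (fun l => ‖c l‖ₑ) (fun l => ‖d l‖ₑ)
  calc _ ≤ ∑' l, (ENNReal.ofReal (wt a b l ^ s) * ∑' k, ‖c k‖ₑ * ‖d (l - k)‖ₑ) ^ 2 := by
        refine ENNReal.tsum_le_tsum fun l => ?_
        gcongr
        unfold conv
        refine enorm_tsum_le_tsum_enorm.trans (le_of_eq ?_)
        simp only [enorm_mul]
    _ ≤ _ := hW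
    _ ≤ 8 * ENNReal.ofReal (2 ^ s) ^ 2 * ENNReal.ofReal (wtSum a b) * ENNReal.ofReal K ^ 2
          * ENNReal.ofReal L ^ 2 := by
        gcongr
        exact tsum_wt_inv_sq hab hs
    _ = ENNReal.ofReal (C0 * K * L) ^ 2 := by
        rw [← ENNReal.ofReal_pow (p := C0 * K * L) (by positivity),
          ← ENNReal.ofReal_pow (p := 2 ^ s) (by positivity), mul_pow, mul_pow, hC0,
          ENNReal.ofReal_mul (by have := wtSum_nonneg a b; positivity),
          ENNReal.ofReal_mul (by have := wtSum_nonneg a b; positivity),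
          ENNReal.ofReal_mul (by positivity), ENNReal.ofReal_mul (by positivity),
          ENNReal.ofReal_pow hK, ENNReal.ofReal_pow hL]
        norm_num

/-- Weighted absolute summability. -/
lemma HsBound.summable {a b : ℝ} (hab : a < b) {s : ℕ} {c : ℤ → ℂ} {K : ℝ} (hK : 0 ≤ K)
    (h : HsBound a b (s + 1) c K) : (Summable fun l => wt a b l ^ s * ‖c l‖) ∧
      ∑' l, wt a b l ^ s * ‖c l‖ ≤ Real.sqrt (wtSum a b) * K := by
  have hpart : ∀ S : Finset ℤ, ∑ l ∈ S, wt a b l ^ s * ‖c l‖ ≤ Real.sqrt (wtSum a b) * K := by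
    intro S
    apply le_of_sq_le_sq _ (by positivity)
    rw [mul_pow, Real.sq_sqrt (wtSum_nonneg a b)]
    have e : ∀ l, wt a b l ^ s * ‖c l‖ = (wt a b l)⁻¹ * (wt a b l ^ (s + 1) * ‖c l‖) := fun l => by
      have := wt_pos a b l
      rw [pow_succ]; field_simp
    simp only [e]
    refine (Finset.sum_mul_sq_le_sq_mul_sq _ _ _).trans ?_
    have h2 := (summable_wt_inv_sq hab).sum_le_tsum S fun l _ => by positivity
    have h3 := h S
    have : 0 ≤ ∑ l ∈ S, (wt a b l ^ (s + 1) * ‖c l‖) ^ 2 := by positivity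
    exact mul_le_mul h2 h3 this (wtSum_nonneg a b)
  have hnn : ∀ l, 0 ≤ wt a b l ^ s * ‖c l‖ := fun l => by
    have := wt_pos a b l; positivity
  exact ⟨summable_of_sum_le hnn hpart, Real.tsum_le_of_sum_le hnn hpart⟩
where le_of_sq_le_sq {x y : ℝ} (h : x ^ 2 ≤ y ^ 2) (hy : 0 ≤ y) : x ≤ y :=
  abs_le_of_sq_le_sq' h hy |>.2

lemma HsBound.summable_norm {a b : ℝ} (hab : a < b) {s : ℕ} (hs : 1 ≤ s) {c : ℤ → ℂ} {K : ℝ}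
    (hK : 0 ≤ K) (h : HsBound a b s c K) : Summable fun l => ‖c l‖ := by
  simpa using (HsBound.summable hab (s := 0) hK (h.of_le (by omega))).1

/-- Bound of the weighted norm by the Sobolev norm. -/
lemma MemHper.hsBound {a b : ℝ} (hab : a < b) {m : ℕ} {u : ℝ → ℂ} (h : MemHper a b m u) :
    HsBound a b m (fcoef a b u) (Real.sqrt (2 ^ m / (b - a)) * sobolevNorm a b m u) := by
  intro S
  have hb : 0 < b - a := sub_pos.2 hab
  have hs := h.hasSum_sobolevNorm hab
  have h1 : ∀ l, (wt a b l ^ m * ‖fcoef a b u l‖) ^ 2 ≤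
      2 ^ m * ∑ k ∈ Finset.range (m + 1), (|freq a b l| ^ k * ‖fcoef a b u l‖) ^ 2 := by
    intro l
    have e : (wt a b l ^ m * ‖fcoef a b u l‖) ^ 2 = (freq a b l ^ 2 + 1) ^ m * ‖fcoef a b u l‖ ^ 2 := by
      rw [mul_pow, ← pow_mul, mul_comm m 2, pow_mul, wt_sq, add_comm]
    rw [e, add_pow, Finset.sum_mul, Finset.mul_sum]
    refine Finset.sum_le_sum fun k hk => ?_
    have hc : (m.choose k : ℝ) ≤ 2 ^ m := by exact_mod_cast Nat.choose_le_two_pow m k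
    rw [one_pow, mul_one, mul_pow, ← pow_mul (|freq a b l|), mul_comm k 2, pow_mul (|freq a b l|), sq_abs]
    calc (freq a b l ^ 2) ^ k * (m.choose k) * ‖fcoef a b u l‖ ^ 2
        ≤ (freq a b l ^ 2) ^ k * 2 ^ m * ‖fcoef a b u l‖ ^ 2 := by gcongr
      _ = _ := by ring
  calc _ ≤ ∑ l ∈ S, 2 ^ m * ∑ k ∈ Finset.range (m + 1), (|freq a b l| ^ k * ‖fcoef a b u l‖) ^ 2 :=
        Finset.sum_le_sum fun l _ => h1 l
    _ = 2 ^ m * ∑ l ∈ S, ∑ k ∈ Finset.range (m + 1), (|freq a b l| ^ k * ‖fcoef a b u l‖) ^ 2 := by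
        rw [Finset.mul_sum]
    _ ≤ 2 ^ m * ((b - a)⁻¹ * sobolevNorm a b m u ^ 2) := by
        gcongr
        exact sum_le_hasSum S (fun l _ => by positivity) hs
    _ = _ := by
        rw [mul_pow, Real.sq_sqrt (by positivity)]; ring

/-- The `H¹` norm in terms of Fourier coefficients. -/
lemma MemHper.hasSum_sobolevNorm_one {a b : ℝ} (hab : a < b) {u : ℝ → ℂ} (h : MemHper a b 1 u) :
    HasSum (fun l => (wt a b l ^ 1 * ‖fcoef a b u l‖) ^ 2)
      ((b - a)⁻¹ * sobolevNorm a b 1 u ^ 2) := by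
  convert h.hasSum_sobolevNorm hab using 2 with l
  simp [Finset.sum_range_succ, mul_pow, wt_sq]
  ring

end KGS

namespace KGS

/-! ### Discrete Fourier analysis -/

lemma basisFun_gridPoint {a b : ℝ} (hab : a < b) {N : ℕ} (hN : 0 < N) (k : ℤ) (j : ℕ) :
    basisFun a b k (gridPoint a b N j) = Complex.exp (2 * Real.pi * Complex.I * (k * j / N)) := by
  unfold basisFun gridPoint meshSize freq
  have h : (b : ℂ) - a ≠ 0 := by
    rw [← Complex.ofReal_sub, Complex.ofReal_ne_zero]; linarith
  have hN' : (N : ℂ) ≠ 0 := by exact_mod_cast hN.ne'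
  congr 1; push_cast; field_simp; ring

lemma sum_basisFun_gridPoint {a b : ℝ} (hab : a < b) {N : ℕ} (hN : 0 < N) (k : ℤ) :
    ∑ j ∈ Finset.range N, basisFun a b k (gridPoint a b N j) = if (N : ℤ) ∣ k then (N : ℂ) else 0 := by
  have hN' : (N : ℂ) ≠ 0 := by exact_mod_cast hN.ne'
  have e : ∀ j : ℕ, basisFun a b k (gridPoint a b N j)
      = Complex.exp (2 * Real.pi * Complex.I * (k / N)) ^ j := fun j => by
    rw [basisFun_gridPoint hab hN, ← Complex.exp_nat_mul]; congr 1; field_simp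
  simp only [e]
  split_ifs with h
  · obtain ⟨m, rfl⟩ := h
    have : Complex.exp (2 * Real.pi * Complex.I * (((N * m : ℤ) : ℂ) / N)) = 1 := by
      rw [Complex.exp_eq_one_iff]; exact ⟨m, by push_cast; field_simp⟩
    rw [this]; simp
  · have h1 : Complex.exp (2 * Real.pi * Complex.I * ((k : ℂ) / N)) ≠ 1 := by
      intro hcon
      rw [Complex.exp_eq_one_iff] at hcon
      obtain ⟨m, hm⟩ := hcon
      apply h
      have h2 : (2 * Real.pi * Complex.I : ℂ) ≠ 0 := Complex.two_pi_I_ne_zero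
      have h3 : (k : ℂ) / N = m := mul_left_cancel₀ h2 (by rw [hm]; ring)
      rw [div_eq_iff hN'] at h3
      exact ⟨m, by rw [mul_comm]; exact_mod_cast h3⟩
    rw [geom_sum_eq h1, ← Complex.exp_nat_mul]
    have : Complex.exp (N * (2 * Real.pi * Complex.I * ((k : ℂ) / N))) = 1 := by
      rw [Complex.exp_eq_one_iff]; exact ⟨k, by field_simp⟩
    rw [this]; simp

lemma dft_eq (a b : ℝ) (N : ℕ) (v : Fin (N + 1) → ℂ) (l : ℤ) :
    dft a b N v l = 1 / N * ∑ j : Fin N, v j.castSucc * basisFun a b (-l) (gridPoint a b N j) := by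
  simp only [dft, exp_neg_eq_basisFun]

lemma gridValues_eq (a b : ℝ) (N : ℕ) (c : ℤ → ℂ) (j : Fin (N + 1)) :
    gridValues a b N c j = ∑ l ∈ modes N, c l * basisFun a b l (gridPoint a b N j) := rfl

lemma dft_congr {a b : ℝ} {N : ℕ} {v w : Fin (N + 1) → ℂ}
    (h : ∀ j : Fin N, v j.castSucc = w j.castSucc) : dft a b N v = dft a b N w := by
  ext l; simp only [dft, h]

/-- Discrete coefficients of a grid function given by a convergent trigonometric series. -/
lemma hasSum_dft {a b : ℝ} (hab : a < b) {N : ℕ} (hN : 0 < N) {ι : Type*} {c : ι → ℂ} {n : ι → ℤ}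
    {v : Fin (N + 1) → ℂ}
    (h : ∀ j : Fin N, HasSum (fun i => c i * basisFun a b (n i) (gridPoint a b N j)) (v j.castSucc))
    (l : ℤ) : HasSum (fun i => if (N : ℤ) ∣ n i - l then c i else 0) (dft a b N v l) := by
  rw [dft_eq]
  have h1 := (hasSum_sum (s := Finset.univ) fun (j : Fin N) _ =>
    (h j).mul_right (basisFun a b (-l) (gridPoint a b N j))).mul_left (1 / (N : ℂ))
  suffices hh : (fun i => if (N : ℤ) ∣ n i - l then c i else 0) = fun i =>
      1 / (N : ℂ) * ∑ j : Fin N, c i * basisFun a b (n i) (gridPoint a b N j) *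
        basisFun a b (-l) (gridPoint a b N j) by
    rw [hh]; exact h1
  ext i
  have hN' : (N : ℂ) ≠ 0 := by exact_mod_cast hN.ne'
  have e : ∀ j : Fin N, c i * basisFun a b (n i) (gridPoint a b N j) *
      basisFun a b (-l) (gridPoint a b N j) = c i * basisFun a b (n i - l) (gridPoint a b N j) := by
    intro j; rw [sub_eq_add_neg, basisFun_add]; ring
  simp only [e, ← Finset.mul_sum]
  rw [Fin.sum_univ_eq_sum_range (fun j => basisFun a b (n i - l) (gridPoint a b N j)),
    sum_basisFun_gridPoint hab hN]
  split_ifs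
  · field_simp
  · simp

lemma mem_modes {N : ℕ} {l : ℤ} : l ∈ modes N ↔ -((N : ℤ) / 2) ≤ l ∧ l < (N : ℤ) / 2 := by
  simp [modes]

lemma eq_of_dvd_sub_of_mem_modes {N : ℕ} {k l : ℤ} (hk : k ∈ modes N) (hl : l ∈ modes N)
    (h : (N : ℤ) ∣ k - l) : k = l := by
  rw [mem_modes] at hk hl
  have : |k - l| < N := by rw [abs_lt]; omega
  have := Int.eq_zero_of_abs_lt_dvd h this
  omega

lemma dft_gridValues {a b : ℝ} (hab : a < b) {N : ℕ} (hN : 0 < N) (c : ℤ → ℂ) {l : ℤ}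
    (hl : l ∈ modes N) : dft a b N (gridValues a b N c) l = c l := by
  have h := hasSum_dft hab hN (ι := modes N) (c := fun k => c k) (n := fun k => k)
    (v := gridValues a b N c) (fun j => by
      rw [gridValues_eq, ← Finset.sum_coe_sort]
      exact hasSum_fintype _) l
  refine h.unique ?_
  have : (fun i : modes N => if (N : ℤ) ∣ (i : ℤ) - l then c i else 0)
      = fun i => if i = ⟨l, hl⟩ then c l else 0 := by
    ext i
    by_cases hi : i = ⟨l, hl⟩
    · subst hi; simp
    · rw [if_neg hi, if_neg]
      intro hcon; apply hi
      exact Subtype.ext (eq_of_dvd_sub_of_mem_modes i.2 hl hcon)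
  rw [this]
  exact hasSum_ite_eq _ _

lemma sum_modes {M : Type*} [AddCommMonoid M] {N : ℕ} (hN : Even N) (f : ℤ → M) :
    ∑ l ∈ modes N, f l = ∑ i ∈ Finset.range N, f (i - (N : ℤ) / 2) := by
  obtain ⟨m, rfl⟩ := hN
  have e : (((m + m : ℕ) : ℤ)) / 2 = m := by omega
  refine Finset.sum_nbij' (fun l => (l + m).toNat) (fun i => (i : ℤ) - m) ?_ ?_ ?_ ?_ ?_
  · intro l hl; rw [mem_modes, e] at hl; simp; omega
  · intro i hi; rw [mem_modes, e]; simp at hi; omega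
  · intro l hl; rw [mem_modes, e] at hl; omega
  · intro i hi; omega
  · intro l hl; rw [mem_modes, e] at hl; congr 1; omega

/-- Only for even N are there exactly N modes, so evenness is essential. The last component of a
grid vector is never read by `dft`, which is why the identity is stated for the nodes 0, …, N-1
alone. -/
lemma gridValues_dft {a b : ℝ} (hab : a < b) {N : ℕ} (hN : 0 < N) (hE : Even N)
    (v : Fin (N + 1) → ℂ) (j : Fin N) :
    gridValues a b N (dft a b N v) j.castSucc = v j.castSucc := by
  have hN' : (N : ℂ) ≠ 0 := by exact_mod_cast hN.ne'
  have key : ∀ k : Fin N, ∑ l ∈ modes N, basisFun a b (-l) (gridPoint a b N k) *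
      basisFun a b l (gridPoint a b N j) = if k = j then (N : ℂ) else 0 := by
    intro k
    rw [sum_modes hE]
    have e : ∀ i : ℕ, basisFun a b (-(i - (N : ℤ) / 2)) (gridPoint a b N k) *
        basisFun a b (i - (N : ℤ) / 2) (gridPoint a b N j) =
        Complex.exp (-(2 * Real.pi * Complex.I * (((N : ℤ) / 2 : ℤ) * ((j : ℤ) - k) / N))) *
          basisFun a b ((j : ℤ) - k) (gridPoint a b N i) := by
      intro i
      simp only [basisFun_gridPoint hab hN, ← Complex.exp_add]
      congr 1; push_cast; ring
    simp only [e, ← Finset.mul_sum, sum_basisFun_gridPoint hab hN]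
    by_cases hkj : k = j
    · subst hkj; simp
    · rw [if_neg hkj, if_neg, mul_zero]
      intro hcon
      apply hkj
      have hj := j.2
      have hk := k.2
      have : |((j : ℕ) : ℤ) - ((k : ℕ) : ℤ)| < N := by rw [abs_lt]; omega
      have := Int.eq_zero_of_abs_lt_dvd hcon this
      ext; omega
  rw [gridValues_eq]
  simp only [dft_eq, Fin.val_castSucc, Finset.mul_sum, Finset.sum_mul]
  rw [Finset.sum_comm]
  have e : ∀ k : Fin N, ∑ l ∈ modes N, 1 / (N : ℂ) * (v k.castSucc * basisFun a b (-l)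
      (gridPoint a b N k)) * basisFun a b l (gridPoint a b N j) = if k = j then v j.castSucc else 0 := by
    intro k
    have : ∀ l, 1 / (N : ℂ) * (v k.castSucc * basisFun a b (-l)
      (gridPoint a b N k)) * basisFun a b l (gridPoint a b N j) = 1 / (N : ℂ) * v k.castSucc *
        (basisFun a b (-l) (gridPoint a b N k) * basisFun a b l (gridPoint a b N j)) := fun l => by
      ring
    simp only [this, ← Finset.mul_sum, key]
    split_ifs with h
    · subst h; field_simp
    · simp
  simp only [e, Finset.sum_ite_eq', Finset.mem_univ, if_true]

/-- The norm `(∑_{l} (1 + μ_l²)^s |c_l|²)^{1/2}` over the modes `-N/2 ≤ l < N/2`. -/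
noncomputable def nrm (a b : ℝ) (N s : ℕ) (c : ℤ → ℂ) : ℝ :=
  Real.sqrt (∑ l ∈ modes N, (wt a b l ^ s * ‖c l‖) ^ 2)

/-- The weighted coefficients as a vector of a Euclidean space. -/
noncomputable def nrmVec (a b : ℝ) (N s : ℕ) (c : ℤ → ℂ) : EuclideanSpace ℂ (modes N) :=
  WithLp.toLp 2 fun l => (wt a b l ^ s : ℝ) * c l

/-! ### Calculus of the weighted norms over the modes. -/

section nrm
variable {a b : ℝ} {N s : ℕ}

lemma nrm_eq_norm (c : ℤ → ℂ) : nrm a b N s c = ‖nrmVec a b N s c‖ := by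
  rw [nrm, EuclideanSpace.norm_eq, ← Finset.sum_coe_sort]
  congr 1
  refine Finset.sum_congr rfl fun l _ => ?_
  simp [nrmVec, abs_of_pos (wt_pos a b l)]

lemma nrm_nonneg (c : ℤ → ℂ) : 0 ≤ nrm a b N s c := Real.sqrt_nonneg _

lemma nrm_sq (c : ℤ → ℂ) : nrm a b N s c ^ 2 = ∑ l ∈ modes N, (wt a b l ^ s * ‖c l‖) ^ 2 :=
  Real.sq_sqrt (by positivity)

lemma nrm_congr {c d : ℤ → ℂ} (h : ∀ l ∈ modes N, c l = d l) : nrm a b N s c = nrm a b N s d := by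
  unfold nrm; congr 1; exact Finset.sum_congr rfl fun l hl => by rw [h l hl]

lemma nrm_add_le (c d : ℤ → ℂ) :
    nrm a b N s (fun l => c l + d l) ≤ nrm a b N s c + nrm a b N s d := by
  simp only [nrm_eq_norm]
  have : nrmVec a b N s (fun l => c l + d l) = nrmVec a b N s c + nrmVec a b N s d := by
    ext l; simp [nrmVec, mul_add]
  rw [this]; exact norm_add_le _ _

lemma nrm_sub_le (c d : ℤ → ℂ) :
    nrm a b N s (fun l => c l - d l) ≤ nrm a b N s c + nrm a b N s d := by
  simp only [nrm_eq_norm]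
  have : nrmVec a b N s (fun l => c l - d l) = nrmVec a b N s c - nrmVec a b N s d := by
    ext l; simp [nrmVec, mul_sub]
  rw [this]; exact norm_sub_le _ _

/-- Fourier multipliers; the two indices `s`, `s'` allow a growing symbol to be paid for with
derivatives. -/
lemma nrm_mul_le {s' : ℕ} {M : ℝ} (hM : 0 ≤ M) (m c : ℤ → ℂ)
    (h : ∀ l ∈ modes N, wt a b l ^ s * ‖m l‖ ≤ M * wt a b l ^ s') :
    nrm a b N s (fun l => m l * c l) ≤ M * nrm a b N s' c := by
  have e : M * nrm a b N s' c = Real.sqrt (∑ l ∈ modes N, (M * (wt a b l ^ s' * ‖c l‖)) ^ 2) := by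
    simp only [mul_pow M, ← Finset.mul_sum]
    rw [Real.sqrt_mul (by positivity), Real.sqrt_sq hM, nrm]
  rw [e, nrm]
  apply Real.sqrt_le_sqrt
  refine Finset.sum_le_sum fun l hl => ?_
  have := wt_pos a b l
  rw [norm_mul]
  have h2 := mul_le_mul_of_nonneg_right (h l hl) (norm_nonneg (c l))
  refine pow_le_pow_left₀ (by positivity) ?_ 2
  linarith

lemma nrm_mul_le_self {M : ℝ} (hM : 0 ≤ M) (m c : ℤ → ℂ) (h : ∀ l ∈ modes N, ‖m l‖ ≤ M) :
    nrm a b N s (fun l => m l * c l) ≤ M * nrm a b N s c :=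
  nrm_mul_le hM m c fun l hl => by
    have := pow_pos (wt_pos a b l) s
    rw [mul_comm]; exact mul_le_mul_of_nonneg_right (h l hl) this.le

lemma nrm_const_mul (z : ℂ) (c : ℤ → ℂ) :
    nrm a b N s (fun l => z * c l) = ‖z‖ * nrm a b N s c := by
  simp only [nrm_eq_norm]
  rw [← norm_smul]; congr 1
  ext l; simp [nrmVec]; ring

lemma nrm_mono {s' : ℕ} (hs : s ≤ s') (c : ℤ → ℂ) : nrm a b N s c ≤ nrm a b N s' c := by
  have := nrm_mul_le (a := a) (b := b) (N := N) (s := s) (s' := s') zero_le_one (fun _ => 1) c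
    fun l _ => by
      have := one_le_wt a b l
      simp only [norm_one, mul_one, one_mul]; gcongr
  simpa using this

lemma nrm_le_of_norm_le {c d : ℤ → ℂ} (h : ∀ l ∈ modes N, ‖c l‖ ≤ ‖d l‖) :
    nrm a b N s c ≤ nrm a b N s d := by
  unfold nrm
  apply Real.sqrt_le_sqrt
  refine Finset.sum_le_sum fun l hl => ?_
  have := wt_pos a b l
  have := h l hl
  gcongr

lemma HsBound.nrm_le {c : ℤ → ℂ} {K : ℝ} (hK : 0 ≤ K) (h : HsBound a b s c K) :
    nrm a b N s c ≤ K := by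
  unfold nrm
  exact Real.sqrt_le_iff.2 ⟨hK, h (modes N)⟩

/-- The mean value inequality. -/
lemma nrm_sub_le_of_hasDerivAt {α β K : ℝ} (hαβ : α ≤ β) {f f' : ℝ → ℤ → ℂ}
    (hc : ∀ l ∈ modes N, ContinuousOn (fun t => f t l) (Icc α β))
    (hd : ∀ l ∈ modes N, ∀ t ∈ Ioo α β, HasDerivAt (fun t => f t l) (f' t l) t)
    (hb : ∀ t ∈ Ioo α β, nrm a b N s (f' t) ≤ K) :
    nrm a b N s (fun l => f β l - f α l) ≤ K * (β - α) := by
  have hFc : ContinuousOn (fun t => nrmVec a b N s (f t)) (Icc α β) := by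
    refine (PiLp.continuous_toLp 2 _).comp_continuousOn ?_
    exact continuousOn_pi.2 fun l => continuousOn_const.mul (hc l l.2)
  have hFd : ∀ t ∈ Ioo α β, HasDerivAt (fun t => nrmVec a b N s (f t)) (nrmVec a b N s (f' t)) t := by
    intro t ht
    have h : HasDerivAt (fun t => fun l : modes N => ((wt a b l ^ s : ℝ) : ℂ) * f t l)
        (fun l : modes N => ((wt a b l ^ s : ℝ) : ℂ) * f' t l) t :=
      hasDerivAt_pi.2 fun l => (hd l l.2 t ht).const_mul ((wt a b l ^ s : ℝ) : ℂ)
    exact (PiLp.continuousLinearEquiv 2 ℝ (fun _ : modes N => ℂ)).symm.hasFDerivAt.comp_hasDerivAt t h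
  have e : nrmVec a b N s (fun l => f β l - f α l) = nrmVec a b N s (f β) - nrmVec a b N s (f α) := by
    ext l; simp [nrmVec, mul_sub]
  rw [nrm_eq_norm, e]
  rcases hαβ.eq_or_lt with rfl | hlt
  · simp
  -- Derivatives are available only in the open interval, so the estimate is proved there for pairs
  -- of points and extended to the end points by continuity.
  have hI : ∀ x ∈ Ioo α β, ∀ y ∈ Ioo α β, ‖nrmVec a b N s (f y) - nrmVec a b N s (f x)‖
      ≤ K * ‖y - x‖ := fun x hx y hy =>
    Convex.norm_image_sub_le_of_norm_hasDerivWithin_le (fun t ht => (hFd t ht).hasDerivWithinAt)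
      (fun t ht => by rw [← nrm_eq_norm]; exact hb t ht) (convex_Ioo α β) hx hy
  have hcl : closure (Ioo α β ×ˢ Ioo α β) = Icc α β ×ˢ Icc α β := by
    rw [closure_prod_eq, closure_Ioo hlt.ne]
  have : ∀ p ∈ Icc α β ×ˢ Icc α β, ‖nrmVec a b N s (f p.2) - nrmVec a b N s (f p.1)‖
      ≤ K * ‖p.2 - p.1‖ := by
    rw [← hcl]
    intro p hp
    refine ContinuousWithinAt.closure_le hp (f := fun p : ℝ × ℝ => ‖nrmVec a b N s (f p.2) - nrmVec a b N s (f p.1)‖)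
      (g := fun p : ℝ × ℝ => K * ‖p.2 - p.1‖) ?_ ?_ ?_
    · rw [hcl] at hp
      have h1 : ContinuousOn (fun p : ℝ × ℝ => ‖nrmVec a b N s (f p.2) - nrmVec a b N s (f p.1)‖)
          (Icc α β ×ˢ Icc α β) :=
        ((hFc.comp continuousOn_snd fun p hp => hp.2).sub
          (hFc.comp continuousOn_fst fun p hp => hp.1)).norm
      exact (h1 p hp).mono (prod_mono Ioo_subset_Icc_self Ioo_subset_Icc_self)
    · exact (by fun_prop : Continuous fun p : ℝ × ℝ => K * ‖p.2 - p.1‖).continuousWithinAt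
    · exact fun p hp => hI _ hp.1 _ hp.2
  have h2 := this (α, β) ⟨left_mem_Icc.2 hαβ, right_mem_Icc.2 hαβ⟩
  simpa [abs_of_pos (sub_pos.2 hlt)] using h2

end nrm

/-! ### Aliasing -/

/-- A mode has least absolute value in its residue class modulo N, so undoing an alias never
increases a weight. -/
lemma abs_le_abs_add_mul {N : ℕ} {l : ℤ} (hl : l ∈ modes N) (m : ℤ) : |l| ≤ |l + m * N| := by
  rw [mem_modes] at hl
  have h2 : 2 * |l| ≤ N := by have := abs_le.2 (⟨by omega, by omega⟩ : -((N : ℤ) / 2) ≤ l ∧ l ≤ (N : ℤ) / 2); omega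
  by_cases hm : m = 0
  · simp [hm]
  have h3 : (N : ℤ) ≤ |m * N| := by
    rw [abs_mul, Nat.abs_cast]
    have : 1 ≤ |m| := Int.one_le_abs hm
    nlinarith [Int.natCast_nonneg N]
  have h4 : |m * (N : ℤ)| - |l| ≤ |l + m * N| := by
    have := abs_sub_abs_le_abs_sub (m * (N : ℤ)) (-l)
    rw [abs_neg] at this
    rwa [sub_neg_eq_add, add_comm (m * (N : ℤ)) l] at this
  omega

lemma meshSize_pos {a b : ℝ} (hab : a < b) {N : ℕ} (hN : 0 < N) : 0 < meshSize a b N := by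
  unfold meshSize
  have : 0 < b - a := sub_pos.2 hab
  positivity

lemma inv_wt_le {a b : ℝ} (hab : a < b) {N : ℕ} (hN : 0 < N) {l : ℤ} (hl : (N : ℤ) ≤ 2 * |l|) :
    (wt a b l)⁻¹ ≤ meshSize a b N := by
  have hh := meshSize_pos hab hN
  rw [inv_le_comm₀ (wt_pos a b l) hh]
  refine le_trans ?_ (abs_freq_le_wt a b l)
  rw [abs_freq hab]
  unfold meshSize
  have hb : 0 < b - a := sub_pos.2 hab
  have : (N : ℝ) ≤ 2 * |(l : ℝ)| := by exact_mod_cast hl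
  have hpi := Real.pi_gt_three
  rw [inv_div, div_mul_eq_mul_div, div_le_div_iff_of_pos_right hb]
  nlinarith [abs_nonneg (l : ℝ)]

/-- From |l + mN| ≥ |m|N/2. The decay in m is kept because it later makes the sum over all aliases
converge. -/
lemma inv_wt_alias_le {a b : ℝ} (hab : a < b) {N : ℕ} (hN : 0 < N) {l : ℤ} (hl : l ∈ modes N)
    {m : ℤ} (hm : m ≠ 0) : (wt a b (l + m * N))⁻¹ ≤ meshSize a b N * |(m : ℝ)|⁻¹ := by
  have hh := meshSize_pos hab hN
  have hm0 : (0 : ℝ) < |(m : ℝ)| := by positivity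
  have hb : 0 < b - a := sub_pos.2 hab
  rw [← inv_inv (meshSize a b N), ← mul_inv]
  apply inv_anti₀ (by positivity)
  refine le_trans ?_ (abs_freq_le_wt a b _)
  rw [abs_freq hab]
  unfold meshSize
  rw [inv_div, div_mul_eq_mul_div, div_mul_eq_mul_div, div_le_div_iff_of_pos_right hb]
  rw [mem_modes] at hl
  have h2 : 2 * |l| ≤ N := by have := abs_le.2 (⟨by omega, by omega⟩ : -((N : ℤ) / 2) ≤ l ∧ l ≤ (N : ℤ) / 2); omega
  have h4 : |m * (N : ℤ)| - |l| ≤ |l + m * N| := by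
    have := abs_sub_abs_le_abs_sub (m * (N : ℤ)) (-l)
    rw [abs_neg] at this
    rwa [sub_neg_eq_add, add_comm (m * (N : ℤ)) l] at this
  have h3 : (N : ℤ) ≤ |m * N| := by
    rw [abs_mul, Nat.abs_cast]
    have : 1 ≤ |m| := Int.one_le_abs hm
    nlinarith [Int.natCast_nonneg N]
  have h5 : |m| * N ≤ 2 * |l + m * N| := by
    rw [abs_mul, Nat.abs_cast] at h3 h4; omega
  have h6 : |(m : ℝ)| * N ≤ 2 * |((l + m * N : ℤ) : ℝ)| := by exact_mod_cast h5
  have hpi := Real.pi_gt_three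
  nlinarith [abs_nonneg ((l + m * N : ℤ) : ℝ)]

lemma injective_add_mul {N : ℕ} (hN : 0 < N) (l : ℤ) : Function.Injective fun m : ℤ => l + m * N := by
  intro m m' h
  have : m * (N : ℤ) = m' * N := by simpa using h
  exact mul_right_cancel₀ (by exact_mod_cast hN.ne') this

/-- The aliasing formula. -/
lemma hasSum_alias {a b : ℝ} (hab : a < b) {N : ℕ} (hN : 0 < N) {u : ℝ → ℂ}
    (hc : ContinuousOn u (Icc a b)) (hper : u a = u b) (hs : Summable (fun l => ‖fcoef a b u l‖))
    (l : ℤ) : HasSum (fun m : ℤ => fcoef a b u (l + m * N))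
      (dft a b N (fun j => u (gridPoint a b N j)) l) := by
  have hmem : ∀ j : Fin N, gridPoint a b N j ∈ Icc a b := fun j => by
    have hh := meshSize_pos hab hN
    have hj : ((j : ℕ) : ℝ) ≤ N := by exact_mod_cast j.2.le
    unfold gridPoint
    refine ⟨by have : 0 ≤ ((j : ℕ) : ℝ) * meshSize a b N := by positivity
               linarith, ?_⟩
    have e : (N : ℝ) * meshSize a b N = b - a := by
      unfold meshSize; field_simp
    nlinarith
  have h := hasSum_dft hab hN (v := fun j => u (gridPoint a b N j)) (c := fcoef a b u) (n := id)
    (fun j => by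
      have := hasSum_fourier_series hab hc hper hs (hmem j)
      simpa using this) l
  rw [← (injective_add_mul hN l).hasSum_iff] at h
  · convert h using 1
    ext m; simp
  · intro x hx
    rw [if_neg]
    rintro ⟨m, hm⟩
    exact hx ⟨m, by simp only [id] at hm; linarith⟩

lemma tsum_mul_sq_le_real {ι : Type*} {f g : ι → ℝ} (hf0 : ∀ i, 0 ≤ f i) (hg0 : ∀ i, 0 ≤ g i)
    (hf : Summable fun i => f i ^ 2) (hg : Summable fun i => g i ^ 2) :
    (Summable fun i => f i * g i) ∧
      (∑' i, f i * g i) ^ 2 ≤ (∑' i, f i ^ 2) * ∑' i, g i ^ 2 := by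
  have h := Real.summable_and_inner_le_Lp_mul_Lq_tsum_of_nonneg (p := 2) (q := 2)
    (by rw [Real.holderConjugate_iff]; norm_num) hf0 hg0 (by simpa using hf) (by simpa using hg)
  refine ⟨h.1, ?_⟩
  have h2 := h.2
  simp only [Real.rpow_ofNat, ← Real.sqrt_eq_rpow] at h2
  have h3 : 0 ≤ ∑' i, f i * g i := tsum_nonneg fun i => mul_nonneg (hf0 i) (hg0 i)
  calc _ ≤ (√(∑' i, f i ^ 2) * √(∑' i, g i ^ 2)) ^ 2 := pow_le_pow_left₀ h3 h2 2
    _ = _ := by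
      rw [mul_pow, Real.sq_sqrt (tsum_nonneg fun i => by positivity),
        Real.sq_sqrt (tsum_nonneg fun i => by positivity)]

/-- The interpolation error at the mode l is the sum of the aliased coefficients at l + mN with m ≠
0. Trading s - r weights for (h/|m|)^(s-r) and applying Cauchy-Schwarz against ∑ |m|⁻² gives the
power of h, with a constant depending on neither r, s nor N. -/
lemma exists_nrm_alias_le {a b : ℝ} (hab : a < b) : ∃ C : ℝ, 0 < C ∧
    ∀ {N : ℕ}, 0 < N → ∀ {r s : ℕ}, r + 1 ≤ s → ∀ {u : ℝ → ℂ} {K : ℝ}, 0 ≤ K →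
    ContinuousOn u (Icc a b) → u a = u b → HsBound a b s (fcoef a b u) K →
    nrm a b N r (fun l => dft a b N (fun j => u (gridPoint a b N j)) l - fcoef a b u l)
      ≤ C * meshSize a b N ^ (s - r) * K := by
  have hsum : Summable fun m : ℤ => (|(m : ℝ)|⁻¹) ^ 2 := by
    have := Real.summable_one_div_int_pow (p := 2).2 (by norm_num)
    refine this.congr fun m => ?_
    rw [inv_pow, sq_abs, one_div]
  set S := ∑' m : ℤ, (|(m : ℝ)|⁻¹) ^ 2
  have hS : 0 ≤ S := tsum_nonneg fun m => by positivity
  refine ⟨Real.sqrt S + 1, by positivity, fun {N} hN {r s} hrs {u K} hK hc hper hb => ?_⟩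
  have hh := meshSize_pos hab hN
  set h := meshSize a b N
  suffices hmain : nrm a b N r (fun l => dft a b N (fun j => u (gridPoint a b N j)) l - fcoef a b u l)
      ≤ Real.sqrt S * h ^ (s - r) * K by
    refine hmain.trans ?_
    gcongr; linarith
  have hs := hb.summable_norm hab (by omega) hK
  unfold nrm
  apply Real.sqrt_le_iff.2 ⟨by positivity, ?_⟩
  rw [mul_pow, mul_pow, Real.sq_sqrt hS, ← pow_mul]
  -- the bound of a single coefficient
  have h1 : ∀ l ∈ modes N, (wt a b l ^ r * ‖dft a b N (fun j => u (gridPoint a b N j)) l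
      - fcoef a b u l‖) ^ 2 ≤ S * h ^ ((s - r) * 2) *
        ∑' m : ℤ, (wt a b (l + m * N) ^ s * ‖fcoef a b u (l + m * N)‖) ^ 2 := by
    intro l hl
    have hal := hasSum_alias hab hN hc hper hs l
    have hsq : Summable fun k => (wt a b k ^ s * ‖fcoef a b u k‖) ^ 2 :=
      summable_of_sum_le (fun k => by positivity) hb
    have hsq' := hsq.comp_injective (injective_add_mul hN l)
    have hfsum : Summable fun m : ℤ => (h ^ (s - r) * |(m : ℝ)|⁻¹) ^ 2 := by
      simp only [mul_pow (h ^ (s - r))]; exact hsum.mul_left _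
    have hsn : Summable fun m : ℤ => if m = 0 then 0 else ‖fcoef a b u (l + m * N)‖ := by
      refine Summable.of_nonneg_of_le (fun m => by split_ifs <;> positivity) (fun m => ?_)
        (hs.comp_injective (injective_add_mul hN l))
      split_ifs
      · exact norm_nonneg _
      · exact le_rfl
    have e1 : ‖dft a b N (fun j => u (gridPoint a b N j)) l - fcoef a b u l‖
        ≤ ∑' m : ℤ, if m = 0 then 0 else ‖fcoef a b u (l + m * N)‖ := by
      have h2 := hal.sub (hasSum_ite_eq (0 : ℤ) (fcoef a b u l))
      rw [← h2.tsum_eq]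
      refine tsum_of_norm_bounded hsn.hasSum fun m => ?_
      by_cases hm : m = 0
      · simp [hm]
      · simp [hm]
    have e2 : wt a b l ^ r * (∑' m : ℤ, if m = 0 then 0 else ‖fcoef a b u (l + m * N)‖)
        ≤ ∑' m : ℤ, (h ^ (s - r) * |(m : ℝ)|⁻¹) * (wt a b (l + m * N) ^ s * ‖fcoef a b u (l + m * N)‖) := by
      rw [← tsum_mul_left]
      refine Summable.tsum_le_tsum (fun m => ?_) (hsn.mul_left _) ?_
      · split_ifs with hm
        · simp [hm]
        · have w0 := wt_pos a b l
          have w1 := wt_pos a b (l + m * N)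
          have w2 := wt_le_wt_of_abs_le hab (abs_le_abs_add_mul hl m)
          have w3 := inv_wt_alias_le hab hN hl hm
          have hm1 : |(m : ℝ)|⁻¹ ≤ 1 := by
            apply inv_le_one_of_one_le₀; exact_mod_cast Int.one_le_abs hm
          have hm0 : (0 : ℝ) < |(m : ℝ)|⁻¹ := by positivity
          have w4 : ((wt a b (l + m * N))⁻¹) ^ (s - r) ≤ h ^ (s - r) * |(m : ℝ)|⁻¹ := by
            calc ((wt a b (l + m * N))⁻¹) ^ (s - r) ≤ (h * |(m : ℝ)|⁻¹) ^ (s - r) := by gcongr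
              _ = h ^ (s - r) * |(m : ℝ)|⁻¹ ^ (s - r) := by rw [mul_pow]
              _ ≤ _ := by
                gcongr
                exact pow_le_of_le_one hm0.le hm1 (by omega)
          have w5 : wt a b l ^ r ≤ (h ^ (s - r) * |(m : ℝ)|⁻¹) * wt a b (l + m * N) ^ s := by
            calc wt a b l ^ r ≤ wt a b (l + m * N) ^ r := by gcongr
              _ = ((wt a b (l + m * N))⁻¹) ^ (s - r) * wt a b (l + m * N) ^ s := by
                rw [inv_pow, ← div_eq_inv_mul, eq_div_iff (by positivity), ← pow_add]
                congr 1; omega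
              _ ≤ _ := by gcongr
          rw [← mul_assoc]
          exact mul_le_mul_of_nonneg_right w5 (norm_nonneg _)
      · exact (tsum_mul_sq_le_real (fun m => by positivity) (fun m => by
          have := wt_pos a b (l + m * N); positivity) hfsum hsq').1
    have e3 := (tsum_mul_sq_le_real (f := fun m : ℤ => h ^ (s - r) * |(m : ℝ)|⁻¹)
      (g := fun m : ℤ => wt a b (l + m * N) ^ s * ‖fcoef a b u (l + m * N)‖)
      (fun m => by positivity) (fun m => by
          have := wt_pos a b (l + m * N); positivity) hfsum hsq').2
    have w0 := wt_pos a b l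
    calc _ ≤ (wt a b l ^ r * (∑' m : ℤ, if m = 0 then 0 else ‖fcoef a b u (l + m * N)‖)) ^ 2 := by
          gcongr
      _ ≤ (∑' m : ℤ, (h ^ (s - r) * |(m : ℝ)|⁻¹) *
            (wt a b (l + m * N) ^ s * ‖fcoef a b u (l + m * N)‖)) ^ 2 := by
          refine pow_le_pow_left₀ (mul_nonneg (by positivity) (tsum_nonneg fun m => ?_)) e2 2
          split_ifs <;> positivity
      _ ≤ _ := e3
      _ = _ := by
          simp only [mul_pow (h ^ (s - r)), tsum_mul_left]
          rw [← pow_mul]; ring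
  calc _ ≤ ∑ l ∈ modes N, S * h ^ ((s - r) * 2) *
        ∑' m : ℤ, (wt a b (l + m * N) ^ s * ‖fcoef a b u (l + m * N)‖) ^ 2 := Finset.sum_le_sum h1
    _ = S * h ^ ((s - r) * 2) * ∑ l ∈ modes N,
        ∑' m : ℤ, (wt a b (l + m * N) ^ s * ‖fcoef a b u (l + m * N)‖) ^ 2 := by
        rw [Finset.mul_sum]
    _ ≤ _ := by
        gcongr
        have hsq : Summable fun k => (wt a b k ^ s * ‖fcoef a b u k‖) ^ 2 :=
          summable_of_sum_le (fun k => by positivity) hb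
        have e := (hasSum_sum (s := modes N) fun l _ =>
          (hsq.comp_injective (injective_add_mul hN l)).hasSum).tsum_eq
        simp only [Function.comp_def] at e
        rw [← e]
        refine Real.tsum_le_of_sum_le (fun m => by positivity) fun M => ?_
        rw [Finset.sum_comm, ← Finset.sum_product']
        -- Distinct modes lie in distinct residue classes, so each integer is l + mN for at most one
        -- pair and the double sum is part of the full weighted norm of `u`.
        have hinj : Set.InjOn (fun p : ℤ × ℤ => p.1 + p.2 * (N : ℤ)) (modes N ×ˢ M : Finset (ℤ × ℤ)) := by
          rintro ⟨l, m⟩ hp ⟨l', m'⟩ hp' heq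
          simp only [Finset.coe_product, Set.mem_prod, Finset.mem_coe] at hp hp'
          have heq' : l + m * (N : ℤ) = l' + m' * N := heq
          have : l = l' := eq_of_dvd_sub_of_mem_modes hp.1 hp'.1 ⟨m' - m, by linarith⟩
          subst this
          have := injective_add_mul hN l heq'
          rw [this]
        have := hb ((modes N ×ˢ M).image fun p : ℤ × ℤ => p.1 + p.2 * (N : ℤ))
        rw [Finset.sum_image hinj] at this
        exact this

end KGS

namespace KGS

/-! ### Pointwise products and conjugates of grid functions, in terms of coefficients -/

/-- The coefficients of the pointwise product of two grid functions. -/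
noncomputable def dprod (a b : ℝ) (N : ℕ) (c d : ℤ → ℂ) : ℤ → ℂ :=
  dft a b N (fun j => gridValues a b N c j * gridValues a b N d j)

/-- The coefficients of the complex conjugate of a grid function. -/
noncomputable def dconj (a b : ℝ) (N : ℕ) (c : ℤ → ℂ) : ℤ → ℂ :=
  dft a b N (fun j => starRingEnd ℂ (gridValues a b N c j))

section
variable {a b : ℝ} {N : ℕ}

lemma dft_mul (hab : a < b) (hN : 0 < N) (hE : Even N) (v w : Fin (N + 1) → ℂ) :
    dft a b N (fun j => v j * w j) = dprod a b N (dft a b N v) (dft a b N w) :=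
  dft_congr fun j => by rw [gridValues_dft hab hN hE, gridValues_dft hab hN hE]

lemma dft_conj (hab : a < b) (hN : 0 < N) (hE : Even N) (v : Fin (N + 1) → ℂ) :
    dft a b N (fun j => starRingEnd ℂ (v j)) = dconj a b N (dft a b N v) :=
  dft_congr fun j => by rw [gridValues_dft hab hN hE]

lemma gridValues_congr {c d : ℤ → ℂ} (h : ∀ l ∈ modes N, c l = d l) :
    gridValues a b N c = gridValues a b N d := by
  ext j; rw [gridValues_eq, gridValues_eq]
  exact Finset.sum_congr rfl fun l hl => by rw [h l hl]

lemma dprod_congr {c c' d d' : ℤ → ℂ} (h : ∀ l ∈ modes N, c l = c' l) (h' : ∀ l ∈ modes N, d l = d' l) :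
    dprod a b N c d = dprod a b N c' d' := by
  unfold dprod; rw [gridValues_congr h, gridValues_congr h']

lemma dconj_congr {c c' : ℤ → ℂ} (h : ∀ l ∈ modes N, c l = c' l) :
    dconj a b N c = dconj a b N c' := by
  unfold dconj; rw [gridValues_congr h]

/-- The cyclic convolution. It exhibits `dprod` as a finite bilinear expression, from which
continuity and differentiability in time are immediate. -/
lemma dprod_apply (hab : a < b) (hN : 0 < N) (c d : ℤ → ℂ) (l : ℤ) : dprod a b N c d l =
    ∑ k ∈ modes N, ∑ k' ∈ modes N, if (N : ℤ) ∣ k + k' - l then c k * d k' else 0 := by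
  have h := hasSum_dft hab hN (ι := modes N × modes N) (c := fun p => c p.1 * d p.2)
    (n := fun p => (p.1 : ℤ) + p.2)
    (v := fun j => gridValues a b N c j * gridValues a b N d j) (fun j => by
      have e : gridValues a b N c j.castSucc * gridValues a b N d j.castSucc =
          ∑ p : modes N × modes N, (c p.1 * d p.2) *
            basisFun a b ((p.1 : ℤ) + p.2) (gridPoint a b N j) := by
        rw [gridValues_eq, gridValues_eq, ← Finset.sum_coe_sort (modes N),
          ← Finset.sum_coe_sort (modes N), Finset.sum_mul_sum, ← Finset.univ_product_univ, Finset.sum_product]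
        refine Finset.sum_congr rfl fun k _ => Finset.sum_congr rfl fun k' _ => ?_
        rw [basisFun_add]; simp only [Fin.val_castSucc]; ring
      simp only [e]
      exact hasSum_fintype _) l
  rw [dprod, h.unique (hasSum_fintype _), ← Finset.univ_product_univ, Finset.sum_product]
  simp only [← Finset.sum_coe_sort (modes N)]

lemma dconj_apply (hab : a < b) (hN : 0 < N) (c : ℤ → ℂ) (l : ℤ) : dconj a b N c l =
    ∑ k ∈ modes N, if (N : ℤ) ∣ -k - l then starRingEnd ℂ (c k) else 0 := by
  have h := hasSum_dft hab hN (ι := modes N) (c := fun k => starRingEnd ℂ (c k))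
    (n := fun k => -(k : ℤ)) (v := fun j => starRingEnd ℂ (gridValues a b N c j)) (fun j => by
      rw [gridValues_eq, map_sum, ← Finset.sum_coe_sort (modes N)]
      simp only [map_mul, conj_basisFun, Fin.val_castSucc]
      exact hasSum_fintype _) l
  rw [dconj, h.unique (hasSum_fintype _), ← Finset.sum_coe_sort (modes N)]

lemma dft_add (v w : Fin (N + 1) → ℂ) (l : ℤ) :
    dft a b N (fun j => v j + w j) l = dft a b N v l + dft a b N w l := by
  simp only [dft, add_mul, Finset.sum_add_distrib, mul_add]

lemma dft_const_mul (z : ℂ) (v : Fin (N + 1) → ℂ) (l : ℤ) :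
    dft a b N (fun j => z * v j) l = z * dft a b N v l := by
  simp only [dft, mul_assoc z, ← Finset.mul_sum]; ring

lemma dft_sub (v w : Fin (N + 1) → ℂ) (l : ℤ) :
    dft a b N (fun j => v j - w j) l = dft a b N v l - dft a b N w l := by
  simp only [dft, sub_mul, Finset.sum_sub_distrib, mul_sub]

lemma gridValues_add (c d : ℤ → ℂ) (j : Fin (N + 1)) :
    gridValues a b N (fun l => c l + d l) j = gridValues a b N c j + gridValues a b N d j := by
  simp only [gridValues_eq, add_mul, Finset.sum_add_distrib]

lemma gridValues_sub (c d : ℤ → ℂ) (j : Fin (N + 1)) :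
    gridValues a b N (fun l => c l - d l) j = gridValues a b N c j - gridValues a b N d j := by
  simp only [gridValues_eq, sub_mul, Finset.sum_sub_distrib]

lemma gridValues_const_mul (z : ℂ) (c : ℤ → ℂ) (j : Fin (N + 1)) :
    gridValues a b N (fun l => z * c l) j = z * gridValues a b N c j := by
  simp only [gridValues_eq, mul_assoc z, ← Finset.mul_sum]

lemma dprod_add_left (c c' d : ℤ → ℂ) (l : ℤ) : dprod a b N (fun l => c l + c' l) d l =
    dprod a b N c d l + dprod a b N c' d l := by
  unfold dprod; simp only [gridValues_add, add_mul, dft_add]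

lemma dprod_sub_left (c c' d : ℤ → ℂ) (l : ℤ) : dprod a b N (fun l => c l - c' l) d l =
    dprod a b N c d l - dprod a b N c' d l := by
  unfold dprod; simp only [gridValues_sub, sub_mul, dft_sub]

lemma dprod_const_mul_left (z : ℂ) (c d : ℤ → ℂ) (l : ℤ) : dprod a b N (fun l => z * c l) d l =
    z * dprod a b N c d l := by
  unfold dprod; simp only [gridValues_const_mul, mul_assoc z, dft_const_mul]

lemma dprod_add_right (c d d' : ℤ → ℂ) (l : ℤ) : dprod a b N c (fun l => d l + d' l) l =
    dprod a b N c d l + dprod a b N c d' l := by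
  unfold dprod; simp only [gridValues_add, mul_add, dft_add]

lemma dprod_sub_right (c d d' : ℤ → ℂ) (l : ℤ) : dprod a b N c (fun l => d l - d' l) l =
    dprod a b N c d l - dprod a b N c d' l := by
  unfold dprod; simp only [gridValues_sub, mul_sub, dft_sub]

lemma dprod_const_mul_right (z : ℂ) (c d : ℤ → ℂ) (l : ℤ) : dprod a b N c (fun l => z * d l) l =
    z * dprod a b N c d l := by
  unfold dprod; simp only [gridValues_const_mul, mul_left_comm _ z, dft_const_mul]

lemma dconj_sub (c c' : ℤ → ℂ) (l : ℤ) : dconj a b N (fun l => c l - c' l) l =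
    dconj a b N c l - dconj a b N c' l := by
  unfold dconj; simp only [gridValues_sub, map_sub, dft_sub]

lemma dconj_add (c c' : ℤ → ℂ) (l : ℤ) : dconj a b N (fun l => c l + c' l) l =
    dconj a b N c l + dconj a b N c' l := by
  unfold dconj; simp only [gridValues_add, map_add, dft_add]

lemma dconj_const_mul (z : ℂ) (c : ℤ → ℂ) (l : ℤ) : dconj a b N (fun l => z * c l) l =
    starRingEnd ℂ z * dconj a b N c l := by
  unfold dconj; simp only [gridValues_const_mul, map_mul, dft_const_mul]

lemma hasDerivAt_dprod (hab : a < b) (hN : 0 < N) {c d : ℝ → ℤ → ℂ} {c' d' : ℤ → ℂ} {t : ℝ}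
    (hc : ∀ k ∈ modes N, HasDerivAt (fun t => c t k) (c' k) t)
    (hd : ∀ k ∈ modes N, HasDerivAt (fun t => d t k) (d' k) t) (l : ℤ) :
    HasDerivAt (fun t => dprod a b N (c t) (d t) l)
      (dprod a b N c' (d t) l + dprod a b N (c t) d' l) t := by
  simp only [dprod_apply hab hN, ← Finset.sum_add_distrib]
  refine HasDerivAt.fun_sum fun k hk => HasDerivAt.fun_sum fun k' hk' => ?_
  split_ifs
  · exact (hc k hk).mul (hd k' hk')
  · simpa using hasDerivAt_const t (0 : ℂ)

lemma continuousOn_dprod (hab : a < b) (hN : 0 < N) {c d : ℝ → ℤ → ℂ} {S : Set ℝ}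
    (hc : ∀ k ∈ modes N, ContinuousOn (fun t => c t k) S)
    (hd : ∀ k ∈ modes N, ContinuousOn (fun t => d t k) S) (l : ℤ) :
    ContinuousOn (fun t => dprod a b N (c t) (d t) l) S := by
  simp only [dprod_apply hab hN]
  refine continuousOn_finsetSum _ fun k hk => continuousOn_finsetSum _ fun k' hk' => ?_
  split_ifs
  · exact (hc k hk).mul (hd k' hk')
  · exact continuousOn_const

lemma hasDerivAt_dconj (hab : a < b) (hN : 0 < N) {c : ℝ → ℤ → ℂ} {c' : ℤ → ℂ} {t : ℝ}
    (hc : ∀ k ∈ modes N, HasDerivAt (fun t => c t k) (c' k) t) (l : ℤ) :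
    HasDerivAt (fun t => dconj a b N (c t) l) (dconj a b N c' l) t := by
  simp only [dconj_apply hab hN]
  refine HasDerivAt.fun_sum fun k hk => ?_
  split_ifs
  · exact Complex.conjCLE.hasFDerivAt.comp_hasDerivAt t (hc k hk)
  · exact hasDerivAt_const t (0 : ℂ)

lemma continuousOn_dconj (hab : a < b) (hN : 0 < N) {c : ℝ → ℤ → ℂ} {S : Set ℝ}
    (hc : ∀ k ∈ modes N, ContinuousOn (fun t => c t k) S) (l : ℤ) :
    ContinuousOn (fun t => dconj a b N (c t) l) S := by
  simp only [dconj_apply hab hN]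
  refine continuousOn_finsetSum _ fun k hk => ?_
  split_ifs
  · exact Complex.continuous_conj.comp_continuousOn (hc k hk)
  · exact continuousOn_const

/-- The mode onto which conjugation maps the mode `l`. -/
def reflMode (N : ℕ) (l : ℤ) : ℤ := if l = -((N : ℤ) / 2) then l else -l

lemma reflMode_mem (hE : Even N) {l : ℤ} (hl : l ∈ modes N) : reflMode N l ∈ modes N := by
  obtain ⟨m, rfl⟩ := hE
  rw [mem_modes] at *; unfold reflMode; split_ifs <;> omega

lemma reflMode_reflMode {l : ℤ} (hl : l ∈ modes N) : reflMode N (reflMode N l) = l := by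
  rw [mem_modes] at hl
  unfold reflMode; split_ifs <;> omega

lemma wt_reflMode (l : ℤ) : wt a b (reflMode N l) = wt a b l := by
  unfold reflMode; split_ifs
  · rfl
  · exact wt_neg a b l

lemma freq_sq_reflMode (l : ℤ) : freq a b (reflMode N l) ^ 2 = freq a b l ^ 2 := by
  unfold reflMode; split_ifs
  · rfl
  · rw [freq_neg]; ring

/-- Conjugation sends l to -l modulo N. The mode -N/2 is congruent to its own negative and stays in
place; here discrete conjugation departs from that of Fourier series. -/
lemma dconj_eq (hab : a < b) (hN : 0 < N) (hE : Even N) (c : ℤ → ℂ) {l : ℤ} (hl : l ∈ modes N) :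
    dconj a b N c l = starRingEnd ℂ (c (reflMode N l)) := by
  rw [dconj_apply hab hN, Finset.sum_eq_single (reflMode N l)]
  · rw [if_pos]
    obtain ⟨m, rfl⟩ := hE
    unfold reflMode; split_ifs with h
    · exact ⟨1, by omega⟩
    · exact ⟨0, by omega⟩
  · intro k hk hne
    rw [if_neg]
    rintro ⟨t, ht⟩
    apply hne
    rw [mem_modes] at hk hl
    obtain ⟨m, rfl⟩ := hE
    have hm : (0 : ℤ) ≤ (m + m : ℕ) := by omega
    have h1 : t < 2 := by
      by_contra hc
      have := mul_le_mul_of_nonneg_left (not_lt.1 hc) hm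
      omega
    have h2 : -1 < t := by
      by_contra hc
      have := mul_le_mul_of_nonneg_left (not_lt.1 hc) hm
      omega
    unfold reflMode
    interval_cases t
    · split_ifs <;> omega
    · split_ifs <;> omega
  · intro h; exact absurd (reflMode_mem hE hl) h

lemma nrm_dconj (hab : a < b) (hN : 0 < N) (hE : Even N) (s : ℕ) (c : ℤ → ℂ) :
    nrm a b N s (dconj a b N c) = nrm a b N s c := by
  unfold nrm
  congr 1
  refine Finset.sum_nbij' (reflMode N) (reflMode N) (fun l hl => reflMode_mem hE hl)
    (fun l hl => reflMode_mem hE hl) (fun l hl => reflMode_reflMode hl)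
    (fun l hl => reflMode_reflMode hl) fun l hl => ?_
  rw [dconj_eq hab hN hE c hl, wt_reflMode]; simp

/-- Extension of coefficients by `0`. -/
noncomputable def trunc (N : ℕ) (c : ℤ → ℂ) (l : ℤ) : ℂ := if l ∈ modes N then c l else 0

lemma hsBound_trunc (s : ℕ) (c : ℤ → ℂ) : HsBound a b s (trunc N c) (nrm a b N s c) := by
  intro S
  rw [nrm_sq]
  have e : ∀ l, (wt a b l ^ s * ‖trunc N c l‖) ^ 2
      = if l ∈ modes N then (wt a b l ^ s * ‖c l‖) ^ 2 else 0 := fun l => by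
    unfold trunc; split_ifs <;> simp
  simp only [e]
  rw [← Finset.sum_filter]
  refine Finset.sum_le_sum_of_subset_of_nonneg (fun l hl => (Finset.mem_filter.1 hl).2) ?_
  intro l _ _; positivity

/-- For three modes |k + k' - l| < 2N, so only the wrap-arounds -1, 0, 1 can occur. -/
lemma sum_modes_dvd (c : ℤ → ℂ) {k l : ℤ} (hk : k ∈ modes N) (hl : l ∈ modes N) :
    (∑ k' ∈ modes N, if (N : ℤ) ∣ k + k' - l then c k' else 0) =
      trunc N c (l - N - k) + trunc N c (l - k) + trunc N c (l + N - k) := by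
  have e : ∀ n, trunc N c n = ∑ k' ∈ modes N, if k' = n then c k' else 0 := fun n => by
    rw [Finset.sum_ite_eq']; rfl
  rw [e, e, e, ← Finset.sum_add_distrib, ← Finset.sum_add_distrib]
  refine Finset.sum_congr rfl fun k' hk' => ?_
  rw [mem_modes] at hk hl hk'
  have hN : (0 : ℤ) < N := by omega
  by_cases h : (N : ℤ) ∣ k + k' - l
  · rw [if_pos h]
    obtain ⟨t, ht⟩ := h
    have h1 : t < 2 := by
      by_contra hc
      have := mul_le_mul_of_nonneg_left (not_lt.1 hc) hN.le
      omega
    have h2 : -2 < t := by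
      by_contra hc
      have := mul_le_mul_of_nonneg_left (show t ≤ -2 by omega) hN.le
      omega
    interval_cases t
    · rw [if_pos (by omega), if_neg (by omega), if_neg (by omega)]; simp
    · rw [if_neg (by omega), if_pos (by omega), if_neg (by omega)]; simp
    · rw [if_neg (by omega), if_neg (by omega), if_pos (by omega)]; simp
  · rw [if_neg h, if_neg, if_neg, if_neg]
    · simp
    · rintro rfl; apply h; exact ⟨1, by ring⟩
    · rintro rfl; apply h; exact ⟨0, by ring⟩
    · rintro rfl; apply h; exact ⟨-1, by ring⟩

lemma conv_trunc (c d : ℤ → ℂ) (n : ℤ) :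
    conv (trunc N c) (trunc N d) n = ∑ k ∈ modes N, c k * trunc N d (n - k) := by
  unfold conv
  rw [tsum_eq_sum (s := modes N)]
  · exact Finset.sum_congr rfl fun k hk => by rw [trunc, if_pos hk]
  · intro k hk; rw [trunc, if_neg hk, zero_mul]

lemma dprod_eq_conv (hab : a < b) (hN : 0 < N) (c d : ℤ → ℂ) {l : ℤ} (hl : l ∈ modes N) :
    dprod a b N c d l = conv (trunc N c) (trunc N d) (l + (-1 : ℤ) * N)
      + conv (trunc N c) (trunc N d) (l + (0 : ℤ) * N)
      + conv (trunc N c) (trunc N d) (l + (1 : ℤ) * N) := by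
  rw [dprod_apply hab hN, conv_trunc, conv_trunc, conv_trunc, ← Finset.sum_add_distrib,
    ← Finset.sum_add_distrib]
  refine Finset.sum_congr rfl fun k hk => ?_
  have e : ∀ k', (if (N : ℤ) ∣ k + k' - l then c k * d k' else 0)
      = c k * if (N : ℤ) ∣ k + k' - l then d k' else 0 := fun k' => by split_ifs <;> simp
  simp only [e]
  rw [← Finset.mul_sum, sum_modes_dvd d hk hl]
  have e1 : l + (-1 : ℤ) * N - k = l - N - k := by ring
  have e2 : l + (0 : ℤ) * N - k = l - k := by ring
  have e3 : l + (1 : ℤ) * N - k = l + N - k := by ring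
  rw [e1, e2, e3]; ring

/-- Folding back by mN moves every coefficient to a frequency of no larger weight. Aliasing is
therefore harmless in these norms, and cyclic convolution inherits the bound of the ordinary one. -/
lemma HsBound.nrm_shift_le (hab : a < b) {s : ℕ} {c : ℤ → ℂ} {K : ℝ} (hK : 0 ≤ K)
    (h : HsBound a b s c K) (m : ℤ) : nrm a b N s (fun l => c (l + m * N)) ≤ K := by
  unfold nrm
  refine Real.sqrt_le_iff.2 ⟨hK, ?_⟩
  refine le_trans ?_ (h ((modes N).map (addRightEmbedding (m * (N : ℤ)))))
  rw [Finset.sum_map]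
  refine Finset.sum_le_sum fun l hl => ?_
  have := wt_le_wt_of_abs_le hab (abs_le_abs_add_mul hl m)
  have := wt_pos a b l
  simp only [addRightEmbedding_apply]
  gcongr

end

/-- The discrete product is bounded in the weighted norms, uniformly in `N`. -/
lemma exists_nrm_dprod_le {a b : ℝ} (hab : a < b) {s : ℕ} (hs : 1 ≤ s) : ∃ C : ℝ, 0 < C ∧
    ∀ {N : ℕ}, 0 < N → ∀ c d : ℤ → ℂ,
      nrm a b N s (dprod a b N c d) ≤ C * nrm a b N s c * nrm a b N s d := by
  obtain ⟨C, hC, h⟩ := exists_hsBound_conv hab hs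
  refine ⟨3 * C, by positivity, fun {N} hN c d => ?_⟩
  have hc := nrm_nonneg (a := a) (b := b) (N := N) (s := s) c
  have hd := nrm_nonneg (a := a) (b := b) (N := N) (s := s) d
  have hb := h _ _ _ _ hc hd (hsBound_trunc s c) (hsBound_trunc s d)
  have hK : 0 ≤ C * nrm a b N s c * nrm a b N s d := by positivity
  rw [nrm_congr fun l hl => dprod_eq_conv hab hN c d hl]
  refine (nrm_add_le _ _).trans ?_
  have h0 := nrm_add_le (a := a) (b := b) (N := N) (s := s)
    (fun l => conv (trunc N c) (trunc N d) (l + (-1 : ℤ) * N))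
    (fun l => conv (trunc N c) (trunc N d) (l + (0 : ℤ) * N))
  have h1 := hb.nrm_shift_le (N := N) hab hK (-1)
  have h2 := hb.nrm_shift_le (N := N) hab hK 0
  have h3 := hb.nrm_shift_le (N := N) hab hK 1
  linarith

end KGS

namespace KGS

/-! ### Products of periodic functions -/

lemma intervalIntegrable_of_continuousOn {a b : ℝ} (hab : a < b) {u : ℝ → ℂ}
    (hu : ContinuousOn u (Icc a b)) : IntervalIntegrable u volume a b :=
  ContinuousOn.intervalIntegrable (by rwa [uIcc_of_le hab.le])

/-- The absolutely convergent series of `f` may be integrated term by term against the bounded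
function `g`. -/
lemma fcoef_mul {a b : ℝ} (hab : a < b) {f g : ℝ → ℂ} (hf : ContinuousOn f (Icc a b))
    (hper : f a = f b) (hs : Summable (fun l => ‖fcoef a b f l‖)) (hg : ContinuousOn g (Icc a b))
    (l : ℤ) : fcoef a b (fun x => f x * g x) l = conv (fcoef a b f) (fcoef a b g) l := by
  obtain ⟨M, hM⟩ := isCompact_Icc.exists_bound_of_continuousOn hg
  have hgi := intervalIntegrable_of_continuousOn hab hg
  have h := intervalIntegral.hasSum_integral_of_dominated_convergence (μ := volume) (a := a) (b := b)
    (F := fun k x => fcoef a b f k * basisFun a b k x * (g x * basisFun a b (-l) x))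
    (f := fun x => f x * g x * basisFun a b (-l) x)
    (fun k _ => ‖fcoef a b f k‖ * M) ?_ ?_ ?_ ?_ ?_
  · rw [fcoef_def']
    have h2 := h.mul_left (1 / ((b : ℂ) - a))
    rw [← h2.tsum_eq]
    unfold conv
    congr 1; ext k
    rw [fcoef_def' a b g]
    have e : ∀ x, fcoef a b f k * basisFun a b k x * (g x * basisFun a b (-l) x)
        = fcoef a b f k * (g x * basisFun a b (-(l - k)) x) := fun x => by
      rw [show -(l - k) = k + -l by ring, basisFun_add]; ring
    simp only [e, intervalIntegral.integral_const_mul]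
    ring
  · intro k
    have : IntervalIntegrable (fun x => fcoef a b f k * basisFun a b k x *
        (g x * basisFun a b (-l) x)) volume a b :=
      (intervalIntegrable_mul_basisFun hgi _).continuousOn_mul
        (continuous_const.mul (continuous_basisFun a b k)).continuousOn
    exact (intervalIntegrable_iff.1 this).aestronglyMeasurable
  · intro k
    refine ae_of_all _ fun x hx => ?_
    rw [uIoc_of_le hab.le] at hx
    rw [norm_mul, norm_mul, norm_mul, norm_basisFun, norm_basisFun, mul_one, mul_one]
    have := hM x (Ioc_subset_Icc_self hx)
    gcongr
  · exact ae_of_all _ fun x _ => hs.mul_right M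
  · exact intervalIntegrable_const
  · refine ae_of_all _ fun x hx => ?_
    rw [uIoc_of_le hab.le] at hx
    have := (hasSum_fourier_series hab hf hper hs (Ioc_subset_Icc_self hx)).mul_right
      (g x * basisFun a b (-l) x)
    rwa [← mul_assoc] at this

/-- A continuous periodic function with Fourier coefficients in a ball of `H^s`. -/
structure PerBound (a b : ℝ) (s : ℕ) (u : ℝ → ℂ) (K : ℝ) : Prop where
  nonneg : 0 ≤ K
  continuousOn : ContinuousOn u (Icc a b)
  periodic : u a = u b
  hsBound : HsBound a b s (fcoef a b u) K

lemma PerBound.conj {a b : ℝ} {s : ℕ} {u : ℝ → ℂ} {K : ℝ} (h : PerBound a b s u K) :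
    PerBound a b s (fun x => starRingEnd ℂ (u x)) K where
  nonneg := h.nonneg
  continuousOn := Complex.continuous_conj.comp_continuousOn h.continuousOn
  periodic := by rw [h.periodic]
  hsBound := by
    have := h.hsBound.conj_neg
    intro S
    simp only [fcoef_conj]
    exact this S

lemma exists_perBound_mul {a b : ℝ} (hab : a < b) {s : ℕ} (hs : 1 ≤ s) : ∃ C : ℝ, 0 < C ∧
    ∀ {f g : ℝ → ℂ} {K L : ℝ}, PerBound a b s f K → PerBound a b s g L →
      PerBound a b s (fun x => f x * g x) (C * K * L) := by
  obtain ⟨C, hC, h⟩ := exists_hsBound_conv hab hs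
  refine ⟨C, hC, fun {f g K L} hf hg => ⟨?_, hf.continuousOn.mul hg.continuousOn, ?_, ?_⟩⟩
  · have := hf.nonneg; have := hg.nonneg; positivity
  · rw [hf.periodic, hg.periodic]
  · have hb := h _ _ _ _ hf.nonneg hg.nonneg hf.hsBound hg.hsBound
    intro S
    simp only [fcoef_mul hab hf.continuousOn hf.periodic (hf.hsBound.summable_norm hab hs hf.nonneg)
      hg.continuousOn]
    exact hb S

/-- The sequence `d` is left free because it is used for two different approximations of the
coefficients of `g`: the Fourier coefficients, and, for a conjugate, `dconj` of those of the
original function, which is different at the mode -N/2. -/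
lemma exists_nrm_defect_le {a b : ℝ} (hab : a < b) {s : ℕ} (hs : 2 ≤ s) : ∃ C : ℝ, 0 < C ∧
    ∀ {N : ℕ}, 0 < N → Even N → meshSize a b N ≤ 1 → ∀ {f g : ℝ → ℂ} {K L : ℝ},
      PerBound a b s f K → PerBound a b s g L → ∀ (d : ℤ → ℂ) {η : ℝ},
      nrm a b N 1 (fun l => dft a b N (fun j => g (gridPoint a b N j)) l - d l) ≤ η →
      nrm a b N 1 (fun l => fcoef a b (fun x => f x * g x) l - dprod a b N (fcoef a b f) d l)
        ≤ C * K * (meshSize a b N ^ (s - 1) * L + η) := by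
  obtain ⟨A, hA, hal⟩ := exists_nrm_alias_le hab
  obtain ⟨P, hP, hmul⟩ := exists_perBound_mul hab (show 1 ≤ s by omega)
  obtain ⟨D, hD, hdp⟩ := exists_nrm_dprod_le hab (le_refl 1)
  refine ⟨A * P + D * A * (A + 1) + D, by positivity, fun {N} hN hE hh1 {f g K L} hf hg d {η} hη => ?_⟩
  have hK := hf.nonneg
  have hL := hg.nonneg
  have hh := meshSize_pos hab hN
  set h := meshSize a b N
  set F := dft a b N (fun j => f (gridPoint a b N j))
  set G := dft a b N (fun j => g (gridPoint a b N j))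
  have hη0 : 0 ≤ η := (nrm_nonneg _).trans hη
  have hfg := hmul hf hg
  have h1 := hal hN (r := 1) (s := s) (by omega) hfg.nonneg hfg.continuousOn hfg.periodic hfg.hsBound
  have h2 : nrm a b N 1 (fun l => F l - fcoef a b f l) ≤ A * h ^ (s - 1) * K :=
    hal hN (r := 1) (s := s) (by omega) hK hf.continuousOn hf.periodic hf.hsBound
  have h3 : nrm a b N 1 (fun l => G l - fcoef a b g l) ≤ A * h ^ (s - 1) * L :=
    hal hN (r := 1) (s := s) (by omega) hL hg.continuousOn hg.periodic hg.hsBound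
  have hpow : h ^ (s - 1) ≤ 1 := pow_le_one₀ hh.le hh1
  have h4 : nrm a b N 1 G ≤ (A + 1) * L := by
    have e : nrm a b N 1 G = nrm a b N 1 (fun l => (G l - fcoef a b g l) + fcoef a b g l) :=
      nrm_congr fun l _ => by ring
    rw [e]
    refine (nrm_add_le _ _).trans ?_
    have h5 := (hg.hsBound.of_le (show 1 ≤ s by omega)).nrm_le hL (N := N)
    have : A * h ^ (s - 1) * L ≤ A * 1 * L := by gcongr
    linarith
  have h6 : nrm a b N 1 (fcoef a b f) ≤ K := (hf.hsBound.of_le (show 1 ≤ s by omega)).nrm_le hK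
  -- The grid product `dprod F G` is the intermediate term: it is the interpolation of `f * g`, and
  -- its factors are exchanged one at a time for the coefficients of `f` and for `d`.
  have key : ∀ l ∈ modes N, fcoef a b (fun x => f x * g x) l - dprod a b N (fcoef a b f) d l =
      (dprod a b N (fun l => F l - fcoef a b f l) G l
        + dprod a b N (fcoef a b f) (fun l => G l - d l) l)
      - (dft a b N (fun j => f (gridPoint a b N j) * g (gridPoint a b N j)) l
        - fcoef a b (fun x => f x * g x) l) := by
    intro l _
    rw [dprod_sub_left, dprod_sub_right, dft_mul hab hN hE]
    ring
  rw [nrm_congr key]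
  refine (nrm_sub_le _ _).trans ((add_le_add_left (nrm_add_le _ _) _).trans ?_)
  have h7 := hdp hN (fun l => F l - fcoef a b f l) G
  have h8 := hdp hN (fcoef a b f) (fun l => G l - d l)
  have n1 := nrm_nonneg (a := a) (b := b) (N := N) (s := 1) G
  have n2 := nrm_nonneg (a := a) (b := b) (N := N) (s := 1) (fun l => G l - d l)
  have h9 : D * nrm a b N 1 (fun l => F l - fcoef a b f l) * nrm a b N 1 G
      ≤ D * (A * h ^ (s - 1) * K) * ((A + 1) * L) := by gcongr
  have h10 : D * nrm a b N 1 (fcoef a b f) * nrm a b N 1 (fun l => G l - d l) ≤ D * K * η := by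
    gcongr
  have h11 : 0 ≤ h ^ (s - 1) * L * K := by positivity
  have h12 : 0 ≤ K * η := by positivity
  have h13 : 0 ≤ D * (h ^ (s - 1) * L * K) := by positivity
  have h14 : 0 ≤ A * P * (K * η) := by positivity
  have h15 : 0 ≤ D * A * (A + 1) * (K * η) := by positivity
  have e : (A * P + D * A * (A + 1) + D) * K * (h ^ (s - 1) * L + η) = A * h ^ (s - 1) * (P * K * L)
      + D * (A * h ^ (s - 1) * K) * ((A + 1) * L) + D * K * η + D * (h ^ (s - 1) * L * K)
      + A * P * (K * η) + D * A * (A + 1) * (K * η) := by ring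
  rw [e]
  linarith

/-- The defect between the exact product and the product on the grid. -/
lemma exists_nrm_defect_mul_le {a b : ℝ} (hab : a < b) {s : ℕ} (hs : 2 ≤ s) : ∃ C : ℝ, 0 < C ∧
    ∀ {N : ℕ}, 0 < N → Even N → meshSize a b N ≤ 1 → ∀ {f g : ℝ → ℂ} {K L : ℝ},
      PerBound a b s f K → PerBound a b s g L →
      nrm a b N 1 (fun l => fcoef a b (fun x => f x * g x) l
        - dprod a b N (fcoef a b f) (fcoef a b g) l) ≤ C * meshSize a b N ^ (s - 1) * K * L := by
  obtain ⟨A, hA, hal⟩ := exists_nrm_alias_le hab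
  obtain ⟨C, hC, h⟩ := exists_nrm_defect_le hab hs
  refine ⟨C * (1 + A), by positivity, fun {N} hN hE hh1 {f g K L} hf hg => ?_⟩
  refine (h hN hE hh1 hf hg _ (hal hN (r := 1) (s := s) (by omega) hg.nonneg hg.continuousOn
    hg.periodic hg.hsBound)).trans (le_of_eq ?_)
  ring

lemma exists_nrm_defect_sq_le {a b : ℝ} (hab : a < b) {s : ℕ} (hs : 2 ≤ s) : ∃ C : ℝ, 0 < C ∧
    ∀ {N : ℕ}, 0 < N → Even N → meshSize a b N ≤ 1 → ∀ {f : ℝ → ℂ} {K : ℝ},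
      PerBound a b s f K →
      nrm a b N 1 (fun l => fcoef a b (fun x => f x * starRingEnd ℂ (f x)) l
        - dprod a b N (fcoef a b f) (dconj a b N (fcoef a b f)) l)
        ≤ C * meshSize a b N ^ (s - 1) * K * K := by
  obtain ⟨A, hA, hal⟩ := exists_nrm_alias_le hab
  obtain ⟨C, hC, h⟩ := exists_nrm_defect_le hab hs
  refine ⟨C * (1 + A), by positivity, fun {N} hN hE hh1 {f K} hf => ?_⟩
  have h1 := hal hN (r := 1) (s := s) (by omega) hf.nonneg hf.continuousOn hf.periodic hf.hsBound
  rw [← nrm_dconj hab hN hE] at h1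
  refine (h hN hE hh1 hf hf.conj (dconj a b N (fcoef a b f)) (η := A * meshSize a b N ^ (s - 1) * K)
    ?_).trans (le_of_eq ?_)
  · refine le_trans (le_of_eq (nrm_congr fun l _ => ?_)) h1
    rw [dconj_sub, dft_conj hab hN hE]
  · ring

lemma MemHper.perBound {a b : ℝ} (hab : a < b) {m : ℕ} (hm : 1 ≤ m) {u : ℝ → ℂ}
    (h : MemHper a b m u) :
    PerBound a b m u (Real.sqrt (2 ^ m / (b - a)) * sobolevNorm a b m u) :=
  ⟨mul_nonneg (Real.sqrt_nonneg _) (sobolevNorm_nonneg _ _ _ _), h.continuousOn hm, h.apply_eq hab hm,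
    h.hsBound hab⟩

lemma PerBound.mono {a b : ℝ} {s : ℕ} {u : ℝ → ℂ} {K K' : ℝ} (h : PerBound a b s u K)
    (hK : K ≤ K') : PerBound a b s u K' :=
  ⟨h.nonneg.trans hK, h.continuousOn, h.periodic, h.hsBound.mono h.nonneg hK⟩

/-! ### Trigonometric polynomials -/

lemma trigPoly_eq (a b : ℝ) (N : ℕ) (c : ℤ → ℂ) (x : ℝ) :
    trigPoly a b N c x = ∑ l ∈ modes N, c l * basisFun a b l x := rfl

lemma continuous_trigPoly (a b : ℝ) (N : ℕ) (c : ℤ → ℂ) : Continuous (trigPoly a b N c) := by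
  unfold trigPoly; fun_prop

lemma hasDerivAt_trigPoly (a b : ℝ) (N : ℕ) (c : ℤ → ℂ) (x : ℝ) :
    HasDerivAt (trigPoly a b N c)
      (trigPoly a b N (fun l => Complex.I * freq a b l * c l) x) x := by
  have : HasDerivAt (fun x => ∑ l ∈ modes N, c l * basisFun a b l x)
      (∑ l ∈ modes N, c l * (Complex.I * freq a b l * basisFun a b l x)) x :=
    HasDerivAt.fun_sum fun l _ => (hasDerivAt_basisFun a b l x).const_mul (c l)
  have e : trigPoly a b N (fun l => Complex.I * freq a b l * c l) x
      = ∑ l ∈ modes N, c l * (Complex.I * freq a b l * basisFun a b l x) :=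
    Finset.sum_congr rfl fun l _ => by simp only [basisFun]; ring
  rw [e]
  exact this

lemma trigPoly_left_eq_right {a b : ℝ} (hab : a < b) (N : ℕ) (c : ℤ → ℂ) :
    trigPoly a b N c a = trigPoly a b N c b := by
  simp only [trigPoly_eq, basisFun_left, basisFun_right hab]

lemma memLp_of_continuous {a b : ℝ} {u : ℝ → ℂ} (hu : Continuous u) :
    MemLp u 2 (volume.restrict (Ioo a b)) := by
  have : MemLp u 2 (volume.restrict (Icc a b)) := by
    obtain ⟨M, hM⟩ := isCompact_Icc.exists_bound_of_continuousOn (hu.continuousOn (s := Icc a b))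
    refine MemLp.of_bound hu.aestronglyMeasurable M ?_
    filter_upwards [ae_restrict_mem measurableSet_Icc] with x hx using hM x hx
  exact this.mono_measure (Measure.restrict_mono Ioo_subset_Icc_self le_rfl)

lemma memHper_trigPoly {a b : ℝ} (hab : a < b) (N : ℕ) (c : ℤ → ℂ) :
    MemHper a b 1 (trigPoly a b N c) where
  memH k hk := by
    interval_cases k
    · exact ⟨_, hasWeakDeriv_zero (memLp_of_continuous (continuous_trigPoly a b N c))⟩
    · refine ⟨trigPoly a b N (fun l => Complex.I * freq a b l * c l),
        memLp_of_continuous (continuous_trigPoly _ _ _ _),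
        memLp_of_continuous (continuous_trigPoly _ _ _ _), fun η hη => ?_⟩
      have hd : Continuous (deriv η) := hη.1.continuous_deriv (by norm_num)
      rw [iteratedDeriv_one, intervalIntegral.integral_mul_deriv_eq_deriv_mul
        (fun x _ => hasDerivAt_trigPoly a b N c x)
        (fun x _ => (hη.1.differentiable (by norm_num) x).hasDerivAt)
        ((continuous_trigPoly _ _ _ _).intervalIntegrable _ _) (hd.intervalIntegrable _ _)]
      have ha : η a = 0 := image_eq_zero_of_notMem_tsupport fun h' => by simpa using hη.2.2 h'
      have hb : η b = 0 := image_eq_zero_of_notMem_tsupport fun h' => by simpa using hη.2.2 h'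
      rw [ha, hb]; simp
  continuousOn _ := (continuous_trigPoly _ _ _ _).continuousOn
  periodic k hk := by
    interval_cases k
    exact ⟨_, hasWeakDeriv_zero (memLp_of_continuous (continuous_trigPoly a b N c)),
      (continuous_trigPoly _ _ _ _).continuousOn, trigPoly_left_eq_right hab N c⟩

lemma fcoef_basisFun {a b : ℝ} (hab : a < b) (k l : ℤ) :
    fcoef a b (basisFun a b k) l = if k = l then 1 else 0 := by
  have hb : (b : ℂ) - a ≠ 0 := by
    rw [← Complex.ofReal_sub, Complex.ofReal_ne_zero]; linarith
  rw [fcoef_def']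
  simp only [← basisFun_add]
  split_ifs with h
  · subst h
    have : ∀ x, basisFun a b (k + -k) x = 1 := fun x => by simp [basisFun, freq]
    simp only [this, intervalIntegral.integral_const]
    rw [Complex.real_smul]; push_cast; field_simp
  · set n := k + -l with hn
    have hn0 : n ≠ 0 := by omega
    have hf : Complex.I * freq a b n ≠ 0 := by
      refine mul_ne_zero Complex.I_ne_zero (Complex.ofReal_ne_zero.2 ?_)
      have h1 := Real.pi_pos
      have h2 : (n : ℝ) ≠ 0 := by exact_mod_cast hn0
      have h3 : b - a ≠ 0 := by linarith
      unfold freq; positivity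
    have h1 := intervalIntegral.integral_eq_sub_of_hasDerivAt (a := a) (b := b)
      (fun x _ => hasDerivAt_basisFun a b n x)
      ((continuous_const.mul (continuous_basisFun a b n)).intervalIntegrable _ _)
    rw [basisFun_left, basisFun_right hab, sub_self, intervalIntegral.integral_const_mul] at h1
    rw [(mul_eq_zero.1 h1).resolve_left hf, mul_zero]

lemma fcoef_trigPoly {a b : ℝ} (hab : a < b) (N : ℕ) (c : ℤ → ℂ) (l : ℤ) :
    fcoef a b (trigPoly a b N c) l = trunc N c l := by
  have h : fcoef a b (trigPoly a b N c) l
      = ∑ k ∈ modes N, c k * fcoef a b (basisFun a b k) l := by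
    rw [fcoef_def']
    simp only [trigPoly_eq, Finset.sum_mul]
    have hi : ∀ k ∈ modes N, IntervalIntegrable
        (fun x => c k * basisFun a b k x * basisFun a b (-l) x) volume a b := fun k _ =>
      ((continuous_const.mul (continuous_basisFun a b k)).mul
        (continuous_basisFun a b (-l))).intervalIntegrable _ _
    rw [intervalIntegral.integral_finsetSum hi, Finset.mul_sum]
    refine Finset.sum_congr rfl fun k _ => ?_
    simp only [mul_assoc (c k), intervalIntegral.integral_const_mul, fcoef_def']
    ring
  rw [h]
  simp only [fcoef_basisFun hab, mul_ite, mul_one, mul_zero]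
  rw [Finset.sum_ite_eq', trunc]

lemma sobolevNorm_one_interp {a b : ℝ} (hab : a < b) {N : ℕ} (v : Fin (N + 1) → ℂ) :
    sobolevNorm a b 1 (interp a b N v) = Real.sqrt (b - a) * nrm a b N 1 (dft a b N v) := by
  have hb : 0 < b - a := sub_pos.2 hab
  have h := (memHper_trigPoly hab N (dft a b N v)).hasSum_sobolevNorm_one hab
  simp only [fcoef_trigPoly hab] at h
  have h2 : HasSum (fun l => (wt a b l ^ 1 * ‖trunc N (dft a b N v) l‖) ^ 2)
      (nrm a b N 1 (dft a b N v) ^ 2) := by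
    rw [nrm_sq]
    have := hasSum_sum_of_ne_finset_zero (L := SummationFilter.unconditional ℤ) (s := modes N)
      (f := fun l => (wt a b l ^ 1 * ‖trunc N (dft a b N v) l‖) ^ 2) (by
        intro l hl; simp [trunc, hl])
    convert this using 1
    exact Finset.sum_congr rfl fun l hl => by simp [trunc, hl]
  have h3 := h.unique h2
  have h4 : sobolevNorm a b 1 (interp a b N v) ^ 2
      = (Real.sqrt (b - a) * nrm a b N 1 (dft a b N v)) ^ 2 := by
    rw [mul_pow, Real.sq_sqrt hb.le, ← h3]
    unfold interp; field_simp
  exact (sq_eq_sq₀ (sobolevNorm_nonneg _ _ _ _)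
    (mul_nonneg (Real.sqrt_nonneg _) (nrm_nonneg _))).1 h4

lemma MemHper.nrm_fcoef_le {a b : ℝ} (hab : a < b) {u : ℝ → ℂ} (h : MemHper a b 1 u) (N : ℕ) :
    Real.sqrt (b - a) * nrm a b N 1 (fcoef a b u) ≤ sobolevNorm a b 1 u := by
  have hb : 0 < b - a := sub_pos.2 hab
  have h1 := sum_le_hasSum (modes N) (fun l _ => by positivity) (h.hasSum_sobolevNorm_one hab)
  rw [← nrm_sq] at h1
  refine (abs_le_of_sq_le_sq' ?_ (sobolevNorm_nonneg _ _ _ _)).2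
  rw [mul_pow, Real.sq_sqrt hb.le]
  calc _ ≤ (b - a) * ((b - a)⁻¹ * sobolevNorm a b 1 u ^ 2) := by gcongr
    _ = _ := by field_simp

/-- The `H¹` distance of a function to an interpolant. -/
lemma MemHper.sobolevNorm_sub_interp_le {a b : ℝ} (hab : a < b) {s : ℕ} (hs : 1 ≤ s) {u : ℝ → ℂ}
    (hu : MemHper a b s u) {K : ℝ} (hK : 0 ≤ K) (hb : HsBound a b s (fcoef a b u) K) {N : ℕ}
    (hN : 0 < N) (hE : Even N) (v : Fin (N + 1) → ℂ) :
    sobolevNorm a b 1 (fun x => u x - interp a b N v x) ≤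
      Real.sqrt (b - a) * (nrm a b N 1 (fun l => fcoef a b u l - dft a b N v l)
        + meshSize a b N ^ (s - 1) * K) := by
  have hb0 : 0 < b - a := sub_pos.2 hab
  have hh := meshSize_pos hab hN
  set h := meshSize a b N
  set c := dft a b N v
  have hmem : MemHper a b 1 (fun x => u x - interp a b N v x) :=
    (hu.of_le hs).sub hab (memHper_trigPoly hab N c)
  have hco : ∀ l, fcoef a b (fun x => u x - interp a b N v x) l = fcoef a b u l - trunc N c l := by
    intro l
    rw [← fcoef_trigPoly hab N c l]
    exact fcoef_sub (intervalIntegrable_of_continuousOn hab (hu.continuousOn hs))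
      ((continuous_trigPoly a b N _).intervalIntegrable _ _) l
  have hS := hmem.hasSum_sobolevNorm_one hab
  simp only [hco] at hS
  set n := nrm a b N 1 (fun l => fcoef a b u l - c l)
  have hn : 0 ≤ n := nrm_nonneg _
  have hle : (b - a)⁻¹ * sobolevNorm a b 1 (fun x => u x - interp a b N v x) ^ 2
      ≤ n ^ 2 + (h ^ (s - 1) * K) ^ 2 := by
    rw [← hS.tsum_eq]
    refine Real.tsum_le_of_sum_le (fun l => by positivity) fun S => ?_
    -- On the modes the coefficients are compared directly; off the modes the inverse weight is at
    -- most h, and s - 1 weights are exchanged for h^(s-1).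
    rw [← Finset.sum_filter_add_sum_filter_not S (· ∈ modes N)]
    gcongr
    · simp only [n, nrm_sq]
      refine le_trans (le_of_eq ?_) (Finset.sum_le_sum_of_subset_of_nonneg
        (s := S.filter (· ∈ modes N)) (fun l hl => (Finset.mem_filter.1 hl).2)
        fun l _ _ => by positivity)
      exact Finset.sum_congr rfl fun l hl => by simp [trunc, (Finset.mem_filter.1 hl).2]
    · rw [mul_pow]
      refine le_trans ?_ (mul_le_mul_of_nonneg_left (hb (S.filter (· ∉ modes N))) (by positivity))
      rw [Finset.mul_sum]
      refine Finset.sum_le_sum fun l hl => ?_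
      have hl' := (Finset.mem_filter.1 hl).2
      have hw : (wt a b l)⁻¹ ≤ h := inv_wt_le hab hN (by
        rw [mem_modes, not_and_or] at hl'
        obtain ⟨m, rfl⟩ := hE
        rcases abs_cases l with ⟨h1, h2⟩ | ⟨h1, h2⟩ <;> omega)
      have hw0 := wt_pos a b l
      rw [trunc, if_neg hl', sub_zero, ← mul_pow]
      have : wt a b l ^ 1 ≤ h ^ (s - 1) * wt a b l ^ s := by
        calc wt a b l ^ 1 = ((wt a b l)⁻¹) ^ (s - 1) * wt a b l ^ s := by
              rw [inv_pow, ← div_eq_inv_mul, eq_div_iff (by positivity), ← pow_add]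
              congr 1; omega
          _ ≤ _ := by gcongr
      rw [← mul_assoc]
      gcongr
  refine (abs_le_of_sq_le_sq' ?_ (by positivity)).2
  rw [mul_pow, Real.sq_sqrt hb0.le]
  rw [inv_mul_le_iff₀ hb0] at hle
  refine hle.trans ?_
  gcongr
  have : 0 ≤ n * (h ^ (s - 1) * K) := by positivity
  nlinarith

end KGS

namespace KGS

/-! ### Time evolution of the Fourier coefficients -/

lemma MemHper.norm_fcoef_le {a b : ℝ} (hab : a < b) {m : ℕ} {u : ℝ → ℂ} (h : MemHper a b m u)
    (l : ℤ) : ‖fcoef a b u l‖ ≤ Real.sqrt (2 ^ m / (b - a)) * sobolevNorm a b m u := by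
  have h1 := h.hsBound hab {l}
  rw [Finset.sum_singleton] at h1
  have h2 := (abs_le_of_sq_le_sq' h1
    (mul_nonneg (Real.sqrt_nonneg _) (sobolevNorm_nonneg _ _ _ _))).2
  refine le_trans ?_ h2
  exact le_mul_of_one_le_left (norm_nonneg _) (one_le_pow₀ (one_le_wt a b l))

lemma MemCHper.continuousOn_fcoef {a b T : ℝ} (hab : a < b) {m : ℕ} (hm : 1 ≤ m) {u : ℝ → ℝ → ℂ}
    (h : MemCHper a b T m u) (l : ℤ) : ContinuousOn (fun t => fcoef a b (u t) l) (Icc 0 T) := by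
  intro t ht
  rw [ContinuousWithinAt, tendsto_iff_norm_sub_tendsto_zero]
  have h1 := (h.tendsto t ht).const_mul (Real.sqrt (2 ^ m / (b - a)))
  rw [mul_zero] at h1
  refine squeeze_zero' (Eventually.of_forall fun _ => norm_nonneg _) ?_ h1
  filter_upwards [self_mem_nhdsWithin] with s hs
  rw [← fcoef_sub (intervalIntegrable_of_continuousOn hab ((h.mem s hs).continuousOn hm))
    (intervalIntegrable_of_continuousOn hab ((h.mem t ht).continuousOn hm))]
  exact ((h.mem s hs).sub hab (h.mem t ht)).norm_fcoef_le hab l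

lemma MemC1Hper.hasDerivWithinAt_fcoef {a b T : ℝ} (hab : a < b) {m : ℕ} (hm : 1 ≤ m)
    {u du : ℝ → ℝ → ℂ} (h : MemC1Hper a b T m u du) (l : ℤ) {t : ℝ} (ht : t ∈ Icc 0 T) :
    HasDerivWithinAt (fun t => fcoef a b (u t) l) (fcoef a b (du t) l) (Icc 0 T) t := by
  rw [hasDerivWithinAt_iff_tendsto_slope, tendsto_iff_norm_sub_tendsto_zero]
  have h1 := (h.tendsto t ht).const_mul (Real.sqrt (2 ^ m / (b - a)))
  rw [mul_zero] at h1
  refine squeeze_zero' (Eventually.of_forall fun _ => norm_nonneg _) ?_ h1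
  filter_upwards [self_mem_nhdsWithin] with s hs
  have hs' := hs.1
  have is := intervalIntegrable_of_continuousOn hab ((h.mem.mem s hs').continuousOn hm)
  have it := intervalIntegrable_of_continuousOn hab ((h.mem.mem t ht).continuousOn hm)
  have id := intervalIntegrable_of_continuousOn hab ((h.mem_deriv.mem t ht).continuousOn hm)
  have e : (fun x => (u s x - u t x) / ((s - t : ℝ) : ℂ) - du t x)
      = fun x => (((s - t : ℝ) : ℂ)⁻¹ * (u s x - u t x)) - du t x := by
    ext x; rw [div_eq_inv_mul]
  have hm2 := (((h.mem.mem s hs').sub hab (h.mem.mem t ht)).const_mul (((s - t : ℝ) : ℂ)⁻¹)).sub hab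
    (h.mem_deriv.mem t ht)
  have h2 := hm2.norm_fcoef_le hab l
  rw [fcoef_sub ((is.sub it).const_mul _) id, fcoef_const_mul, fcoef_sub is it] at h2
  rw [e, slope_def_module]
  refine le_trans (le_of_eq ?_) h2
  rw [Complex.real_smul]; push_cast; rfl

lemma fcoef_tsum {a b : ℝ} (hab : a < b) {c : ℤ → ℂ} (hc : Summable fun l => ‖c l‖) (l : ℤ) :
    fcoef a b (fun x => ∑' k, c k * basisFun a b k x) l = c l := by
  have hs : ∀ x, Summable fun k => c k * basisFun a b k x := fun x =>
    Summable.of_norm (by simpa [norm_basisFun] using hc)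
  have h := intervalIntegral.hasSum_integral_of_dominated_convergence (μ := volume) (a := a) (b := b)
    (F := fun k x => c k * basisFun a b k x * basisFun a b (-l) x)
    (f := fun x => (∑' k, c k * basisFun a b k x) * basisFun a b (-l) x)
    (fun k _ => ‖c k‖) ?_ ?_ ?_ ?_ ?_
  · have h2 := h.mul_left (1 / ((b : ℂ) - a))
    rw [fcoef_def', ← h2.tsum_eq]
    simp only [mul_assoc (c _), intervalIntegral.integral_const_mul]
    have e : ∀ k, 1 / ((b : ℂ) - a) * (c k * ∫ x in a..b, basisFun a b k x * basisFun a b (-l) x)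
        = if k = l then c l else 0 := fun k => by
      rw [mul_left_comm, ← fcoef_def', fcoef_basisFun hab]
      split_ifs with hk
      · rw [hk, mul_one]
      · rw [mul_zero]
    simp only [e, tsum_ite_eq]
  · intro k
    exact ((continuous_const.mul (continuous_basisFun a b k)).mul
      (continuous_basisFun a b (-l))).aestronglyMeasurable
  · intro k
    refine ae_of_all _ fun x _ => ?_
    simp [norm_basisFun]
  · exact ae_of_all _ fun x _ => hc
  · exact intervalIntegrable_const
  · exact ae_of_all _ fun x _ => (hs x).hasSum.mul_right _

/-- The second derivative of a periodic function, by its Fourier series. -/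
noncomputable def lap (a b : ℝ) (u : ℝ → ℂ) (x : ℝ) : ℂ :=
  ∑' l, -(freq a b l : ℂ) ^ 2 * fcoef a b u l * basisFun a b l x

lemma PerBound.norm_le {a b : ℝ} (hab : a < b) {s : ℕ} (hs : 1 ≤ s) {u : ℝ → ℂ} {K : ℝ}
    (h : PerBound a b s u K) {x : ℝ} (hx : x ∈ Icc a b) : ‖u x‖ ≤ Real.sqrt (wtSum a b) * K := by
  have h1 := HsBound.summable hab (s := 0) h.nonneg (h.hsBound.of_le (by omega))
  simp only [pow_zero, one_mul] at h1
  rw [← (hasSum_fourier_series hab h.continuousOn h.periodic h1.1 hx).tsum_eq]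
  refine (tsum_of_norm_bounded h1.1.hasSum fun l => ?_).trans h1.2
  simp [norm_basisFun]

/-! ### The second space derivative as a convergent Fourier series. -/

section lap
variable {a b : ℝ} {u : ℝ → ℂ} {K : ℝ}

/-- Two derivatives for the symbol and one more to pass from ℓ² to ℓ¹: this is the origin of the
index 3. -/
lemma PerBound.lap_bound (hab : a < b) (h : PerBound a b 3 u K) :
    (Summable fun l => ‖-(freq a b l : ℂ) ^ 2 * fcoef a b u l‖) ∧
      ∑' l, ‖-(freq a b l : ℂ) ^ 2 * fcoef a b u l‖ ≤ Real.sqrt (wtSum a b) * K := by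
  have h1 := HsBound.summable hab (s := 2) h.nonneg h.hsBound
  have hle : ∀ l, ‖-(freq a b l : ℂ) ^ 2 * fcoef a b u l‖ ≤ wt a b l ^ 2 * ‖fcoef a b u l‖ :=
    fun l => by
      rw [norm_mul, norm_neg, norm_pow, Complex.norm_real, Real.norm_eq_abs, sq_abs]
      exact mul_le_mul_of_nonneg_right (freq_sq_le_wt_sq a b l) (norm_nonneg _)
  have hs := Summable.of_nonneg_of_le (fun l => norm_nonneg _) hle h1.1
  exact ⟨hs, (hs.tsum_le_tsum hle h1.1).trans h1.2⟩

lemma PerBound.continuous_lap (hab : a < b) (h : PerBound a b 3 u K) : Continuous (lap a b u) := by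
  unfold lap
  refine continuous_tsum (fun l => continuous_const.mul (continuous_basisFun a b l))
    (h.lap_bound hab).1 fun l x => ?_
  rw [norm_mul _ (basisFun a b l x), norm_basisFun, mul_one]

lemma PerBound.norm_lap_le (hab : a < b) (h : PerBound a b 3 u K) (x : ℝ) :
    ‖lap a b u x‖ ≤ Real.sqrt (wtSum a b) * K := by
  unfold lap
  refine (tsum_of_norm_bounded (h.lap_bound hab).1.hasSum fun l => ?_).trans (h.lap_bound hab).2
  rw [norm_mul _ (basisFun a b l x), norm_basisFun, mul_one]

lemma PerBound.fcoef_lap (hab : a < b) (h : PerBound a b 3 u K) (l : ℤ) :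
    fcoef a b (lap a b u) l = -(freq a b l : ℂ) ^ 2 * fcoef a b u l :=
  fcoef_tsum hab (h.lap_bound hab).1 l

/-- The series for `u` represents it only on the closed interval, so its classical derivative is
meaningful only inside. `lap` is the continuous and bounded extension that dominated convergence
needs. -/
lemma PerBound.iteratedDeriv_two (hab : a < b) (h : PerBound a b 3 u K) {x : ℝ} (hx : x ∈ Ioo a b) :
    iteratedDeriv 2 u x = lap a b u x := by
  have hs0 := h.hsBound.summable_norm hab (by norm_num) h.nonneg
  have hs1 := (HsBound.summable hab (s := 1) h.nonneg (h.hsBound.of_le (by norm_num))).1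
  set U : ℝ → ℂ := fun x => ∑' l, fcoef a b u l * basisFun a b l x
  set U' : ℝ → ℂ := fun x => ∑' l, fcoef a b u l * (Complex.I * freq a b l * basisFun a b l x)
  have hU : ∀ y ∈ Icc a b, u y = U y := fun y hy =>
    (hasSum_fourier_series hab h.continuousOn h.periodic hs0 hy).tsum_eq.symm
  have hb1 : ∀ l y, ‖fcoef a b u l * (Complex.I * freq a b l * basisFun a b l y)‖
      ≤ wt a b l ^ 1 * ‖fcoef a b u l‖ := fun l y => by
    rw [norm_mul, norm_mul, norm_mul, norm_basisFun, Complex.norm_I, Complex.norm_real, one_mul,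
      mul_one, pow_one, mul_comm]
    gcongr
    exact abs_freq_le_wt a b l
  have hS0 : Summable fun l => fcoef a b u l * basisFun a b l a :=
    Summable.of_norm (by simpa [norm_basisFun] using hs0)
  have hd0 : ∀ l y, HasDerivAt (fun y => fcoef a b u l * basisFun a b l y)
      (fcoef a b u l * (Complex.I * freq a b l * basisFun a b l y)) y := fun l y =>
    (hasDerivAt_basisFun a b l y).const_mul (fcoef a b u l)
  have hd1 : ∀ y, HasDerivAt U (U' y) y := fun y => hasDerivAt_tsum hs1 hd0 hb1 hS0 y
  have hd0' : ∀ l y, HasDerivAt (fun y => fcoef a b u l * (Complex.I * freq a b l * basisFun a b l y))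
      (-(freq a b l : ℂ) ^ 2 * fcoef a b u l * basisFun a b l y) y := fun l y => by
    have := ((hasDerivAt_basisFun a b l y).const_mul (Complex.I * freq a b l)).const_mul
      (fcoef a b u l)
    refine this.congr_deriv ?_
    linear_combination ((freq a b l : ℂ) ^ 2 * fcoef a b u l * basisFun a b l y) * Complex.I_sq
  have hb2 : ∀ l y, ‖-(freq a b l : ℂ) ^ 2 * fcoef a b u l * basisFun a b l y‖
      ≤ ‖-(freq a b l : ℂ) ^ 2 * fcoef a b u l‖ := fun l y => by
    rw [norm_mul _ (basisFun a b l y), norm_basisFun, mul_one]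
  have hS1 : Summable fun l => fcoef a b u l * (Complex.I * freq a b l * basisFun a b l a) :=
    Summable.of_norm_bounded hs1 fun l => hb1 l a
  have hd2 : ∀ y, HasDerivAt U' (lap a b u y) y := fun y =>
    hasDerivAt_tsum (h.lap_bound hab).1 hd0' hb2 hS1 y
  have he : u =ᶠ[𝓝 x] U := by
    filter_upwards [Ioo_mem_nhds hx.1 hx.2] with y hy using hU y (Ioo_subset_Icc_self hy)
  rw [he.iteratedDeriv_eq, iteratedDeriv_succ, iteratedDeriv_one,
    show deriv U = U' from funext fun y => (hd1 y).deriv]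
  exact (hd2 x).deriv

end lap

/-- Differentiation of a Fourier coefficient with respect to a parameter. -/
lemma hasDerivAt_fcoef {a b T : ℝ} (hab : a < b) {u f : ℝ → ℝ → ℂ} {M : ℝ}
    (hu : ∀ t ∈ Ioo 0 T, ContinuousOn (u t) (Icc a b))
    (hf : ∀ t ∈ Ioo 0 T, ContinuousOn (f t) (Icc a b))
    (hM : ∀ t ∈ Ioo 0 T, ∀ x ∈ Icc a b, ‖f t x‖ ≤ M)
    (hd : ∀ t ∈ Ioo 0 T, ∀ x ∈ Ioo a b, HasDerivAt (fun s => u s x) (f t x) t)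
    {t : ℝ} (ht : t ∈ Ioo 0 T) (l : ℤ) :
    HasDerivAt (fun s => fcoef a b (u s) l) (fcoef a b (f t) l) t := by
  have hnb : Ioo 0 T ∈ 𝓝 t := Ioo_mem_nhds ht.1 ht.2
  have hxb : ∀ᵐ x ∂(volume : Measure ℝ), x ≠ b := by simp [ae_iff, measure_singleton]
  have hint : ∀ {g : ℝ → ℂ}, ContinuousOn g (Icc a b) →
      IntervalIntegrable (fun x => g x * basisFun a b (-l) x) volume a b := fun hg =>
    intervalIntegrable_mul_basisFun (intervalIntegrable_of_continuousOn hab hg) _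
  have h := intervalIntegral.hasDerivAt_integral_of_dominated_loc_of_deriv_le (μ := volume)
    (a := a) (b := b) (bound := fun _ => M) (F := fun s x => u s x * basisFun a b (-l) x)
    (F' := fun s x => f s x * basisFun a b (-l) x) (x₀ := t) (s := Ioo 0 T) hnb ?_
    (hint (hu t ht)) (intervalIntegrable_iff.1 (hint (hf t ht))).aestronglyMeasurable ?_
    intervalIntegrable_const ?_
  · simp only [fcoef_def']
    exact h.2.const_mul _
  · filter_upwards [hnb] with s hs
    exact (intervalIntegrable_iff.1 (hint (hu s hs))).aestronglyMeasurable
  · refine ae_of_all _ fun x hx s hs => ?_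
    rw [uIoc_of_le hab.le] at hx
    rw [norm_mul, norm_basisFun, mul_one]
    exact hM s hs x (Ioc_subset_Icc_self hx)
  · filter_upwards [hxb] with x hxb hx s hs
    rw [uIoc_of_le hab.le] at hx
    exact (hd s hs x ⟨hx.1, lt_of_le_of_ne hx.2 hxb⟩).mul_const _

lemma iteratedDeriv_two_ofReal {a b : ℝ} {f : ℝ → ℝ} (hf : ContDiffOn ℝ 2 f (Ioo a b)) {x : ℝ}
    (hx : x ∈ Ioo a b) : iteratedDeriv 2 (fun x => (f x : ℂ)) x = (iteratedDeriv 2 f x : ℝ) := by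
  have h1 : ∀ y ∈ Ioo a b, HasDerivAt f (deriv f y) y := fun y hy =>
    ((hf.differentiableOn (by norm_num)).differentiableAt (Ioo_mem_nhds hy.1 hy.2)).hasDerivAt
  have h2 : HasDerivAt (deriv f) (deriv (deriv f) x) x := by
    have : ContDiffOn ℝ 1 (deriv f) (Ioo a b) :=
      ((contDiffOn_succ_iff_deriv_of_isOpen (n := 1) isOpen_Ioo).1 (by simpa [one_add_one_eq_two] using hf)).2.2
    exact ((this.differentiableOn (by norm_num)).differentiableAt (Ioo_mem_nhds hx.1 hx.2)).hasDerivAt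
  have he : deriv (fun x => (f x : ℂ)) =ᶠ[𝓝 x] fun y => ((deriv f y : ℝ) : ℂ) := by
    filter_upwards [Ioo_mem_nhds hx.1 hx.2] with y hy using (h1 y hy).ofReal_comp.deriv
  rw [iteratedDeriv_succ, iteratedDeriv_one, he.deriv_eq, h2.ofReal_comp.deriv, iteratedDeriv_succ,
    iteratedDeriv_one]

/-- The evolution of the Fourier coefficients of a solution. -/
structure CoefSystem (a b T ε : ℝ) (ps ph pi Fp Fd : ℝ → ℤ → ℂ) : Prop where
  cont_ps : ∀ l, ContinuousOn (fun t => ps t l) (Icc 0 T)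
  cont_ph : ∀ l, ContinuousOn (fun t => ph t l) (Icc 0 T)
  cont_pi : ∀ l, ContinuousOn (fun t => pi t l) (Icc 0 T)
  deriv_ps : ∀ l, ∀ t ∈ Ioo 0 T, HasDerivAt (fun t => ps t l)
    (Complex.I * (-(freq a b l : ℂ) ^ 2 * ps t l + Fp t l)) t
  deriv_ph : ∀ l, ∀ t ∈ Ioo 0 T, HasDerivAt (fun t => ph t l) (pi t l) t
  deriv_pi : ∀ l, ∀ t ∈ Ioo 0 T, HasDerivAt (fun t => pi t l)
    (1 / (ε : ℂ) ^ 2 * (-((freq a b l : ℂ) ^ 2 + 1 / (ε : ℂ) ^ 2) * ph t l + Fd t l)) t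

/-- The derivative of the coefficients of φ is part of the C¹ hypothesis. For ψ and ∂ₜφ the
pointwise equation supplies the time derivative; it is bounded uniformly in space and time by the H³
bounds, so one may differentiate under the integral. -/
lemma IsSolution.coefSystem {a b T ε : ℝ} (hab : a < b) (hε : 0 < ε) {ψ₀ : ℝ → ℂ} {φ₀ φ₁ : ℝ → ℝ}
    {ψ : ℝ → ℝ → ℂ} {φ : ℝ → ℝ → ℝ} (h : IsSolution a b T ε ψ₀ φ₀ φ₁ ψ φ) {m : ℕ} (hm : 3 ≤ m)
    (hψ : MemCHper a b T m ψ) (hφ : MemC1Hper a b T m (fun t x => (φ t x : ℂ))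
      (fun t x => (timeDeriv T φ t x : ℂ))) {K : ℝ}
    (bψ : ∀ t ∈ Icc 0 T, PerBound a b m (ψ t) K)
    (bφ : ∀ t ∈ Icc 0 T, PerBound a b m (fun x => (φ t x : ℂ)) K) :
    CoefSystem a b T ε (fun t => fcoef a b (ψ t)) (fun t => fcoef a b (fun x => (φ t x : ℂ)))
      (fun t => fcoef a b (fun x => (timeDeriv T φ t x : ℂ)))
      (fun t => fcoef a b (fun x => (φ t x : ℂ) * ψ t x))
      (fun t => fcoef a b (fun x => ψ t x * starRingEnd ℂ (ψ t x))) := by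
  have hm1 : 1 ≤ m := by omega
  have of3 : ∀ {u : ℝ → ℂ}, PerBound a b m u K → PerBound a b 3 u K := fun hu =>
    ⟨hu.nonneg, hu.continuousOn, hu.periodic, hu.hsBound.of_le hm⟩
  set B := Real.sqrt (wtSum a b) * K
  refine ⟨fun l => hψ.continuousOn_fcoef hab hm1 l, fun l => hφ.mem.continuousOn_fcoef hab hm1 l,
    fun l => hφ.mem_deriv.continuousOn_fcoef hab hm1 l, ?_, ?_, ?_⟩
  · intro l t ht
    have hI : ∀ {t}, t ∈ Ioo 0 T → t ∈ Icc 0 T := fun h => Ioo_subset_Icc_self h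
    have key := hasDerivAt_fcoef hab (T := T) (u := ψ)
      (f := fun t x => Complex.I * (lap a b (ψ t) x + (φ t x : ℂ) * ψ t x)) (M := B + B * B)
      (fun t ht => (bψ t (hI ht)).continuousOn)
      (fun t ht => continuousOn_const.mul (((of3 (bψ t (hI ht))).continuous_lap hab).continuousOn.add
        ((bφ t (hI ht)).continuousOn.mul (bψ t (hI ht)).continuousOn)))
      (fun t ht x hx => by
        rw [norm_mul, Complex.norm_I, one_mul]
        refine (norm_add_le _ _).trans ?_
        rw [norm_mul]
        have h1 := (of3 (bψ t (hI ht))).norm_lap_le hab x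
        have h2 := (bφ t (hI ht)).norm_le hab hm1 hx
        have h3 := (bψ t (hI ht)).norm_le hab hm1 hx
        have := mul_le_mul h2 h3 (norm_nonneg _) ((norm_nonneg _).trans h2)
        linarith)
      (fun t ht x hx => by
        have h1 := (h.diff_t_ψ t ht x hx).hasDerivAt
        have h2 := h.schrodinger t ht x hx
        rw [(of3 (bψ t (hI ht))).iteratedDeriv_two hab hx] at h2
        refine h1.congr_deriv ?_
        generalize deriv (fun s => ψ s x) t = D at h2 ⊢
        linear_combination (-Complex.I) * h2 + D * Complex.I_sq)
      ht l
    have i2 : IntervalIntegrable (fun x => (φ t x : ℂ) * ψ t x) volume a b :=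
      intervalIntegrable_of_continuousOn hab ((bφ t (hI ht)).continuousOn.mul (bψ t (hI ht)).continuousOn)
    refine key.congr_deriv ?_
    rw [fcoef_const_mul, fcoef_add (((of3 (bψ t (hI ht))).continuous_lap hab).intervalIntegrable _ _) i2,
      (of3 (bψ t (hI ht))).fcoef_lap hab]
  · intro l t ht
    exact (hφ.hasDerivWithinAt_fcoef hab hm1 l (Ioo_subset_Icc_self ht)).hasDerivAt
      (Icc_mem_nhds ht.1 ht.2)
  · intro l t ht
    have hI : ∀ {t}, t ∈ Ioo 0 T → t ∈ Icc 0 T := fun h => Ioo_subset_Icc_self h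
    have cψ : ∀ t ∈ Ioo 0 T, ContinuousOn (fun x => ψ t x * starRingEnd ℂ (ψ t x)) (Icc a b) :=
      fun t ht => (bψ t (hI ht)).continuousOn.mul (bψ t (hI ht)).conj.continuousOn
    have hε2 : (ε : ℂ) ^ 2 ≠ 0 := by
      have : (ε : ℂ) ≠ 0 := by exact_mod_cast hε.ne'
      positivity
    have key := hasDerivAt_fcoef hab (T := T) (u := fun t x => (timeDeriv T φ t x : ℂ))
      (f := fun t x => 1 / (ε : ℂ) ^ 2 * ((lap a b (fun x => (φ t x : ℂ)) x
        + -(1 / (ε : ℂ) ^ 2) * (φ t x : ℂ)) + ψ t x * starRingEnd ℂ (ψ t x)))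
      (M := 1 / ε ^ 2 * ((B + 1 / ε ^ 2 * B) + B * B))
      (fun t ht => (hφ.mem_deriv.mem t (hI ht)).continuousOn hm1)
      (fun t ht => continuousOn_const.mul ((((of3 (bφ t (hI ht))).continuous_lap hab).continuousOn.add
        (continuousOn_const.mul (bφ t (hI ht)).continuousOn)).add (cψ t ht)))
      (fun t ht x hx => by
        have h1 := (of3 (bφ t (hI ht))).norm_lap_le hab x
        have h2 := (bφ t (hI ht)).norm_le hab hm1 hx
        have h3 := (bψ t (hI ht)).norm_le hab hm1 hx
        have n1 : ‖(1 : ℂ) / (ε : ℂ) ^ 2‖ = 1 / ε ^ 2 := by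
          rw [norm_div, norm_one, norm_pow, Complex.norm_real, Real.norm_of_nonneg hε.le]
        rw [norm_mul, n1]
        gcongr
        refine (norm_add_le _ _).trans (add_le_add ((norm_add_le _ _).trans (add_le_add h1 ?_)) ?_)
        · rw [norm_mul, norm_neg, n1]; gcongr
        · rw [norm_mul, RCLike.norm_conj]
          exact mul_le_mul h3 h3 (norm_nonneg _) ((norm_nonneg _).trans h3))
      (fun t ht x hx => by
        have h1 := (h.diff_tt_φ t ht x hx).hasDerivAt.ofReal_comp
        have h2 := h.klein_gordon t ht x hx
        have h3 := (of3 (bφ t (hI ht))).iteratedDeriv_two hab hx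
        rw [iteratedDeriv_two_ofReal (h.smooth_x_φ t (hI ht)) hx] at h3
        rw [← h3, Complex.mul_conj, Complex.normSq_eq_norm_sq]
        have h4 := congrArg (fun r : ℝ => (r : ℂ)) h2
        push_cast at h4
        refine h1.congr_deriv ?_
        generalize ((deriv (fun s => timeDeriv T φ s x) t : ℝ) : ℂ) = D at h4 ⊢
        have hinv : 1 / (ε : ℂ) ^ 2 * (ε : ℂ) ^ 2 = 1 := div_mul_cancel₀ 1 hε2
        push_cast
        linear_combination (1 / (ε : ℂ) ^ 2) * h4 - D * hinv)
      ht l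
    refine key.congr_deriv ?_
    have i1 := ((of3 (bφ t (hI ht))).continuous_lap hab).intervalIntegrable (μ := volume) a b
    have i2 : IntervalIntegrable (fun x => -(1 / (ε : ℂ) ^ 2) * (φ t x : ℂ)) volume a b :=
      intervalIntegrable_of_continuousOn hab (continuousOn_const (c := -(1 / (ε : ℂ) ^ 2)).mul (bφ t (hI ht)).continuousOn)
    rw [fcoef_const_mul, fcoef_add (i1.add i2) (intervalIntegrable_of_continuousOn hab (cψ t ht)),
      fcoef_add i1 i2, fcoef_const_mul, (of3 (bφ t (hI ht))).fcoef_lap hab]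
    ring

end KGS

namespace KGS

/-! ### Additional regularity of the initial value of the Klein-Gordon field -/

/-- An observability identity: if `φ` and `∂ₜφ` are bounded in `H^m` on `[0, T]`, then `φ(0)` is in
`H^{m+1}`. -/
lemma CoefSystem.hsBound_succ {a b T : ℝ} (hT : 0 < T) {ps ph pi Fp Fd : ℝ → ℤ → ℂ}
    (h : CoefSystem a b T 1 ps ph pi Fp Fd) {m : ℕ} {K : ℝ}
    (h1 : ∀ t ∈ Icc 0 T, HsBound a b m (ph t) K) (h2 : ∀ t ∈ Icc 0 T, HsBound a b m (pi t) K)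
    (h3 : ∀ t ∈ Icc 0 T, HsBound a b m (Fd t) K) :
    HsBound a b (m + 1) (ph 0) (Real.sqrt ((2 * K ^ 2 + (4 * K ^ 2 + 2 * T * K ^ 2) * T) / T)) := by
  intro S
  rw [Real.sq_sqrt (by positivity), le_div_iff₀ hT]
  -- The multiplier T - t produces the energy at time 0 and removes it at time T. The correction by
  -- the inner product cancels the term w²|φ|² in the derivative, leaving only quantities without
  -- the additional weight.
  set g : ℤ → ℝ → ℝ := fun l t => (T - t) * (‖pi t l‖ ^ 2 + wt a b l ^ 2 * ‖ph t l‖ ^ 2)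
    - inner ℝ (pi t l) (ph t l)
  set g' : ℤ → ℝ → ℝ := fun l t => -2 * ‖pi t l‖ ^ 2 + 2 * (T - t) * inner ℝ (pi t l) (Fd t l)
    - inner ℝ (Fd t l) (ph t l)
  have hg : ∀ l, ∀ t ∈ Ioo 0 T, HasDerivAt (g l) (g' l t) t := by
    intro l t ht
    have d1 := h.deriv_ph l t ht
    have d2 : HasDerivAt (fun t => pi t l) ((-(wt a b l ^ 2)) • ph t l + Fd t l) t := by
      refine (h.deriv_pi l t ht).congr_deriv ?_
      rw [wt_sq, Complex.real_smul]; push_cast; ring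
    have d3 := (((hasDerivAt_id t).const_sub T).mul (d2.norm_sq.add (d1.norm_sq.const_mul
      (wt a b l ^ 2)))).sub (d2.inner ℝ d1)
    refine d3.congr_deriv ?_
    simp only [g', inner_add_right, inner_add_left, inner_smul_right, inner_smul_left,
      real_inner_self_eq_norm_sq, id, Pi.add_apply]
    rw [real_inner_comm (pi t l) (ph t l)]
    simp only [conj_trivial]
    ring
  have hgc : ∀ l, ContinuousOn (g l) (Icc 0 T) := fun l =>
    ((continuousOn_const.sub continuousOn_id).mul (((h.cont_pi l).norm.pow 2).add
      (continuousOn_const.mul ((h.cont_ph l).norm.pow 2)))).sub ((h.cont_pi l).inner (h.cont_ph l))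
  set G : ℝ → ℝ := fun t => ∑ l ∈ S, (wt a b l ^ m) ^ 2 * g l t
  -- The mean value theorem for a finite sum of modes takes the place of a time integral: a bound of
  -- the derivative at one unknown time is enough.
  obtain ⟨c, hc, hc'⟩ := exists_hasDerivAt_eq_slope G (fun t => ∑ l ∈ S, (wt a b l ^ m) ^ 2 * g' l t) hT
    (continuousOn_finsetSum _ fun l _ => continuousOn_const.mul (hgc l))
    (fun t ht => HasDerivAt.fun_sum fun l _ => (hg l t ht).const_mul _)
  have hinner : ∀ (z w : ℂ), |inner ℝ z w| ≤ (‖z‖ ^ 2 + ‖w‖ ^ 2) / 2 := fun z w => by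
    have := abs_real_inner_le_norm z w
    nlinarith [sq_nonneg (‖z‖ - ‖w‖)]
  have e : ∀ (c : ℝ → ℤ → ℂ) (t : ℝ), ∑ l ∈ S, (wt a b l ^ m * ‖c t l‖) ^ 2
      = ∑ l ∈ S, (wt a b l ^ m) ^ 2 * ‖c t l‖ ^ 2 := fun c t => by simp only [mul_pow]
  have b1 : ∀ t ∈ Icc 0 T, ∑ l ∈ S, (wt a b l ^ m) ^ 2 * ‖ph t l‖ ^ 2 ≤ K ^ 2 := fun t ht => by
    rw [← e]; exact h1 t ht S
  have b2 : ∀ t ∈ Icc 0 T, ∑ l ∈ S, (wt a b l ^ m) ^ 2 * ‖pi t l‖ ^ 2 ≤ K ^ 2 := fun t ht => by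
    rw [← e]; exact h2 t ht S
  have b3 : ∀ t ∈ Icc 0 T, ∑ l ∈ S, (wt a b l ^ m) ^ 2 * ‖Fd t l‖ ^ 2 ≤ K ^ 2 := fun t ht => by
    rw [← e]; exact h3 t ht S
  have binner : ∀ t ∈ Icc 0 T,
      ∑ l ∈ S, (wt a b l ^ m) ^ 2 * |inner ℝ (pi t l) (ph t l)| ≤ K ^ 2 := fun t ht => by
    calc _ ≤ ∑ l ∈ S, (1 / 2 * ((wt a b l ^ m) ^ 2 * ‖pi t l‖ ^ 2)
          + 1 / 2 * ((wt a b l ^ m) ^ 2 * ‖ph t l‖ ^ 2)) := by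
          refine Finset.sum_le_sum fun l _ => ?_
          have := mul_le_mul_of_nonneg_left (hinner (pi t l) (ph t l)) (sq_nonneg (wt a b l ^ m))
          linarith
      _ ≤ _ := by
          rw [Finset.sum_add_distrib, ← Finset.mul_sum, ← Finset.mul_sum]
          linarith [b1 t ht, b2 t ht]
  have hcI := Ioo_subset_Icc_self hc
  have bG' : -(∑ l ∈ S, (wt a b l ^ m) ^ 2 * g' l c) ≤ 4 * K ^ 2 + 2 * T * K ^ 2 := by
    rw [← Finset.sum_neg_distrib]
    calc _ ≤ ∑ l ∈ S, ((5 / 2 + T) * ((wt a b l ^ m) ^ 2 * ‖pi c l‖ ^ 2)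
          + (1 / 2 + T) * ((wt a b l ^ m) ^ 2 * ‖Fd c l‖ ^ 2)
          + 1 / 2 * ((wt a b l ^ m) ^ 2 * ‖ph c l‖ ^ 2)) := by
          refine Finset.sum_le_sum fun l _ => ?_
          have i1 := neg_abs_le (inner ℝ (pi c l) (Fd c l))
          have i2 := le_abs_self (inner ℝ (Fd c l) (ph c l))
          have i3 := hinner (pi c l) (Fd c l)
          have i4 := hinner (Fd c l) (ph c l)
          have hTc : 0 ≤ T - c := by linarith [hc.2]
          have hTc' : T - c ≤ T := by linarith [hc.1]
          have n1 := sq_nonneg ‖pi c l‖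
          have n2 := sq_nonneg ‖Fd c l‖
          have : -(g' l c) ≤ (5 / 2 + T) * ‖pi c l‖ ^ 2 + (1 / 2 + T) * ‖Fd c l‖ ^ 2
              + 1 / 2 * ‖ph c l‖ ^ 2 := by
            have i5 : -(2 * (T - c) * inner ℝ (pi c l) (Fd c l))
                ≤ T * (‖pi c l‖ ^ 2 + ‖Fd c l‖ ^ 2) := by
              calc _ = (2 * (T - c)) * (-inner ℝ (pi c l) (Fd c l)) := by ring
                _ ≤ (2 * (T - c)) * ((‖pi c l‖ ^ 2 + ‖Fd c l‖ ^ 2) / 2) := by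
                  apply mul_le_mul_of_nonneg_left _ (by positivity); linarith
                _ ≤ (2 * T) * ((‖pi c l‖ ^ 2 + ‖Fd c l‖ ^ 2) / 2) := by gcongr
                _ = _ := by ring
            simp only [g']
            linarith
          have := mul_le_mul_of_nonneg_left this (sq_nonneg (wt a b l ^ m))
          linarith
      _ ≤ (5 / 2 + T) * K ^ 2 + (1 / 2 + T) * K ^ 2 + 1 / 2 * K ^ 2 := by
          rw [Finset.sum_add_distrib, Finset.sum_add_distrib, ← Finset.mul_sum, ← Finset.mul_sum,
            ← Finset.mul_sum]
          gcongr
          · exact b2 c hcI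
          · exact b3 c hcI
          · exact b1 c hcI
      _ ≤ _ := by nlinarith [sq_nonneg K]
  have hT0 : (0 : ℝ) ∈ Icc 0 T := left_mem_Icc.2 hT.le
  have hTT : T ∈ Icc 0 T := right_mem_Icc.2 hT.le
  have hslope : G 0 = G T - T * ∑ l ∈ S, (wt a b l ^ m) ^ 2 * g' l c := by
    rw [hc', sub_zero]; field_simp; ring
  have hG0 : (∑ l ∈ S, (wt a b l ^ (m + 1) * ‖ph 0 l‖) ^ 2) * T - K ^ 2 ≤ G 0 := by
    have : (∑ l ∈ S, (wt a b l ^ (m + 1) * ‖ph 0 l‖) ^ 2) * T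
        - ∑ l ∈ S, (wt a b l ^ m) ^ 2 * |inner ℝ (pi 0 l) (ph 0 l)| ≤ G 0 := by
      rw [Finset.sum_mul, ← Finset.sum_sub_distrib]
      refine Finset.sum_le_sum fun l _ => ?_
      have i1 := mul_le_mul_of_nonneg_left (le_abs_self (inner ℝ (pi 0 l) (ph 0 l)))
        (sq_nonneg (wt a b l ^ m))
      have i2 : 0 ≤ (wt a b l ^ m) ^ 2 * (T * ‖pi 0 l‖ ^ 2) := by positivity
      simp only [g]
      have i3 : (wt a b l ^ (m + 1) * ‖ph 0 l‖) ^ 2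
        = (wt a b l ^ m) ^ 2 * (wt a b l ^ 2 * ‖ph 0 l‖ ^ 2) := by ring
      rw [i3]
      linarith
    linarith [binner 0 hT0]
  have hGT : G T ≤ K ^ 2 := by
    refine le_trans (Finset.sum_le_sum fun l _ => ?_) (binner T hTT)
    have i1 := mul_le_mul_of_nonneg_left (neg_abs_le (inner ℝ (pi T l) (ph T l)))
        (sq_nonneg (wt a b l ^ m))
    simp only [g, sub_self, zero_mul, zero_sub]
    linarith
  nlinarith [mul_le_mul_of_nonneg_left bG' hT.le]

end KGS

namespace KGS

/-! ### The coefficients of the integrator -/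

section coefficients
variable {ε : ℝ} (μ : ℝ)

lemma eps_sq_mul_omega (hε : 0 < ε) : ε ^ 2 * omega ε μ = Real.sqrt (1 + ε ^ 2 * μ ^ 2) := by
  unfold omega; field_simp

lemma one_le_eps_sq_mul_omega (hε : 0 < ε) : 1 ≤ ε ^ 2 * omega ε μ := by
  rw [eps_sq_mul_omega μ hε]
  exact Real.one_le_sqrt.2 (by nlinarith [sq_nonneg (ε * μ)])

lemma omega_pos (hε : 0 < ε) : 0 < omega ε μ := by
  have := one_le_eps_sq_mul_omega μ hε
  by_contra h
  nlinarith [sq_nonneg ε]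

lemma omega_sq (hε : 0 < ε) : omega ε μ ^ 2 = 1 / ε ^ 2 * (μ ^ 2 + 1 / ε ^ 2) := by
  unfold omega
  rw [mul_pow, Real.sq_sqrt (by positivity)]
  field_simp; ring

/-- The source of the gain ε² for the Klein-Gordon part: integrating by parts against e^{iωs}
divides by ω. -/
lemma inv_omega_le (hε : 0 < ε) : (omega ε μ)⁻¹ ≤ ε ^ 2 := by
  rw [inv_le_iff_one_le_mul₀ (omega_pos μ hε)]
  exact one_le_eps_sq_mul_omega μ hε

lemma hasDerivAt_omega_sub (κ τ θ : ℝ) : HasDerivAt (fun θ => κ * (τ - θ)) (-κ) θ := by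
  simpa using ((hasDerivAt_id θ).const_sub τ).const_mul κ

lemma coefP_eq (hε : 0 < ε) (τ : ℝ) :
    coefP ε μ τ = (1 - Real.cos (omega ε μ * τ)) / (ε ^ 2 * omega ε μ ^ 2) := by
  have hω := omega_pos μ hε
  unfold coefP
  rw [intervalIntegral.integral_eq_sub_of_hasDerivAt
    (f := fun θ => Real.cos (omega ε μ * (τ - θ)) / (ε ^ 2 * omega ε μ ^ 2))]
  · simp [sub_div]
  · intro θ _
    refine ((hasDerivAt_omega_sub _ τ θ).cos.div_const _).congr_deriv ?_
    field_simp
  · exact Continuous.intervalIntegrable (by fun_prop) _ _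

lemma coefP'_eq (hε : 0 < ε) (τ : ℝ) :
    coefP' ε μ τ = Real.sin (omega ε μ * τ) / (ε ^ 2 * omega ε μ) := by
  have hω := omega_pos μ hε
  unfold coefP'
  rw [intervalIntegral.integral_eq_sub_of_hasDerivAt
    (f := fun θ => -Real.sin (omega ε μ * (τ - θ)) / (ε ^ 2 * omega ε μ))]
  · simp [neg_div]
  · intro θ _
    refine ((hasDerivAt_omega_sub _ τ θ).sin.neg.div_const _).congr_deriv ?_
    field_simp
  · exact Continuous.intervalIntegrable (by fun_prop) _ _

lemma coefQ_eq (hε : 0 < ε) (τ : ℝ) :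
    coefQ ε μ τ = (τ - Real.sin (omega ε μ * τ) / omega ε μ) / (ε ^ 2 * omega ε μ ^ 2) := by
  have hω := omega_pos μ hε
  unfold coefQ
  rw [intervalIntegral.integral_eq_sub_of_hasDerivAt
    (f := fun θ => θ * Real.cos (omega ε μ * (τ - θ)) / (ε ^ 2 * omega ε μ ^ 2)
      + Real.sin (omega ε μ * (τ - θ)) / (ε ^ 2 * omega ε μ ^ 3))]
  · simp only [sub_self, mul_zero, Real.cos_zero, mul_one, Real.sin_zero, zero_div, add_zero,
      zero_mul, sub_zero, zero_add]
    field_simp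
  · intro θ _
    refine ((((hasDerivAt_id θ).mul (hasDerivAt_omega_sub _ τ θ).cos).div_const _).add
      ((hasDerivAt_omega_sub _ τ θ).sin.div_const _)).congr_deriv ?_
    simp only [id]
    field_simp
    ring
  · exact Continuous.intervalIntegrable (by fun_prop) _ _

lemma coefQ'_eq (hε : 0 < ε) (τ : ℝ) :
    coefQ' ε μ τ = (1 - Real.cos (omega ε μ * τ)) / (ε ^ 2 * omega ε μ ^ 2) := by
  have hω := omega_pos μ hε
  unfold coefQ'
  rw [intervalIntegral.integral_eq_sub_of_hasDerivAt
    (f := fun θ => -θ * Real.sin (omega ε μ * (τ - θ)) / (ε ^ 2 * omega ε μ)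
      + Real.cos (omega ε μ * (τ - θ)) / (ε ^ 2 * omega ε μ ^ 2))]
  · simp only [sub_self, mul_zero, Real.cos_zero, Real.sin_zero, zero_div,
      zero_mul, sub_zero, zero_add, neg_zero]
    field_simp
  · intro θ _
    refine ((((hasDerivAt_id θ).neg.mul (hasDerivAt_omega_sub _ τ θ).sin).div_const _).add
      ((hasDerivAt_omega_sub _ τ θ).cos.div_const _)).congr_deriv ?_
    simp only [id, Pi.neg_apply]
    field_simp
    ring
  · exact Continuous.intervalIntegrable (by fun_prop) _ _

lemma hasDerivAt_omega_mul (κ s : ℝ) : HasDerivAt (fun s => κ * s) κ s := by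
  simpa using (hasDerivAt_id s).const_mul κ

lemma hasDerivAt_coefP (hε : 0 < ε) (s : ℝ) : HasDerivAt (coefP ε μ) (coefP' ε μ s) s := by
  have hω := omega_pos μ hε
  rw [funext (coefP_eq μ hε), coefP'_eq μ hε]
  refine (((hasDerivAt_omega_mul _ s).cos.const_sub 1).div_const _).congr_deriv ?_
  field_simp

lemma hasDerivAt_coefP' (hε : 0 < ε) (s : ℝ) :
    HasDerivAt (coefP' ε μ) (-omega ε μ ^ 2 * coefP ε μ s + 1 / ε ^ 2) s := by
  have hω := omega_pos μ hε
  rw [funext (coefP'_eq μ hε), coefP_eq μ hε]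
  refine ((hasDerivAt_omega_mul _ s).sin.div_const _).congr_deriv ?_
  field_simp
  ring

lemma hasDerivAt_coefQ (hε : 0 < ε) (s : ℝ) : HasDerivAt (coefQ ε μ) (coefQ' ε μ s) s := by
  have hω := omega_pos μ hε
  rw [funext (coefQ_eq μ hε), coefQ'_eq μ hε]
  refine (((hasDerivAt_id s).sub ((hasDerivAt_omega_mul _ s).sin.div_const _)).div_const _).congr_deriv ?_
  field_simp

lemma hasDerivAt_coefQ' (hε : 0 < ε) (s : ℝ) :
    HasDerivAt (coefQ' ε μ) (-omega ε μ ^ 2 * coefQ ε μ s + s / ε ^ 2) s := by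
  have hω := omega_pos μ hε
  rw [funext (coefQ'_eq μ hε), coefQ_eq μ hε]
  refine (((hasDerivAt_omega_mul _ s).cos.const_sub 1).div_const _).congr_deriv ?_
  field_simp
  ring

lemma abs_integral_le {f : ℝ → ℝ} {τ M : ℝ} (hτ : 0 ≤ τ) (h : ∀ θ ∈ Icc 0 τ, |f θ| ≤ M) :
    |∫ θ in (0 : ℝ)..τ, f θ| ≤ M * τ := by
  have := intervalIntegral.norm_integral_le_of_norm_le_const (a := 0) (b := τ) (f := f) (C := M)
    fun x hx => by
      rw [uIoc_of_le hτ] at hx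
      exact h x (Ioc_subset_Icc_self hx)
  simpa [abs_of_nonneg hτ] using this

/-- The weight ε²ω here, and ε² for the primed coefficients, are those with which p, q, p', q' enter
the characteristic variables. Bounding the integrand pointwise keeps the estimates uniform in ε and
in the frequency. -/
lemma abs_coefP_le (hε : 0 < ε) {τ : ℝ} (hτ : 0 ≤ τ) : ε ^ 2 * omega ε μ * |coefP ε μ τ| ≤ τ := by
  have hω := omega_pos μ hε
  have : |coefP ε μ τ| ≤ 1 / (ε ^ 2 * omega ε μ) * τ := abs_integral_le hτ fun θ _ => by
    rw [abs_div, abs_of_pos (by positivity : 0 < ε ^ 2 * omega ε μ)]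
    gcongr
    exact Real.abs_sin_le_one _
  calc _ ≤ ε ^ 2 * omega ε μ * (1 / (ε ^ 2 * omega ε μ) * τ) := by gcongr
    _ = τ := by field_simp

lemma abs_coefQ_le (hε : 0 < ε) {τ : ℝ} (hτ : 0 ≤ τ) :
    ε ^ 2 * omega ε μ * |coefQ ε μ τ| ≤ τ ^ 2 := by
  have hω := omega_pos μ hε
  have : |coefQ ε μ τ| ≤ τ * (1 / (ε ^ 2 * omega ε μ)) * τ := abs_integral_le hτ fun θ hθ => by
    rw [abs_mul, abs_div, abs_of_pos (by positivity : 0 < ε ^ 2 * omega ε μ), abs_of_nonneg hθ.1]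
    gcongr
    · exact hθ.2
    · exact Real.abs_sin_le_one _
  calc _ ≤ ε ^ 2 * omega ε μ * (τ * (1 / (ε ^ 2 * omega ε μ)) * τ) := by gcongr
    _ = τ ^ 2 := by field_simp

lemma abs_coefP'_le (hε : 0 < ε) {τ : ℝ} (hτ : 0 ≤ τ) : ε ^ 2 * |coefP' ε μ τ| ≤ τ := by
  have : |coefP' ε μ τ| ≤ 1 / ε ^ 2 * τ := abs_integral_le hτ fun θ _ => by
    rw [abs_div, abs_of_pos (by positivity : 0 < ε ^ 2)]
    gcongr
    exact Real.abs_cos_le_one _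
  calc _ ≤ ε ^ 2 * (1 / ε ^ 2 * τ) := by gcongr
    _ = τ := by field_simp

lemma abs_coefQ'_le (hε : 0 < ε) {τ : ℝ} (hτ : 0 ≤ τ) : ε ^ 2 * |coefQ' ε μ τ| ≤ τ ^ 2 := by
  have : |coefQ' ε μ τ| ≤ τ * (1 / ε ^ 2) * τ := abs_integral_le hτ fun θ hθ => by
    rw [abs_mul, abs_div, abs_of_pos (by positivity : 0 < ε ^ 2), abs_of_nonneg hθ.1]
    gcongr
    · exact hθ.2
    · exact Real.abs_cos_le_one _
  calc _ ≤ ε ^ 2 * (τ * (1 / ε ^ 2) * τ) := by gcongr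
    _ = τ ^ 2 := by field_simp

lemma norm_exp_I_mul_ofReal_mul (x y : ℝ) : ‖Complex.exp (Complex.I * x * y)‖ = 1 := by
  rw [mul_assoc, ← Complex.ofReal_mul, Complex.norm_exp_I_mul_ofReal]

lemma phase_eq (σ ε μ : ℝ) (θ : ℝ) : Complex.I * ((μ : ℂ) ^ 2 + σ / ε ^ 2) * θ
    = Complex.I * ((μ ^ 2 + σ / ε ^ 2 : ℝ) : ℂ) * (θ : ℂ) := by push_cast; ring

lemma norm_exp_neg_freq_sq (μ τ : ℝ) :
    ‖Complex.exp (-(Complex.I * (μ : ℂ) ^ 2 * τ))‖ = 1 := by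
  have : -(Complex.I * (μ : ℂ) ^ 2 * τ) = Complex.I * ((-(μ ^ 2) : ℝ) : ℂ) * τ := by push_cast; ring
  rw [this, norm_exp_I_mul_ofReal_mul]

lemma norm_coefC_le (σ ε : ℝ) {τ : ℝ} (hτ : 0 ≤ τ) : ‖coefC σ ε μ τ‖ ≤ τ := by
  unfold coefC
  rw [norm_mul, norm_mul, Complex.norm_I, norm_exp_neg_freq_sq, one_mul, one_mul]
  have := intervalIntegral.norm_integral_le_of_norm_le_const (a := 0) (b := τ) (C := 1)
    (f := fun θ : ℝ => Complex.exp (Complex.I * ((μ : ℂ) ^ 2 + σ / ε ^ 2) * θ)) fun x _ => by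
      rw [phase_eq, norm_exp_I_mul_ofReal_mul]
  simpa [abs_of_nonneg hτ] using this

/-- The second power of τ pays for the factor 1/τ of the filtered rate in the stability estimate. -/
lemma norm_coefD_le (σ ε : ℝ) {τ : ℝ} (hτ : 0 ≤ τ) : ‖coefD σ ε μ τ‖ ≤ τ ^ 2 := by
  unfold coefD
  rw [norm_mul, norm_mul, Complex.norm_I, norm_exp_neg_freq_sq, one_mul, one_mul]
  have := intervalIntegral.norm_integral_le_of_norm_le_const (a := 0) (b := τ) (C := τ)
    (f := fun θ : ℝ => (θ : ℂ) * Complex.exp (Complex.I * ((μ : ℂ) ^ 2 + σ / ε ^ 2) * θ))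
    fun x hx => by
      rw [uIoc_of_le hτ] at hx
      rw [norm_mul, phase_eq, norm_exp_I_mul_ofReal_mul, mul_one, Complex.norm_real,
        Real.norm_eq_abs, abs_of_pos hx.1]
      exact hx.2
  simpa [abs_of_nonneg hτ, sq] using this

lemma hasDerivAt_exp_neg_freq_sq (μ s : ℝ) :
    HasDerivAt (fun s : ℝ => Complex.exp (-(Complex.I * (μ : ℂ) ^ 2 * s)))
      (-(Complex.I * (μ : ℂ) ^ 2) * Complex.exp (-(Complex.I * (μ : ℂ) ^ 2 * s))) s := by
  have h1 := ((Complex.ofRealCLM.hasDerivAt (x := s)).const_mul (Complex.I * (μ : ℂ) ^ 2)).neg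
  have h2 := h1.cexp
  simp only [Pi.neg_apply, Complex.ofRealCLM_apply, Complex.ofReal_one, mul_one] at h2
  exact h2.congr_deriv (mul_comm _ _)

lemma exp_neg_mul_exp (σ ε μ s : ℝ) : Complex.exp (-(Complex.I * (μ : ℂ) ^ 2 * s)) *
    Complex.exp (Complex.I * ((μ : ℂ) ^ 2 + σ / ε ^ 2) * s) = Complex.exp (Complex.I * (σ / ε ^ 2) * s) := by
  rw [← Complex.exp_add]; congr 1; ring

/-- As a function of the step length the coefficient solves a forced linear Schrödinger mode. This
is what turns the numerical step into a path that can be compared with the solution. -/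
lemma hasDerivAt_coefC (σ ε s : ℝ) : HasDerivAt (coefC σ ε μ)
    (-(Complex.I * (μ : ℂ) ^ 2) * coefC σ ε μ s
      + Complex.I * Complex.exp (Complex.I * (σ / ε ^ 2) * s)) s := by
  have hc : Continuous fun θ : ℝ => Complex.exp (Complex.I * ((μ : ℂ) ^ 2 + σ / ε ^ 2) * θ) := by
    fun_prop
  have h1 := intervalIntegral.integral_hasDerivAt_right (hc.intervalIntegrable 0 s)
    (hc.stronglyMeasurableAtFilter _ _) hc.continuousAt
  refine (((hasDerivAt_exp_neg_freq_sq μ s).const_mul Complex.I).mul h1).congr_deriv ?_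
  rw [← exp_neg_mul_exp σ ε μ s]
  unfold coefC
  ring

lemma hasDerivAt_coefD (σ ε s : ℝ) : HasDerivAt (coefD σ ε μ)
    (-(Complex.I * (μ : ℂ) ^ 2) * coefD σ ε μ s
      + Complex.I * s * Complex.exp (Complex.I * (σ / ε ^ 2) * s)) s := by
  have hc : Continuous fun θ : ℝ => (θ : ℂ) *
      Complex.exp (Complex.I * ((μ : ℂ) ^ 2 + σ / ε ^ 2) * θ) := by
    fun_prop
  have h1 := intervalIntegral.integral_hasDerivAt_right (hc.intervalIntegrable 0 s)
    (hc.stronglyMeasurableAtFilter _ _) hc.continuousAt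
  refine (((hasDerivAt_exp_neg_freq_sq μ s).const_mul Complex.I).mul h1).congr_deriv ?_
  rw [← exp_neg_mul_exp σ ε μ s]
  unfold coefD
  ring

lemma lamMinus_eq (ε μ : ℝ) : lamMinus ε μ = omega ε μ - 1 / ε ^ 2 := by
  unfold lamMinus omega; ring

lemma lamPlus_eq (ε μ : ℝ) : lamPlus ε μ = -omega ε μ - 1 / ε ^ 2 := by
  unfold lamPlus omega; ring

lemma exp_mul_exp_lamMinus (ε μ τ : ℝ) :
    Complex.exp (Complex.I * τ / ε ^ 2) * Complex.exp (Complex.I * τ * lamMinus ε μ)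
      = Real.cos (omega ε μ * τ) + Real.sin (omega ε μ * τ) * Complex.I := by
  rw [← Complex.exp_add, lamMinus_eq, Complex.ofReal_cos, Complex.ofReal_sin, ← Complex.exp_mul_I]
  congr 1; push_cast; ring

lemma exp_mul_exp_lamPlus (ε μ τ : ℝ) :
    Complex.exp (Complex.I * τ / ε ^ 2) * Complex.exp (Complex.I * τ * lamPlus ε μ)
      = Real.cos (omega ε μ * τ) - Real.sin (omega ε μ * τ) * Complex.I := by
  have h : (Real.cos (omega ε μ * τ) : ℂ) - Real.sin (omega ε μ * τ) * Complex.I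
      = Complex.exp (-(omega ε μ * τ : ℝ) * Complex.I) := by
    rw [Complex.exp_mul_I, Complex.cos_neg, Complex.sin_neg, Complex.ofReal_cos, Complex.ofReal_sin]
    ring
  rw [← Complex.exp_add, lamPlus_eq, h]
  congr 1; push_cast; ring

/-- Since λ^∓ = ±ω - 1/ε², the factor e^{iτ/ε²} undoes the shift by 1/ε² and only the Klein-Gordon
frequency ω remains. -/
lemma exp_mul_coefA (hε : 0 < ε) (τ : ℝ) :
    Complex.exp (Complex.I * τ / ε ^ 2) * coefA ε μ τ = Real.cos (omega ε μ * τ)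
      + Complex.I * (Real.sin (omega ε μ * τ) / (ε ^ 2 * omega ε μ)) := by
  have hω : (omega ε μ : ℂ) ≠ 0 := by exact_mod_cast (omega_pos μ hε).ne'
  have hε' : (ε : ℂ) ≠ 0 := by exact_mod_cast hε.ne'
  have e : (lamPlus ε μ : ℂ) - lamMinus ε μ = -2 * omega ε μ := by
    rw [lamPlus_eq, lamMinus_eq]; push_cast; ring
  unfold coefA
  rw [mul_div_assoc', mul_sub, mul_left_comm, exp_mul_exp_lamMinus, mul_left_comm _ _ (Complex.exp _),
    exp_mul_exp_lamPlus, e, lamPlus_eq, lamMinus_eq]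
  push_cast
  field_simp
  ring

lemma exp_mul_coefA' (hε : 0 < ε) (τ : ℝ) :
    Complex.exp (Complex.I * τ / ε ^ 2) * (coefA' ε μ τ + Complex.I / ε ^ 2 * coefA ε μ τ)
      = -(omega ε μ * Real.sin (omega ε μ * τ)) + Complex.I / ε ^ 2 * Real.cos (omega ε μ * τ) := by
  have hω : (omega ε μ : ℂ) ≠ 0 := by exact_mod_cast (omega_pos μ hε).ne'
  have hε' : (ε : ℂ) ≠ 0 := by exact_mod_cast hε.ne'
  have e : (lamPlus ε μ : ℂ) - lamMinus ε μ = -2 * omega ε μ := by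
    rw [lamPlus_eq, lamMinus_eq]; push_cast; ring
  have e2 : Complex.exp (Complex.I * τ / ε ^ 2) * coefA' ε μ τ
      = Complex.I * lamPlus ε μ * lamMinus ε μ *
        (Complex.exp (Complex.I * τ / ε ^ 2) * Complex.exp (Complex.I * τ * lamMinus ε μ)
        - Complex.exp (Complex.I * τ / ε ^ 2) * Complex.exp (Complex.I * τ * lamPlus ε μ))
        / (lamPlus ε μ - lamMinus ε μ) := by
    unfold coefA'; ring
  rw [mul_add, mul_left_comm, exp_mul_coefA μ hε, e2, exp_mul_exp_lamMinus, exp_mul_exp_lamPlus, e,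
    lamPlus_eq, lamMinus_eq]
  push_cast
  field_simp
  ring_nf
  simp only [Complex.I_sq]
  ring

end coefficients

end KGS

namespace KGS

/-! ### Duhamel's principle for coefficient vectors -/

section duhamel
variable {a b : ℝ} {N s : ℕ}

lemma nrm_le_add_of_eq {c d e : ℤ → ℂ} (h : ∀ l ∈ modes N, c l = d l + e l) :
    nrm a b N s c ≤ nrm a b N s d + nrm a b N s e := by
  rw [nrm_congr h]; exact nrm_add_le d e

lemma nrm_I_mul (c : ℤ → ℂ) : nrm a b N s (fun l => Complex.I * c l) = nrm a b N s c := by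
  rw [nrm_const_mul, Complex.norm_I, one_mul]

lemma nrm_real_mul (x : ℝ) (c : ℤ → ℂ) :
    nrm a b N s (fun l => (x : ℂ) * c l) = |x| * nrm a b N s c := by
  rw [nrm_const_mul, Complex.norm_real, Real.norm_eq_abs]

lemma nrm_neg (c : ℤ → ℂ) : nrm a b N s (fun l => -c l) = nrm a b N s c := by
  simp [nrm]

lemma nrm_lin_le (z w : ℂ) (c d : ℤ → ℂ) :
    nrm a b N s (fun l => z * c l + w * d l) ≤ ‖z‖ * nrm a b N s c + ‖w‖ * nrm a b N s d := by
  rw [← nrm_const_mul, ← nrm_const_mul]; exact nrm_add_le _ _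

lemma nrm_freq_sq_mul_le (c : ℤ → ℂ) :
    nrm a b N s (fun l => (freq a b l : ℂ) ^ 2 * c l) ≤ nrm a b N (s + 2) c := by
  refine (nrm_mul_le zero_le_one _ c fun l _ => ?_).trans (one_mul _).le
  rw [norm_pow, Complex.norm_real, Real.norm_eq_abs, sq_abs, one_mul, pow_add]
  exact mul_le_mul_of_nonneg_left (freq_sq_le_wt_sq a b l) (pow_pos (wt_pos a b l) _).le

lemma hasDerivAt_exp_I_mul (κ t : ℝ) : HasDerivAt (fun t : ℝ => Complex.exp (Complex.I * κ * t))
    (Complex.I * κ * Complex.exp (Complex.I * κ * t)) t := by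
  have h1 := ((Complex.ofRealCLM.hasDerivAt (x := t)).const_mul (Complex.I * κ)).cexp
  simp only [Complex.ofRealCLM_apply, Complex.ofReal_one, mul_one] at h1
  exact h1.congr_deriv (mul_comm _ _)

lemma nrm_phase_mul (κ : ℤ → ℝ) (t : ℝ) (c : ℤ → ℂ) :
    nrm a b N s (fun l => Complex.exp (Complex.I * κ l * t) * c l) = nrm a b N s c := by
  refine le_antisymm (nrm_le_of_norm_le fun l _ => ?_) (nrm_le_of_norm_le fun l _ => ?_) <;>
  rw [norm_mul, norm_exp_I_mul_ofReal_mul, one_mul]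

/-- Conjugation by e^{-iκt} removes the linear term without changing the norm, and the mean value
inequality does the rest. However large κ is, it does not enter the bound. -/
lemma nrm_le_of_hasDerivAt_phase {S M : ℝ} (hS : 0 ≤ S) (κ : ℤ → ℝ) {u f : ℝ → ℤ → ℂ}
    (hc : ∀ l ∈ modes N, ContinuousOn (fun t => u t l) (Icc 0 S))
    (hd : ∀ l ∈ modes N, ∀ t ∈ Ioo 0 S,
      HasDerivAt (fun t => u t l) (Complex.I * κ l * u t l + f t l) t)
    (hu : ∀ l ∈ modes N, u 0 l = 0) (hf : ∀ t ∈ Ioo 0 S, nrm a b N s (f t) ≤ M) :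
    nrm a b N s (u S) ≤ M * S := by
  have h := nrm_sub_le_of_hasDerivAt (a := a) (b := b) (N := N) (s := s) (K := M) hS
    (f := fun t l => Complex.exp (Complex.I * (-κ l : ℝ) * t) * u t l)
    (f' := fun t l => Complex.exp (Complex.I * (-κ l : ℝ) * t) * f t l)
    (fun l hl => (Continuous.continuousOn (by fun_prop)).mul (hc l hl))
    (fun l hl t ht => by
      refine ((hasDerivAt_exp_I_mul (-κ l) t).mul (hd l hl t ht)).congr_deriv ?_
      push_cast; ring)
    (fun t ht => by rw [nrm_phase_mul (fun l => -κ l)]; exact hf t ht)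
  rw [sub_zero] at h
  refine le_trans (le_of_eq ?_) h
  rw [← nrm_phase_mul (fun l => -κ l) S (u S)]
  exact nrm_congr fun l hl => by simp [hu l hl]

end duhamel

/-! ### Approximate semi-discrete solutions -/

/-- Bounds for the products of coefficient vectors. -/
structure ProdBound (a b : ℝ) (N : ℕ) (K : ℝ) : Prop where
  one_le : 1 ≤ K
  one : ∀ c d, nrm a b N 1 (dprod a b N c d) ≤ K * nrm a b N 1 c * nrm a b N 1 d
  three : ∀ c d, nrm a b N 3 (dprod a b N c d) ≤ K * nrm a b N 3 c * nrm a b N 3 d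

lemma ProdBound.le_one {a b : ℝ} {N : ℕ} {K : ℝ} (h : ProdBound a b N K) {c d : ℤ → ℂ} {x y : ℝ}
    (hc : nrm a b N 1 c ≤ x) (hd : nrm a b N 1 d ≤ y) : nrm a b N 1 (dprod a b N c d) ≤ K * x * y := by
  have := h.one_le
  have := (nrm_nonneg (a := a) (b := b) (N := N) (s := 1) c).trans hc
  refine (h.one c d).trans ?_
  have := nrm_nonneg (a := a) (b := b) (N := N) (s := 1) d
  gcongr

lemma ProdBound.le_three {a b : ℝ} {N : ℕ} {K : ℝ} (h : ProdBound a b N K) {c d : ℤ → ℂ} {x y : ℝ}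
    (hc : nrm a b N 3 c ≤ x) (hd : nrm a b N 3 d ≤ y) : nrm a b N 3 (dprod a b N c d) ≤ K * x * y := by
  have := h.one_le
  have := (nrm_nonneg (a := a) (b := b) (N := N) (s := 3) c).trans hc
  refine (h.three c d).trans ?_
  have := nrm_nonneg (a := a) (b := b) (N := N) (s := 3) d
  gcongr

/-- The time derivative of the coefficients of `ψ` according to the Schrödinger equation. -/
noncomputable def rate (a b : ℝ) (N : ℕ) (A P δ : ℤ → ℂ) (l : ℤ) : ℂ :=
  Complex.I * (-(freq a b l : ℂ) ^ 2 * A l + dprod a b N P A l + δ l)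

/-- The coefficients of the filtered approximation of `∂ₜψ`. -/
noncomputable def filteredRate (a b : ℝ) (N : ℕ) (τ : ℝ) (A P : ℤ → ℂ) (l : ℤ) : ℂ :=
  -Complex.I * (Real.sin (freq a b l ^ 2 * τ) / τ) * A l + Complex.I * dprod a b N P A l

/-- The coefficients of `|ψ|²`. -/
noncomputable def dens (a b : ℝ) (N : ℕ) (A : ℤ → ℂ) : ℤ → ℂ := dprod a b N A (dconj a b N A)

/-- The coefficients of `2 Re (conj ψ ∂ₜψ)`. -/
noncomputable def densRate (a b : ℝ) (N : ℕ) (A A' : ℤ → ℂ) (l : ℤ) : ℂ :=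
  dprod a b N A' (dconj a b N A) l + dprod a b N A (dconj a b N A') l

/-- Fourier coefficients on `[0, T]` solving the semi-discrete system up to defects `δ₁`, `δ₂` of
size `η`, with `K` an upper bound of all higher norms. -/
structure ApproxSol (a b T ε : ℝ) (N : ℕ) (η K : ℝ) (ps ph pi δ₁ δ₂ : ℝ → ℤ → ℂ) : Prop where
  cont_ps : ∀ l, ContinuousOn (fun t => ps t l) (Icc 0 T)
  cont_ph : ∀ l, ContinuousOn (fun t => ph t l) (Icc 0 T)
  cont_pi : ∀ l, ContinuousOn (fun t => pi t l) (Icc 0 T)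
  deriv_ps : ∀ l, ∀ t ∈ Ioo 0 T, HasDerivAt (fun t => ps t l) (rate a b N (ps t) (ph t) (δ₁ t) l) t
  deriv_ph : ∀ l, ∀ t ∈ Ioo 0 T, HasDerivAt (fun t => ph t l) (pi t l) t
  deriv_pi : ∀ l, ∀ t ∈ Ioo 0 T, HasDerivAt (fun t => pi t l) (1 / (ε : ℂ) ^ 2 *
    (-((freq a b l : ℂ) ^ 2 + 1 / (ε : ℂ) ^ 2) * ph t l + (dens a b N (ps t) l + δ₂ t l))) t
  nrm_ps : ∀ t ∈ Icc 0 T, nrm a b N 5 (ps t) ≤ K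
  nrm_ph : ∀ t ∈ Icc 0 T, nrm a b N 5 (ph t) ≤ K
  nrm_pi : ∀ t ∈ Icc 0 T, ε ^ 2 * nrm a b N 5 (pi t) ≤ K
  nrm_δ₁ : ∀ t ∈ Icc 0 T, nrm a b N 1 (δ₁ t) ≤ η
  nrm_δ₁_three : ∀ t ∈ Icc 0 T, nrm a b N 3 (δ₁ t) ≤ K
  nrm_δ₂ : ∀ t ∈ Icc 0 T, nrm a b N 1 (δ₂ t) ≤ η
  defect_le : η ≤ 1

lemma ApproxSol.shift {a b T ε : ℝ} {N : ℕ} {η K : ℝ} {ps ph pi δ₁ δ₂ : ℝ → ℤ → ℂ}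
    (h : ApproxSol a b T ε N η K ps ph pi δ₁ δ₂) {t₀ τ : ℝ} (ht₀ : 0 ≤ t₀) (hτ : t₀ + τ ≤ T) :
    ApproxSol a b τ ε N η K (fun s => ps (t₀ + s)) (fun s => ph (t₀ + s)) (fun s => pi (t₀ + s))
      (fun s => δ₁ (t₀ + s)) (fun s => δ₂ (t₀ + s)) := by
  have m1 : ∀ s ∈ Icc 0 τ, t₀ + s ∈ Icc 0 T := fun s hs => ⟨by linarith [hs.1], by linarith [hs.2]⟩
  have m2 : ∀ s ∈ Ioo 0 τ, t₀ + s ∈ Ioo 0 T := fun s hs => ⟨by linarith [hs.1], by linarith [hs.2]⟩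
  have c : ∀ {f : ℝ → ℂ}, ContinuousOn f (Icc 0 T) → ContinuousOn (fun s => f (t₀ + s)) (Icc 0 τ) :=
    fun hf => hf.comp (by fun_prop) m1
  exact
  { cont_ps := fun l => c (h.cont_ps l)
    cont_ph := fun l => c (h.cont_ph l)
    cont_pi := fun l => c (h.cont_pi l)
    deriv_ps := fun l s hs => (h.deriv_ps l _ (m2 s hs)).comp_const_add t₀ s
    deriv_ph := fun l s hs => (h.deriv_ph l _ (m2 s hs)).comp_const_add t₀ s
    deriv_pi := fun l s hs => (h.deriv_pi l _ (m2 s hs)).comp_const_add t₀ s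
    nrm_ps := fun s hs => h.nrm_ps _ (m1 s hs)
    nrm_ph := fun s hs => h.nrm_ph _ (m1 s hs)
    nrm_pi := fun s hs => h.nrm_pi _ (m1 s hs)
    nrm_δ₁ := fun s hs => h.nrm_δ₁ _ (m1 s hs)
    nrm_δ₁_three := fun s hs => h.nrm_δ₁_three _ (m1 s hs)
    nrm_δ₂ := fun s hs => h.nrm_δ₂ _ (m1 s hs)
    defect_le := h.defect_le }

/-! ### Size and consistency of the filtered time derivative. -/

section bounds
variable {a b S ε : ℝ} {N : ℕ} {η K : ℝ} {ps ph pi δ₁ δ₂ : ℝ → ℤ → ℂ}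

lemma abs_sin_mul_div_le (x : ℝ) {τ : ℝ} (hτ : 0 < τ) : |Real.sin (x * τ) / τ| ≤ |x| := by
  rw [abs_div, abs_of_pos hτ, div_le_iff₀ hτ]
  exact Real.abs_sin_le_abs.trans (by rw [abs_mul, abs_of_pos hτ])

/-- Taylor's formula for |xτ| ≤ 1 and the trivial bound beyond. The error is quadratic in x; with x
= μ² it costs four derivatives, which on top of H¹ is the reason for working in H⁵. -/
lemma abs_sin_mul_div_sub_le (x : ℝ) {τ : ℝ} (hτ : 0 < τ) :
    |Real.sin (x * τ) / τ - x| ≤ 2 * τ * x ^ 2 := by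
  have h : |Real.sin (x * τ) - x * τ| ≤ 2 * (x * τ) ^ 2 := by
    rw [← sq_abs (x * τ)]
    rcases le_or_gt |x * τ| 1 with h1 | h1
    · have h2 := Real.sin_bound h1
      have h3 : |x * τ| ^ 4 ≤ |x * τ| ^ 2 := pow_le_pow_of_le_one (abs_nonneg _) h1 (by norm_num)
      have h4 : |x * τ| ^ 3 ≤ |x * τ| ^ 2 := pow_le_pow_of_le_one (abs_nonneg _) h1 (by norm_num)
      have h5 : |Real.sin (x * τ) - x * τ| ≤ |Real.sin (x * τ) - (x * τ - (x * τ) ^ 3 / 6)|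
          + |x * τ| ^ 3 / 6 := by
        have : Real.sin (x * τ) - x * τ = (Real.sin (x * τ) - (x * τ - (x * τ) ^ 3 / 6))
          + (-((x * τ) ^ 3 / 6)) := by ring
        rw [this]
        refine (abs_add_le _ _).trans (le_of_eq ?_)
        rw [abs_neg, abs_div, abs_pow]; norm_num
      nlinarith [sq_nonneg |x * τ|]
    · have h2 := abs_sub (Real.sin (x * τ)) (x * τ)
      have h3 : |Real.sin (x * τ)| ≤ |x * τ| := Real.abs_sin_le_abs
      nlinarith
  have e : Real.sin (x * τ) / τ - x = (Real.sin (x * τ) - x * τ) / τ := by field_simp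
  rw [e, abs_div, abs_of_pos hτ, div_le_iff₀ hτ]
  calc _ ≤ _ := h
    _ = _ := by ring

lemma ApproxSol.nrm_dens (hab : a < b) (hN : 0 < N) (hE : Even N) (hB : ProdBound a b N K)
    (h : ApproxSol a b S ε N η K ps ph pi δ₁ δ₂) {t : ℝ} (ht : t ∈ Icc 0 S) :
    nrm a b N 3 (dens a b N (ps t)) ≤ K ^ 3 := by
  have h1 := (nrm_mono (by norm_num : 3 ≤ 5) _).trans (h.nrm_ps t ht)
  refine (hB.le_three h1 ((nrm_dconj hab hN hE 3 _).le.trans h1)).trans (le_of_eq (by ring))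

/-- The Laplacian lowers H⁵ to H³. H³ is retained instead of H¹ so that two further derivatives can
be spent later. -/
lemma nrm_rate_le (hB : ProdBound a b N K) {A P δ : ℤ → ℂ} (h1 : nrm a b N 5 A ≤ K)
    (h2 : nrm a b N 5 P ≤ K) (h3 : nrm a b N 3 δ ≤ K) : nrm a b N 3 (rate a b N A P δ) ≤ 3 * K ^ 3 := by
  have hK := hB.one_le
  have hK3 : K ≤ K ^ 3 := le_self_pow₀ hK (by norm_num)
  have i1 := hB.le_three ((nrm_mono (by norm_num : 3 ≤ 5) _).trans h2)
    ((nrm_mono (by norm_num : 3 ≤ 5) _).trans h1)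
  unfold rate
  rw [nrm_I_mul]
  refine (nrm_add_le _ _).trans ?_
  have i2 := nrm_add_le (a := a) (b := b) (N := N) (s := 3) (fun l => -(freq a b l : ℂ) ^ 2 * A l)
    (dprod a b N P A)
  have i3 := (nrm_freq_sq_mul_le (a := a) (b := b) (N := N) (s := 3) A).trans h1
  have e : nrm a b N 3 (fun l => -(freq a b l : ℂ) ^ 2 * A l)
      = nrm a b N 3 (fun l => (freq a b l : ℂ) ^ 2 * A l) := by
    rw [← nrm_neg]; simp
  have e2 : K * K * K = K ^ 3 := by ring
  linarith

lemma nrm_filteredRate_le (hB : ProdBound a b N K) {A P : ℤ → ℂ} {τ : ℝ} (hτ : 0 < τ)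
    (h1 : nrm a b N 5 A ≤ K) (h2 : nrm a b N 5 P ≤ K) :
    nrm a b N 3 (filteredRate a b N τ A P) ≤ 2 * K ^ 3 := by
  have hK := hB.one_le
  have hK3 : K ≤ K ^ 3 := le_self_pow₀ hK (by norm_num)
  have i1 := hB.le_three ((nrm_mono (by norm_num : 3 ≤ 5) _).trans h2)
    ((nrm_mono (by norm_num : 3 ≤ 5) _).trans h1)
  unfold filteredRate
  refine (nrm_add_le _ _).trans ?_
  rw [nrm_I_mul]
  have i2 := nrm_mul_le (a := a) (b := b) (N := N) (s := 3) (s' := 5) zero_le_one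
    (fun l => -Complex.I * (Real.sin (freq a b l ^ 2 * τ) / τ)) A fun l _ => by
      rw [norm_mul, norm_neg, Complex.norm_I, one_mul, ← Complex.ofReal_div, Complex.norm_real,
        Real.norm_eq_abs, one_mul]
      have := (abs_sin_mul_div_le (freq a b l ^ 2) hτ).trans (abs_sq _ |>.le.trans (freq_sq_le_wt_sq a b l))
      calc _ ≤ wt a b l ^ 3 * wt a b l ^ 2 := mul_le_mul_of_nonneg_left this (pow_pos (wt_pos a b l) _).le
        _ = _ := by ring
  have e2 : K * K * K = K ^ 3 := by ring
  linarith

end bounds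

end KGS

namespace KGS

/-! ### The leading oscillation of the Klein-Gordon field -/

/-- The solution of `ε⁴ φ'' + φ = 0` with `φ(0) = P`, `φ'(0) = Q`. -/
noncomputable def oscil (ε : ℝ) (P Q : ℤ → ℂ) (s : ℝ) (l : ℤ) : ℂ :=
  (Real.cos (s / ε ^ 2) : ℝ) * P l + (ε ^ 2 * Real.sin (s / ε ^ 2) : ℝ) * Q l

/-- The time derivative of `oscil`. -/
noncomputable def oscil' (ε : ℝ) (P Q : ℤ → ℂ) (s : ℝ) (l : ℤ) : ℂ :=
  (-(Real.sin (s / ε ^ 2) / ε ^ 2) : ℝ) * P l + (Real.cos (s / ε ^ 2) : ℝ) * Q l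

section oscil
variable {a b : ℝ} {N k : ℕ} {ε : ℝ} (P Q : ℤ → ℂ) (s : ℝ) (l : ℤ)

@[simp] lemma oscil_zero : oscil ε P Q 0 l = P l := by simp [oscil]

@[simp] lemma oscil'_zero : oscil' ε P Q 0 l = Q l := by simp [oscil']

lemma oscil'_zero_fun : oscil' ε P Q 0 = Q := funext fun l => oscil'_zero P Q l

lemma hasDerivAt_oscil (hε : 0 < ε) :
    HasDerivAt (fun s => oscil ε P Q s l) (oscil' ε P Q s l) s := by
  have h0 : HasDerivAt (fun s : ℝ => s / ε ^ 2) (1 / ε ^ 2) s := (hasDerivAt_id s).div_const _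
  refine ((h0.cos.ofReal_comp.mul_const (P l)).add
    ((h0.sin.const_mul (ε ^ 2)).ofReal_comp.mul_const (Q l))).congr_deriv ?_
  unfold oscil'
  congr 3
  · ring
  · field_simp

lemma hasDerivAt_oscil' (hε : 0 < ε) :
    HasDerivAt (fun s => oscil' ε P Q s l) (-(1 / (ε : ℂ) ^ 4) * oscil ε P Q s l) s := by
  have hε' : (ε : ℂ) ≠ 0 := by exact_mod_cast hε.ne'
  have h0 : HasDerivAt (fun s : ℝ => s / ε ^ 2) (1 / ε ^ 2) s := (hasDerivAt_id s).div_const _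
  refine (((h0.sin.div_const (ε ^ 2)).neg.ofReal_comp.mul_const (P l)).add
    (h0.cos.ofReal_comp.mul_const (Q l))).congr_deriv ?_
  unfold oscil
  push_cast
  field_simp
  ring

lemma nrm_oscil_le : nrm a b N k (oscil ε P Q s) ≤ nrm a b N k P + ε ^ 2 * nrm a b N k Q := by
  refine (nrm_lin_le _ _ P Q).trans ?_
  have h1 := nrm_nonneg (a := a) (b := b) (N := N) (s := k) P
  have h2 := nrm_nonneg (a := a) (b := b) (N := N) (s := k) Q
  rw [Complex.norm_real, Complex.norm_real, Real.norm_eq_abs, Real.norm_eq_abs, abs_mul,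
    abs_of_nonneg (sq_nonneg ε)]
  refine add_le_add (mul_le_of_le_one_left h1 (Real.abs_cos_le_one _)) ?_
  exact mul_le_mul_of_nonneg_right (mul_le_of_le_one_right (sq_nonneg ε) (Real.abs_sin_le_one _)) h2

lemma nrm_oscil'_le (hε : 0 < ε) :
    ε ^ 2 * nrm a b N k (oscil' ε P Q s) ≤ nrm a b N k P + ε ^ 2 * nrm a b N k Q := by
  have h1 := nrm_nonneg (a := a) (b := b) (N := N) (s := k) P
  have h2 := nrm_nonneg (a := a) (b := b) (N := N) (s := k) Q
  have h3 := nrm_lin_le (a := a) (b := b) (N := N) (s := k)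
    ((-(Real.sin (s / ε ^ 2) / ε ^ 2) : ℝ) : ℂ) ((Real.cos (s / ε ^ 2) : ℝ) : ℂ) P Q
  rw [Complex.norm_real, Complex.norm_real, Real.norm_eq_abs, Real.norm_eq_abs, abs_neg, abs_div,
    abs_of_nonneg (sq_nonneg ε)] at h3
  calc ε ^ 2 * nrm a b N k (oscil' ε P Q s)
      ≤ ε ^ 2 * (|Real.sin (s / ε ^ 2)| / ε ^ 2 * nrm a b N k P
        + |Real.cos (s / ε ^ 2)| * nrm a b N k Q) := by
        exact mul_le_mul_of_nonneg_left h3 (sq_nonneg ε)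
    _ ≤ ε ^ 2 * (1 / ε ^ 2 * nrm a b N k P + 1 * nrm a b N k Q) := by
        gcongr
        · exact Real.abs_sin_le_one _
        · exact Real.abs_cos_le_one _
    _ = _ := by field_simp

/-- Separation into the frequencies ±1/ε², with the amplitudes v⁺ and v⁻ on which the coefficients
c^±, d^± of the scheme act. -/
lemma oscil_eq : oscil ε P Q s l
    = Complex.exp (Complex.I * ((1 : ℝ) / ε ^ 2) * s) * (1 / 2 * (P l - Complex.I * ε ^ 2 * Q l))
      + Complex.exp (Complex.I * ((-1 : ℝ) / ε ^ 2) * s)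
        * (1 / 2 * (P l + Complex.I * ε ^ 2 * Q l)) := by
  have e1 : Complex.I * ((1 : ℝ) / (ε : ℂ) ^ 2) * s = (s / ε ^ 2 : ℝ) * Complex.I := by
    push_cast; ring
  have e2 : Complex.I * (((-1 : ℝ) : ℂ) / (ε : ℂ) ^ 2) * s = -(s / ε ^ 2 : ℝ) * Complex.I := by
    push_cast; ring
  rw [e1, e2, Complex.exp_mul_I, Complex.exp_mul_I, Complex.cos_neg, Complex.sin_neg, oscil,
    ← Complex.ofReal_cos, ← Complex.ofReal_sin]
  push_cast
  linear_combination ((ε : ℂ) ^ 2 * Complex.sin (s / ε ^ 2) * Q l) * Complex.I_sq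

end oscil

namespace ApproxSol

variable {a b S ε : ℝ} {N : ℕ} {η K : ℝ} {ps ph pi δ₁ δ₂ : ℝ → ℤ → ℂ}

lemma continuousOn_oscil_sub (hε : 0 < ε) (h : ApproxSol a b S ε N η K ps ph pi δ₁ δ₂) (l : ℤ) :
    ContinuousOn (fun s => ph s l - oscil ε (ph 0) (pi 0) s l) (Icc 0 S) :=
  (h.cont_ph l).sub fun s _ => (hasDerivAt_oscil _ _ s l hε).continuousAt.continuousWithinAt

lemma continuousOn_oscil'_sub (hε : 0 < ε) (h : ApproxSol a b S ε N η K ps ph pi δ₁ δ₂) (l : ℤ) :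
    ContinuousOn (fun s => pi s l - oscil' ε (ph 0) (pi 0) s l) (Icc 0 S) :=
  (h.cont_pi l).sub fun s _ => (hasDerivAt_oscil' _ _ s l hε).continuousAt.continuousWithinAt

lemma nrm_forcing_le (hab : a < b) (hN : 0 < N) (hE : Even N) (hB : ProdBound a b N K)
    (h : ApproxSol a b S ε N η K ps ph pi δ₁ δ₂) {t : ℝ} (ht : t ∈ Icc 0 S) :
    nrm a b N 1 (fun l => -(freq a b l : ℂ) ^ 2 * ph t l + (dens a b N (ps t) l + δ₂ t l))
      ≤ 3 * K ^ 3 := by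
  have hK3 : K ≤ K ^ 3 := le_self_pow₀ hB.one_le (by norm_num)
  have hK3' : 1 ≤ K ^ 3 := hB.one_le.trans hK3
  have i1 := (nrm_mono (by norm_num : 1 ≤ 3) _).trans (h.nrm_dens hab hN hE hB ht)
  have i2 := (nrm_freq_sq_mul_le (a := a) (b := b) (N := N) (s := 1) (ph t)).trans
    ((nrm_mono (by norm_num : 3 ≤ 5) _).trans (h.nrm_ph t ht))
  have i3 := (h.nrm_δ₂ t ht).trans h.defect_le
  refine (nrm_add_le _ _).trans ?_
  have i4 := nrm_add_le (a := a) (b := b) (N := N) (s := 1) (dens a b N (ps t)) (δ₂ t)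
  have e : nrm a b N 1 (fun l => -(freq a b l : ℂ) ^ 2 * ph t l)
      = nrm a b N 1 (fun l => (freq a b l : ℂ) ^ 2 * ph t l) := by
    rw [← nrm_neg]; simp
  linarith

/-- In the characteristic variables of ε⁴φ'' + φ = 0 the deviation from `oscil` rotates with phase
σ/ε² and is driven by -μ²φ + |ψ|² + δ₂, which is O(1) in H¹. It starts at zero, so it is O(s)
without any loss in ε. -/
lemma nrm_oscil_char_le (hab : a < b) (hN : 0 < N) (hE : Even N) (hB : ProdBound a b N K)
    (hε : 0 < ε) (h : ApproxSol a b S ε N η K ps ph pi δ₁ δ₂) {σ : ℝ} (hσ : σ ^ 2 = 1)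
    {s : ℝ} (hs : s ∈ Icc 0 S) :
    nrm a b N 1 (fun l => (ε : ℂ) ^ 2 * (pi s l - oscil' ε (ph 0) (pi 0) s l)
      + Complex.I * σ * (ph s l - oscil ε (ph 0) (pi 0) s l)) ≤ 3 * K ^ 3 * s := by
  have hε' : (ε : ℂ) ≠ 0 := by exact_mod_cast hε.ne'
  have hσ' : (σ : ℂ) ^ 2 = 1 := by exact_mod_cast hσ
  have hss : Icc 0 s ⊆ Icc 0 S := Icc_subset_Icc_right hs.2
  refine nrm_le_of_hasDerivAt_phase hs.1 (fun _ => σ / ε ^ 2)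
    (u := fun s l => (ε : ℂ) ^ 2 * (pi s l - oscil' ε (ph 0) (pi 0) s l)
      + Complex.I * σ * (ph s l - oscil ε (ph 0) (pi 0) s l))
    (f := fun t l => -(freq a b l : ℂ) ^ 2 * ph t l + (dens a b N (ps t) l + δ₂ t l))
    (fun l _ => ?_) (fun l _ t ht => ?_) (fun l _ => by simp) fun t ht => ?_
  · exact (continuousOn_const.mul ((h.continuousOn_oscil'_sub hε l).mono hss)).add
      (continuousOn_const.mul ((h.continuousOn_oscil_sub hε l).mono hss))
  · have ht' : t ∈ Ioo 0 S := ⟨ht.1, ht.2.trans_le hs.2⟩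
    refine ((((h.deriv_pi l t ht').sub (hasDerivAt_oscil' _ _ t l hε)).const_mul ((ε : ℂ) ^ 2)).add
      (((h.deriv_ph l t ht').sub (hasDerivAt_oscil _ _ t l hε)).const_mul (Complex.I * σ))).congr_deriv ?_
    push_cast
    field_simp
    linear_combination (-(ph t l - oscil ε (ph 0) (pi 0) t l) * Complex.I ^ 2) * hσ'
      - (ph t l - oscil ε (ph 0) (pi 0) t l) * Complex.I_sq
  · exact h.nrm_forcing_le hab hN hE hB (hss (Ioo_subset_Icc_self ht))

lemma nrm_oscil_sub_le (hab : a < b) (hN : 0 < N) (hE : Even N) (hB : ProdBound a b N K)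
    (hε : 0 < ε) (h : ApproxSol a b S ε N η K ps ph pi δ₁ δ₂) {s : ℝ} (hs : s ∈ Icc 0 S) :
    nrm a b N 1 (fun l => ph s l - oscil ε (ph 0) (pi 0) s l) ≤ 3 * K ^ 3 * s ∧
    ε ^ 2 * nrm a b N 1 (fun l => pi s l - oscil' ε (ph 0) (pi 0) s l) ≤ 3 * K ^ 3 * s := by
  have h1 := h.nrm_oscil_char_le hab hN hE hB hε (σ := 1) (by norm_num) hs
  have h2 := h.nrm_oscil_char_le hab hN hE hB hε (σ := -1) (by norm_num) hs
  set u := fun l => (ε : ℂ) ^ 2 * (pi s l - oscil' ε (ph 0) (pi 0) s l)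
      + Complex.I * (1 : ℝ) * (ph s l - oscil ε (ph 0) (pi 0) s l)
  set v := fun l => (ε : ℂ) ^ 2 * (pi s l - oscil' ε (ph 0) (pi 0) s l)
      + Complex.I * (-1 : ℝ) * (ph s l - oscil ε (ph 0) (pi 0) s l)
  constructor
  · have e : (fun l => ph s l - oscil ε (ph 0) (pi 0) s l)
        = fun l => -(Complex.I / 2) * u l + Complex.I / 2 * v l := by
      ext l; simp only [u, v]; push_cast
      linear_combination (ph s l - oscil ε (ph 0) (pi 0) s l) * Complex.I_sq
    rw [e]
    refine (nrm_lin_le _ _ u v).trans ?_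
    norm_num
    linarith
  · have e : (fun l => (ε ^ 2 : ℝ) * (pi s l - oscil' ε (ph 0) (pi 0) s l))
        = fun l => 1 / 2 * u l + 1 / 2 * v l := by
      ext l; simp only [u, v]; push_cast; ring
    rw [← abs_of_nonneg (sq_nonneg ε), ← nrm_real_mul, e]
    refine (nrm_lin_le _ _ u v).trans ?_
    norm_num
    linarith

/-- The bound on the derivative, O(S/ε²), is integrated once more. Second order in S is bought at
the price ε⁻², as the estimate τ²/ε² requires. -/
lemma nrm_oscil_sub_le' (hab : a < b) (hN : 0 < N) (hE : Even N) (hB : ProdBound a b N K)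
    (hε : 0 < ε) (h : ApproxSol a b S ε N η K ps ph pi δ₁ δ₂) {s : ℝ} (hs : s ∈ Icc 0 S) :
    nrm a b N 1 (fun l => ph s l - oscil ε (ph 0) (pi 0) s l) ≤ 3 * K ^ 3 * (S ^ 2 / ε ^ 2) := by
  have hK : 0 < K := by linarith [hB.one_le]
  have hss : Icc 0 s ⊆ Icc 0 S := Icc_subset_Icc_right hs.2
  have := nrm_sub_le_of_hasDerivAt (a := a) (b := b) (N := N) (s := 1)
    (K := 3 * K ^ 3 * (S / ε ^ 2)) hs.1
    (f := fun s l => ph s l - oscil ε (ph 0) (pi 0) s l)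
    (f' := fun s l => pi s l - oscil' ε (ph 0) (pi 0) s l)
    (fun l _ => (h.continuousOn_oscil_sub hε l).mono hss)
    (fun l _ t ht => (h.deriv_ph l t ⟨ht.1, ht.2.trans_le hs.2⟩).sub (hasDerivAt_oscil _ _ t l hε))
    (fun t ht => by
      have ht' := hss (Ioo_subset_Icc_self ht)
      have h2 := (h.nrm_oscil_sub_le hab hN hE hB hε ht').2
      have h3 : 3 * K ^ 3 * t ≤ 3 * K ^ 3 * S := by gcongr; exact ht'.2
      rw [mul_div_assoc', le_div_iff₀ (by positivity)]
      linarith)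
  simp only [oscil_zero, sub_self, sub_zero] at this
  refine this.trans ?_
  have hS0 := hs.1.trans hs.2
  calc 3 * K ^ 3 * (S / ε ^ 2) * s ≤ 3 * K ^ 3 * (S / ε ^ 2) * S := by gcongr; exact hs.2
    _ = _ := by ring

lemma nrm_ps_sub_le (hB : ProdBound a b N K)
    (h : ApproxSol a b S ε N η K ps ph pi δ₁ δ₂) {s : ℝ} (hs : s ∈ Icc 0 S) :
    nrm a b N 3 (fun l => ps s l - ps 0 l) ≤ 3 * K ^ 3 * s := by
  have hss : Icc 0 s ⊆ Icc 0 S := Icc_subset_Icc_right hs.2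
  have := nrm_sub_le_of_hasDerivAt (a := a) (b := b) (N := N) (s := 3) (K := 3 * K ^ 3) hs.1
    (f := ps) (f' := fun t => rate a b N (ps t) (ph t) (δ₁ t))
    (fun l _ => (h.cont_ps l).mono hss)
    (fun l _ t ht => h.deriv_ps l t ⟨ht.1, ht.2.trans_le hs.2⟩)
    (fun t ht => by
      have ht' := hss (Ioo_subset_Icc_self ht)
      exact nrm_rate_le hB (h.nrm_ps t ht') (h.nrm_ph t ht') (h.nrm_δ₁_three t ht'))
  simpa using this

lemma nrm_ph_sub_le (hε : 0 < ε)
    (h : ApproxSol a b S ε N η K ps ph pi δ₁ δ₂) {s : ℝ} (hs : s ∈ Icc 0 S) :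
    nrm a b N 1 (fun l => ph s l - ph 0 l) ≤ K / ε ^ 2 * s := by
  have hss : Icc 0 s ⊆ Icc 0 S := Icc_subset_Icc_right hs.2
  have := nrm_sub_le_of_hasDerivAt (a := a) (b := b) (N := N) (s := 1) (K := K / ε ^ 2) hs.1
    (f := ph) (f' := pi)
    (fun l _ => (h.cont_ph l).mono hss)
    (fun l _ t ht => h.deriv_ph l t ⟨ht.1, ht.2.trans_le hs.2⟩)
    (fun t ht => by
      have ht' := hss (Ioo_subset_Icc_self ht)
      have h2 := nrm_mono (a := a) (b := b) (N := N) (by norm_num : 1 ≤ 5) (pi t)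
      have h3 := mul_le_mul_of_nonneg_left h2 (sq_nonneg ε)
      rw [le_div_iff₀ (by positivity)]
      linarith [h.nrm_pi t ht'])
  simpa using this

/-- Consistency of the filtered rate over a whole step: φ moves with speed O(1/ε²), ψ with speed
O(1), and the filter adds an error O(S). -/
lemma nrm_rate_sub_le (hB : ProdBound a b N K) (hε : 0 < ε) (hε1 : ε ≤ 1) (hS : 0 < S)
    (h : ApproxSol a b S ε N η K ps ph pi δ₁ δ₂) {s : ℝ} (hs : s ∈ Icc 0 S) :
    nrm a b N 1 (fun l => rate a b N (ps s) (ph s) (δ₁ s) l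
      - filteredRate a b N S (ps 0) (ph 0) l) ≤ 9 * K ^ 5 * (S / ε ^ 2) + η := by
  have hK := hB.one_le
  have h0 : (0 : ℝ) ∈ Icc 0 S := left_mem_Icc.2 hS.le
  have e : ∀ l, rate a b N (ps s) (ph s) (δ₁ s) l - filteredRate a b N S (ps 0) (ph 0) l
      = Complex.I * (((-((freq a b l : ℂ) ^ 2 * (ps s l - ps 0 l))
          + ((Real.sin (freq a b l ^ 2 * S) / S - freq a b l ^ 2 : ℝ) : ℂ) * ps 0 l)
          + (dprod a b N (fun l => ph s l - ph 0 l) (ps s) l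
            + dprod a b N (ph 0) (fun l => ps s l - ps 0 l) l)) + δ₁ s l) := by
    intro l
    rw [dprod_sub_left, dprod_sub_right]
    unfold rate filteredRate
    push_cast; ring
  rw [nrm_congr fun l _ => e l, nrm_I_mul]
  refine (nrm_add_le _ _).trans ?_
  have j0 := h.nrm_ps_sub_le hB hs
  have i1 := nrm_freq_sq_mul_le (a := a) (b := b) (N := N) (s := 1) (fun l => ps s l - ps 0 l)
  -- The filter error has symbol of size Sμ⁴, which takes `ps 0` from H⁵ to H¹.
  have i2 := nrm_mul_le (a := a) (b := b) (N := N) (s := 1) (s' := 5) (M := 2 * S) (by positivity)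
    (fun l => ((Real.sin (freq a b l ^ 2 * S) / S - freq a b l ^ 2 : ℝ) : ℂ)) (ps 0) fun l _ => by
      rw [Complex.norm_real, Real.norm_eq_abs]
      have h1 := abs_sin_mul_div_sub_le (freq a b l ^ 2) hS
      have h2 : (freq a b l ^ 2) ^ 2 ≤ (wt a b l ^ 2) ^ 2 :=
        pow_le_pow_left₀ (sq_nonneg _) (freq_sq_le_wt_sq a b l) 2
      have h3 := wt_pos a b l
      calc _ ≤ wt a b l ^ 1 * (2 * S * (wt a b l ^ 2) ^ 2) := by gcongr; exact h1.trans (by gcongr)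
        _ = _ := by ring
  have m35 := (nrm_mono (a := a) (b := b) (N := N) (by norm_num : 1 ≤ 5) (ps s)).trans (h.nrm_ps s hs)
  have m35' := (nrm_mono (a := a) (b := b) (N := N) (by norm_num : 1 ≤ 5) (ph 0)).trans (h.nrm_ph 0 h0)
  have i3 := hB.le_one (h.nrm_ph_sub_le hε hs) m35
  have i4 := hB.le_one m35' ((nrm_mono (by norm_num : 1 ≤ 3) _).trans j0)
  have i5 := h.nrm_δ₁ s hs
  have a1 := nrm_add_le (a := a) (b := b) (N := N) (s := 1)
    (fun l => (-((freq a b l : ℂ) ^ 2 * (ps s l - ps 0 l))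
          + ((Real.sin (freq a b l ^ 2 * S) / S - freq a b l ^ 2 : ℝ) : ℂ) * ps 0 l))
    (fun l => dprod a b N (fun l => ph s l - ph 0 l) (ps s) l
            + dprod a b N (ph 0) (fun l => ps s l - ps 0 l) l)
  have a2 := nrm_add_le (a := a) (b := b) (N := N) (s := 1)
    (fun l => -((freq a b l : ℂ) ^ 2 * (ps s l - ps 0 l)))
    (fun l => ((Real.sin (freq a b l ^ 2 * S) / S - freq a b l ^ 2 : ℝ) : ℂ) * ps 0 l)
  have a3 := nrm_add_le (a := a) (b := b) (N := N) (s := 1)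
    (dprod a b N (fun l => ph s l - ph 0 l) (ps s))
    (dprod a b N (ph 0) (fun l => ps s l - ps 0 l))
  rw [nrm_neg] at a2
  set X := S / ε ^ 2
  have hε2 : ε ^ 2 ≤ 1 := pow_le_one₀ hε.le hε1
  have hSX : S ≤ X := (le_div_iff₀ (by positivity)).2 (mul_le_of_le_one_right hS.le hε2)
  have hsX : s ≤ X := hs.2.trans hSX
  have hX : 0 < X := hS.trans_le hSX
  have k3 : K ^ 3 ≤ K ^ 5 := pow_le_pow_right₀ hK (by norm_num)
  have k1 : K ≤ K ^ 5 := le_self_pow₀ hK (by norm_num)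
  have b1 : 3 * K ^ 3 * s ≤ 3 * K ^ 5 * X := by gcongr; exact hs.1
  have b2 : 2 * S * nrm a b N 5 (ps 0) ≤ 2 * (K ^ 5 * X) := by
    have h5 := nrm_nonneg (a := a) (b := b) (N := N) (s := 5) (ps 0)
    have h6 := (h.nrm_ps 0 h0).trans k1
    calc _ ≤ 2 * X * K ^ 5 := by gcongr
      _ = _ := by ring
  have b3 : K * (K / ε ^ 2 * s) * K ≤ K ^ 5 * X := by
    have : K / ε ^ 2 * s ≤ K * X := by
      rw [div_mul_eq_mul_div, mul_div_assoc]; unfold X; gcongr; exact hs.2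
    calc _ ≤ K * (K * X) * K := by gcongr
      _ = K ^ 3 * X := by ring
      _ ≤ _ := by gcongr
  have b4 : K * K * (3 * K ^ 3 * s) ≤ 3 * (K ^ 5 * X) := by
    calc _ = 3 * (K ^ 5 * s) := by ring
      _ ≤ _ := by gcongr
  linarith

/-- First-order Taylor remainder of ψ with the filtered rate as slope. It is used with two values of
`M`: one O(S/ε²) plus the defect, one merely bounded. -/
lemma nrm_remainder_le (h : ApproxSol a b S ε N η K ps ph pi δ₁ δ₂) {M : ℝ}
    (hM : ∀ s ∈ Icc 0 S, nrm a b N 1 (fun l => rate a b N (ps s) (ph s) (δ₁ s) l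
      - filteredRate a b N S (ps 0) (ph 0) l) ≤ M) {s : ℝ} (hs : s ∈ Icc 0 S) :
    nrm a b N 1 (fun l => ps s l - (ps 0 l + s * filteredRate a b N S (ps 0) (ph 0) l)) ≤ M * s := by
  have hss : Icc 0 s ⊆ Icc 0 S := Icc_subset_Icc_right hs.2
  have := nrm_sub_le_of_hasDerivAt (a := a) (b := b) (N := N) (s := 1) (K := M) hs.1
    (f := fun s l => ps s l - s * filteredRate a b N S (ps 0) (ph 0) l)
    (f' := fun s l => rate a b N (ps s) (ph s) (δ₁ s) l - filteredRate a b N S (ps 0) (ph 0) l)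
    (fun l _ => ((h.cont_ps l).mono hss).sub (Continuous.continuousOn (by fun_prop)))
    (fun l _ t ht => by
      refine ((h.deriv_ps l t ⟨ht.1, ht.2.trans_le hs.2⟩).sub
        ((Complex.ofRealCLM.hasDerivAt (x := t)).mul_const _)).congr_deriv ?_
      simp)
    (fun t ht => hM t (hss (Ioo_subset_Icc_self ht)))
  rw [sub_zero] at this
  refine le_trans (le_of_eq (nrm_congr fun l _ => ?_)) this
  simp; ring

end ApproxSol

end KGS

namespace KGS

/-! ### The local error of the Schrödinger part -/

/-- The coefficients of `v⁺ = (φ - iε²∂ₜφ) / 2` for `σ = 1` and of `v⁻ = (φ + iε²∂ₜφ) / 2` for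
`σ = -1`. -/
noncomputable def vcoef (σ ε : ℝ) (P Q : ℤ → ℂ) (l : ℤ) : ℂ :=
  1 / 2 * (P l - Complex.I * σ * ε ^ 2 * Q l)

/-- The coefficients of the numerical approximation of `ψ` at time `s` after a time level with
coefficients `A`, `P`, `Q` of `ψ`, `φ`, `∂ₜφ`, where `A'` is the approximation of `∂ₜψ`. -/
noncomputable def pathPsi (a b ε : ℝ) (N : ℕ) (A A' P Q : ℤ → ℂ) (s : ℝ) (l : ℤ) : ℂ :=
  Complex.exp (-(Complex.I * freq a b l ^ 2 * s)) * A l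
    + coefC 1 ε (freq a b l) s * dprod a b N (vcoef 1 ε P Q) A l
    + coefD 1 ε (freq a b l) s * dprod a b N (vcoef 1 ε P Q) A' l
    + coefC (-1) ε (freq a b l) s * dprod a b N (vcoef (-1) ε P Q) A l
    + coefD (-1) ε (freq a b l) s * dprod a b N (vcoef (-1) ε P Q) A' l

section
variable {a b ε : ℝ} {N : ℕ}

lemma oscil_eq_vcoef (P Q : ℤ → ℂ) (s : ℝ) : oscil ε P Q s = fun l =>
    Complex.exp (Complex.I * ((1 : ℝ) / ε ^ 2) * s) * vcoef 1 ε P Q l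
      + Complex.exp (Complex.I * ((-1 : ℝ) / ε ^ 2) * s) * vcoef (-1) ε P Q l := by
  ext l
  rw [oscil_eq]; unfold vcoef; push_cast; ring

lemma pathPsi_zero (A A' P Q : ℤ → ℂ) (l : ℤ) : pathPsi a b ε N A A' P Q 0 l = A l := by
  simp [pathPsi, coefC, coefD]

/-- The numerical step solves exactly a Schrödinger equation in which φ is replaced by `oscil` and ψ
by its linear polynomial. The exponential integrals c^± and d^± commit no further error. -/
lemma hasDerivAt_pathPsi (A A' P Q : ℤ → ℂ) (s : ℝ) (l : ℤ) :
    HasDerivAt (fun s => pathPsi a b ε N A A' P Q s l)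
      (-(Complex.I * freq a b l ^ 2) * pathPsi a b ε N A A' P Q s l
        + Complex.I * dprod a b N (oscil ε P Q s) (fun l => A l + s * A' l) l) s := by
  refine ((((((hasDerivAt_exp_neg_freq_sq (freq a b l) s).mul_const _).add
    ((hasDerivAt_coefC (freq a b l) 1 ε s).mul_const _)).add
    ((hasDerivAt_coefD (freq a b l) 1 ε s).mul_const _)).add
    ((hasDerivAt_coefC (freq a b l) (-1) ε s).mul_const _)).add
    ((hasDerivAt_coefD (freq a b l) (-1) ε s).mul_const _)).congr_deriv ?_
  rw [oscil_eq_vcoef, dprod_add_left, dprod_const_mul_left, dprod_const_mul_left, dprod_add_right,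
    dprod_add_right, dprod_const_mul_right, dprod_const_mul_right]
  unfold pathPsi
  ring

end

namespace ApproxSol

variable {a b S ε : ℝ} {N : ℕ} {η K : ℝ} {ps ph pi δ₁ δ₂ : ℝ → ℤ → ℂ}

lemma nrm_oscil_le_two (h : ApproxSol a b S ε N η K ps ph pi δ₁ δ₂) (hS : 0 ≤ S) (s : ℝ) :
    nrm a b N 5 (oscil ε (ph 0) (pi 0) s) ≤ 2 * K := by
  have h0 : (0 : ℝ) ∈ Icc 0 S := left_mem_Icc.2 hS
  have := nrm_oscil_le (a := a) (b := b) (N := N) (k := 5) (ε := ε) (ph 0) (pi 0) s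
  linarith [h.nrm_ph 0 h0, h.nrm_pi 0 h0]

lemma nrm_oscil'_le_two (hε : 0 < ε) (h : ApproxSol a b S ε N η K ps ph pi δ₁ δ₂) (hS : 0 ≤ S)
    (s : ℝ) : ε ^ 2 * nrm a b N 5 (oscil' ε (ph 0) (pi 0) s) ≤ 2 * K := by
  have h0 : (0 : ℝ) ∈ Icc 0 S := left_mem_Icc.2 hS
  have := nrm_oscil'_le (a := a) (b := b) (N := N) (k := 5) (ph 0) (pi 0) s hε
  linarith [h.nrm_ph 0 h0, h.nrm_pi 0 h0]

lemma nrm_remainder_le_first (hB : ProdBound a b N K) (hε : 0 < ε) (hε1 : ε ≤ 1) (hS : 0 < S)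
    (h : ApproxSol a b S ε N η K ps ph pi δ₁ δ₂) (hη : 0 ≤ η) {s : ℝ} (hs : s ∈ Icc 0 S) :
    nrm a b N 1 (fun l => ps s l - (ps 0 l + s * filteredRate a b N S (ps 0) (ph 0) l))
      ≤ 9 * K ^ 5 * (S ^ 2 / ε ^ 2) + η * S := by
  have hK := hB.one_le
  refine (h.nrm_remainder_le (fun s hs => h.nrm_rate_sub_le hB hε hε1 hS hs) hs).trans ?_
  calc _ ≤ (9 * K ^ 5 * (S / ε ^ 2) + η) * S := by gcongr; exact hs.2
    _ = _ := by ring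

lemma nrm_remainder_le_second (hB : ProdBound a b N K) (hS : 0 < S)
    (h : ApproxSol a b S ε N η K ps ph pi δ₁ δ₂) {s : ℝ} (hs : s ∈ Icc 0 S) :
    nrm a b N 1 (fun l => ps s l - (ps 0 l + s * filteredRate a b N S (ps 0) (ph 0) l))
      ≤ 5 * K ^ 3 * s := by
  have h0 : (0 : ℝ) ∈ Icc 0 S := left_mem_Icc.2 hS.le
  refine h.nrm_remainder_le (fun s hs => ?_) hs
  have i1 := (nrm_mono (by norm_num : 1 ≤ 3) _).trans
    (nrm_rate_le hB (h.nrm_ps s hs) (h.nrm_ph s hs) (h.nrm_δ₁_three s hs))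
  have i2 := (nrm_mono (by norm_num : 1 ≤ 3) _).trans
    (nrm_filteredRate_le hB hS (h.nrm_ps 0 h0) (h.nrm_ph 0 h0))
  refine (nrm_sub_le _ _).trans ?_
  linarith

lemma nrm_linear_le (hB : ProdBound a b N K) (hS : 0 < S) (hS1 : S ≤ 1)
    (h : ApproxSol a b S ε N η K ps ph pi δ₁ δ₂) {s : ℝ} (hs : s ∈ Icc 0 S) :
    nrm a b N 3 (fun l => ps 0 l + s * filteredRate a b N S (ps 0) (ph 0) l) ≤ 3 * K ^ 3 := by
  have hK := hB.one_le
  have h0 : (0 : ℝ) ∈ Icc 0 S := left_mem_Icc.2 hS.le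
  have i2 := nrm_filteredRate_le hB hS (h.nrm_ps 0 h0) (h.nrm_ph 0 h0)
  have i1 := (nrm_mono (by norm_num : 3 ≤ 5) _).trans (h.nrm_ps 0 h0)
  refine (nrm_add_le _ _).trans ?_
  rw [nrm_real_mul, abs_of_nonneg hs.1]
  have hK3 : K ≤ K ^ 3 := le_self_pow₀ hK (by norm_num)
  have : s * nrm a b N 3 (filteredRate a b N S (ps 0) (ph 0)) ≤ 1 * (2 * K ^ 3) := by
    have := nrm_nonneg (a := a) (b := b) (N := N) (s := 3) (filteredRate a b N S (ps 0) (ph 0))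
    gcongr
    exact hs.2.trans hS1
  linarith

/-- Duhamel for the difference: the source splits into the error of `oscil`, the Taylor remainder of
ψ and the defect, the first two being O(S²/ε²) up to the defect. -/
lemma localError_psi_first (hab : a < b) (hN : 0 < N) (hE : Even N) (hB : ProdBound a b N K)
    (hε : 0 < ε) (hε1 : ε ≤ 1) (hS : 0 < S) (hS1 : S ≤ 1) (hη : 0 ≤ η)
    (h : ApproxSol a b S ε N η K ps ph pi δ₁ δ₂) :
    nrm a b N 1 (fun l => ps S l
      - pathPsi a b ε N (ps 0) (filteredRate a b N S (ps 0) (ph 0)) (ph 0) (pi 0) S l)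
      ≤ 21 * K ^ 7 * (S ^ 2 / ε ^ 2 + η) * S := by
  have hK := hB.one_le
  set A' := filteredRate a b N S (ps 0) (ph 0)
  refine nrm_le_of_hasDerivAt_phase hS.le (fun l => -(freq a b l ^ 2))
    (u := fun s l => ps s l - pathPsi a b ε N (ps 0) A' (ph 0) (pi 0) s l)
    (f := fun s l => Complex.I * ((dprod a b N (fun l => ph s l - oscil ε (ph 0) (pi 0) s l) (ps s) l
      + dprod a b N (oscil ε (ph 0) (pi 0) s) (fun l => ps s l - (ps 0 l + s * A' l)) l) + δ₁ s l))
    (fun l _ => (h.cont_ps l).sub fun s _ =>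
      (hasDerivAt_pathPsi _ _ _ _ s l).continuousAt.continuousWithinAt)
    (fun l _ t ht => ?_) (fun l _ => by simp [pathPsi_zero]) fun t ht => ?_
  · refine ((h.deriv_ps l t ht).sub (hasDerivAt_pathPsi _ _ _ _ t l)).congr_deriv ?_
    rw [dprod_sub_left, dprod_sub_right]
    unfold rate
    push_cast; ring
  · have ht' := Ioo_subset_Icc_self ht
    rw [nrm_I_mul]
    refine (nrm_add_le _ _).trans ?_
    have i1 := hB.le_one (h.nrm_oscil_sub_le' hab hN hE hB hε ht')
      ((nrm_mono (by norm_num : 1 ≤ 5) _).trans (h.nrm_ps t ht'))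
    have i2 := hB.le_one ((nrm_mono (by norm_num : 1 ≤ 5) _).trans (h.nrm_oscil_le_two hS.le t))
      (h.nrm_remainder_le_first hB hε hε1 hS hη ht')
    have i3 := h.nrm_δ₁ t ht'
    have i4 := nrm_add_le (a := a) (b := b) (N := N) (s := 1)
      (dprod a b N (fun l => ph t l - oscil ε (ph 0) (pi 0) t l) (ps t))
      (dprod a b N (oscil ε (ph 0) (pi 0) t) (fun l => ps t l - (ps 0 l + t * A' l)))
    set X := S ^ 2 / ε ^ 2
    have hX : 0 ≤ X := by positivity
    have b1 : K * (3 * K ^ 3 * X) * K ≤ 3 * (K ^ 7 * X) := by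
      calc _ = 3 * (K ^ 5 * X) := by ring
        _ ≤ _ := by gcongr; norm_num
    have b2 : K * (2 * K) * (9 * K ^ 5 * X + η * S) ≤ 18 * (K ^ 7 * X) + 2 * (K ^ 7 * η) := by
      have : η * S ≤ η * 1 := by gcongr
      calc _ = 18 * (K ^ 7 * X) + 2 * (K ^ 2 * (η * S)) := by ring
        _ ≤ 18 * (K ^ 7 * X) + 2 * (K ^ 7 * (η * 1)) := by gcongr; norm_num
        _ = _ := by ring
    have b3 : η ≤ K ^ 7 * η := le_mul_of_one_le_left hη (one_le_pow₀ hK)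
    have b4 : 0 ≤ K ^ 7 * η := by positivity
    linarith

/-- The source is only O(s) uniformly in ε, but it oscillates. From ε⁴∂ₜₜφ = -φ + ε²g with bounded
g, and the same relation without g for `oscil`, the source is up to O(ε²) the time derivative of
-iε⁴G. Correcting the unknown by iε⁴G therefore leaves a source of size ε². -/
lemma localError_psi_second (hab : a < b) (hN : 0 < N) (hE : Even N) (hB : ProdBound a b N K)
    (hε : 0 < ε) (hS : 0 < S) (hS1 : S ≤ 1) (hη : 0 ≤ η)
    (h : ApproxSol a b S ε N η K ps ph pi δ₁ δ₂) :
    nrm a b N 1 (fun l => ps S l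
      - pathPsi a b ε N (ps 0) (filteredRate a b N S (ps 0) (ph 0)) (ph 0) (pi 0) S l)
      ≤ 40 * K ^ 7 * (ε ^ 2 + η) * S := by
  have hK := hB.one_le
  have h0 : (0 : ℝ) ∈ Icc 0 S := left_mem_Icc.2 hS.le
  have hSS : S ∈ Icc 0 S := right_mem_Icc.2 hS.le
  have hε' : (ε : ℂ) ≠ 0 := by exact_mod_cast hε.ne'
  set A' := filteredRate a b N S (ps 0) (ph 0)
  set L : ℝ → ℤ → ℂ := fun s l => ps 0 l + s * A' l
  set G : ℝ → ℤ → ℂ := fun s l =>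
    dprod a b N (pi s) (ps s) l - dprod a b N (oscil' ε (ph 0) (pi 0) s) (L s) l
  set g : ℝ → ℤ → ℂ := fun t l =>
    -(freq a b l : ℂ) ^ 2 * ph t l + (dens a b N (ps t) l + δ₂ t l)
  set R : ℝ → ℤ → ℂ := fun t => rate a b N (ps t) (ph t) (δ₁ t)
  have hL : ∀ l s, HasDerivAt (fun s => L s l) (A' l) s := fun l s => by
    refine (((Complex.ofRealCLM.hasDerivAt (x := s)).mul_const (A' l)).const_add
      (ps 0 l)).congr_deriv ?_
    simp
  have hLc : ∀ l, ContinuousOn (fun s => L s l) (Icc 0 S) := fun l s _ =>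
    (hL l s).continuousAt.continuousWithinAt
  have hG : ∀ l ∈ modes N, ∀ t ∈ Ioo 0 S, HasDerivAt (fun s => G s l)
      ((dprod a b N (fun l => 1 / (ε : ℂ) ^ 2 * (g t l - 1 / (ε : ℂ) ^ 2 * ph t l)) (ps t) l
        + dprod a b N (pi t) (R t) l)
       - (dprod a b N (fun l => -(1 / (ε : ℂ) ^ 4) * oscil ε (ph 0) (pi 0) t l) (L t) l
        + dprod a b N (oscil' ε (ph 0) (pi 0) t) A' l)) t := fun l _ t ht => by
    refine (hasDerivAt_dprod hab hN (fun k _ => (h.deriv_pi k t ht).congr_deriv ?_)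
      (fun k _ => h.deriv_ps k t ht) l).sub
      (hasDerivAt_dprod hab hN (fun k _ => hasDerivAt_oscil' _ _ t k hε) (fun k _ => hL k t) l)
    simp only [g]; ring
  have hGc : ∀ l, ContinuousOn (fun s => G s l) (Icc 0 S) := fun l =>
    (continuousOn_dprod hab hN (fun k _ => h.cont_pi k) (fun k _ => h.cont_ps k) l).sub
      (continuousOn_dprod hab hN (fun k _ s _ =>
        (hasDerivAt_oscil' _ _ s k hε).continuousAt.continuousWithinAt) (fun k _ => hLc k) l)
  have main := nrm_le_of_hasDerivAt_phase (a := a) (b := b) (N := N) (s := 1)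
    (M := 20 * K ^ 7 * ε ^ 2 + η) hS.le (fun l => -(freq a b l ^ 2))
    (u := fun s l => (ps s l - pathPsi a b ε N (ps 0) A' (ph 0) (pi 0) s l)
      + Complex.I * (ε ^ 4 * G s l))
    (f := fun s l => Complex.I * (((((ε ^ 2 : ℝ) : ℂ) * dprod a b N (g s) (ps s) l
      + ((ε ^ 4 : ℝ) : ℂ) * dprod a b N (pi s) (R s) l)
      + (-(((ε ^ 4 : ℝ) : ℂ) * dprod a b N (oscil' ε (ph 0) (pi 0) s) A' l)
      + Complex.I * (((ε ^ 4 : ℝ) : ℂ) * ((freq a b l : ℂ) ^ 2 * G s l)))) + δ₁ s l))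
    (fun l _ => ((h.cont_ps l).sub fun s _ =>
      (hasDerivAt_pathPsi _ _ _ _ s l).continuousAt.continuousWithinAt).add
      (continuousOn_const.mul (continuousOn_const.mul (hGc l))))
    (fun l hl t ht => ?_) (fun l _ => by simp [pathPsi_zero, G, L, oscil'_zero_fun]) fun t ht => ?_
  · have c1 := nrm_sub_le (a := a) (b := b) (N := N) (s := 1) (fun l =>
      (ps S l - pathPsi a b ε N (ps 0) A' (ph 0) (pi 0) S l) + Complex.I * (ε ^ 4 * G S l))
      (fun l => Complex.I * (((ε ^ 4 : ℝ) : ℂ) * G S l))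
    rw [nrm_I_mul, nrm_real_mul, abs_of_nonneg (by positivity)] at c1
    have e : (fun l => (ps S l - pathPsi a b ε N (ps 0) A' (ph 0) (pi 0) S l)
        + Complex.I * (ε ^ 4 * G S l) - Complex.I * (((ε ^ 4 : ℝ) : ℂ) * G S l))
        = fun l => ps S l - pathPsi a b ε N (ps 0) A' (ph 0) (pi 0) S l := by
      ext l; push_cast; ring
    rw [e] at c1
    -- Removing the correction at the final time must cost O(ε²S), not just O(ε²). The factors in
    -- `G` differ from their counterparts by O(S), and ε²∂ₜφ is bounded.
    have i1 : ε ^ 4 * nrm a b N 1 (G S) ≤ 13 * K ^ 7 * ε ^ 2 * S := by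
      have e2 : ∀ l, ((ε ^ 2 : ℝ) : ℂ) * G S l
          = dprod a b N (fun l => ((ε ^ 2 : ℝ) : ℂ) * (pi S l - oscil' ε (ph 0) (pi 0) S l)) (ps S) l
          + dprod a b N (fun l => ((ε ^ 2 : ℝ) : ℂ) * oscil' ε (ph 0) (pi 0) S l)
            (fun l => ps S l - L S l) l := fun l => by
        rw [dprod_const_mul_left, dprod_const_mul_left, dprod_sub_left, dprod_sub_right]
        simp only [G]; ring
      have i2 := nrm_le_add_of_eq (a := a) (b := b) (s := 1) fun l (_ : l ∈ modes N) => e2 l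
      rw [nrm_real_mul, abs_of_nonneg (by positivity)] at i2
      have i3 := hB.le_one (c := fun l => ((ε ^ 2 : ℝ) : ℂ) * (pi S l - oscil' ε (ph 0) (pi 0) S l))
        (x := 3 * K ^ 3 * S) (by
          rw [nrm_real_mul, abs_of_nonneg (by positivity)]
          exact (h.nrm_oscil_sub_le hab hN hE hB hε hSS).2)
        ((nrm_mono (by norm_num : 1 ≤ 5) _).trans (h.nrm_ps S hSS))
      have i4 := hB.le_one (c := fun l => ((ε ^ 2 : ℝ) : ℂ) * oscil' ε (ph 0) (pi 0) S l)
        (x := 2 * K) (by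
          rw [nrm_real_mul, abs_of_nonneg (by positivity)]
          exact (mul_le_mul_of_nonneg_left (nrm_mono (by norm_num : 1 ≤ 5) _) (sq_nonneg ε)).trans
            (h.nrm_oscil'_le_two hε hS.le S))
        (h.nrm_remainder_le_second hB hS hSS)
      have k : K ^ 5 ≤ K ^ 7 := pow_le_pow_right₀ hK (by norm_num)
      calc ε ^ 4 * nrm a b N 1 (G S) = ε ^ 2 * (ε ^ 2 * nrm a b N 1 (G S)) := by ring
        _ ≤ ε ^ 2 * (K * (3 * K ^ 3 * S) * K + K * (2 * K) * (5 * K ^ 3 * S)) := by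
          gcongr; linarith
        _ = 13 * K ^ 5 * ε ^ 2 * S := by ring
        _ ≤ _ := by gcongr
    have b1 : η ≤ K ^ 7 * η := le_mul_of_one_le_left hη (one_le_pow₀ hK)
    have b2 : 0 ≤ K ^ 7 * ε ^ 2 := by positivity
    have b3 : 0 ≤ K ^ 7 * η := by positivity
    calc _ ≤ (20 * K ^ 7 * ε ^ 2 + η) * S + 13 * K ^ 7 * ε ^ 2 * S := by linarith
      _ = (33 * (K ^ 7 * ε ^ 2) + η) * S := by ring
      _ ≤ (40 * (K ^ 7 * ε ^ 2) + 40 * (K ^ 7 * η)) * S := by gcongr ?_ * S; linarith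
      _ = _ := by ring
  -- The terms of order one, `ph * ps` and `oscil * L`, cancel here against those in ε⁴ times the
  -- derivative of `G`; the terms listed in `f` are what survives.
  · refine (((h.deriv_ps l t ht).sub (hasDerivAt_pathPsi _ _ _ _ t l)).add
      (((hG l hl t ht).const_mul ((ε : ℂ) ^ 4)).const_mul Complex.I)).congr_deriv ?_
    simp only [dprod_const_mul_left, dprod_sub_left]
    simp only [L, R, rate]
    push_cast
    field_simp
    ring
  · have ht' := Ioo_subset_Icc_self ht
    have q : ∀ x : ℝ, ε ^ 4 * x = ε ^ 2 * (ε ^ 2 * x) := fun x => by ring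
    have e2 : (0 : ℝ) ≤ ε ^ 2 := by positivity
    have e4 : (0 : ℝ) ≤ ε ^ 4 := by positivity
    have hps1 := (nrm_mono (by norm_num : 1 ≤ 5) _).trans (h.nrm_ps t ht')
    have hps3 := (nrm_mono (by norm_num : 3 ≤ 5) _).trans (h.nrm_ps t ht')
    have hA' : nrm a b N 3 A' ≤ _ := nrm_filteredRate_le hB hS (h.nrm_ps 0 h0) (h.nrm_ph 0 h0)
    have hR : nrm a b N 3 (R t) ≤ _ := nrm_rate_le hB (h.nrm_ps t ht') (h.nrm_ph t ht') (h.nrm_δ₁_three t ht')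
    have hpi : ∀ k ≤ 5, nrm a b N k (fun l => ((ε ^ 2 : ℝ) : ℂ) * pi t l) ≤ K := fun k hk => by
      rw [nrm_real_mul, abs_of_nonneg e2]
      exact (mul_le_mul_of_nonneg_left (nrm_mono hk _) e2).trans (h.nrm_pi t ht')
    have hos : ∀ k ≤ 5, nrm a b N k (fun l => ((ε ^ 2 : ℝ) : ℂ) * oscil' ε (ph 0) (pi 0) t l)
        ≤ 2 * K := fun k hk => by
      rw [nrm_real_mul, abs_of_nonneg e2]
      exact (mul_le_mul_of_nonneg_left (nrm_mono hk _) e2).trans (h.nrm_oscil'_le_two hε hS.le t)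
    -- One factor ε² is kept next to each time derivative of φ, where it makes that factor bounded.
    -- The second factor ε² of ε⁴ is the gain.
    have pull : ∀ (k : ℕ) (c d : ℤ → ℂ), nrm a b N k (dprod a b N (fun l => ((ε ^ 2 : ℝ) : ℂ) * c l) d)
        = ε ^ 2 * nrm a b N k (dprod a b N c d) := fun k c d => by
      rw [nrm_congr fun l _ => dprod_const_mul_left _ _ _ _, nrm_real_mul, abs_of_nonneg e2]
    have i1 : nrm a b N 1 (dprod a b N (g t) (ps t)) ≤ _ :=
      hB.le_one (h.nrm_forcing_le hab hN hE hB ht') hps1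
    have i2 := hB.le_one (hpi 1 (by norm_num)) ((nrm_mono (by norm_num : 1 ≤ 3) _).trans hR)
    have i3 := hB.le_one (hos 1 (by norm_num)) ((nrm_mono (by norm_num : 1 ≤ 3) _).trans hA')
    have i4 := hB.le_three (hpi 3 (by norm_num)) hps3
    have i5 := hB.le_three (hos 3 (by norm_num)) (show nrm a b N 3 (L t) ≤ _ from h.nrm_linear_le hB hS hS1 ht')
    rw [pull] at i2 i3 i4 i5
    have i6 : _ ≤ nrm a b N 3 _ + nrm a b N 3 _ := (nrm_freq_sq_mul_le (a := a) (b := b) (N := N) (s := 1) (G t)).trans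
      (nrm_sub_le (dprod a b N (pi t) (ps t)) (dprod a b N (oscil' ε (ph 0) (pi 0) t) (L t)))
    have i7 := h.nrm_δ₁ t ht'
    rw [nrm_I_mul]
    refine (nrm_add_le _ _).trans (add_le_add ?_ i7)
    refine (nrm_add_le _ _).trans ?_
    have s1 := nrm_add_le (a := a) (b := b) (N := N) (s := 1)
      (fun l => ((ε ^ 2 : ℝ) : ℂ) * dprod a b N (g t) (ps t) l)
      (fun l => ((ε ^ 4 : ℝ) : ℂ) * dprod a b N (pi t) (R t) l)
    have s2 := nrm_add_le (a := a) (b := b) (N := N) (s := 1)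
      (fun l => -(((ε ^ 4 : ℝ) : ℂ) * dprod a b N (oscil' ε (ph 0) (pi 0) t) A' l))
      (fun l => Complex.I * (((ε ^ 4 : ℝ) : ℂ) * ((freq a b l : ℂ) ^ 2 * G t l)))
    rw [nrm_real_mul, nrm_real_mul, abs_of_nonneg e2, abs_of_nonneg e4] at s1
    rw [nrm_neg, nrm_I_mul, nrm_real_mul, nrm_real_mul, abs_of_nonneg e4] at s2
    have k5 : K ^ 5 ≤ K ^ 7 := pow_le_pow_right₀ hK (by norm_num)
    have k3 : K ^ 3 ≤ K ^ 5 := pow_le_pow_right₀ hK (by norm_num)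
    have t1 := mul_le_mul_of_nonneg_left i1 e2
    have t2 := mul_le_mul_of_nonneg_left i2 e2
    have t3 := mul_le_mul_of_nonneg_left i3 e2
    have t6 := mul_le_mul_of_nonneg_left i6 e4
    have t4 := mul_le_mul_of_nonneg_left i4 e2
    have t5 := mul_le_mul_of_nonneg_left i5 e2
    have u5 := mul_le_mul_of_nonneg_left k5 e2
    have u3 := mul_le_mul_of_nonneg_left k3 e2
    rw [q] at s1 s2 t6
    rw [q] at s2 t6
    have v : ε ^ 2 * (K * (3 * K ^ 3) * K) + ε ^ 2 * (K * K * (3 * K ^ 3))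
        + (ε ^ 2 * (K * (2 * K) * (2 * K ^ 3)) + (ε ^ 2 * (K * K * K)
        + ε ^ 2 * (K * (2 * K) * (3 * K ^ 3)))) ≤ 20 * K ^ 7 * ε ^ 2 := by
      have : ε ^ 2 * (K * (3 * K ^ 3) * K) + ε ^ 2 * (K * K * (3 * K ^ 3))
        + (ε ^ 2 * (K * (2 * K) * (2 * K ^ 3)) + (ε ^ 2 * (K * K * K)
        + ε ^ 2 * (K * (2 * K) * (3 * K ^ 3)))) = 16 * (ε ^ 2 * K ^ 5) + ε ^ 2 * K ^ 3 := by ring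
      rw [this]
      have : 0 ≤ ε ^ 2 * K ^ 5 := by positivity
      linarith
    linarith

end ApproxSol

end KGS

namespace KGS

/-! ### The local error of the Klein-Gordon part -/

/-- The coefficients of the numerical approximation of `φ` at time `s` after a time level with
coefficients `P`, `Q` of `φ`, `∂ₜφ`, where `F`, `F'` are those of `|ψ|²` and of its derivative. -/
noncomputable def pathPhi (a b ε : ℝ) (P Q F F' : ℤ → ℂ) (s : ℝ) (l : ℤ) : ℂ :=
  (Real.cos (omega ε (freq a b l) * s) : ℝ) * P l
    + (Real.sin (omega ε (freq a b l) * s) / omega ε (freq a b l) : ℝ) * Q l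
    + coefP ε (freq a b l) s * F l + coefQ ε (freq a b l) s * F' l

/-- The time derivative of `pathPhi`. -/
noncomputable def pathPi (a b ε : ℝ) (P Q F F' : ℤ → ℂ) (s : ℝ) (l : ℤ) : ℂ :=
  (-(omega ε (freq a b l) * Real.sin (omega ε (freq a b l) * s)) : ℝ) * P l
    + (Real.cos (omega ε (freq a b l) * s) : ℝ) * Q l
    + coefP' ε (freq a b l) s * F l + coefQ' ε (freq a b l) s * F' l

/-- The characteristic variables `ε²∂ₜφ ± iε²ωφ` of the Klein-Gordon equation, for `σ = ±1`. -/
noncomputable def charVar (a b σ ε : ℝ) (P Q : ℤ → ℂ) (l : ℤ) : ℂ :=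
  (ε : ℂ) ^ 2 * Q l + Complex.I * σ * (ε ^ 2 * omega ε (freq a b l) : ℝ) * P l

section
variable {a b ε : ℝ} (P Q F F' : ℤ → ℂ) (s : ℝ) (l : ℤ)

lemma pathPhi_zero : pathPhi a b ε P Q F F' 0 l = P l := by
  simp [pathPhi, coefP, coefQ]

lemma pathPi_zero : pathPi a b ε P Q F F' 0 l = Q l := by
  simp [pathPi, coefP', coefQ']

lemma hasDerivAt_pathPhi (hε : 0 < ε) :
    HasDerivAt (fun s => pathPhi a b ε P Q F F' s l) (pathPi a b ε P Q F F' s l) s := by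
  have hω := omega_pos (freq a b l) hε
  have h0 := hasDerivAt_omega_mul (omega ε (freq a b l)) s
  refine ((((h0.cos.ofReal_comp.mul_const (P l)).add
    ((h0.sin.div_const _).ofReal_comp.mul_const (Q l))).add
    ((hasDerivAt_coefP _ hε s).ofReal_comp.mul_const (F l))).add
    ((hasDerivAt_coefQ _ hε s).ofReal_comp.mul_const (F' l))).congr_deriv ?_
  unfold pathPi
  congr 5
  · ring
  · field_simp

/-- The step for φ solves the Klein-Gordon mode exactly, with the source |ψ|² replaced by `F + s
F'`. -/
lemma hasDerivAt_pathPi (hε : 0 < ε) :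
    HasDerivAt (fun s => pathPi a b ε P Q F F' s l)
      (-(omega ε (freq a b l) : ℂ) ^ 2 * pathPhi a b ε P Q F F' s l
        + 1 / (ε : ℂ) ^ 2 * (F l + s * F' l)) s := by
  have hω : (omega ε (freq a b l) : ℂ) ≠ 0 := by exact_mod_cast (omega_pos (freq a b l) hε).ne'
  have h0 := hasDerivAt_omega_mul (omega ε (freq a b l)) s
  refine (((((h0.sin.const_mul (omega ε (freq a b l))).neg.ofReal_comp.mul_const (P l)).add
    (h0.cos.ofReal_comp.mul_const (Q l))).add
    ((hasDerivAt_coefP' _ hε s).ofReal_comp.mul_const (F l))).add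
    ((hasDerivAt_coefQ' _ hε s).ofReal_comp.mul_const (F' l))).congr_deriv ?_
  unfold pathPhi
  push_cast
  field_simp
  ring

end

section densRate
variable {a b K : ℝ} {N : ℕ}

lemma ProdBound.nrm_densRate_le (hab : a < b) (hN : 0 < N) (hE : Even N) (hB : ProdBound a b N K)
    {A A' : ℤ → ℂ} {x y : ℝ} (h1 : nrm a b N 1 A ≤ x) (h2 : nrm a b N 1 A' ≤ y) :
    nrm a b N 1 (densRate a b N A A') ≤ 2 * (K * x * y) := by
  have i1 := hB.le_one h2 ((nrm_dconj hab hN hE 1 A).le.trans h1)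
  have i2 := hB.le_one h1 ((nrm_dconj hab hN hE 1 A').le.trans h2)
  refine (nrm_add_le _ _).trans ?_
  linarith

end densRate

namespace ApproxSol

variable {a b S ε : ℝ} {N : ℕ} {η K : ℝ} {ps ph pi δ₁ δ₂ : ℝ → ℤ → ℂ}

lemma hasDerivAt_dens (hab : a < b) (hN : 0 < N) (h : ApproxSol a b S ε N η K ps ph pi δ₁ δ₂)
    {t : ℝ} (ht : t ∈ Ioo 0 S) (l : ℤ) : HasDerivAt (fun t => dens a b N (ps t) l)
      (densRate a b N (ps t) (rate a b N (ps t) (ph t) (δ₁ t)) l) t :=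
  hasDerivAt_dprod hab hN (fun k _ => h.deriv_ps k t ht)
    (fun k _ => hasDerivAt_dconj hab hN (fun j _ => h.deriv_ps j t ht) k) l

lemma continuousOn_dens (hab : a < b) (hN : 0 < N) (h : ApproxSol a b S ε N η K ps ph pi δ₁ δ₂)
    (l : ℤ) : ContinuousOn (fun t => dens a b N (ps t) l) (Icc 0 S) :=
  continuousOn_dprod hab hN (fun k _ => h.cont_ps k)
    (fun k _ => continuousOn_dconj hab hN (fun j _ => h.cont_ps j) k) l

lemma nrm_densRate_exact_le (hab : a < b) (hN : 0 < N) (hE : Even N) (hB : ProdBound a b N K)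
    (h : ApproxSol a b S ε N η K ps ph pi δ₁ δ₂) {t : ℝ} (ht : t ∈ Icc 0 S) :
    nrm a b N 1 (densRate a b N (ps t) (rate a b N (ps t) (ph t) (δ₁ t))) ≤ 6 * K ^ 5 := by
  refine (hB.nrm_densRate_le hab hN hE ((nrm_mono (by norm_num : 1 ≤ 5) _).trans (h.nrm_ps t ht))
    ((nrm_mono (by norm_num : 1 ≤ 3) _).trans
    (nrm_rate_le hB (h.nrm_ps t ht) (h.nrm_ph t ht) (h.nrm_δ₁_three t ht)))).trans (le_of_eq ?_)
  ring

lemma nrm_densRate_filtered_le (hab : a < b) (hN : 0 < N) (hE : Even N) (hB : ProdBound a b N K)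
    (hS : 0 < S) (h : ApproxSol a b S ε N η K ps ph pi δ₁ δ₂) :
    nrm a b N 1 (densRate a b N (ps 0) (filteredRate a b N S (ps 0) (ph 0))) ≤ 4 * K ^ 5 := by
  have h0 : (0 : ℝ) ∈ Icc 0 S := left_mem_Icc.2 hS.le
  refine (hB.nrm_densRate_le hab hN hE ((nrm_mono (by norm_num : 1 ≤ 5) _).trans (h.nrm_ps 0 h0))
    ((nrm_mono (by norm_num : 1 ≤ 3) _).trans
    (nrm_filteredRate_le hB hS (h.nrm_ps 0 h0) (h.nrm_ph 0 h0)))).trans (le_of_eq ?_)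
  ring

/-- Both the true and the filtered rate of |ψ|² are bounded uniformly in ε, which gives a remainder
of first order in s. -/
lemma nrm_dens_remainder_le_second (hab : a < b) (hN : 0 < N) (hE : Even N)
    (hB : ProdBound a b N K) (hS : 0 < S) (h : ApproxSol a b S ε N η K ps ph pi δ₁ δ₂) {s : ℝ}
    (hs : s ∈ Icc 0 S) :
    nrm a b N 1 (fun l => dens a b N (ps s) l - (dens a b N (ps 0) l
      + s * densRate a b N (ps 0) (filteredRate a b N S (ps 0) (ph 0)) l)) ≤ 10 * K ^ 5 * s := by
  have hss : Icc 0 s ⊆ Icc 0 S := Icc_subset_Icc_right hs.2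
  set D := densRate a b N (ps 0) (filteredRate a b N S (ps 0) (ph 0))
  have := nrm_sub_le_of_hasDerivAt (a := a) (b := b) (N := N) (s := 1) (K := 10 * K ^ 5) hs.1
    (f := fun s l => dens a b N (ps s) l - s * D l)
    (f' := fun s l => densRate a b N (ps s) (rate a b N (ps s) (ph s) (δ₁ s)) l - D l)
    (fun l _ => ((h.continuousOn_dens hab hN l).mono hss).sub (Continuous.continuousOn (by fun_prop)))
    (fun l _ t ht => by
      refine ((h.hasDerivAt_dens hab hN ⟨ht.1, ht.2.trans_le hs.2⟩ l).sub
        ((Complex.ofRealCLM.hasDerivAt (x := t)).mul_const _)).congr_deriv ?_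
      simp)
    (fun t ht => by
      have i1 := h.nrm_densRate_exact_le hab hN hE hB (hss (Ioo_subset_Icc_self ht))
      have i2 : nrm a b N 1 D ≤ _ := h.nrm_densRate_filtered_le hab hN hE hB hS
      refine (nrm_sub_le _ _).trans ?_
      linarith)
  rw [sub_zero] at this
  refine le_trans (le_of_eq (nrm_congr fun l _ => ?_)) this
  simp; ring

lemma nrm_dens_remainder_le_first (hab : a < b) (hN : 0 < N) (hE : Even N)
    (hB : ProdBound a b N K) (hε : 0 < ε) (hε1 : ε ≤ 1) (hS : 0 < S) (hS1 : S ≤ 1) (hη : 0 ≤ η)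
    (h : ApproxSol a b S ε N η K ps ph pi δ₁ δ₂) {s : ℝ} (hs : s ∈ Icc 0 S) :
    nrm a b N 1 (fun l => dens a b N (ps s) l - (dens a b N (ps 0) l
      + s * densRate a b N (ps 0) (filteredRate a b N S (ps 0) (ph 0)) l))
      ≤ 40 * K ^ 9 * (S ^ 2 / ε ^ 2) + 4 * K ^ 9 * η := by
  have hK := hB.one_le
  have h0 : (0 : ℝ) ∈ Icc 0 S := left_mem_Icc.2 hS.le
  set A' := filteredRate a b N S (ps 0) (ph 0)
  set L : ℤ → ℂ := fun l => ps 0 l + s * A' l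
  -- With ψ = L + ρ, where L is linear in time, |ψ|² - |L|² is linear in ρ, and |L|² exceeds its own
  -- linear part by s²|A'|².
  have e : ∀ l, dens a b N (ps s) l - (dens a b N (ps 0) l + s * densRate a b N (ps 0) A' l)
      = ((s ^ 2 : ℝ) : ℂ) * dprod a b N A' (dconj a b N A') l
        + (dprod a b N (fun l => ps s l - L l) (dconj a b N (ps s)) l
          + dprod a b N L (dconj a b N (fun l => ps s l - L l)) l) := fun l => by
    have e1 : dconj a b N (fun l => ps s l - L l)
        = fun l => dconj a b N (ps s) l - dconj a b N L l := funext fun l => dconj_sub _ _ l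
    have e2 : dconj a b N L = fun l => dconj a b N (ps 0) l + s * dconj a b N A' l :=
      funext fun l => by simp only [L]; rw [dconj_add, dconj_const_mul]; simp
    rw [e1, dprod_sub_left, dprod_sub_right, e2]
    have e3 : dprod a b N L (fun l => dconj a b N (ps 0) l + s * dconj a b N A' l) l
      = dprod a b N (ps 0) (dconj a b N (ps 0)) l + s * dprod a b N A' (dconj a b N (ps 0)) l
        + s * (dprod a b N (ps 0) (dconj a b N A') l + s * dprod a b N A' (dconj a b N A') l) := by
      simp only [L]
      rw [dprod_add_right, dprod_const_mul_right, dprod_add_left, dprod_add_left,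
        dprod_const_mul_left, dprod_const_mul_left]
    rw [e3]
    unfold dens densRate
    push_cast; ring
  rw [nrm_congr fun l _ => e l]
  have hA' : nrm a b N 1 A' ≤ 2 * K ^ 3 := (nrm_mono (by norm_num : 1 ≤ 3) _).trans
    (nrm_filteredRate_le hB hS (h.nrm_ps 0 h0) (h.nrm_ph 0 h0))
  have hL : nrm a b N 1 L ≤ 3 * K ^ 3 := (nrm_mono (by norm_num : 1 ≤ 3) _).trans
    (h.nrm_linear_le hB hS hS1 hs)
  have hρ := h.nrm_remainder_le_first hB hε hε1 hS hη hs
  have hps := (nrm_mono (by norm_num : 1 ≤ 5) _).trans (h.nrm_ps s hs)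
  have i1 := hB.le_one hA' ((nrm_dconj hab hN hE 1 A').le.trans hA')
  have i2 := hB.le_one hρ ((nrm_dconj hab hN hE 1 (ps s)).le.trans hps)
  have i3 := hB.le_one hL ((nrm_dconj hab hN hE 1 _).le.trans hρ)
  have a1 := nrm_add_le (a := a) (b := b) (N := N) (s := 1)
    (dprod a b N (fun l => ps s l - L l) (dconj a b N (ps s)))
    (dprod a b N L (dconj a b N (fun l => ps s l - L l)))
  refine (nrm_add_le _ _).trans ?_
  rw [nrm_real_mul, abs_of_nonneg (sq_nonneg s)]
  set X := S ^ 2 / ε ^ 2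
  have hX : 0 ≤ X := by positivity
  have hsX : s ^ 2 ≤ X := by
    rw [le_div_iff₀ (by positivity)]
    have hε2 : ε ^ 2 ≤ 1 := pow_le_one₀ hε.le hε1
    have : s ^ 2 ≤ S ^ 2 := pow_le_pow_left₀ hs.1 hs.2 2
    nlinarith [sq_nonneg s]
  have hηS : η * S ≤ η := mul_le_of_le_one_right hη hS1
  have b1 : s ^ 2 * nrm a b N 1 (dprod a b N A' (dconj a b N A')) ≤ 4 * (K ^ 9 * X) := by
    have n := nrm_nonneg (a := a) (b := b) (N := N) (s := 1) (dprod a b N A' (dconj a b N A'))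
    calc _ ≤ X * (K * (2 * K ^ 3) * (2 * K ^ 3)) := by gcongr
      _ = 4 * (K ^ 7 * X) := by ring
      _ ≤ _ := by gcongr; norm_num
  have b2 : K * (9 * K ^ 5 * X + η * S) * K ≤ 9 * (K ^ 9 * X) + K ^ 9 * η := by
    calc _ = 9 * (K ^ 7 * X) + K ^ 2 * (η * S) := by ring
      _ ≤ 9 * (K ^ 9 * X) + K ^ 9 * η := by gcongr <;> norm_num
  have b3 : K * (3 * K ^ 3) * (9 * K ^ 5 * X + η * S) ≤ 27 * (K ^ 9 * X) + 3 * (K ^ 9 * η) := by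
    calc _ = 27 * (K ^ 9 * X) + 3 * (K ^ 4 * (η * S)) := by ring
      _ ≤ 27 * (K ^ 9 * X) + 3 * (K ^ 9 * η) := by gcongr; norm_num
  have e1 : dconj a b N (fun l => ps s l - L l) = dconj a b N (fun l => ps s l - (ps 0 l + s * A' l)) :=
    rfl
  linarith

/-- In the characteristic variables the second-order equation becomes two scalar equations with
phases ±ω. The powers of ε cancel in the source, so |ψ|² and the defect enter with factor one. -/
lemma hasDerivAt_charVar (hε : 0 < ε) (h : ApproxSol a b S ε N η K ps ph pi δ₁ δ₂) {σ : ℝ}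
    (hσ : σ ^ 2 = 1) (F F' : ℤ → ℂ) (l : ℤ) {t : ℝ} (ht : t ∈ Ioo 0 S) :
    HasDerivAt (fun t => charVar a b σ ε
        (fun l => ph t l - pathPhi a b ε (ph 0) (pi 0) F F' t l)
        (fun l => pi t l - pathPi a b ε (ph 0) (pi 0) F F' t l) l)
      (Complex.I * (σ * omega ε (freq a b l) : ℝ) * charVar a b σ ε
        (fun l => ph t l - pathPhi a b ε (ph 0) (pi 0) F F' t l)
        (fun l => pi t l - pathPi a b ε (ph 0) (pi 0) F F' t l) l
        + (dens a b N (ps t) l - (F l + t * F' l) + δ₂ t l)) t := by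
  have hε' : (ε : ℂ) ≠ 0 := by exact_mod_cast hε.ne'
  have hσ' : (σ : ℂ) ^ 2 = 1 := by exact_mod_cast hσ
  have hω : (omega ε (freq a b l) : ℂ) ^ 2
      = 1 / (ε : ℂ) ^ 2 * ((freq a b l : ℂ) ^ 2 + 1 / (ε : ℂ) ^ 2) := by
    exact_mod_cast omega_sq (freq a b l) hε
  refine ((((h.deriv_pi l t ht).sub (hasDerivAt_pathPi _ _ F F' t l hε)).const_mul
    ((ε : ℂ) ^ 2)).add (((h.deriv_ph l t ht).sub (hasDerivAt_pathPhi _ _ F F' t l hε)).const_mul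
    (Complex.I * σ * (ε ^ 2 * omega ε (freq a b l) : ℝ)))).congr_deriv ?_
  unfold charVar
  set x := ph t l
  set y := pathPhi a b ε (ph 0) (pi 0) F F' t l
  have e1 : (ε : ℂ) ^ 2 * (1 / (ε : ℂ) ^ 2 * (-((freq a b l : ℂ) ^ 2 + 1 / (ε : ℂ) ^ 2) * x
      + (dens a b N (ps t) l + δ₂ t l))) = -(ε : ℂ) ^ 2 * (omega ε (freq a b l) : ℂ) ^ 2 * x
      + (dens a b N (ps t) l + δ₂ t l) := by
    rw [hω]; field_simp
  have e2 : (ε : ℂ) ^ 2 * (1 / (ε : ℂ) ^ 2 * (F l + t * F' l)) = F l + t * F' l := by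
    field_simp
  rw [mul_sub, e1, mul_add ((ε : ℂ) ^ 2) (-(omega ε (freq a b l) : ℂ) ^ 2 * y), e2]
  push_cast
  linear_combination (-(ε : ℂ) ^ 2 * (omega ε (freq a b l) : ℂ) ^ 2 * (x - y) * Complex.I ^ 2) * hσ'
    - ((ε : ℂ) ^ 2 * (omega ε (freq a b l) : ℂ) ^ 2 * (x - y)) * Complex.I_sq

lemma continuousOn_charVar (hε : 0 < ε) (h : ApproxSol a b S ε N η K ps ph pi δ₁ δ₂) (σ : ℝ)
    (F F' : ℤ → ℂ) (l : ℤ) :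
    ContinuousOn (fun t => charVar a b σ ε
        (fun l => ph t l - pathPhi a b ε (ph 0) (pi 0) F F' t l)
        (fun l => pi t l - pathPi a b ε (ph 0) (pi 0) F F' t l) l) (Icc 0 S) :=
  (continuousOn_const.mul ((h.cont_pi l).sub fun t _ =>
    (hasDerivAt_pathPi _ _ F F' t l hε).continuousAt.continuousWithinAt)).add
    (continuousOn_const.mul ((h.cont_ph l).sub fun t _ =>
    (hasDerivAt_pathPhi _ _ F F' t l hε).continuousAt.continuousWithinAt))

lemma localError_phi_first (hab : a < b) (hN : 0 < N) (hE : Even N) (hB : ProdBound a b N K)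
    (hε : 0 < ε) (hε1 : ε ≤ 1) (hS : 0 < S) (hS1 : S ≤ 1) (hη : 0 ≤ η)
    (h : ApproxSol a b S ε N η K ps ph pi δ₁ δ₂) {σ : ℝ} (hσ : σ ^ 2 = 1) {F F' : ℤ → ℂ}
    (hF : F = dens a b N (ps 0))
    (hF' : F' = densRate a b N (ps 0) (filteredRate a b N S (ps 0) (ph 0))) :
    nrm a b N 1 (charVar a b σ ε
        (fun l => ph S l - pathPhi a b ε (ph 0) (pi 0) F F' S l)
        (fun l => pi S l - pathPi a b ε (ph 0) (pi 0) F F' S l))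
      ≤ 40 * K ^ 9 * (S ^ 2 / ε ^ 2 + η) * S := by
  have hK := hB.one_le
  refine nrm_le_of_hasDerivAt_phase hS.le (fun l => σ * omega ε (freq a b l))
    (u := fun t => charVar a b σ ε
        (fun l => ph t l - pathPhi a b ε (ph 0) (pi 0) F F' t l)
        (fun l => pi t l - pathPi a b ε (ph 0) (pi 0) F F' t l))
    (fun l _ => h.continuousOn_charVar hε σ F F' l)
    (fun l _ t ht => h.hasDerivAt_charVar hε hσ F F' l ht)
    (fun l _ => by simp [charVar, pathPhi_zero, pathPi_zero]) fun t ht => ?_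
  have ht' := Ioo_subset_Icc_self ht
  refine (nrm_add_le _ _).trans ?_
  have i1 := h.nrm_dens_remainder_le_first hab hN hE hB hε hε1 hS hS1 hη ht'
  have i2 := h.nrm_δ₂ t ht'
  rw [← hF, ← hF'] at i1
  have b3 : η ≤ K ^ 9 * η := le_mul_of_one_le_left hη (one_le_pow₀ hK)
  have : 0 ≤ K ^ 9 * η := by positivity
  linarith

/-- The source remainder r is O(s) with bounded derivative. Integration by parts against the phase
ω, i.e. passing to u + r/(iσω) up to sign conventions fixed by `m`, replaces r by r'/ω = O(ε²). -/
lemma localError_phi_second (hab : a < b) (hN : 0 < N) (hE : Even N) (hB : ProdBound a b N K)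
    (hε : 0 < ε) (hS : 0 < S) (hη : 0 ≤ η)
    (h : ApproxSol a b S ε N η K ps ph pi δ₁ δ₂) {σ : ℝ} (hσ : σ ^ 2 = 1) {F F' : ℤ → ℂ}
    (hF : F = dens a b N (ps 0))
    (hF' : F' = densRate a b N (ps 0) (filteredRate a b N S (ps 0) (ph 0))) :
    nrm a b N 1 (charVar a b σ ε
        (fun l => ph S l - pathPhi a b ε (ph 0) (pi 0) F F' S l)
        (fun l => pi S l - pathPi a b ε (ph 0) (pi 0) F F' S l))
      ≤ 20 * K ^ 5 * (ε ^ 2 + η) * S := by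
  have hK := hB.one_le
  have hSS : S ∈ Icc 0 S := right_mem_Icc.2 hS.le
  have hσ1 : ‖(σ : ℂ)‖ = 1 := by
    rw [Complex.norm_real, Real.norm_eq_abs, ← abs_one, ← sq_eq_sq_iff_abs_eq_abs, hσ, one_pow]
  have hσ' : (σ : ℂ) ^ 2 = 1 := by exact_mod_cast hσ
  set u : ℝ → ℤ → ℂ := fun t => charVar a b σ ε
        (fun l => ph t l - pathPhi a b ε (ph 0) (pi 0) F F' t l)
        (fun l => pi t l - pathPi a b ε (ph 0) (pi 0) F F' t l)
  set r : ℝ → ℤ → ℂ := fun t l => dens a b N (ps t) l - (F l + t * F' l)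
  set r' : ℝ → ℤ → ℂ := fun t l =>
    densRate a b N (ps t) (rate a b N (ps t) (ph t) (δ₁ t)) l - F' l
  set m : ℤ → ℂ := fun l => -(Complex.I * σ * (omega ε (freq a b l) : ℂ)⁻¹)
  have hm : ∀ l ∈ modes N, ‖m l‖ ≤ ε ^ 2 := fun l _ => by
    simp only [m]
    rw [norm_neg, norm_mul, norm_mul, Complex.norm_I, hσ1, one_mul, one_mul, norm_inv,
      Complex.norm_real, Real.norm_eq_abs, abs_of_pos (omega_pos _ hε)]
    exact inv_omega_le _ hε
  have hr : ∀ l, ∀ t ∈ Ioo 0 S, HasDerivAt (fun t => r t l) (r' t l) t := fun l t ht => by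
    refine ((h.hasDerivAt_dens hab hN ht l).sub (((Complex.ofRealCLM.hasDerivAt (x := t)).mul_const
      (F' l)).const_add (F l))).congr_deriv ?_
    simp [r']
  have hrc : ∀ l, ContinuousOn (fun t => r t l) (Icc 0 S) := fun l =>
    (h.continuousOn_dens hab hN l).sub (Continuous.continuousOn (by fun_prop))
  have main := nrm_le_of_hasDerivAt_phase (a := a) (b := b) (N := N) (s := 1)
    (M := ε ^ 2 * (10 * K ^ 5) + η) hS.le (fun l => σ * omega ε (freq a b l))
    (u := fun t l => u t l + m l * r t l) (f := fun t l => m l * r' t l + δ₂ t l)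
    (fun l _ => (h.continuousOn_charVar hε σ F F' l).add (continuousOn_const.mul (hrc l)))
    (fun l _ t ht => ?_) (fun l _ => by simp [u, r, charVar, pathPhi_zero, pathPi_zero, hF])
    fun t ht => ?_
  · have c1 := nrm_sub_le (a := a) (b := b) (N := N) (s := 1) (fun l => u S l + m l * r S l)
      (fun l => m l * r S l)
    simp only [add_sub_cancel_right] at c1
    have i1 := nrm_mul_le_self (a := a) (b := b) (s := 1) (sq_nonneg ε) m (r S) hm
    have i2 := h.nrm_dens_remainder_le_second hab hN hE hB hS hSS
    rw [← hF, ← hF'] at i2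
    have i3 := mul_le_mul_of_nonneg_left i2 (sq_nonneg ε)
    have b3 : η ≤ K ^ 5 * η := le_mul_of_one_le_left hη (one_le_pow₀ hK)
    have b4 : 0 ≤ K ^ 5 * η := by positivity
    have : nrm a b N 1 (u S) ≤ (20 * (K ^ 5 * ε ^ 2) + η) * S := by
      have : ε ^ 2 * nrm a b N 1 (r S) ≤ ε ^ 2 * (10 * K ^ 5 * S) := i3
      calc _ ≤ (ε ^ 2 * (10 * K ^ 5) + η) * S + ε ^ 2 * (10 * K ^ 5 * S) := by linarith
        _ = _ := by ring
    refine this.trans ?_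
    calc _ ≤ (20 * (K ^ 5 * ε ^ 2) + 20 * (K ^ 5 * η)) * S := by gcongr; linarith
      _ = _ := by ring
  · have hω : (omega ε (freq a b l) : ℂ) ≠ 0 := by exact_mod_cast (omega_pos (freq a b l) hε).ne'
    refine ((h.hasDerivAt_charVar hε hσ F F' l ht).add ((hr l t ht).const_mul (m l))).congr_deriv ?_
    -- The multiplier `m` is the inverse of iσω, so the linear term applied to `m r` cancels the
    -- source `r`.
    have e : Complex.I * ((σ * omega ε (freq a b l) : ℝ) : ℂ) * m l = 1 := by
      simp only [m]; push_cast; field_simp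
      linear_combination (-Complex.I ^ 2) * hσ' - Complex.I_sq
    linear_combination (-r t l) * e
  · have ht' := Ioo_subset_Icc_self ht
    have i1 := nrm_mul_le_self (a := a) (b := b) (s := 1) (sq_nonneg ε) m (r' t) hm
    have i2 := h.nrm_densRate_exact_le hab hN hE hB ht'
    have i3 := h.nrm_densRate_filtered_le hab hN hE hB hS
    rw [← hF'] at i3
    have i4 : nrm a b N 1 (r' t) ≤ 10 * K ^ 5 := (nrm_sub_le _ _).trans (by linarith)
    refine (nrm_add_le _ _).trans (add_le_add (i1.trans ?_) (h.nrm_δ₂ t ht'))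
    gcongr

end ApproxSol

end KGS

namespace KGS

/-! ### Stability of the integrator -/

/-- The coefficients of `ψ` after one step of the integrator. -/
noncomputable def stepPsi (a b ε : ℝ) (N : ℕ) (τ : ℝ) (A P Q : ℤ → ℂ) : ℤ → ℂ :=
  pathPsi a b ε N A (filteredRate a b N τ A P) P Q τ

/-- The coefficients of `φ` after one step of the integrator. -/
noncomputable def stepPhi (a b ε : ℝ) (N : ℕ) (τ : ℝ) (A P Q : ℤ → ℂ) : ℤ → ℂ :=
  pathPhi a b ε P Q (dens a b N A) (densRate a b N A (filteredRate a b N τ A P)) τ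

/-- The coefficients of `∂ₜφ` after one step of the integrator. -/
noncomputable def stepPi (a b ε : ℝ) (N : ℕ) (τ : ℝ) (A P Q : ℤ → ℂ) : ℤ → ℂ :=
  pathPi a b ε P Q (dens a b N A) (densRate a b N A (filteredRate a b N τ A P)) τ

/-- The norm in which the integrator is stable. -/
noncomputable def energy (a b ε : ℝ) (N : ℕ) (A P Q : ℤ → ℂ) : ℝ :=
  nrm a b N 1 A + nrm a b N 1 (charVar a b 1 ε P Q) + nrm a b N 1 (charVar a b (-1) ε P Q)

/-! ### The energy controls the H¹ errors. -/

section energy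
variable {a b ε : ℝ} {N : ℕ} {A P Q : ℤ → ℂ}

lemma energy_nonneg : 0 ≤ energy a b ε N A P Q :=
  add_nonneg (add_nonneg (nrm_nonneg _) (nrm_nonneg _)) (nrm_nonneg _)

lemma nrm_le_energy : nrm a b N 1 A ≤ energy a b ε N A P Q := by
  have h1 := nrm_nonneg (a := a) (b := b) (N := N) (s := 1) (charVar a b 1 ε P Q)
  have h2 := nrm_nonneg (a := a) (b := b) (N := N) (s := 1) (charVar a b (-1) ε P Q)
  unfold energy; linarith

/-- The difference of the two characteristic variables is 2iε²ωφ, and ε²ω ≥ 1. -/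
lemma nrm_phi_le_energy (hε : 0 < ε) : nrm a b N 1 P ≤ energy a b ε N A P Q := by
  have h0 := nrm_nonneg (a := a) (b := b) (N := N) (s := 1) A
  have h1 := nrm_lin_le (a := a) (b := b) (N := N) (s := 1) (1 / 2) (-(1 / 2))
    (charVar a b 1 ε P Q) (charVar a b (-1) ε P Q)
  have h2 : nrm a b N 1 P ≤ nrm a b N 1 (fun l => 1 / 2 * charVar a b 1 ε P Q l
      + -(1 / 2) * charVar a b (-1) ε P Q l) := nrm_le_of_norm_le fun l _ => by
    have e : 1 / 2 * charVar a b 1 ε P Q l + -(1 / 2) * charVar a b (-1) ε P Q l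
        = Complex.I * ((ε ^ 2 * omega ε (freq a b l) : ℝ) : ℂ) * P l := by
      unfold charVar; push_cast; ring
    have h3 := one_le_eps_sq_mul_omega (freq a b l) hε
    rw [e, norm_mul, norm_mul, Complex.norm_I, one_mul, Complex.norm_real, Real.norm_eq_abs,
      abs_of_nonneg (by linarith)]
    exact le_mul_of_one_le_left (norm_nonneg _) h3
  have h4 := nrm_nonneg (a := a) (b := b) (N := N) (s := 1) (charVar a b 1 ε P Q)
  have h5 := nrm_nonneg (a := a) (b := b) (N := N) (s := 1) (charVar a b (-1) ε P Q)
  norm_num at h1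
  norm_num at h2
  unfold energy; linarith

lemma nrm_pi_le_energy : ε ^ 2 * nrm a b N 1 Q ≤ energy a b ε N A P Q := by
  have h0 := nrm_nonneg (a := a) (b := b) (N := N) (s := 1) A
  have h1 := nrm_lin_le (a := a) (b := b) (N := N) (s := 1) (1 / 2) (1 / 2)
    (charVar a b 1 ε P Q) (charVar a b (-1) ε P Q)
  have e : (fun l => ((ε ^ 2 : ℝ) : ℂ) * Q l) = fun l => 1 / 2 * charVar a b 1 ε P Q l
      + 1 / 2 * charVar a b (-1) ε P Q l := by
    ext l; unfold charVar; push_cast; ring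
  have h4 := nrm_nonneg (a := a) (b := b) (N := N) (s := 1) (charVar a b 1 ε P Q)
  have h5 := nrm_nonneg (a := a) (b := b) (N := N) (s := 1) (charVar a b (-1) ε P Q)
  rw [← abs_of_nonneg (sq_nonneg ε), ← nrm_real_mul, e]
  norm_num at h1 ⊢
  unfold energy; linarith

lemma energy_add_le (A' P' Q' : ℤ → ℂ) :
    energy a b ε N (fun l => A l + A' l) (fun l => P l + P' l) (fun l => Q l + Q' l)
      ≤ energy a b ε N A P Q + energy a b ε N A' P' Q' := by
  have h : ∀ σ, nrm a b N 1 (charVar a b σ ε (fun l => P l + P' l) (fun l => Q l + Q' l))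
      ≤ nrm a b N 1 (charVar a b σ ε P Q) + nrm a b N 1 (charVar a b σ ε P' Q') := fun σ =>
    nrm_le_add_of_eq fun l _ => by unfold charVar; ring
  have h1 := nrm_add_le (a := a) (b := b) (N := N) (s := 1) A A'
  unfold energy
  linarith [h 1, h (-1)]

end energy

/-! ### Lipschitz bounds for a single step. -/

section stability
variable {a b ε K : ℝ} {N : ℕ}

lemma ProdBound.nrm_sub_le (hB : ProdBound a b N K) {c c' d d' : ℤ → ℂ} {x y x' y' : ℝ}
    (h1 : nrm a b N 1 (fun l => c l - c' l) ≤ x) (h2 : nrm a b N 1 d ≤ y)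
    (h3 : nrm a b N 1 c' ≤ x') (h4 : nrm a b N 1 (fun l => d l - d' l) ≤ y') :
    nrm a b N 1 (fun l => dprod a b N c d l - dprod a b N c' d' l) ≤ K * x * y + K * x' * y' := by
  refine (nrm_le_add_of_eq (d := dprod a b N (fun l => c l - c' l) d)
    (e := dprod a b N c' (fun l => d l - d' l)) fun l _ => ?_).trans
    (add_le_add (hB.le_one h1 h2) (hB.le_one h3 h4))
  rw [dprod_sub_left, dprod_sub_right]; ring

/-- The filter bounds the symbol by 1/τ, so no derivative is lost. This is what the scheme gains by
not using -μ², and why no condition linking τ to h appears. -/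
lemma nrm_filteredRate_le_div (hB : ProdBound a b N K) {τ : ℝ} (hτ : 0 < τ) (hτ1 : τ ≤ 1)
    {A P : ℤ → ℂ} (h1 : nrm a b N 1 A ≤ 2 * K) (h2 : nrm a b N 1 P ≤ 2 * K) :
    nrm a b N 1 (filteredRate a b N τ A P) ≤ 6 * K ^ 3 / τ := by
  have hK := hB.one_le
  have hK3 : K ≤ K ^ 3 := le_self_pow₀ hK (by norm_num)
  unfold filteredRate
  refine (nrm_add_le _ _).trans ?_
  rw [nrm_I_mul]
  have i1 := nrm_mul_le_self (a := a) (b := b) (N := N) (s := 1) (M := 1 / τ) (by positivity)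
    (fun l => -Complex.I * (Real.sin (freq a b l ^ 2 * τ) / τ)) A fun l _ => by
      rw [norm_mul, norm_neg, Complex.norm_I, one_mul, ← Complex.ofReal_div, Complex.norm_real,
        Real.norm_eq_abs, abs_div, abs_of_pos hτ]
      gcongr
      exact Real.abs_sin_le_one _
  have i2 := hB.le_one h2 h1
  have i3 : 1 / τ * nrm a b N 1 A ≤ 1 / τ * (2 * K) := by gcongr
  have i4 : K * (2 * K) * (2 * K) ≤ 4 * K ^ 3 / τ := by
    rw [le_div_iff₀ hτ]
    calc _ ≤ K * (2 * K) * (2 * K) * 1 := by gcongr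
      _ = _ := by ring
  calc _ ≤ 1 / τ * (2 * K) + 4 * K ^ 3 / τ := by linarith
    _ ≤ 1 / τ * (2 * K ^ 3) + 4 * K ^ 3 / τ := by gcongr
    _ = _ := by ring

lemma nrm_filteredRate_sub_le (hB : ProdBound a b N K) {τ : ℝ} (hτ : 0 < τ) (hτ1 : τ ≤ 1)
    {A P A₂ P₂ : ℤ → ℂ} {e : ℝ} (h1 : nrm a b N 1 A ≤ K) (h2 : nrm a b N 1 P₂ ≤ 2 * K)
    (h3 : nrm a b N 1 (fun l => A l - A₂ l) ≤ e) (h4 : nrm a b N 1 (fun l => P l - P₂ l) ≤ e) :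
    nrm a b N 1 (fun l => filteredRate a b N τ A P l - filteredRate a b N τ A₂ P₂ l)
      ≤ 6 * K ^ 3 * e / τ := by
  have hK := hB.one_le
  have he := (nrm_nonneg _).trans h3
  refine (nrm_le_add_of_eq (d := fun l => (-Complex.I * (Real.sin (freq a b l ^ 2 * τ) / τ))
    * (A l - A₂ l)) (e := fun l => Complex.I * (dprod a b N P A l - dprod a b N P₂ A₂ l))
    fun l _ => ?_).trans ?_
  · unfold filteredRate; ring
  rw [nrm_I_mul]
  have i1 := nrm_mul_le_self (a := a) (b := b) (N := N) (s := 1) (M := 1 / τ) (by positivity)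
    (fun l => -Complex.I * (Real.sin (freq a b l ^ 2 * τ) / τ)) (fun l => A l - A₂ l) fun l _ => by
      rw [norm_mul, norm_neg, Complex.norm_I, one_mul, ← Complex.ofReal_div, Complex.norm_real,
        Real.norm_eq_abs, abs_div, abs_of_pos hτ]
      gcongr
      exact Real.abs_sin_le_one _
  have i2 := hB.nrm_sub_le h4 h1 h2 h3
  have i3 : 1 / τ * nrm a b N 1 (fun l => A l - A₂ l) ≤ 1 / τ * e := by gcongr
  have i4 : K * e * K + K * (2 * K) * e ≤ 3 * K ^ 2 * e / τ := by
    rw [le_div_iff₀ hτ]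
    calc _ ≤ (K * e * K + K * (2 * K) * e) * 1 := by gcongr
      _ = _ := by ring
  have k2 : K ^ 2 ≤ K ^ 3 := pow_le_pow_right₀ hK (by norm_num)
  have k0 : 1 ≤ K ^ 3 := one_le_pow₀ hK
  calc _ ≤ 1 / τ * (1 * e) + 3 * K ^ 2 * e / τ := by linarith
    _ ≤ 1 / τ * (3 * K ^ 3 * e) + 3 * K ^ 3 * e / τ := by gcongr; linarith
    _ = _ := by ring

lemma nrm_vcoef_le {σ : ℝ} (hσ : |σ| = 1) (P Q : ℤ → ℂ) :
    nrm a b N 1 (vcoef σ ε P Q) ≤ 1 / 2 * (nrm a b N 1 P + ε ^ 2 * nrm a b N 1 Q) := by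
  have h : vcoef σ ε P Q = fun l => (1 / 2 : ℂ) * P l + -(Complex.I * σ * ε ^ 2 / 2) * Q l := by
    ext l; unfold vcoef; ring
  rw [h]
  refine (nrm_lin_le _ _ P Q).trans (le_of_eq ?_)
  have : ‖-(Complex.I * σ * (ε : ℂ) ^ 2 / 2)‖ = ε ^ 2 / 2 := by
    rw [norm_neg, norm_div, norm_mul, norm_mul, Complex.norm_I, Complex.norm_real, Real.norm_eq_abs,
      hσ, norm_pow, Complex.norm_real, Real.norm_eq_abs, sq_abs]; norm_num
  rw [this]; norm_num; ring

/-- The free flow is isometric, the coefficients c^± are O(τ), and the d^± are O(τ²) against rates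
of size 1/τ; the nonlinear part is Lipschitz with constant O(τ). -/
lemma nrm_stepPsi_sub_le (hB : ProdBound a b N K) {τ : ℝ} (hτ : 0 < τ)
    {A P Q A₂ P₂ Q₂ A' A₂' : ℤ → ℂ} {e : ℝ}
    (hA : nrm a b N 1 A ≤ K) (hP₂ : nrm a b N 1 P₂ ≤ 2 * K) (hQ₂ : ε ^ 2 * nrm a b N 1 Q₂ ≤ 2 * K)
    (eA : nrm a b N 1 (fun l => A l - A₂ l) ≤ e) (eP : nrm a b N 1 (fun l => P l - P₂ l) ≤ e)
    (eQ : ε ^ 2 * nrm a b N 1 (fun l => Q l - Q₂ l) ≤ e)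
    (hA' : nrm a b N 1 A' ≤ 6 * K ^ 3 / τ)
    (eA' : nrm a b N 1 (fun l => A' l - A₂' l) ≤ 6 * K ^ 3 * e / τ) :
    nrm a b N 1 (fun l => pathPsi a b ε N A A' P Q τ l - pathPsi a b ε N A₂ A₂' P₂ Q₂ τ l)
      ≤ nrm a b N 1 (fun l => A l - A₂ l) + 42 * K ^ 5 * e * τ := by
  have hK := hB.one_le
  have he := (nrm_nonneg _).trans eA
  have term : ∀ σ : ℝ, |σ| = 1 → nrm a b N 1 (fun l =>
      coefC σ ε (freq a b l) τ * (dprod a b N (vcoef σ ε P Q) A l - dprod a b N (vcoef σ ε P₂ Q₂) A₂ l)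
      + coefD σ ε (freq a b l) τ
        * (dprod a b N (vcoef σ ε P Q) A' l - dprod a b N (vcoef σ ε P₂ Q₂) A₂' l))
      ≤ 21 * K ^ 5 * e * τ := fun σ hσ => by
    have v1 : nrm a b N 1 (vcoef σ ε P₂ Q₂) ≤ 2 * K := (nrm_vcoef_le hσ _ _).trans (by linarith)
    have v2 : nrm a b N 1 (fun l => vcoef σ ε P Q l - vcoef σ ε P₂ Q₂ l) ≤ e := by
      have : (fun l => vcoef σ ε P Q l - vcoef σ ε P₂ Q₂ l)
        = vcoef σ ε (fun l => P l - P₂ l) (fun l => Q l - Q₂ l) := by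
        ext l; unfold vcoef; ring
      rw [this]
      exact (nrm_vcoef_le hσ _ _).trans (by linarith)
    have i1 := hB.nrm_sub_le v2 hA v1 eA
    have i2 := hB.nrm_sub_le v2 hA' v1 eA'
    have j1 := nrm_mul_le_self (a := a) (b := b) (N := N) (s := 1) hτ.le
      (fun l => coefC σ ε (freq a b l) τ) (fun l => dprod a b N (vcoef σ ε P Q) A l
        - dprod a b N (vcoef σ ε P₂ Q₂) A₂ l) fun l _ => norm_coefC_le _ _ _ hτ.le
    have j2 := nrm_mul_le_self (a := a) (b := b) (N := N) (s := 1) (sq_nonneg τ)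
      (fun l => coefD σ ε (freq a b l) τ) (fun l => dprod a b N (vcoef σ ε P Q) A' l
        - dprod a b N (vcoef σ ε P₂ Q₂) A₂' l) fun l _ => norm_coefD_le _ _ _ hτ.le
    refine (nrm_add_le _ _).trans ?_
    have k1 := mul_le_mul_of_nonneg_left i1 hτ.le
    have k2 := mul_le_mul_of_nonneg_left i2 (sq_nonneg τ)
    have p1 : K ^ 2 ≤ K ^ 5 := pow_le_pow_right₀ hK (by norm_num)
    have p2 : K ^ 4 ≤ K ^ 5 := pow_le_pow_right₀ hK (by norm_num)
    calc _ ≤ τ * (K * e * K + K * (2 * K) * e)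
          + τ ^ 2 * (K * e * (6 * K ^ 3 / τ) + K * (2 * K) * (6 * K ^ 3 * e / τ)) := by linarith
      _ = 3 * (K ^ 2 * e * τ) + 6 * (K ^ 4 * e * τ) + 12 * (K ^ 5 * e * τ) := by field_simp; ring
      _ ≤ 3 * (K ^ 5 * e * τ) + 6 * (K ^ 5 * e * τ) + 12 * (K ^ 5 * e * τ) := by gcongr
      _ = _ := by ring
  have t1 := term 1 (by norm_num)
  have t2 := term (-1) (by norm_num)
  have ph := nrm_phase_mul (a := a) (b := b) (N := N) (s := 1) (fun l => -(freq a b l ^ 2)) τ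
    (fun l => A l - A₂ l)
  have a1 := nrm_add_le (a := a) (b := b) (N := N) (s := 1) (fun l =>
      coefC 1 ε (freq a b l) τ * (dprod a b N (vcoef 1 ε P Q) A l - dprod a b N (vcoef 1 ε P₂ Q₂) A₂ l)
      + coefD 1 ε (freq a b l) τ
        * (dprod a b N (vcoef 1 ε P Q) A' l - dprod a b N (vcoef 1 ε P₂ Q₂) A₂' l)) (fun l =>
      coefC (-1) ε (freq a b l) τ * (dprod a b N (vcoef (-1) ε P Q) A l
        - dprod a b N (vcoef (-1) ε P₂ Q₂) A₂ l)
      + coefD (-1) ε (freq a b l) τ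
        * (dprod a b N (vcoef (-1) ε P Q) A' l - dprod a b N (vcoef (-1) ε P₂ Q₂) A₂' l))
  refine (nrm_le_add_of_eq fun l _ => ?_).trans (add_le_add ph.le (a1.trans ?_))
  · have : Complex.I * ((-(freq a b l ^ 2) : ℝ) : ℂ) * τ = -(Complex.I * (freq a b l : ℂ) ^ 2 * τ) := by
      push_cast; ring
    rw [this]; unfold pathPsi; ring
  · linarith

/-- The homogeneous Klein-Gordon flow acts on a characteristic variable as multiplication by
e^{iσωs}. The source coefficients appear exactly in the combinations whose bounds are uniform in ε.
-/
lemma charVar_path_eq (hε : 0 < ε) {σ : ℝ} (hσ : σ = 1 ∨ σ = -1) (P Q F F' : ℤ → ℂ) (s : ℝ) (l : ℤ) :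
    charVar a b σ ε (pathPhi a b ε P Q F F' s) (pathPi a b ε P Q F F' s) l
      = Complex.exp (Complex.I * (σ * omega ε (freq a b l) : ℝ) * s) * charVar a b σ ε P Q l
        + ((((ε ^ 2 * coefP' ε (freq a b l) s : ℝ) : ℂ)
            + Complex.I * σ * (ε ^ 2 * omega ε (freq a b l) * coefP ε (freq a b l) s : ℝ)) * F l
        + (((ε ^ 2 * coefQ' ε (freq a b l) s : ℝ) : ℂ)
            + Complex.I * σ * (ε ^ 2 * omega ε (freq a b l) * coefQ ε (freq a b l) s : ℝ)) * F' l) := by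
  have hω : (omega ε (freq a b l) : ℂ) ≠ 0 := by exact_mod_cast (omega_pos (freq a b l) hε).ne'
  have hexp : Complex.exp (Complex.I * (σ * omega ε (freq a b l) : ℝ) * s)
      = (Real.cos (omega ε (freq a b l) * s) : ℝ)
        + Complex.I * σ * (Real.sin (omega ε (freq a b l) * s) : ℝ) := by
    rcases hσ with rfl | rfl
    · have : Complex.I * ((1 * omega ε (freq a b l) : ℝ) : ℂ) * s
        = ((omega ε (freq a b l) * s : ℝ) : ℂ) * Complex.I := by push_cast; ring
      rw [this, Complex.exp_mul_I, ← Complex.ofReal_cos, ← Complex.ofReal_sin]; push_cast; ring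
    · have : Complex.I * ((-1 * omega ε (freq a b l) : ℝ) : ℂ) * s
        = -((omega ε (freq a b l) * s : ℝ) : ℂ) * Complex.I := by push_cast; ring
      rw [this, Complex.exp_mul_I, Complex.cos_neg, Complex.sin_neg, ← Complex.ofReal_cos,
        ← Complex.ofReal_sin]; push_cast; ring
  have hσ2 : (σ : ℂ) ^ 2 = 1 := by rcases hσ with rfl | rfl <;> norm_num
  have hsin : (omega ε (freq a b l) : ℂ) * ((Real.sin (omega ε (freq a b l) * s)
      / omega ε (freq a b l) : ℝ) : ℂ) = (Real.sin (omega ε (freq a b l) * s) : ℝ) := by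
    push_cast; field_simp
  rw [hexp]
  unfold charVar pathPhi pathPi
  rw [Complex.ofReal_mul (ε ^ 2), Complex.ofReal_mul (ε ^ 2 * _), Complex.ofReal_mul (ε ^ 2 * _),
    Complex.ofReal_mul (ε ^ 2) (omega _ _)]
  set sn := ((Real.sin (omega ε (freq a b l) * s) : ℝ) : ℂ)
  set sd := ((Real.sin (omega ε (freq a b l) * s) / omega ε (freq a b l) : ℝ) : ℂ)
  have hsn : Complex.sin (omega ε (freq a b l) * s) = sn := by simp [sn]
  rw [Complex.ofReal_neg, Complex.ofReal_mul (omega _ _)]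
  push_cast
  linear_combination (Complex.I * σ * (ε : ℂ) ^ 2 * Q l) * hsin
    - ((ε : ℂ) ^ 2 * omega ε (freq a b l) * sn * P l * Complex.I ^ 2) * hσ2
    - ((ε : ℂ) ^ 2 * omega ε (freq a b l) * sn * P l) * Complex.I_sq
    - ((ε : ℂ) ^ 2 * omega ε (freq a b l) * P l) * hsn

lemma nrm_charVar_path_le (hε : 0 < ε) {σ : ℝ} (hσ : σ = 1 ∨ σ = -1) {τ : ℝ} (hτ : 0 ≤ τ)
    (P Q F F' : ℤ → ℂ) :
    nrm a b N 1 (charVar a b σ ε (pathPhi a b ε P Q F F' τ) (pathPi a b ε P Q F F' τ))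
      ≤ nrm a b N 1 (charVar a b σ ε P Q) + (2 * τ * nrm a b N 1 F + 2 * τ ^ 2 * nrm a b N 1 F') := by
  have ph := nrm_phase_mul (a := a) (b := b) (N := N) (s := 1) (fun l => σ * omega ε (freq a b l)) τ
    (charVar a b σ ε P Q)
  have hσ1 : ‖(σ : ℂ)‖ = 1 := by rcases hσ with rfl | rfl <;> norm_num
  have key : ∀ (x y : ℝ) {z : ℝ}, |x| ≤ z → |y| ≤ z → ‖(x : ℂ) + Complex.I * σ * y‖ ≤ 2 * z :=
    fun x y z hx hy => by
      refine (norm_add_le _ _).trans ?_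
      rw [norm_mul, norm_mul, Complex.norm_I, hσ1, Complex.norm_real, Complex.norm_real,
        Real.norm_eq_abs, Real.norm_eq_abs]
      linarith
  refine (nrm_le_add_of_eq fun l _ => charVar_path_eq hε hσ P Q F F' τ l).trans
    (add_le_add ph.le ((nrm_add_le _ _).trans (add_le_add ?_ ?_)))
  · refine nrm_mul_le_self (by positivity) _ F fun l _ => key _ _ ?_ ?_
    · rw [abs_mul, abs_of_nonneg (sq_nonneg ε)]; exact abs_coefP'_le _ hε hτ
    · rw [abs_mul, abs_of_nonneg (by linarith [one_le_eps_sq_mul_omega (freq a b l) hε])]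
      exact abs_coefP_le _ hε hτ
  · refine nrm_mul_le_self (by positivity) _ F' fun l _ => key _ _ ?_ ?_
    · rw [abs_mul, abs_of_nonneg (sq_nonneg ε)]; exact abs_coefQ'_le _ hε hτ
    · rw [abs_mul, abs_of_nonneg (by linarith [one_le_eps_sq_mul_omega (freq a b l) hε])]
      exact abs_coefQ_le _ hε hτ

lemma pathPhi_sub (P Q F F' P₂ Q₂ F₂ F₂' : ℤ → ℂ) (s : ℝ) :
    (fun l => pathPhi a b ε P Q F F' s l - pathPhi a b ε P₂ Q₂ F₂ F₂' s l)
      = pathPhi a b ε (fun l => P l - P₂ l) (fun l => Q l - Q₂ l) (fun l => F l - F₂ l)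
        (fun l => F' l - F₂' l) s := by
  ext l; unfold pathPhi; ring

lemma pathPi_sub (P Q F F' P₂ Q₂ F₂ F₂' : ℤ → ℂ) (s : ℝ) :
    (fun l => pathPi a b ε P Q F F' s l - pathPi a b ε P₂ Q₂ F₂ F₂' s l)
      = pathPi a b ε (fun l => P l - P₂ l) (fun l => Q l - Q₂ l) (fun l => F l - F₂ l)
        (fun l => F' l - F₂' l) s := by
  ext l; unfold pathPi; ring

lemma nrm_dens_sub_le (hab : a < b) (hN : 0 < N) (hE : Even N) (hB : ProdBound a b N K)
    {A A₂ : ℤ → ℂ} {e : ℝ} (hA : nrm a b N 1 A ≤ K) (hA₂ : nrm a b N 1 A₂ ≤ 2 * K)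
    (eA : nrm a b N 1 (fun l => A l - A₂ l) ≤ e) :
    nrm a b N 1 (fun l => dens a b N A l - dens a b N A₂ l) ≤ 3 * K ^ 3 * e := by
  have he := (nrm_nonneg _).trans eA
  have hK := hB.one_le
  have c1 : nrm a b N 1 (fun l => dconj a b N A l - dconj a b N A₂ l) ≤ e := by
    rw [← funext fun l => dconj_sub A A₂ l]
    exact (nrm_dconj hab hN hE 1 _).le.trans eA
  refine (hB.nrm_sub_le eA ((nrm_dconj hab hN hE 1 A).le.trans hA) hA₂ c1).trans ?_
  calc _ = 3 * K ^ 2 * e := by ring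
    _ ≤ _ := by gcongr; norm_num

lemma nrm_densRate_sub_le (hab : a < b) (hN : 0 < N) (hE : Even N) (hB : ProdBound a b N K) {τ : ℝ}
    (hτ : 0 < τ) {A A₂ A' A₂' : ℤ → ℂ} {e : ℝ} (hA : nrm a b N 1 A ≤ K)
    (hA₂ : nrm a b N 1 A₂ ≤ 2 * K) (eA : nrm a b N 1 (fun l => A l - A₂ l) ≤ e)
    (hA' : nrm a b N 1 A' ≤ 6 * K ^ 3 / τ) (hA₂' : nrm a b N 1 A₂' ≤ 6 * K ^ 3 / τ)
    (eA' : nrm a b N 1 (fun l => A' l - A₂' l) ≤ 6 * K ^ 3 * e / τ) :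
    nrm a b N 1 (fun l => densRate a b N A A' l - densRate a b N A₂ A₂' l) ≤ 30 * K ^ 5 * e / τ := by
  have he := (nrm_nonneg _).trans eA
  have hK := hB.one_le
  have cj : ∀ {c d : ℤ → ℂ} {x : ℝ}, nrm a b N 1 (fun l => c l - d l) ≤ x →
      nrm a b N 1 (fun l => dconj a b N c l - dconj a b N d l) ≤ x := fun h => by
    rw [← funext fun l => dconj_sub _ _ l]
    exact (nrm_dconj hab hN hE 1 _).le.trans h
  have i1 := hB.nrm_sub_le eA' ((nrm_dconj hab hN hE 1 A).le.trans hA) hA₂' (cj eA)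
  have i2 := hB.nrm_sub_le eA ((nrm_dconj hab hN hE 1 A').le.trans hA') hA₂ (cj eA')
  refine (nrm_le_add_of_eq (d := fun l => dprod a b N A' (dconj a b N A) l
    - dprod a b N A₂' (dconj a b N A₂) l) (e := fun l => dprod a b N A (dconj a b N A') l
    - dprod a b N A₂ (dconj a b N A₂') l) fun l _ => ?_).trans ?_
  · unfold densRate; ring
  calc _ ≤ (K * (6 * K ^ 3 * e / τ) * K + K * (6 * K ^ 3 / τ) * e)
        + (K * e * (6 * K ^ 3 / τ) + K * (2 * K) * (6 * K ^ 3 * e / τ)) := add_le_add i1 i2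
    _ = 18 * (K ^ 5 * e / τ) + 12 * (K ^ 4 * e / τ) := by ring
    _ ≤ 18 * (K ^ 5 * e / τ) + 12 * (K ^ 5 * e / τ) := by gcongr; norm_num
    _ = _ := by ring

/-- Stability of one step of the integrator near a bounded state. -/
lemma energy_step_sub_le (hab : a < b) (hN : 0 < N) (hE : Even N) (hB : ProdBound a b N K)
    (hε : 0 < ε) {τ : ℝ} (hτ : 0 < τ) (hτ1 : τ ≤ 1) {A P Q A₂ P₂ Q₂ : ℤ → ℂ}
    (hA : nrm a b N 1 A ≤ K) (hP : nrm a b N 1 P ≤ K) (hQ : ε ^ 2 * nrm a b N 1 Q ≤ K)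
    (he : energy a b ε N (fun l => A l - A₂ l) (fun l => P l - P₂ l) (fun l => Q l - Q₂ l) ≤ 1) :
    energy a b ε N (fun l => stepPsi a b ε N τ A P Q l - stepPsi a b ε N τ A₂ P₂ Q₂ l)
      (fun l => stepPhi a b ε N τ A P Q l - stepPhi a b ε N τ A₂ P₂ Q₂ l)
      (fun l => stepPi a b ε N τ A P Q l - stepPi a b ε N τ A₂ P₂ Q₂ l)
      ≤ (1 + 200 * K ^ 5 * τ) * energy a b ε N (fun l => A l - A₂ l) (fun l => P l - P₂ l)
        (fun l => Q l - Q₂ l) := by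
  have hK := hB.one_le
  set e := energy a b ε N (fun l => A l - A₂ l) (fun l => P l - P₂ l) (fun l => Q l - Q₂ l)
  have he0 : 0 ≤ e := energy_nonneg
  have eA : nrm a b N 1 (fun l => A l - A₂ l) ≤ e := nrm_le_energy
  have eP : nrm a b N 1 (fun l => P l - P₂ l) ≤ e := nrm_phi_le_energy hε
  have eQ : ε ^ 2 * nrm a b N 1 (fun l => Q l - Q₂ l) ≤ e := nrm_pi_le_energy
  have two : ∀ {c d : ℤ → ℂ}, nrm a b N 1 c ≤ nrm a b N 1 d + nrm a b N 1 (fun l => d l - c l) :=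
    fun {c d} => by
      have := nrm_sub_le (a := a) (b := b) (N := N) (s := 1) d (fun l => d l - c l)
      simpa using this
  have hA₂ : nrm a b N 1 A₂ ≤ 2 * K := (two (d := A)).trans (by linarith)
  have hP₂ : nrm a b N 1 P₂ ≤ 2 * K := (two (d := P)).trans (by linarith)
  have hQ₂ : ε ^ 2 * nrm a b N 1 Q₂ ≤ 2 * K := by
    have := mul_le_mul_of_nonneg_left (two (c := Q₂) (d := Q)) (sq_nonneg ε)
    linarith
  have hA' := nrm_filteredRate_le_div hB hτ hτ1 (hA.trans (by linarith)) (hP.trans (by linarith))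
  have hA₂' := nrm_filteredRate_le_div hB hτ hτ1 hA₂ hP₂
  have eA' := nrm_filteredRate_sub_le hB hτ hτ1 hA hP₂ eA eP
  have s1 := nrm_stepPsi_sub_le hB hτ hA hP₂ hQ₂ eA eP eQ hA' eA'
  have hF := nrm_dens_sub_le hab hN hE hB hA hA₂ eA
  have hF' := nrm_densRate_sub_le hab hN hE hB hτ hA hA₂ eA hA' hA₂' eA'
  have hF'' := mul_le_mul_of_nonneg_left hF' (by positivity : 0 ≤ 2 * τ ^ 2)
  have hF0 := mul_le_mul_of_nonneg_left hF (by positivity : 0 ≤ 2 * τ)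
  -- The factor τ² of the coefficients q, q' against the rate of size 1/τ leaves a single τ.
  have e1 : 2 * τ ^ 2 * (30 * K ^ 5 * e / τ) = 60 * (K ^ 5 * e * τ) := by field_simp; ring
  have k3 : K ^ 3 * (e * τ) ≤ K ^ 5 * (e * τ) :=
    mul_le_mul_of_nonneg_right (pow_le_pow_right₀ hK (by norm_num)) (by positivity)
  have s2 : ∀ σ : ℝ, σ = 1 ∨ σ = -1 → nrm a b N 1 (charVar a b σ ε
      (fun l => stepPhi a b ε N τ A P Q l - stepPhi a b ε N τ A₂ P₂ Q₂ l)
      (fun l => stepPi a b ε N τ A P Q l - stepPi a b ε N τ A₂ P₂ Q₂ l))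
      ≤ nrm a b N 1 (charVar a b σ ε (fun l => P l - P₂ l) (fun l => Q l - Q₂ l))
        + 66 * (K ^ 5 * e * τ) := fun σ hσ => by
    unfold stepPhi stepPi
    rw [pathPhi_sub, pathPi_sub]
    refine (nrm_charVar_path_le hε hσ hτ.le _ _ _ _).trans ?_
    linarith
  have t1 := s2 1 (Or.inl rfl)
  have t2 := s2 (-1) (Or.inr rfl)
  have t0 : nrm a b N 1 (fun l => stepPsi a b ε N τ A P Q l - stepPsi a b ε N τ A₂ P₂ Q₂ l) ≤ _ := s1
  have e2 : e = nrm a b N 1 (fun l => A l - A₂ l)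
      + nrm a b N 1 (charVar a b 1 ε (fun l => P l - P₂ l) (fun l => Q l - Q₂ l))
      + nrm a b N 1 (charVar a b (-1) ε (fun l => P l - P₂ l) (fun l => Q l - Q₂ l)) := rfl
  have : 0 ≤ K ^ 5 * e * τ := by positivity
  calc _ ≤ e + 174 * (K ^ 5 * e * τ) := by rw [energy]; linarith
    _ ≤ _ := by linarith

end stability

end KGS

namespace KGS

/-! ### Convergence of the integrator for the coefficients -/

section convergence
variable {a b ε K : ℝ} {N : ℕ}

lemma energy_congr {A P Q A₂ P₂ Q₂ : ℤ → ℂ} (hA : ∀ l ∈ modes N, A l = A₂ l)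
    (hP : ∀ l ∈ modes N, P l = P₂ l) (hQ : ∀ l ∈ modes N, Q l = Q₂ l) :
    energy a b ε N A P Q = energy a b ε N A₂ P₂ Q₂ := by
  have h : ∀ σ, nrm a b N 1 (charVar a b σ ε P Q) = nrm a b N 1 (charVar a b σ ε P₂ Q₂) := fun σ =>
    nrm_congr fun l hl => by unfold charVar; rw [hP l hl, hQ l hl]
  unfold energy
  rw [nrm_congr hA, h 1, h (-1)]

/-- The two quantities have product τ², so the smaller one is at most τ. Uniform first-order
convergence, and the smallness needed for the bootstrap, both rest on this. -/
lemma min_sq_div_le {τ ε : ℝ} (hτ : 0 < τ) (hε : 0 < ε) : min (τ ^ 2 / ε ^ 2) (ε ^ 2) ≤ τ := by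
  rcases le_total (ε ^ 2) τ with h | h
  · exact (min_le_right _ _).trans h
  · refine (min_le_left _ _).trans ?_
    rw [div_le_iff₀ (by positivity), sq]
    gcongr

namespace ApproxSol

variable {T η : ℝ} {ps ph pi δ₁ δ₂ : ℝ → ℤ → ℂ}

lemma localError (hab : a < b) (hN : 0 < N) (hE : Even N) (hB : ProdBound a b N K)
    (hε : 0 < ε) (hε1 : ε ≤ 1) {τ : ℝ} (hτ : 0 < τ) (hτ1 : τ ≤ 1) (hη : 0 ≤ η)
    (h : ApproxSol a b τ ε N η K ps ph pi δ₁ δ₂) :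
    energy a b ε N (fun l => ps τ l - stepPsi a b ε N τ (ps 0) (ph 0) (pi 0) l)
      (fun l => ph τ l - stepPhi a b ε N τ (ps 0) (ph 0) (pi 0) l)
      (fun l => pi τ l - stepPi a b ε N τ (ps 0) (ph 0) (pi 0) l)
      ≤ 101 * K ^ 9 * (min (τ ^ 2 / ε ^ 2) (ε ^ 2) + η) * τ := by
  have hK := hB.one_le
  have k5 : K ^ 5 ≤ K ^ 9 := pow_le_pow_right₀ hK (by norm_num)
  have k7 : K ^ 7 ≤ K ^ 9 := pow_le_pow_right₀ hK (by norm_num)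
  rcases min_choice (τ ^ 2 / ε ^ 2) (ε ^ 2) with hm | hm <;> rw [hm]
  · have i0 := h.localError_psi_first hab hN hE hB hε hε1 hτ hτ1 hη
    have i1 := h.localError_phi_first hab hN hE hB hε hε1 hτ hτ1 hη (σ := 1) (by norm_num) rfl rfl
    have i2 := h.localError_phi_first hab hN hE hB hε hε1 hτ hτ1 hη (σ := -1) (by norm_num) rfl rfl
    calc _ ≤ 21 * K ^ 7 * (τ ^ 2 / ε ^ 2 + η) * τ + 40 * K ^ 9 * (τ ^ 2 / ε ^ 2 + η) * τ
          + 40 * K ^ 9 * (τ ^ 2 / ε ^ 2 + η) * τ := add_le_add (add_le_add i0 i1) i2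
      _ ≤ 21 * K ^ 9 * (τ ^ 2 / ε ^ 2 + η) * τ + 40 * K ^ 9 * (τ ^ 2 / ε ^ 2 + η) * τ
          + 40 * K ^ 9 * (τ ^ 2 / ε ^ 2 + η) * τ := by gcongr
      _ = _ := by ring
  · have i0 := h.localError_psi_second hab hN hE hB hε hτ hτ1 hη
    have i1 := h.localError_phi_second hab hN hE hB hε hτ hη (σ := 1) (by norm_num) rfl rfl
    have i2 := h.localError_phi_second hab hN hE hB hε hτ hη (σ := -1) (by norm_num) rfl rfl
    have : 0 ≤ K ^ 9 * (ε ^ 2 + η) * τ := by positivity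
    calc _ ≤ 40 * K ^ 7 * (ε ^ 2 + η) * τ + 20 * K ^ 5 * (ε ^ 2 + η) * τ
          + 20 * K ^ 5 * (ε ^ 2 + η) * τ := add_le_add (add_le_add i0 i1) i2
      _ ≤ 40 * K ^ 9 * (ε ^ 2 + η) * τ + 20 * K ^ 9 * (ε ^ 2 + η) * τ
          + 20 * K ^ 9 * (ε ^ 2 + η) * τ := by gcongr
      _ ≤ _ := by linarith

/-- Discrete Gronwall argument coupled with a bootstrap: stability is available only while the error
is at most 1, and the bound being proved is at most 1 by `hsmall`. The induction runs with nτ in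
place of T in the bound, which grows with n. -/
lemma energy_le (hab : a < b) (hN : 0 < N) (hE : Even N) (hB : ProdBound a b N K)
    (hε : 0 < ε) (hε1 : ε ≤ 1) {τ : ℝ} (hτ : 0 < τ) (hτ1 : τ ≤ 1) (hη : 0 ≤ η)
    (h : ApproxSol a b T ε N η K ps ph pi δ₁ δ₂) {cA cP cQ : ℕ → ℤ → ℂ}
    (hA : ∀ n, ∀ l ∈ modes N, cA (n + 1) l = stepPsi a b ε N τ (cA n) (cP n) (cQ n) l)
    (hP : ∀ n, ∀ l ∈ modes N, cP (n + 1) l = stepPhi a b ε N τ (cA n) (cP n) (cQ n) l)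
    (hQ : ∀ n, ∀ l ∈ modes N, cQ (n + 1) l = stepPi a b ε N τ (cA n) (cP n) (cQ n) l)
    (h0 : energy a b ε N (fun l => ps 0 l - cA 0 l) (fun l => ph 0 l - cP 0 l)
      (fun l => pi 0 l - cQ 0 l) ≤ η)
    (hsmall : Real.exp (200 * K ^ 5 * T) * (1 + 101 * K ^ 9 * T)
      * (min (τ ^ 2 / ε ^ 2) (ε ^ 2) + η) ≤ 1) (n : ℕ) (hn : n * τ ≤ T) :
    energy a b ε N (fun l => ps (n * τ) l - cA n l) (fun l => ph (n * τ) l - cP n l)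
      (fun l => pi (n * τ) l - cQ n l)
      ≤ Real.exp (200 * K ^ 5 * T) * (1 + 101 * K ^ 9 * T) * (min (τ ^ 2 / ε ^ 2) (ε ^ 2) + η) := by
  have hK := hB.one_le
  set χ := min (τ ^ 2 / ε ^ 2) (ε ^ 2) + η
  have hχ0 : 0 ≤ min (τ ^ 2 / ε ^ 2) (ε ^ 2) := le_min (by positivity) (by positivity)
  have hχ : 0 ≤ χ := add_nonneg hχ0 hη
  have hηχ : η ≤ χ := le_add_of_nonneg_left hχ0
  set L := 200 * K ^ 5
  have hL : 0 ≤ L := by positivity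
  set D := 101 * K ^ 9
  have hD : 0 ≤ D := by positivity
  have final : ∀ n : ℕ, n * τ ≤ T → Real.exp (L * (n * τ)) * (1 + D * (n * τ)) * χ
      ≤ Real.exp (L * T) * (1 + D * T) * χ := fun n hn => by gcongr
  suffices H : ∀ n : ℕ, n * τ ≤ T → energy a b ε N (fun l => ps (n * τ) l - cA n l)
      (fun l => ph (n * τ) l - cP n l) (fun l => pi (n * τ) l - cQ n l)
      ≤ Real.exp (L * (n * τ)) * (1 + D * (n * τ)) * χ from (H n hn).trans (final n hn)
  intro n
  induction n with
  | zero => intro _; simpa using h0.trans hηχ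
  | succ n ih =>
    intro hn
    push_cast at hn ⊢
    have hnτ : n * τ ≤ T := by linarith
    have hnτ0 : 0 ≤ n * τ := by positivity
    have hen := ih hnτ
    have hmem : n * τ ∈ Icc 0 T := ⟨hnτ0, hnτ⟩
    have hloc := (h.shift hnτ0 (τ := τ) (by linarith)).localError hab hN hE hB hε hε1 hτ hτ1 hη
    simp only [add_zero] at hloc
    have m15 : ∀ c : ℤ → ℂ, nrm a b N 1 c ≤ nrm a b N 5 c := fun c => nrm_mono (by norm_num) c
    -- The numerical state need not be bounded in advance: the exact solution is, and the induction
    -- hypothesis makes their distance at most 1.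
    have hst := energy_step_sub_le hab hN hE hB hε hτ hτ1 ((m15 _).trans (h.nrm_ps _ hmem))
      ((m15 _).trans (h.nrm_ph _ hmem))
      ((mul_le_mul_of_nonneg_left (m15 _) (sq_nonneg ε)).trans (h.nrm_pi _ hmem))
      (hen.trans ((final n hnτ).trans hsmall))
    have hadd := (energy_add_le (a := a) (b := b) (ε := ε) (N := N) _ _ _).trans (add_le_add hloc hst)
    have e : ((n : ℝ) + 1) * τ = n * τ + τ := by ring
    rw [e]
    rw [energy_congr (fun l hl => by rw [hA n l hl, ← sub_add_sub_cancel])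
      (fun l hl => by rw [hP n l hl, ← sub_add_sub_cancel])
      (fun l hl => by rw [hQ n l hl, ← sub_add_sub_cancel])]
    refine hadd.trans ?_
    have hexp : (1 + L * τ) * Real.exp (L * (n * τ)) ≤ Real.exp (L * (n * τ + τ)) := by
      rw [mul_add, Real.exp_add, mul_comm]
      gcongr
      linarith [Real.add_one_le_exp (L * τ)]
    have hexp1 : 1 ≤ Real.exp (L * (n * τ + τ)) := Real.one_le_exp (by positivity)
    calc _ ≤ D * χ * τ + (1 + L * τ) * (Real.exp (L * (n * τ)) * (1 + D * (n * τ)) * χ) := by gcongr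
      _ = D * χ * τ * 1 + (1 + L * τ) * Real.exp (L * (n * τ)) * ((1 + D * (n * τ)) * χ) := by ring
      _ ≤ D * χ * τ * Real.exp (L * (n * τ + τ))
          + Real.exp (L * (n * τ + τ)) * ((1 + D * (n * τ)) * χ) := by gcongr
      _ = _ := by ring

end ApproxSol

end convergence

end KGS

namespace KGS

/-! ### The coefficients of the numerical solution -/

section numeric
variable {a b ε τ : ℝ} {N : ℕ}

lemma omega_eq_of_sq_eq {μ ν : ℝ} (h : μ ^ 2 = ν ^ 2) : omega ε μ = omega ε ν := by
  unfold omega; rw [h]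

/-- Multipliers depending on μ² only are invariant under `reflMode`, including at the mode -N/2
which is fixed. They therefore pass through conjugation and preserve real grid functions. -/
lemma dconj_mul_of_even (hab : a < b) (hN : 0 < N) (hE : Even N) {m : ℤ → ℂ}
    (hm : ∀ l, m (reflMode N l) = m l) (c : ℤ → ℂ) {l : ℤ} (hl : l ∈ modes N) :
    dconj a b N (fun l => m l * c l) l = starRingEnd ℂ (m l) * dconj a b N c l := by
  rw [dconj_eq hab hN hE _ hl, dconj_eq hab hN hE _ hl, map_mul, hm]

/-- A grid function with real values at the nodes `x_0, …, x_{N-1}`. -/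
def IsRealGrid {N : ℕ} (v : Fin (N + 1) → ℂ) : Prop :=
  ∀ j : Fin N, starRingEnd ℂ (v j.castSucc) = v j.castSucc

lemma IsRealGrid.dconj_dft (hab : a < b) (hN : 0 < N) (hE : Even N) {v : Fin (N + 1) → ℂ}
    (h : IsRealGrid v) : dconj a b N (dft a b N v) = dft a b N v := by
  rw [← dft_conj hab hN hE]; exact dft_congr h

lemma isRealGrid_gridValues (hab : a < b) (hN : 0 < N) (hE : Even N) {c : ℤ → ℂ}
    (h : ∀ l ∈ modes N, dconj a b N c l = c l) : IsRealGrid (gridValues a b N c) := fun j => by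
  have := gridValues_dft hab hN hE (fun j => starRingEnd ℂ (gridValues a b N c j)) j
  rw [← this]
  exact congrFun (gridValues_congr h) _

lemma dft_density (hab : a < b) (hN : 0 < N) (hE : Even N) (S : State N) :
    dft a b N (density S) = dens a b N (dft a b N S.Ψ) := by
  rw [dens, ← dft_conj hab hN hE, ← dft_mul hab hN hE]
  congr 1; ext j
  rw [density, Complex.mul_conj, Complex.normSq_eq_norm_sq]

lemma dft_dΨ (hab : a < b) (hN : 0 < N) (hE : Even N) (S : State N) {l : ℤ} (hl : l ∈ modes N) :
    dft a b N (dΨ a b τ S) l = filteredRate a b N τ (dft a b N S.Ψ) (dft a b N S.Φ) l := by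
  rw [dΨ, dft_gridValues hab hN _ hl, dft_mul hab hN hE, filteredRate]

lemma dft_densityRate (hab : a < b) (hN : 0 < N) (hE : Even N) (S : State N) (l : ℤ) :
    2 * dft a b N (densityRate a b τ S) l = densRate a b N (dft a b N S.Ψ)
      (filteredRate a b N τ (dft a b N S.Ψ) (dft a b N S.Φ)) l := by
  have h := fun l hl => dft_dΨ (τ := τ) hab hN hE S (l := l) hl
  rw [densRate, ← dprod_congr h fun _ _ => rfl, ← dconj_congr h, ← dft_conj hab hN hE,
    ← dft_conj hab hN hE, ← dft_mul hab hN hE, ← dft_mul hab hN hE, ← dft_add, ← dft_const_mul]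
  congr 1; ext j
  have e := Complex.add_conj (starRingEnd ℂ (S.Ψ j) * dΨ a b τ S j)
  rw [map_mul, Complex.conj_conj] at e
  rw [densityRate]
  push_cast at e ⊢
  linear_combination -e

lemma dft_vZero (S : State N) : dft a b N (vZero ε S)
    = vcoef 1 ε (dft a b N S.Φ) (dft a b N S.dΦ) := by
  ext l
  have : vZero ε S = fun j => (1 / 2 : ℂ) * S.Φ j + (-(Complex.I * ε ^ 2 / 2)) * S.dΦ j := by
    ext j; unfold vZero; ring
  rw [this, dft_add, dft_const_mul, dft_const_mul, vcoef]; push_cast; ring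

/-- The conjugate of v⁰ is v⁻ only when Φ and ∂ₜΦ are real on the grid; this is why reality has to
be propagated along the iteration. -/
lemma dft_conj_vZero {S : State N} (h1 : IsRealGrid S.Φ)
    (h2 : IsRealGrid S.dΦ) : dft a b N (fun j => starRingEnd ℂ (vZero ε S j))
    = vcoef (-1) ε (dft a b N S.Φ) (dft a b N S.dΦ) := by
  ext l
  have : dft a b N (fun j => starRingEnd ℂ (vZero ε S j))
      = dft a b N (fun j => (1 / 2 : ℂ) * S.Φ j + (Complex.I * ε ^ 2 / 2) * S.dΦ j) :=
    dft_congr fun j => by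
      unfold vZero
      simp only [map_mul, map_sub, h1 j, h2 j, map_pow, Complex.conj_I, Complex.conj_ofReal, map_div₀,
        map_one, map_ofNat]
      ring
  rw [this, dft_add, dft_const_mul, dft_const_mul, vcoef]; push_cast; ring

lemma dft_step_Ψ (hab : a < b) (hN : 0 < N) (hE : Even N) {S : State N} (h1 : IsRealGrid S.Φ)
    (h2 : IsRealGrid S.dΦ) {l : ℤ} (hl : l ∈ modes N) : dft a b N (step a b ε τ S).Ψ l
      = stepPsi a b ε N τ (dft a b N S.Ψ) (dft a b N S.Φ) (dft a b N S.dΦ) l := by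
  have h := fun l hl => dft_dΨ (τ := τ) hab hN hE S (l := l) hl
  rw [step, dft_gridValues hab hN _ hl, dft_mul hab hN hE, dft_mul hab hN hE,
    dft_mul hab hN hE (fun j => starRingEnd ℂ (vZero ε S j)),
    dft_mul hab hN hE (fun j => starRingEnd ℂ (vZero ε S j)), dft_conj_vZero h1 h2, dft_vZero,
    dprod_congr (fun _ _ => rfl) h, dprod_congr (fun _ _ => rfl) h]
  rfl

lemma coefA_reflMode (l : ℤ) (s : ℝ) :
    coefA ε (freq a b (reflMode N l)) s = coefA ε (freq a b l) s := by
  unfold coefA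
  rw [lamPlus_eq, lamPlus_eq, lamMinus_eq, lamMinus_eq, omega_eq_of_sq_eq (freq_sq_reflMode l)]

lemma coefA'_reflMode (l : ℤ) (s : ℝ) :
    coefA' ε (freq a b (reflMode N l)) s = coefA' ε (freq a b l) s := by
  unfold coefA'
  rw [lamPlus_eq, lamPlus_eq, lamMinus_eq, lamMinus_eq, omega_eq_of_sq_eq (freq_sq_reflMode l)]

lemma dft_vOne (hab : a < b) (hN : 0 < N) (S : State N) {l : ℤ} (hl : l ∈ modes N) :
    dft a b N (vOne a b ε τ S) l
      = coefA ε (freq a b l) τ * vcoef 1 ε (dft a b N S.Φ) (dft a b N S.dΦ) l := by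
  rw [vOne, dft_gridValues hab hN _ hl, dft_vZero]

lemma dft_dvOne (hab : a < b) (hN : 0 < N) (S : State N) {l : ℤ} (hl : l ∈ modes N) :
    dft a b N (dvOne a b ε τ S) l
      = coefA' ε (freq a b l) τ * vcoef 1 ε (dft a b N S.Φ) (dft a b N S.dΦ) l := by
  rw [dvOne, dft_gridValues hab hN _ hl, dft_vZero]

lemma dconj_vcoef (hab : a < b) (hN : 0 < N) (hE : Even N) {S : State N} (h1 : IsRealGrid S.Φ)
    (h2 : IsRealGrid S.dΦ) : dconj a b N (vcoef 1 ε (dft a b N S.Φ) (dft a b N S.dΦ))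
      = vcoef (-1) ε (dft a b N S.Φ) (dft a b N S.dΦ) := by
  rw [← dft_vZero, ← dft_conj hab hN hE, dft_conj_vZero h1 h2]

lemma dft_conj_vOne (hab : a < b) (hN : 0 < N) (hE : Even N) {S : State N} (h1 : IsRealGrid S.Φ)
    (h2 : IsRealGrid S.dΦ) {l : ℤ} (hl : l ∈ modes N) :
    dft a b N (fun j => starRingEnd ℂ (vOne a b ε τ S j)) l = starRingEnd ℂ (coefA ε (freq a b l) τ)
      * vcoef (-1) ε (dft a b N S.Φ) (dft a b N S.dΦ) l := by
  rw [dft_conj hab hN hE, dconj_congr fun l hl => dft_vOne hab hN S hl,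
    dconj_mul_of_even hab hN hE (fun l => coefA_reflMode l τ) _ hl, dconj_vcoef hab hN hE h1 h2]

lemma dft_conj_dvOne (hab : a < b) (hN : 0 < N) (hE : Even N) {S : State N} (h1 : IsRealGrid S.Φ)
    (h2 : IsRealGrid S.dΦ) {l : ℤ} (hl : l ∈ modes N) :
    dft a b N (fun j => starRingEnd ℂ (dvOne a b ε τ S j)) l = starRingEnd ℂ (coefA' ε (freq a b l) τ)
      * vcoef (-1) ε (dft a b N S.Φ) (dft a b N S.dΦ) l := by
  rw [dft_conj hab hN hE, dconj_congr fun l hl => dft_dvOne hab hN S hl,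
    dconj_mul_of_even hab hN hE (fun l => coefA'_reflMode l τ) _ hl, dconj_vcoef hab hN hE h1 h2]

lemma conj_exp_phase (ε τ : ℝ) : starRingEnd ℂ (Complex.exp (Complex.I * τ / ε ^ 2))
    = Complex.exp (-(Complex.I * τ / ε ^ 2)) := by
  rw [← Complex.exp_conj]; simp [neg_div]

/-- The terms with v¹ and its conjugate add up to the cosine and sine propagators of frequency ω
applied to φ and ∂ₜφ: the multiscale decomposition reproduces the linear flow exactly. -/
lemma dft_step_Φ (hab : a < b) (hN : 0 < N) (hE : Even N) (hε : 0 < ε) {S : State N}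
    (h1 : IsRealGrid S.Φ) (h2 : IsRealGrid S.dΦ) {l : ℤ} (hl : l ∈ modes N) :
    dft a b N (step a b ε τ S).Φ l
      = stepPhi a b ε N τ (dft a b N S.Ψ) (dft a b N S.Φ) (dft a b N S.dΦ) l := by
  have hε' : (ε : ℂ) ≠ 0 := by exact_mod_cast hε.ne'
  have hω : (omega ε (freq a b l) : ℂ) ≠ 0 := by exact_mod_cast (omega_pos (freq a b l) hε).ne'
  have k1 := exp_mul_coefA (freq a b l) hε τ
  have k2 := congrArg (starRingEnd ℂ) k1
  simp only [map_mul, map_add, map_div₀, conj_exp_phase, Complex.conj_ofReal, Complex.conj_I,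
    map_pow] at k2
  unfold step
  simp only [dft_add, dft_const_mul]
  rw [dft_conj_vOne hab hN hE h1 h2 hl, dft_vOne hab hN S hl, rOne, dft_gridValues hab hN _ hl,
    mul_assoc 2, mul_left_comm 2, dft_densityRate hab hN hE, dft_density hab hN hE, stepPhi, pathPhi,
    ← mul_assoc, ← mul_assoc, k1, k2]
  unfold vcoef
  push_cast
  field_simp
  linear_combination (-2 * Complex.sin (omega ε (freq a b l) * τ) * (ε : ℂ) ^ 2
    * dft a b N S.dΦ l) * Complex.I_sq

lemma dft_step_dΦ (hab : a < b) (hN : 0 < N) (hE : Even N) (hε : 0 < ε) {S : State N}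
    (h1 : IsRealGrid S.Φ) (h2 : IsRealGrid S.dΦ) {l : ℤ} (hl : l ∈ modes N) :
    dft a b N (step a b ε τ S).dΦ l
      = stepPi a b ε N τ (dft a b N S.Ψ) (dft a b N S.Φ) (dft a b N S.dΦ) l := by
  have hε' : (ε : ℂ) ≠ 0 := by exact_mod_cast hε.ne'
  have k1 := exp_mul_coefA' (freq a b l) hε τ
  have k2 := congrArg (starRingEnd ℂ) k1
  simp only [map_mul, map_add, map_div₀, conj_exp_phase, Complex.conj_ofReal, Complex.conj_I,
    map_pow, map_neg] at k2
  unfold step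
  simp only [dft_add, dft_sub, dft_const_mul]
  rw [dft_conj_vOne hab hN hE h1 h2 hl, dft_vOne hab hN S hl, dft_conj_dvOne hab hN hE h1 h2 hl,
    dft_dvOne hab hN S hl, drOne, dft_gridValues hab hN _ hl,
    mul_assoc 2, mul_left_comm 2, dft_densityRate hab hN hE, dft_density hab hN hE, stepPi, pathPi]
  have e1 : ∀ E x y v : ℂ, E * (x * v + Complex.I / ε ^ 2 * (y * v))
      = (E * (x + Complex.I / ε ^ 2 * y)) * v := fun E x y v => by ring
  have e2 : ∀ E x y v : ℂ, E * (x * v - Complex.I / ε ^ 2 * (y * v))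
      = (E * (x + -Complex.I / ε ^ 2 * y)) * v := fun E x y v => by ring
  rw [e1, e2, k1, k2]
  unfold vcoef
  push_cast
  field_simp
  linear_combination (-2 * (ε : ℂ) ^ 2 * Complex.cos (omega ε (freq a b l) * τ)
    * dft a b N S.dΦ l) * Complex.I_sq

lemma isRealGrid_rOne (hab : a < b) (hN : 0 < N) (hE : Even N) (S : State N) :
    IsRealGrid (rOne a b ε τ S) ∧ IsRealGrid (drOne a b ε τ S) := by
  have d1 : IsRealGrid (density S) := fun j => Complex.conj_ofReal _
  have d2 : IsRealGrid (densityRate a b τ S) := fun j => Complex.conj_ofReal _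
  have om : ∀ l, omega ε (freq a b (reflMode N l)) = omega ε (freq a b l) := fun l =>
    omega_eq_of_sq_eq (freq_sq_reflMode l)
  constructor
  · refine isRealGrid_gridValues hab hN hE fun l hl => ?_
    rw [dconj_add, dconj_mul_of_even hab hN hE (fun l => by unfold coefP; rw [om]) _ hl,
      dconj_mul_of_even hab hN hE (m := fun l => 2 * (coefQ ε (freq a b l) τ : ℂ))
        (fun l => by unfold coefQ; rw [om]) _ hl,
      d1.dconj_dft hab hN hE, d2.dconj_dft hab hN hE]
    simp only [Complex.conj_ofReal, map_mul, map_ofNat]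
  · refine isRealGrid_gridValues hab hN hE fun l hl => ?_
    rw [dconj_add, dconj_mul_of_even hab hN hE (fun l => by unfold coefP'; rw [om]) _ hl,
      dconj_mul_of_even hab hN hE (m := fun l => 2 * (coefQ' ε (freq a b l) τ : ℂ))
        (fun l => by unfold coefQ'; rw [om]) _ hl,
      d1.dconj_dft hab hN hE, d2.dconj_dft hab hN hE]
    simp only [Complex.conj_ofReal, map_mul, map_ofNat]

/-- Each new field is a quantity plus its conjugate plus the real contribution of r¹. No reality of
the old state is needed. -/
lemma isRealGrid_step (hab : a < b) (hN : 0 < N) (hE : Even N) (S : State N) :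
    IsRealGrid (step a b ε τ S).Φ ∧ IsRealGrid (step a b ε τ S).dΦ := by
  obtain ⟨r1, r2⟩ := isRealGrid_rOne (ε := ε) (τ := τ) hab hN hE S
  constructor
  · intro j
    have := r1 j
    simp only [step, map_add, map_mul, this, conj_exp_phase, Complex.conj_conj]
    rw [← conj_exp_phase, Complex.conj_conj]
    ring
  · intro j
    have := r2 j
    simp only [step, map_add, map_sub, map_mul, this, conj_exp_phase, Complex.conj_conj, map_div₀,
      Complex.conj_I, map_pow, Complex.conj_ofReal]
    rw [← conj_exp_phase, Complex.conj_conj]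
    ring

variable {ψ₀ : ℝ → ℂ} {φ₀ φ₁ : ℝ → ℝ}

lemma mtifp_succ (n : ℕ) : mtifp a b ε ψ₀ φ₀ φ₁ N τ (n + 1)
    = step a b ε τ (mtifp a b ε ψ₀ φ₀ φ₁ N τ n) := Function.iterate_succ_apply' _ _ _

lemma isRealGrid_mtifp (hab : a < b) (hN : 0 < N) (hE : Even N) (n : ℕ) :
    IsRealGrid (mtifp a b ε ψ₀ φ₀ φ₁ N τ n).Φ ∧ IsRealGrid (mtifp a b ε ψ₀ φ₀ φ₁ N τ n).dΦ := by
  cases n with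
  | zero => exact ⟨fun j => Complex.conj_ofReal _, fun j => Complex.conj_ofReal _⟩
  | succ n => rw [mtifp_succ]; exact isRealGrid_step hab hN hE _

end numeric

end KGS

namespace KGS

/-! ### Exact solutions as approximate semi-discrete solutions -/

lemma gridPoint_mem_Icc {a b : ℝ} (hab : a < b) {N : ℕ} (j : Fin N) :
    gridPoint a b N j ∈ Icc a b := by
  have hN : (0 : ℝ) < N := by exact_mod_cast j.pos
  have hj : (j : ℝ) ≤ N := by exact_mod_cast j.isLt.le
  have hh : 0 ≤ meshSize a b N := (meshSize_pos hab j.pos).le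
  have e : N * meshSize a b N = b - a := by unfold meshSize; field_simp
  have h1 : (j : ℝ) * meshSize a b N ≤ N * meshSize a b N := by gcongr
  have h2 : 0 ≤ (j : ℝ) * meshSize a b N := by positivity
  unfold gridPoint
  constructor <;> linarith

/-- Uniform bounds of a solution on `[0, T]`. -/
structure SolBound (a b T ε : ℝ) (m : ℕ) (ψ : ℝ → ℝ → ℂ) (φ : ℝ → ℝ → ℝ) (K : ℝ) : Prop where
  psi : ∀ t ∈ Icc 0 T, PerBound a b m (ψ t) K
  phi : ∀ t ∈ Icc 0 T, PerBound a b m (fun x => (φ t x : ℂ)) K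
  dphi : ∀ t ∈ Icc 0 T, PerBound a b m (fun x => (timeDeriv T φ t x : ℂ)) (K / ε ^ 2)

lemma Regular.exists_solBound {a b T : ℝ} (hab : a < b) {m : ℕ} (hm : 1 ≤ m)
    {ψ : ℝ → ℝ → ℝ → ℂ} {φ : ℝ → ℝ → ℝ → ℝ} (h : Regular a b T m ψ φ) :
    ∃ K : ℝ, 0 ≤ K ∧ ∀ ε ∈ Ioc (0 : ℝ) 1, SolBound a b T ε m (ψ ε) (φ ε) K := by
  obtain ⟨K₁, h1⟩ := h.bound_ψ
  obtain ⟨K₂, h2⟩ := h.bound_φ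
  set c := Real.sqrt (2 ^ m / (b - a))
  have hc : 0 ≤ c := Real.sqrt_nonneg _
  refine ⟨c * (|K₁| + |K₂|), by positivity, fun ε hε => ⟨fun t ht => ?_, fun t ht => ?_,
    fun t ht => ?_⟩⟩
  · refine (((h.mem_ψ ε hε).mem t ht).perBound hab hm).mono ?_
    have := h1 ε hε t ht
    gcongr
    linarith [le_abs_self K₁, abs_nonneg K₂]
  · refine (((h.mem_φ ε hε).mem.mem t ht).perBound hab hm).mono ?_
    have i1 := h2 ε hε t ht
    have i2 := mul_nonneg (sq_nonneg ε)
      (sobolevNorm_nonneg a b m (fun x => (timeDeriv T (φ ε) t x : ℂ)))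
    gcongr
    linarith [le_abs_self K₂, abs_nonneg K₁]
  · refine (((h.mem_φ ε hε).mem_deriv.mem t ht).perBound hab hm).mono ?_
    have i1 := h2 ε hε t ht
    have i2 := sobolevNorm_nonneg a b m (fun x => (φ ε t x : ℂ))
    rw [mul_div_assoc]
    refine mul_le_mul_of_nonneg_left ?_ hc
    rw [le_div_iff₀ (pow_pos hε.1 2)]
    linarith [le_abs_self K₂, abs_nonneg K₁]

lemma exists_prodBound {a b : ℝ} (hab : a < b) : ∃ K : ℝ, ∀ K' : ℝ, K ≤ K' → ∀ {N : ℕ}, 0 < N →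
    ProdBound a b N K' := by
  obtain ⟨C₁, hC₁, h1⟩ := exists_nrm_dprod_le hab (s := 1) le_rfl
  obtain ⟨C₂, hC₂, h2⟩ := exists_nrm_dprod_le hab (s := 3) (by norm_num)
  refine ⟨1 + C₁ + C₂, fun K' hK' {N} hN => ⟨by linarith, fun c d => ?_, fun c d => ?_⟩⟩
  · have n1 := nrm_nonneg (a := a) (b := b) (N := N) (s := 1) c
    have n2 := nrm_nonneg (a := a) (b := b) (N := N) (s := 1) d
    refine (h1 hN c d).trans ?_
    gcongr; linarith
  · have n1 := nrm_nonneg (a := a) (b := b) (N := N) (s := 3) c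
    have n2 := nrm_nonneg (a := a) (b := b) (N := N) (s := 3) d
    refine (h2 hN c d).trans ?_
    gcongr; linarith

/-- The defects are defined as the differences between exact and cyclic products, so the equations
hold by construction and only their size has to be estimated. -/
lemma exists_approxSol {a b : ℝ} (hab : a < b) {m : ℕ} (hm : 5 ≤ m) {K : ℝ} (hK : 0 ≤ K) :
    ∃ K' C : ℝ, 0 < C ∧ ∀ {N : ℕ}, 0 < N → Even N → meshSize a b N ≤ 1 →
      ProdBound a b N K' ∧ ∀ {T ε η : ℝ}, 0 < ε → C * meshSize a b N ^ (m - 1) ≤ η → η ≤ 1 →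
      ∀ {ψ₀ : ℝ → ℂ} {φ₀ φ₁ : ℝ → ℝ} {ψ : ℝ → ℝ → ℂ} {φ : ℝ → ℝ → ℝ},
      IsSolution a b T ε ψ₀ φ₀ φ₁ ψ φ → MemCHper a b T m ψ →
      MemC1Hper a b T m (fun t x => (φ t x : ℂ)) (fun t x => (timeDeriv T φ t x : ℂ)) →
      SolBound a b T ε m ψ φ K → ∃ δ₁ δ₂,
      ApproxSol a b T ε N η K' (fun t => fcoef a b (ψ t)) (fun t => fcoef a b (fun x => (φ t x : ℂ)))
        (fun t => fcoef a b (fun x => (timeDeriv T φ t x : ℂ))) δ₁ δ₂ := by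
  obtain ⟨K₀, hK₀⟩ := exists_prodBound hab
  obtain ⟨C₁, hC₁, h1⟩ := exists_nrm_defect_mul_le hab (s := m) (by omega)
  obtain ⟨C₂, hC₂, h2⟩ := exists_nrm_defect_sq_le hab (s := m) (by omega)
  obtain ⟨C₃, hC₃, h3⟩ := exists_perBound_mul hab (s := m) (by omega)
  obtain ⟨C₄, hC₄, h4⟩ := exists_nrm_dprod_le hab (s := 3) (by norm_num)
  -- The last entry bounds the defect in H³ crudely, each product on its own; no smallness is
  -- required there. The summand 1 in the second constant gives positivity even for K = 0.
  refine ⟨max K₀ (max K (C₃ * K * K + C₄ * K * K)), (C₁ + C₂) * (K * K) + 1, by positivity,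
    fun {N} hN hE hh => ⟨hK₀ _ (le_max_left _ _) hN, ?_⟩⟩
  intro T ε η hε hη hη1 ψ₀ φ₀ φ₁ ψ φ hsol hψ hφ hb
  set K' := max K₀ (max K (C₃ * K * K + C₄ * K * K))
  have hKK : K ≤ K' := (le_max_left _ _).trans (le_max_right _ _)
  have hKK2 : C₃ * K * K + C₄ * K * K ≤ K' := (le_max_right _ _).trans (le_max_right _ _)
  have sys := hsol.coefSystem hab hε (by omega) hψ hφ hb.psi hb.phi
  have hp := pow_pos (meshSize_pos hab hN) (m - 1)
  set p := meshSize a b N ^ (m - 1)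
  have nrm5 : ∀ {u : ℝ → ℂ} {L : ℝ}, PerBound a b m u L → ∀ k ≤ m, nrm a b N k (fcoef a b u) ≤ L :=
    fun hu k hk => (hu.hsBound.of_le hk).nrm_le hu.nonneg
  refine ⟨fun t l => fcoef a b (fun x => (φ t x : ℂ) * ψ t x) l
    - dprod a b N (fcoef a b (fun x => (φ t x : ℂ))) (fcoef a b (ψ t)) l,
    fun t l => fcoef a b (fun x => ψ t x * starRingEnd ℂ (ψ t x)) l
    - dens a b N (fcoef a b (ψ t)) l, ?_⟩
  exact
  { cont_ps := sys.cont_ps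
    cont_ph := sys.cont_ph
    cont_pi := sys.cont_pi
    deriv_ps := fun l t ht => (sys.deriv_ps l t ht).congr_deriv (by unfold rate; ring)
    deriv_ph := sys.deriv_ph
    deriv_pi := fun l t ht => (sys.deriv_pi l t ht).congr_deriv (by ring)
    nrm_ps := fun t ht => (nrm5 (hb.psi t ht) 5 hm).trans hKK
    nrm_ph := fun t ht => (nrm5 (hb.phi t ht) 5 hm).trans hKK
    nrm_pi := fun t ht => by
      have := nrm5 (hb.dphi t ht) 5 hm
      rw [le_div_iff₀ (by positivity)] at this
      linarith
    nrm_δ₁ := fun t ht => by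
      refine (h1 hN hE hh (hb.phi t ht) (hb.psi t ht)).trans ?_
      have : 0 ≤ C₂ * (K * K) * p := by positivity
      nlinarith
    nrm_δ₁_three := fun t ht => by
      have i1 := nrm5 (h3 (hb.phi t ht) (hb.psi t ht)) 3 (by omega)
      have i2 := h4 hN (fcoef a b (fun x => (φ t x : ℂ))) (fcoef a b (ψ t))
      have i3 := nrm5 (hb.phi t ht) 3 (by omega)
      have i4 := nrm5 (hb.psi t ht) 3 (by omega)
      have n := nrm_nonneg (a := a) (b := b) (N := N) (s := 3) (fcoef a b (ψ t))
      have i5 : C₄ * nrm a b N 3 (fcoef a b (fun x => (φ t x : ℂ))) * nrm a b N 3 (fcoef a b (ψ t))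
          ≤ C₄ * K * K := by gcongr
      refine (nrm_sub_le _ _).trans ?_
      linarith
    nrm_δ₂ := fun t ht => by
      refine (h2 hN hE hh (hb.psi t ht)).trans ?_
      have : 0 ≤ C₁ * (K * K) * p := by positivity
      nlinarith
    defect_le := hη1 }

/-- The additional regularity of the initial value of the Klein-Gordon field. -/
lemma Regular.exists_hsBound_succ {a b T : ℝ} (hab : a < b) (hT : 0 < T) {m : ℕ} (hm : 3 ≤ m)
    {ψ₀ : ℝ → ℂ} {φ₀ φ₁ : ℝ → ℝ} {ψ : ℝ → ℝ → ℝ → ℂ} {φ : ℝ → ℝ → ℝ → ℝ}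
    (hsol : ∀ ε ∈ Ioc (0 : ℝ) 1, IsSolution a b T ε ψ₀ φ₀ φ₁ (ψ ε) (φ ε))
    (h : Regular a b T m ψ φ) :
    ∃ L : ℝ, 0 ≤ L ∧ ∀ ε ∈ Ioc (0 : ℝ) 1, HsBound a b (m + 1) (fcoef a b fun x => (φ ε 0 x : ℂ)) L := by
  obtain ⟨K, hK, hb⟩ := h.exists_solBound hab (by omega)
  obtain ⟨C, hC, hmul⟩ := exists_perBound_mul hab (s := m) (by omega)
  -- The observability identity is applied at ε = 1 only, where the bounds on ∂ₜφ carry no power of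
  -- 1/ε. The data φ₀ are common to all ε, so the result serves the whole family.
  have one : (1 : ℝ) ∈ Ioc (0 : ℝ) 1 := by norm_num
  have hb1 := hb 1 one
  have sys := (hsol 1 one).coefSystem hab one_pos (by omega) (h.mem_ψ 1 one) (h.mem_φ 1 one) hb1.psi hb1.phi
  have hK' : K ≤ K + C * K * K := le_add_of_nonneg_right (by positivity)
  have H := sys.hsBound_succ hT (m := m) (K := K + C * K * K)
    (fun t ht => (hb1.phi t ht).hsBound.mono hK hK')
    (fun t ht => (hb1.dphi t ht).hsBound.mono (by positivity) (by rw [one_pow, div_one]; exact hK'))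
    (fun t ht => (hmul (hb1.psi t ht) (hb1.psi t ht).conj).hsBound.mono (by positivity) (by linarith))
  have e : ∀ ε ∈ Ioc (0 : ℝ) 1,
      fcoef a b (fun x => (φ ε 0 x : ℂ)) = fcoef a b (fun x => (φ 1 0 x : ℂ)) := fun ε hε => by
    ext l
    refine fcoef_congr hab (fun x hx => ?_) l
    rw [(hsol ε hε).init_φ x (Ioo_subset_Icc_self hx),
      (hsol 1 one).init_φ x (Ioo_subset_Icc_self hx)]
  exact ⟨√_, Real.sqrt_nonneg _, fun ε hε => (e ε hε).symm ▸ H⟩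

/-- The weight ε²ω is at most √(1 + μ²) for ε ≤ 1, so the energy of the initial error involves φ in
H². The additional derivative in the hypothesis restores the power m - 1 of h. -/
lemma exists_energy_init_le {a b : ℝ} (hab : a < b) {m : ℕ} (hm : 5 ≤ m) {K L : ℝ} (hK : 0 ≤ K)
    (hL : 0 ≤ L) :
    ∃ C : ℝ, 0 < C ∧ ∀ {N : ℕ}, 0 < N → ∀ {T ε τ : ℝ}, 0 ≤ T → 0 < ε → ε ≤ 1 →
      ∀ {ψ₀ : ℝ → ℂ} {φ₀ φ₁ : ℝ → ℝ} {ψ : ℝ → ℝ → ℂ} {φ : ℝ → ℝ → ℝ},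
      IsSolution a b T ε ψ₀ φ₀ φ₁ ψ φ → SolBound a b T ε m ψ φ K →
      HsBound a b (m + 1) (fcoef a b fun x => (φ 0 x : ℂ)) L →
      energy a b ε N
        (fun l => fcoef a b (ψ 0) l - dft a b N (mtifp a b ε ψ₀ φ₀ φ₁ N τ 0).Ψ l)
        (fun l => fcoef a b (fun x => (φ 0 x : ℂ)) l - dft a b N (mtifp a b ε ψ₀ φ₀ φ₁ N τ 0).Φ l)
        (fun l => fcoef a b (fun x => (timeDeriv T φ 0 x : ℂ)) l
          - dft a b N (mtifp a b ε ψ₀ φ₀ φ₁ N τ 0).dΦ l)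
        ≤ C * meshSize a b N ^ (m - 1) := by
  obtain ⟨C, hC, hal⟩ := exists_nrm_alias_le hab
  refine ⟨C * (3 * K + 2 * L) + 1, by positivity, ?_⟩
  intro N hN T ε τ hT hε hε1 ψ₀ φ₀ φ₁ ψ φ hsol hb hL'
  have h0 : (0 : ℝ) ∈ Icc 0 T := left_mem_Icc.2 hT
  have hp := pow_pos (meshSize_pos hab hN) (m - 1)
  have flip : ∀ c d : ℤ → ℂ, nrm a b N 1 (fun l => c l - d l) = nrm a b N 1 (fun l => d l - c l) :=
    fun c d => by rw [← nrm_neg]; simp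
  have flip2 : ∀ c d : ℤ → ℂ, nrm a b N 2 (fun l => c l - d l) = nrm a b N 2 (fun l => d l - c l) :=
    fun c d => by rw [← nrm_neg]; simp
  have e1 : dft a b N (mtifp a b ε ψ₀ φ₀ φ₁ N τ 0).Ψ
      = dft a b N (fun j => ψ 0 (gridPoint a b N j)) := dft_congr fun j => by
    rw [hsol.init_ψ _ (by exact gridPoint_mem_Icc hab j)]; rfl
  have e2 : dft a b N (mtifp a b ε ψ₀ φ₀ φ₁ N τ 0).Φ
      = dft a b N (fun j => (φ 0 (gridPoint a b N j) : ℂ)) := dft_congr fun j => by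
    rw [hsol.init_φ _ (by exact gridPoint_mem_Icc hab j)]; rfl
  have e3 : dft a b N (mtifp a b ε ψ₀ φ₀ φ₁ N τ 0).dΦ
      = dft a b N (fun j => (timeDeriv T φ 0 (gridPoint a b N j) : ℂ)) := dft_congr fun j => by
    rw [hsol.init_dt_φ _ (by exact gridPoint_mem_Icc hab j)]; rfl
  have hψ := hb.psi 0 h0
  have hφ := hb.phi 0 h0
  have hd := hb.dphi 0 h0
  have i1 := hal hN (r := 1) (s := m) (by omega) hψ.nonneg hψ.continuousOn hψ.periodic hψ.hsBound
  -- Two derivatives measured out of m + 1 available: the power of h is again m - 1.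
  have i2 := hal hN (r := 2) (s := m + 1) (by omega) hL hφ.continuousOn hφ.periodic hL'
  have i3 := hal hN (r := 1) (s := m) (by omega) hd.nonneg hd.continuousOn hd.periodic hd.hsBound
  rw [flip, ← e1] at i1
  rw [flip2, ← e2, show m + 1 - 2 = m - 1 by omega] at i2
  rw [flip, ← e3] at i3
  set p := meshSize a b N ^ (m - 1)
  set Pe := fun l => fcoef a b (fun x => (φ 0 x : ℂ)) l - dft a b N (mtifp a b ε ψ₀ φ₀ φ₁ N τ 0).Φ l
  set Qe := fun l => fcoef a b (fun x => (timeDeriv T φ 0 x : ℂ)) l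
          - dft a b N (mtifp a b ε ψ₀ φ₀ φ₁ N τ 0).dΦ l
  have ch : ∀ σ : ℝ, |σ| = 1 → nrm a b N 1 (charVar a b σ ε Pe Qe)
      ≤ ε ^ 2 * nrm a b N 1 Qe + nrm a b N 2 Pe := fun σ hσ => by
    refine (nrm_add_le _ _).trans (add_le_add (le_of_eq ?_) ?_)
    · rw [nrm_const_mul, norm_pow, Complex.norm_real, Real.norm_eq_abs, sq_abs]
    · refine (nrm_mul_le zero_le_one _ _ fun l _ => ?_).trans (one_mul _).le
      rw [norm_mul, norm_mul, Complex.norm_I, Complex.norm_real, Complex.norm_real, Real.norm_eq_abs,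
        Real.norm_eq_abs, hσ, one_mul, one_mul, one_mul, eps_sq_mul_omega _ hε,
        abs_of_nonneg (Real.sqrt_nonneg _), pow_one, sq (wt a b l)]
      refine mul_le_mul_of_nonneg_left ?_ (wt_pos a b l).le
      rw [Real.sqrt_le_left (wt_pos a b l).le, wt_sq]
      have : ε ^ 2 ≤ 1 := pow_le_one₀ hε.le hε1
      nlinarith [sq_nonneg (freq a b l)]
  have j3 : ε ^ 2 * nrm a b N 1 Qe ≤ C * p * K := by
    calc _ ≤ ε ^ 2 * (C * p * (K / ε ^ 2)) := by gcongr
      _ = _ := by field_simp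
  have t1 := ch 1 (by norm_num)
  have t2 := ch (-1) (by norm_num)
  unfold energy
  calc _ ≤ C * p * K + (C * p * K + C * p * L) + (C * p * K + C * p * L) := by
        refine add_le_add (add_le_add i1 ?_) ?_ <;> linarith
    _ = C * (3 * K + 2 * L) * p := by ring
    _ ≤ _ := by gcongr; linarith

end KGS

namespace KGS

/-! ### The error of the MTI-FP method -/

/-- The energy of the difference between the Fourier coefficients of a solution at time `t` and the
discrete Fourier coefficients of a numerical solution. -/
noncomputable def errorEnergy {N : ℕ} (a b T ε : ℝ) (ψ : ℝ → ℝ → ℂ) (φ : ℝ → ℝ → ℝ) (t : ℝ)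
    (S : State N) : ℝ :=
  energy a b ε N (fun l => fcoef a b (ψ t) l - dft a b N S.Ψ l)
    (fun l => fcoef a b (fun x => (φ t x : ℂ)) l - dft a b N S.Φ l)
    (fun l => fcoef a b (fun x => (timeDeriv T φ t x : ℂ)) l - dft a b N S.dΦ l)

lemma errorEnergy_nonneg {N : ℕ} {a b T ε : ℝ} {ψ : ℝ → ℝ → ℂ} {φ : ℝ → ℝ → ℝ} {t : ℝ}
    {S : State N} : 0 ≤ errorEnergy a b T ε ψ φ t S := energy_nonneg

/-- Convergence of the coefficients, with the additional information that the error is small. -/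
lemma exists_errorEnergy_le {a b T : ℝ} (hab : a < b) (hT : 0 < T) {m : ℕ} (hm : 5 ≤ m)
    {ψ₀ : ℝ → ℂ} {φ₀ φ₁ : ℝ → ℝ} {ψ : ℝ → ℝ → ℝ → ℂ} {φ : ℝ → ℝ → ℝ → ℝ}
    (hsol : ∀ ε ∈ Ioc (0 : ℝ) 1, IsSolution a b T ε ψ₀ φ₀ φ₁ (ψ ε) (φ ε))
    (hreg : Regular a b T m ψ φ) {ρ : ℝ} (hρ : 0 < ρ) :
    ∃ h₀ τ₀ C : ℝ, 0 < h₀ ∧ h₀ < 1 ∧ 0 < τ₀ ∧ τ₀ < 1 ∧ 0 < C ∧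
      ∀ ε ∈ Ioc (0 : ℝ) 1, ∀ N : ℕ, 0 < N → Even N → meshSize a b N ≤ h₀ →
      ∀ τ : ℝ, 0 < τ → τ ≤ τ₀ → ∀ n : ℕ, n * τ ≤ T →
        errorEnergy a b T ε (ψ ε) (φ ε) (n * τ) (mtifp a b ε ψ₀ φ₀ φ₁ N τ n)
          ≤ C * (meshSize a b N ^ (m - 1) + min (τ ^ 2 / ε ^ 2) (ε ^ 2)) ∧
        errorEnergy a b T ε (ψ ε) (φ ε) (n * τ) (mtifp a b ε ψ₀ φ₀ φ₁ N τ n) ≤ ρ := by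
  obtain ⟨K, hK, hb⟩ := hreg.exists_solBound hab (by omega)
  obtain ⟨L, hL, hb'⟩ := hreg.exists_hsBound_succ hab hT (by omega) hsol
  obtain ⟨K₁, C₁, hC₁, happ⟩ := exists_approxSol hab hm hK
  obtain ⟨C₂, hC₂, hinit⟩ := exists_energy_init_le hab hm hK hL
  set K' := max K₁ 1
  set B := Real.exp (200 * K' ^ 5 * T) * (1 + 101 * K' ^ 9 * T)
  have hK' : 1 ≤ K' := le_max_right _ _
  have hB : 1 ≤ B := one_le_mul_of_one_le_of_one_le (Real.one_le_exp (by positivity))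
    (le_add_of_nonneg_right (by positivity))
  have hB0 : 0 < B := by linarith
  -- One constant for both roles of η = c·h^(m-1): bound of the defects and bound of the initial
  -- error.
  set c := C₁ + C₂
  have hc : 0 < c := by positivity
  set r := min ρ 1
  have hr : 0 < r := lt_min hρ one_pos
  have hr1 : r ≤ 1 := min_le_right _ _
  -- The final bound is B(χ + c p) with p ≤ h, because m - 1 ≥ 1, and χ ≤ τ. Each half is given r/2;
  -- the entries 1/2 keep the thresholds below 1.
  refine ⟨min (1 / 2) (r / (2 * B * c)), min (1 / 2) (r / (2 * B)), B * (1 + c), by positivity,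
    (min_le_left _ _).trans_lt (by norm_num), by positivity,
    (min_le_left _ _).trans_lt (by norm_num), by positivity, ?_⟩
  intro ε hε N hN hE hh τ hτ hτ' n hn
  have hpos := meshSize_pos hab hN
  have hh1 : meshSize a b N ≤ 1 := (hh.trans (min_le_left _ _)).trans (by norm_num)
  have hτ1 : τ ≤ 1 := (hτ'.trans (min_le_left _ _)).trans (by norm_num)
  have hp0 : 0 < meshSize a b N ^ (m - 1) := pow_pos hpos _
  have hp : meshSize a b N ^ (m - 1) ≤ meshSize a b N := by
    calc _ ≤ meshSize a b N ^ 1 := pow_le_pow_of_le_one hpos.le hh1 (by omega)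
      _ = _ := pow_one _
  set p := meshSize a b N ^ (m - 1)
  set χ := min (τ ^ 2 / ε ^ 2) (ε ^ 2)
  have hχ0 : 0 ≤ χ := le_min (by positivity) (by positivity)
  have i1 : B * (c * p) ≤ r / 2 := by
    have := (hp.trans hh).trans (min_le_right _ _)
    rw [le_div_iff₀ (by positivity)] at this
    linarith
  have i2 : B * χ ≤ r / 2 := by
    have := ((min_sq_div_le hτ hε.1).trans hτ').trans (min_le_right _ _)
    rw [le_div_iff₀ (by positivity)] at this
    linarith
  have hη : c * p ≤ 1 := by nlinarith [mul_pos hc hp0]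
  obtain ⟨hprod, happ⟩ := happ hN hE hh1
  -- That `K₁` is at least 1 is known only once an N is given, through `ProdBound`, whereas the
  -- thresholds had to be fixed earlier; `max K₁ 1` bridges this.
  have hKK : K₁ = K' := (max_eq_left hprod.one_le).symm
  rw [hKK] at hprod happ
  obtain ⟨δ₁, δ₂, h⟩ := happ (η := c * p) hε.1 (by simp only [c]; nlinarith) hη (hsol ε hε)
    (hreg.mem_ψ ε hε) (hreg.mem_φ ε hε) (hb ε hε)
  have h0 := (hinit hN (τ := τ) hT.le hε.1 hε.2 (hsol ε hε) (hb ε hε) (hb' ε hε)).trans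
    (show C₂ * p ≤ c * p by simp only [c]; nlinarith)
  have real := isRealGrid_mtifp (ε := ε) (τ := τ) (ψ₀ := ψ₀) (φ₀ := φ₀) (φ₁ := φ₁) hab hN hE
  have hsmall : B * (χ + c * p) ≤ r := by linarith
  have key := h.energy_le hab hN hE hprod hε.1 hε.2 hτ hτ1 (by positivity)
    (cA := fun n => dft a b N (mtifp a b ε ψ₀ φ₀ φ₁ N τ n).Ψ)
    (cP := fun n => dft a b N (mtifp a b ε ψ₀ φ₀ φ₁ N τ n).Φ)
    (cQ := fun n => dft a b N (mtifp a b ε ψ₀ φ₀ φ₁ N τ n).dΦ)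
    (fun n l hl => by rw [mtifp_succ]; exact dft_step_Ψ hab hN hE (real n).1 (real n).2 hl)
    (fun n l hl => by rw [mtifp_succ]; exact dft_step_Φ hab hN hE hε.1 (real n).1 (real n).2 hl)
    (fun n l hl => by rw [mtifp_succ]; exact dft_step_dΦ hab hN hE hε.1 (real n).1 (real n).2 hl)
    h0 (hsmall.trans hr1) n hn
  refine ⟨key.trans ?_, key.trans (hsmall.trans (min_le_left _ _))⟩
  have : 0 ≤ c * χ + p := by positivity
  calc B * (χ + c * p) ≤ B * ((1 + c) * (p + χ)) := by gcongr; nlinarith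
    _ = _ := by ring

/-- On the modes the energy dominates the three H¹ errors; the part of the exact solution outside
the modes contributes h^(m-1). -/
lemma exists_errorH1_le {a b : ℝ} (hab : a < b) {m : ℕ} (hm : 1 ≤ m) {K : ℝ} (hK : 0 ≤ K) :
    ∃ C : ℝ, 0 < C ∧ ∀ {N : ℕ}, 0 < N → Even N → ∀ {T ε : ℝ}, 0 < ε →
      ∀ {ψ : ℝ → ℝ → ℂ} {φ : ℝ → ℝ → ℝ}, MemCHper a b T m ψ →
      MemC1Hper a b T m (fun t x => (φ t x : ℂ)) (fun t x => (timeDeriv T φ t x : ℂ)) →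
      SolBound a b T ε m ψ φ K → ∀ t ∈ Icc 0 T, ∀ S : State N,
        errorH1 a b T ε ψ φ t S ≤ C * (errorEnergy a b T ε ψ φ t S + meshSize a b N ^ (m - 1)) := by
  refine ⟨3 * √(b - a) * (K + 1), by have := sub_pos.2 hab; positivity, ?_⟩
  intro N hN hE T ε hε ψ φ hψ hφ hb t ht S
  have i1 := (hψ.mem t ht).sobolevNorm_sub_interp_le hab hm hK (hb.psi t ht).hsBound hN hE S.Ψ
  have i2 := (hφ.mem.mem t ht).sobolevNorm_sub_interp_le hab hm hK (hb.phi t ht).hsBound hN hE S.Φ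
  have i3 := (hφ.mem_deriv.mem t ht).sobolevNorm_sub_interp_le hab hm (by positivity)
    (hb.dphi t ht).hsBound hN hE S.dΦ
  have e1 : _ ≤ errorEnergy a b T ε ψ φ t S := nrm_le_energy
  have e2 : _ ≤ errorEnergy a b T ε ψ φ t S := nrm_phi_le_energy hε
  have e3 : _ ≤ errorEnergy a b T ε ψ φ t S := nrm_pi_le_energy
  have e0 : 0 ≤ errorEnergy a b T ε ψ φ t S := errorEnergy_nonneg
  have hp := (pow_pos (meshSize_pos hab hN) (m - 1)).le
  set p := meshSize a b N ^ (m - 1)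
  set E := errorEnergy a b T ε ψ φ t S
  have hs := Real.sqrt_nonneg (b - a)
  have fin : √(b - a) * (E + p * K) ≤ √(b - a) * (K + 1) * (E + p) := by
    rw [mul_assoc]
    gcongr
    nlinarith [mul_nonneg hK e0]
  have j1 := i1.trans ((mul_le_mul_of_nonneg_left (add_le_add_left e1 _) hs).trans fin)
  have j2 := i2.trans ((mul_le_mul_of_nonneg_left (add_le_add_left e2 _) hs).trans fin)
  have j3 := mul_le_mul_of_nonneg_left i3 (sq_nonneg ε)
  have j3' : ε ^ 2 * (√(b - a) * (nrm a b N 1 (fun l =>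
      fcoef a b (fun x => (timeDeriv T φ t x : ℂ)) l - dft a b N S.dΦ l) + p * (K / ε ^ 2)))
      = √(b - a) * (ε ^ 2 * nrm a b N 1 (fun l =>
      fcoef a b (fun x => (timeDeriv T φ t x : ℂ)) l - dft a b N S.dΦ l) + p * K) := by
    field_simp
  rw [j3'] at j3
  have j4 := j3.trans ((mul_le_mul_of_nonneg_left (add_le_add_left e3 _) hs).trans fin)
  unfold errorH1
  linarith

lemma sobolevNorm_interp_le {a b : ℝ} (hab : a < b) {m : ℕ} (hm : 1 ≤ m) {N : ℕ} {u : ℝ → ℂ}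
    (hu : MemHper a b m u) (v : Fin (N + 1) → ℂ) :
    sobolevNorm a b 1 (interp a b N v) ≤ sobolevNorm a b m u
      + √(b - a) * nrm a b N 1 (fun l => fcoef a b u l - dft a b N v l) := by
  have e : dft a b N v = fun l => fcoef a b u l - (fcoef a b u l - dft a b N v l) := by
    ext l; ring
  have h1 := nrm_sub_le (a := a) (b := b) (N := N) (s := 1) (fcoef a b u)
    (fun l => fcoef a b u l - dft a b N v l)
  rw [← e] at h1
  rw [sobolevNorm_one_interp hab]
  have h2 := (hu.of_le hm).nrm_fcoef_le hab N
  have h3 := sobolevNorm_mono hab hm u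
  have h4 := mul_le_mul_of_nonneg_left h1 (Real.sqrt_nonneg (b - a))
  linarith

lemma Regular.sobolevNorm_le_boundψ {a b T : ℝ} {m : ℕ} {ψ : ℝ → ℝ → ℝ → ℂ}
    {φ : ℝ → ℝ → ℝ → ℝ} (h : Regular a b T m ψ φ) {ε : ℝ} (hε : ε ∈ Ioc (0 : ℝ) 1) {t : ℝ}
    (ht : t ∈ Icc 0 T) : sobolevNorm a b m (ψ ε t) ≤ boundψ a b T m ψ := by
  obtain ⟨K, hK⟩ := h.bound_ψ
  refine le_csSup ⟨K, ?_⟩ ⟨ε, hε, t, ht, rfl⟩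
  rintro _ ⟨ε, hε, t, ht, rfl⟩
  exact hK ε hε t ht

lemma Regular.max_sobolevNorm_le_boundφ {a b T : ℝ} {m : ℕ} {ψ : ℝ → ℝ → ℝ → ℂ}
    {φ : ℝ → ℝ → ℝ → ℝ} (h : Regular a b T m ψ φ) {ε : ℝ} (hε : ε ∈ Ioc (0 : ℝ) 1) {t : ℝ}
    (ht : t ∈ Icc 0 T) :
    max (sobolevNorm a b m (fun x => (φ ε t x : ℂ)))
      (ε ^ 2 * sobolevNorm a b m (fun x => (timeDeriv T (φ ε) t x : ℂ))) ≤ boundφ a b T m φ := by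
  obtain ⟨K, hK⟩ := h.bound_φ
  refine le_csSup ⟨K, ?_⟩ ⟨ε, hε, t, ht, rfl⟩
  rintro _ ⟨ε, hε, t, ht, rfl⟩
  have h1 := sobolevNorm_nonneg a b m (fun x => (φ ε t x : ℂ))
  have h2 := mul_nonneg (sq_nonneg ε)
    (sobolevNorm_nonneg a b m (fun x => (timeDeriv T (φ ε) t x : ℂ)))
  have h3 := hK ε hε t ht
  exact max_le (by linarith) (by linarith)

/-- The maximum is attained where the two competing bounds coincide, at δ = √τ, and equals τ. -/
lemma isGreatest_min_sq_div {τ : ℝ} (hτ : 0 < τ) (hτ1 : τ ≤ 1) :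
    IsGreatest ((fun δ : ℝ => min (τ ^ 2 / δ ^ 2) (δ ^ 2)) '' Ioc 0 1) τ := by
  refine ⟨⟨√τ, ⟨Real.sqrt_pos.2 hτ, Real.sqrt_le_one.2 hτ1⟩, ?_⟩, ?_⟩
  · simp only [Real.sq_sqrt hτ.le, sq, mul_div_assoc, div_self hτ.ne', mul_one, min_self]
  · rintro _ ⟨δ, hδ, rfl⟩
    exact min_sq_div_le hτ hδ.1

end KGS

theorem theorem1
    (a b T : ℝ) (hab : a < b) (hT : 0 < T)
    (m₀ : ℕ) (hm₀ : 5 ≤ m₀)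
    (ψ₀ : ℝ → ℂ) (φ₀ φ₁ : ℝ → ℝ)
    (ψ : ℝ → ℝ → ℝ → ℂ) (φ : ℝ → ℝ → ℝ → ℝ)
    (hsol : ∀ ε ∈ Set.Ioc (0 : ℝ) 1, KGS.IsSolution a b T ε ψ₀ φ₀ φ₁ (ψ ε) (φ ε))
    (hreg : KGS.Regular a b T m₀ ψ φ) :
    ∃ h₀ τ₀ C : ℝ, 0 < h₀ ∧ h₀ < 1 ∧ 0 < τ₀ ∧ τ₀ < 1 ∧ 0 < C ∧
      ∀ ε ∈ Set.Ioc (0 : ℝ) 1, ∀ N : ℕ, 0 < N → Even N → KGS.meshSize a b N ≤ h₀ →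
      ∀ τ : ℝ, 0 < τ → τ ≤ τ₀ → ∀ n : ℕ, (n : ℝ) ≤ T / τ →
        KGS.errorH1 a b T ε (ψ ε) (φ ε) (n * τ) (KGS.mtifp a b ε ψ₀ φ₀ φ₁ N τ n)
          ≤ C * (KGS.meshSize a b N ^ (m₀ - 1) + τ ^ 2 / ε ^ 2) ∧
        KGS.errorH1 a b T ε (ψ ε) (φ ε) (n * τ) (KGS.mtifp a b ε ψ₀ φ₀ φ₁ N τ n)
          ≤ C * (KGS.meshSize a b N ^ (m₀ - 1) + ε ^ 2) ∧
        KGS.sobolevNorm a b 1 (KGS.interp a b N (KGS.mtifp a b ε ψ₀ φ₀ φ₁ N τ n).Ψ)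
          ≤ KGS.boundψ a b T m₀ ψ + 1 ∧
        KGS.sobolevNorm a b 1 (KGS.interp a b N (KGS.mtifp a b ε ψ₀ φ₀ φ₁ N τ n).Φ)
          ≤ KGS.boundφ a b T m₀ φ + 1 ∧
        KGS.sobolevNorm a b 1 (KGS.interp a b N (KGS.mtifp a b ε ψ₀ φ₀ φ₁ N τ n).dΦ)
          ≤ 1 / ε ^ 2 * (KGS.boundφ a b T m₀ φ + 1) ∧
        ∃ M : ℝ,
          IsGreatest ((fun δ : ℝ => min (τ ^ 2 / δ ^ 2) (δ ^ 2)) '' Set.Ioc 0 1) M ∧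
          KGS.errorH1 a b T ε (ψ ε) (φ ε) (n * τ) (KGS.mtifp a b ε ψ₀ φ₀ φ₁ N τ n)
            ≤ C * (KGS.meshSize a b N ^ (m₀ - 1) + M) ∧
          KGS.errorH1 a b T ε (ψ ε) (φ ε) (n * τ) (KGS.mtifp a b ε ψ₀ φ₀ φ₁ N τ n)
            ≤ C * (KGS.meshSize a b N ^ (m₀ - 1) + τ) ∧
          KGS.meshSize a b N ^ (m₀ - 1) + M ≤ C * (KGS.meshSize a b N ^ (m₀ - 1) + τ) := by
  obtain ⟨K, hK, hb⟩ := hreg.exists_solBound hab (by omega)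
  have hba : 0 < √(b - a) := Real.sqrt_pos.2 (sub_pos.2 hab)
  -- The threshold 1/√(b - a): the H¹ norm of an interpolant is √(b - a) times the coefficient norm,
  -- so an energy below it costs at most 1 in the bounds of the numerical solution.
  obtain ⟨h₀, τ₀, C₁, hh₀, hh₀', hτ₀, hτ₀', hC₁, henergy⟩ :=
    KGS.exists_errorEnergy_le hab hT hm₀ hsol hreg (one_div_pos.2 hba)
  obtain ⟨C₂, hC₂, herror⟩ := KGS.exists_errorH1_le hab (m := m₀) (by omega) hK
  refine ⟨h₀, τ₀, C₂ * (C₁ + 1) + 1, hh₀, hh₀', hτ₀, hτ₀', by positivity, ?_⟩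
  intro ε hε N hN hE hh τ hτ hττ n hn
  rw [le_div_iff₀ hτ] at hn
  have ht : (n * τ : ℝ) ∈ Icc 0 T := ⟨by positivity, hn⟩
  obtain ⟨e1, e2⟩ := henergy ε hε N hN hE hh τ hτ hττ n hn
  have err := herror hN hE hε.1 (hreg.mem_ψ ε hε) (hreg.mem_φ ε hε) (hb ε hε) _ ht
    (KGS.mtifp a b ε ψ₀ φ₀ φ₁ N τ n)
  have hE1 : _ ≤ KGS.errorEnergy a b T ε (ψ ε) (φ ε) (n * τ) (KGS.mtifp a b ε ψ₀ φ₀ φ₁ N τ n) :=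
    KGS.nrm_le_energy
  have hE2 : _ ≤ KGS.errorEnergy a b T ε (ψ ε) (φ ε) (n * τ) (KGS.mtifp a b ε ψ₀ φ₀ φ₁ N τ n) :=
    KGS.nrm_phi_le_energy hε.1
  have hE3 : _ ≤ KGS.errorEnergy a b T ε (ψ ε) (φ ε) (n * τ) (KGS.mtifp a b ε ψ₀ φ₀ φ₁ N τ n) :=
    KGS.nrm_pi_le_energy
  have hp := pow_pos (KGS.meshSize_pos hab hN) (m₀ - 1)
  set S := KGS.mtifp a b ε ψ₀ φ₀ φ₁ N τ n
  set p := KGS.meshSize a b N ^ (m₀ - 1)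
  -- All error bounds are this single one, with y equal to τ²/ε², to ε² or to τ.
  have main : ∀ y, min (τ ^ 2 / ε ^ 2) (ε ^ 2) ≤ y →
      KGS.errorH1 a b T ε (ψ ε) (φ ε) (n * τ) S ≤ (C₂ * (C₁ + 1) + 1) * (p + y) := by
    intro y hy
    have hy0 : 0 ≤ y := (le_min (by positivity) (by positivity)).trans hy
    have i1 : C₁ * (p + min (τ ^ 2 / ε ^ 2) (ε ^ 2)) + p ≤ (C₁ + 1) * (p + y) := by
      have : C₁ * (p + min (τ ^ 2 / ε ^ 2) (ε ^ 2)) ≤ C₁ * (p + y) := by gcongr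
      linarith
    calc _ ≤ C₂ * ((C₁ + 1) * (p + y)) := err.trans (by gcongr; linarith)
      _ ≤ _ := by linarith
  have cap : ∀ {x : ℝ}, x ≤ KGS.errorEnergy a b T ε (ψ ε) (φ ε) (n * τ) S → √(b - a) * x ≤ 1 :=
    fun hx => by
      have := hx.trans e2
      rw [le_div_iff₀ hba] at this
      linarith
  have hm₁ : 1 ≤ m₀ := by omega
  have n1 := KGS.sobolevNorm_interp_le hab hm₁ ((hreg.mem_ψ ε hε).mem _ ht) S.Ψ
  have n2 := KGS.sobolevNorm_interp_le hab hm₁ ((hreg.mem_φ ε hε).mem.mem _ ht) S.Φ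
  have n3 := KGS.sobolevNorm_interp_le hab hm₁ ((hreg.mem_φ ε hε).mem_deriv.mem _ ht) S.dΦ
  have b1 := hreg.sobolevNorm_le_boundψ hε ht
  have b2 := hreg.max_sobolevNorm_le_boundφ hε ht
  have c1 := cap hE1
  have c2 := cap hE2
  have c3 := cap hE3
  have hε2 : 0 < ε ^ 2 := pow_pos hε.1 2
  refine ⟨main _ (min_le_left _ _), main _ (min_le_right _ _), by linarith,
    by linarith [le_max_left _ _ |>.trans b2], ?_, τ,
    KGS.isGreatest_min_sq_div hτ (hττ.trans hτ₀'.le), main _ (KGS.min_sq_div_le hτ hε.1),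
    main _ (KGS.min_sq_div_le hτ hε.1), ?_⟩
  · rw [one_div, inv_mul_eq_div, le_div_iff₀ hε2]
    have := mul_le_mul_of_nonneg_right n3 hε2.le
    linarith [(le_max_right _ _).trans b2]
  · have : 0 ≤ C₂ * (C₁ + 1) * (p + τ) := by positivity
    linarith
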